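/- Let $h_1,h_2>0$, $h_{\max}:=\max\{h_1,h_2\}$, and let $K\subset\mathbb R^2$ be either the open triangle with vertices $(0,0),(h_1,0),(h_1,h_2)$ or the open rectangle with vertices $(0,0),(h_1,0),(0,h_2),(h_1,h_2)$. Write $\|\cdot\|_{0,K}$ for the $L^2(K)$ norm; for $0<s<1$ let $$|v|_{H^s(K)}^2=\int_K\int_K\frac{|v(x)-v(y)|^2}{|x-y|^{2+2s}}\,dx\,dy,\qquad \|v\|_{H^s(K)}^2=\|v\|_{0,K}^2+|v|_{H^s(K)}^2 .$$ The anisotropic seminorm is $$|v|_{AH^{1/2}_1(K)}^2=\int_{\mathbb R}\int_{I}\int_{I}\frac{|v(t,x_2)-v(t',x_2)|^2}{|t-t'|^2}\,dt\,dt'\,dx_2,\qquad I=I(x_2)=\{t:(t,x_2)\in K\},$$ and $|v|_{AH^{1/2}_2(K)}$ is defined in the same way with the roles of the two variables exchanged. $H^{-1/2}(K)$ is the dual space of $\widetilde H^{1/2}(K)$, the space of functions on $K$ whose extension by zero belongs to $H^{1/2}(\mathbb R^2)$, normed by the $H^{1/2}(\mathbb R^2)$ norm of this extension; it carries the dual norm.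 The lowest-order Raviart–Thomas space on $K$ consists of the fields $(a+cx_1,\,b+cx_2)$ if $K$ is the triangle and $(a+cx_1,\,b+dx_2)$ if $K$ is the rectangle, with $a,b,c,d\in\mathbb R$. For $\mathbf u\in H^{1/2}(K)^2$ with $\operatorname{div}\mathbf u\in L^2(K)$, the normal flux through an edge $e$ of $K$ is $$(\mathbf u\cdot\mathbf n,1)_{0,e}:=(\mathbf u,\nabla\varphi)_{0,K}+\int_K\operatorname{div}\mathbf u\,\varphi ,$$ where $\varphi\in H^{1-\varepsilon}(K)$, $0<\varepsilon<1/2$, is any function with trace $1$ on $e$ and $0$ on $\partial K\setminus e$, and $(\mathbf u,\nabla\varphi)_{0,K}$ is the duality pairing of $H^{\varepsilon}(K)$ with $H^{-\varepsilon}(K)$. The Raviart–Thomas interpolant $\Pi_{\rm RT}\mathbf u$ is the field in the lowest-order Raviart–Thomas space that has the same normal flux as $\mathbf u$ through every edge of $K$. **Theorem.** There is a constant $C$, independent of $h_1$, $h_2$, of the type of $K$ and of $\mathbf u$, such that for every $\mathbf u=(u_1,u_2)\in H^{1/2}(K)^2$ whose distributional divergence is a real constant, $\Pi_{\rm RT}\mathbf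 u$ exists and is unique, and for $l=1,2$ (with $l+1$ taken mod $2$) $$\|(\Pi_{\rm RT}\mathbf u)_l\|_{0,K}^2\le C\left(\|u_l\|_{0,K}^2+\frac{h_{\max}^3}{h_1h_2}\Big(|u_l|_{H^{1/2}(K)}^2+|u_{l+1}|_{AH^{1/2}_{l+1}(K)}^2+\|\operatorname{div}\mathbf u\|_{H^{-1/2}(K)}^2\Big)\right)$$ and $$\|u_l-(\Pi_{\rm RT}\mathbf u)_l\|_{0,K}^2\le C\,\frac{h_{\max}^3}{h_1h_2}\Big(|u_l|_{H^{1/2}(K)}^2+|u_{l+1}|_{AH^{1/2}_{l+1}(K)}^2+\|\operatorname{div}\mathbf u\|_{H^{-1/2}(K)}^2\Big).$$ -/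

import Mathlib

open MeasureTheory Filter Topology
open scoped ENNReal NNReal ContDiff

namespace RTAniso

noncomputable section

/-! ### Elements, edges -/

/-- The two kinds of elements. -/
inductive Shape
  | triangle
  | rectangle

/-- The open element `K`: the triangle with vertices `(0,0)`, `(h₁,0)`, `(h₁,h₂)`, or the rectangle
`(0,h₁) × (0,h₂)`. -/
def element (κ : Shape) (h₁ h₂ : ℝ) : Set (ℝ × ℝ) :=
  match κ with
  | .triangle => {x | 0 < x.1 ∧ x.1 < h₁ ∧ 0 < x.2 ∧ x.2 < h₂ * x.1 / h₁}
  | .rectangle => {x | 0 < x.1 ∧ x.1 < h₁ ∧ 0 < x.2 ∧ x.2 < h₂}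

/-- The Euclidean distance in the plane (`dist` on `ℝ × ℝ` would be the maximum distance). -/
def eucl (x y : ℝ × ℝ) : ℝ := Real.sqrt ((x.1 - y.1) ^ 2 + (x.2 - y.2) ^ 2)

/-- A directed segment, from its first to its second end point. -/
abbrev Edge := (ℝ × ℝ) × (ℝ × ℝ)

/-- The edges of the element, directed counterclockwise. -/
def edges (κ : Shape) (h₁ h₂ : ℝ) : List Edge :=
  match κ with
  | .triangle => [((0, 0), (h₁, 0)), ((h₁, 0), (h₁, h₂)), ((h₁, h₂), (0, 0))]
  | .rectangle =>
    [((0, 0), (h₁, 0)), ((h₁, 0), (h₁, h₂)), ((h₁, h₂), (0, h₂)), ((0, h₂), (0, 0))]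

/-- Length of an edge. -/
def Edge.length (e : Edge) : ℝ := eucl e.1 e.2

/-- Point of an edge with parameter `t ∈ [0,1]`. -/
def Edge.point (e : Edge) (t : ℝ) : ℝ × ℝ := e.1 + t • (e.2 - e.1)

/-- Unit normal of a directed edge, pointing to its right: the outward normal when the boundary is
directed counterclockwise. -/
def Edge.normal (e : Edge) : Fin 2 → ℝ :=
  ![(e.2.2 - e.1.2) / e.length, -(e.2.1 - e.1.1) / e.length]

/-- `∫_e f ds` with respect to arc length. -/
def Edge.integral (e : Edge) (f : ℝ × ℝ → ℝ) : ℝ :=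
  e.length * ∫ t in (0 : ℝ)..1, f (e.point t)

/-- `‖f‖²_{L²(e)}` with respect to arc length. -/
def Edge.l2sq (e : Edge) (f : ℝ × ℝ → ℝ) : ℝ≥0∞ :=
  ENNReal.ofReal e.length * ∫⁻ t in Set.Icc (0 : ℝ) 1, ‖f (e.point t)‖ₑ ^ 2

/-! ### Sobolev norms (all squared, with values in `[0, ∞]`) -/

/-- `‖f‖²_{0,K}`. -/
def l2sq (K : Set (ℝ × ℝ)) (f : ℝ × ℝ → ℝ) : ℝ≥0∞ :=
  ∫⁻ x in K, ‖f x‖ₑ ^ 2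

/-- The Sobolev–Slobodeckij seminorm `|f|²_{H^s(K)}`, `0 < s < 1`, on a planar domain. -/
def hsSemiSq (s : ℝ) (K : Set (ℝ × ℝ)) (f : ℝ × ℝ → ℝ) : ℝ≥0∞ :=
  ∫⁻ x in K, ∫⁻ y in K, ‖f x - f y‖ₑ ^ 2 / ENNReal.ofReal (eucl x y ^ (2 + 2 * s))

/-- `‖f‖²_{H^s(K)}`, `0 < s < 1`. -/
def hsNormSq (s : ℝ) (K : Set (ℝ × ℝ)) (f : ℝ × ℝ → ℝ) : ℝ≥0∞ :=
  l2sq K f + hsSemiSq s K f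

/-- `f ∈ H^s(K)`, `0 < s < 1`. -/
def MemHs (s : ℝ) (K : Set (ℝ × ℝ)) (f : ℝ × ℝ → ℝ) : Prop :=
  AEStronglyMeasurable f (volume.restrict K) ∧ hsNormSq s K f < ⊤

/-- The Sobolev–Slobodeckij seminorm `|g|²_{H^s(I)}`, `0 < s < 1`, on a subset of the line. -/
def hsSemiSq₁ (s : ℝ) (I : Set ℝ) (g : ℝ → ℝ) : ℝ≥0∞ :=
  ∫⁻ a in I, ∫⁻ b in I, ‖g a - g b‖ₑ ^ 2 / ENNReal.ofReal (|a - b| ^ (1 + 2 * s))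

/-- The anisotropic seminorms `|f|²_{AH_1^s(K)}` (index `0`) and `|f|²_{AH_2^s(K)}` (index `1`):
the `H^s` seminorms of `f` along the segments in which the lines parallel to the first (second)
axis meet `K`, integrated over the other variable. Lines that miss `K` contribute `0`. -/
def ahSemiSq (s : ℝ) (K : Set (ℝ × ℝ)) (l : Fin 2) (f : ℝ × ℝ → ℝ) : ℝ≥0∞ :=
  match l with
  | 0 => ∫⁻ x₂ : ℝ, hsSemiSq₁ s {t | (t, x₂) ∈ K} (fun t => f (t, x₂))
  | 1 => ∫⁻ x₁ : ℝ, hsSemiSq₁ s {t | (x₁, t) ∈ K} (fun t => f (x₁, t))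

/-- `v` (defined on the whole plane) is the extension by zero of an element of `H̃^{1/2}(K)`:
`v ∈ H^{1/2}(ℝ²)` and `v = 0` outside `K`. Its norm is `‖v‖_{H^{1/2}(ℝ²)}`. -/
def MemHtildeHalf (K : Set (ℝ × ℝ)) (v : ℝ × ℝ → ℝ) : Prop :=
  MemHs (1 / 2) Set.univ v ∧ ∀ x, x ∉ K → v x = 0

/-- The norm of `g` in `H^{-1/2}(K)`, the dual space of `H̃^{1/2}(K)`, where `g` acts by
`v ↦ ∫_K g v`: the supremum over the unit ball of `H̃^{1/2}(K)`. -/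
def hMinusHalfNorm (K : Set (ℝ × ℝ)) (g : ℝ × ℝ → ℝ) : ℝ≥0∞ :=
  ⨆ (v : ℝ × ℝ → ℝ) (_ : MemHtildeHalf K v ∧ hsNormSq (1 / 2) Set.univ v ≤ 1),
    ‖∫ x in K, g x * v x‖ₑ

/-! ### Divergence -/

/-- Partial derivative `∂_i φ` (indices `0`, `1`). -/
def partialD (i : Fin 2) (φ : ℝ × ℝ → ℝ) (x : ℝ × ℝ) : ℝ :=
  fderiv ℝ φ x ((![(1, 0), (0, 1)] : Fin 2 → ℝ × ℝ) i)

/-- `(u, ∇φ)_{0,K}` for differentiable `φ`. -/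
def gradPairing (K : Set (ℝ × ℝ)) (u : Fin 2 → ℝ × ℝ → ℝ) (φ : ℝ × ℝ → ℝ) : ℝ :=
  ∫ x in K, ∑ i, u i x * partialD i φ x

/-- `div u = d` in the sense of distributions on the open set `K`. -/
def HasWeakDiv (K : Set (ℝ × ℝ)) (u : Fin 2 → ℝ × ℝ → ℝ) (d : ℝ × ℝ → ℝ) : Prop :=
  ∀ φ : ℝ × ℝ → ℝ, ContDiff ℝ ∞ φ → HasCompactSupport φ → tsupport φ ⊆ K →
    gradPairing K u φ = -∫ x in K, d x * φ x

/-! ### The Raviart–Thomas interpolant -/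

/-- `f` is the weak normal flux `(u · n, 1)_{0,e}` through the edge `e` of the element `K`, for
`u ∈ H^{1/2}(K)²` with `div u = d ∈ L²(K)`: for all `ε ∈ (0, 1/2)` and all `φ ∈ H^{1-ε}(K)` with
trace `1` on `e` and trace `0` on the other edges, `f = (u, ∇φ)_{0,K} + ∫_K d φ`.

Here `(u, ∇φ)_{0,K}` is the duality pairing of `H^ε(K)` and `H^{-ε}(K)`. It and the trace
`H^{1-ε}(K) → L²(∂K)` are the continuous extensions of the pointwise defined objects for functions
that are smooth up to the boundary, which are dense in `H^{1-ε}(K)`; so both are expressed through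
approximation of `φ` in `H^{1-ε}(K)` by smooth `ψ n`. -/
def HasNormalFlux (κ : Shape) (h₁ h₂ : ℝ) (u : Fin 2 → ℝ × ℝ → ℝ) (d : ℝ × ℝ → ℝ)
    (e : Edge) (f : ℝ) : Prop :=
  ∀ ε : ℝ, 0 < ε → ε < 1 / 2 →
  ∀ φ : ℝ × ℝ → ℝ, MemHs (1 - ε) (element κ h₁ h₂) φ →
  ∀ ψ : ℕ → ℝ × ℝ → ℝ, (∀ n, ContDiff ℝ ∞ (ψ n)) →
    Tendsto (fun n => hsNormSq (1 - ε) (element κ h₁ h₂) (fun x => ψ n x - φ x)) atTop (𝓝 0) →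
    Tendsto (fun n => e.l2sq (fun x => ψ n x - 1)) atTop (𝓝 0) →
    (∀ e' ∈ edges κ h₁ h₂, e' ≠ e → Tendsto (fun n => e'.l2sq (ψ n)) atTop (𝓝 0)) →
    Tendsto (fun n => gradPairing (element κ h₁ h₂) u (ψ n)
      + ∫ x in element κ h₁ h₂, d x * ψ n x) atTop (𝓝 f)

/-- The lowest-order Raviart–Thomas space: fields `(a + c x₁, b + c x₂)` on triangles and
`(a + c x₁, b + d x₂)` on rectangles. -/
def MemRT0 (κ : Shape) (p : Fin 2 → ℝ × ℝ → ℝ) : Prop :=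
  match κ with
  | .triangle => ∃ a b c : ℝ, ∀ x : ℝ × ℝ, p 0 x = a + c * x.1 ∧ p 1 x = b + c * x.2
  | .rectangle => ∃ a b c d : ℝ, ∀ x : ℝ × ℝ, p 0 x = a + c * x.1 ∧ p 1 x = b + d * x.2

/-- `p = Π_RT u`: `p` lies in the lowest-order Raviart–Thomas space, and on every edge
`∫_e p · n ds` equals the weak normal flux of `u`, where `d = div u`. -/
def IsRTInterpolant (κ : Shape) (h₁ h₂ : ℝ) (u : Fin 2 → ℝ × ℝ → ℝ) (d : ℝ × ℝ → ℝ)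
    (p : Fin 2 → ℝ × ℝ → ℝ) : Prop :=
  MemRT0 κ p ∧ ∀ e ∈ edges κ h₁ h₂,
    HasNormalFlux κ h₁ h₂ u d e (e.integral (fun x => ∑ i, p i x * e.normal i))

end

end RTAniso

namespace RTAniso

/-! ### Elementary inequalities -/

/-! Scaling the axes carries every element to one of two reference elements of size one. The Piola
transform, which divides component `i` by `hᵢ`, keeps the divergence and the Raviart–Thomas space
and multiplies all fluxes by one factor, so it commutes with interpolation. It remains to bound
`‖u_l - p_l‖²` on a reference element by `|u_l|²` in `H^{1/2}` plus `|u_{l+1}|²` in the seminorm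
along direction `l+1` only (`reference_estimate`). The `H^{1/2}` seminorm on a line is scale
invariant, while the planar one loses `h_max³`; collecting the powers gives `h_max³ / (h₁ h₂)`
(`le_of_scaled`). With the full planar seminorm of `u_{l+1}`, the same bookkeeping would leave an
additional factor `h_l² / h_{l+1}²`.

On a reference element the normal fluxes are limits of the functional `flux`, that is `ψ ↦ (u, ∇ψ) +
∫ c ψ`, along smooth `ψ` tending to a function with trace one on an edge and zero on the others.
Everything rests on the continuity of this functional in `H^s`, `s > 1/2`. In dimension one, the
pairing of `w ∈ H^{1/2}` with `ψ'` is summed over dyadic subintervals: on each scale a difference of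
means of `w` meets an increment of `ψ`, and the latter is small by Morrey's inequality
(`abs_integral_sub_mean_mul_deriv_le`). In the plane this is applied to slices, whose seminorms
integrate to at most the planar seminorm (`ahSemiSq_one_le`). If `ψ` takes equal values at both ends
of each slice, constants in `w` drop out and only the seminorm of `w` along the slices remains
(`pairing_le_of_ends`); this is the source of the anisotropic term.

The fluxes are well defined because two admissible sequences differ by one that is Cauchy in `H^s`
and has vanishing traces, and `flux` tends to zero along such a sequence (`tendsto_flux_zero`): for
smooth fields it is a boundary integral, and mollification inside the convex element supplies smooth
fields of constant divergence with uniform bounds (`exists_approximation`). Explicit functions built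
from regularized angles at the corners provide admissible sequences for every edge
(`exists_edgeSequence`).

For an edge with normal along axis `l`, a test function vanishing on the other edges has equal
values at the ends of the slices in direction `l+1`, and its derivative in direction `l` has
integral close to `±1`. Hence the flux is, up to sign, close to a constant `k` that approximates
`u_l` (`flux_gap_le`, `exists_flux_close`). On the rectangle such fluxes determine the interpolant.
On the triangle the hypotenuse is handled by the sum of all fluxes, which is the integral of the
divergence (`sum_flux_triangle`).

The constant divergence itself is bounded by the other two seminorms, by testing with a bump
function inside the element (`exists_const_div`). The negative norm in the theorem is therefore a
spare nonnegative term. -/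

lemma ennreal_add_sq_le (a b : ℝ≥0∞) : (a + b) ^ 2 ≤ 2 * (a ^ 2 + b ^ 2) := by
  rcases eq_or_ne a ⊤ with rfl | ha
  · simp
  rcases eq_or_ne b ⊤ with rfl | hb
  · simp
  lift a to ℝ≥0 using ha
  lift b to ℝ≥0 using hb
  norm_cast
  rw [← NNReal.coe_le_coe]
  push_cast
  nlinarith [sq_nonneg ((a : ℝ) - b)]

lemma enorm_add_sq_le (a b : ℝ) : ‖a + b‖ₑ ^ 2 ≤ 2 * (‖a‖ₑ ^ 2 + ‖b‖ₑ ^ 2) :=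
  (pow_le_pow_left' (enorm_add_le a b) 2).trans (ennreal_add_sq_le _ _)

lemma enorm_sub_sq_le (a b : ℝ) : ‖a - b‖ₑ ^ 2 ≤ 2 * (‖a‖ₑ ^ 2 + ‖b‖ₑ ^ 2) := by
  simpa [sub_eq_add_neg] using enorm_add_sq_le a (-b)

lemma lintegral_mul_sq_le {α : Type*} [MeasurableSpace α] {μ : Measure α} {f g : α → ℝ≥0∞}
    (hf : AEMeasurable f μ) (hg : AEMeasurable g μ) :
    (∫⁻ x, f x * g x ∂μ) ^ 2 ≤ (∫⁻ x, f x ^ 2 ∂μ) * ∫⁻ x, g x ^ 2 ∂μ := by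
  have h := ENNReal.lintegral_mul_le_Lp_mul_Lq μ Real.HolderConjugate.two_two hf hg
  have h2 := pow_le_pow_left' h 2
  rw [mul_pow] at h2
  have e : ∀ x : ℝ≥0∞, (x ^ (1 / (2 : ℝ))) ^ 2 = x := fun x => by
    rw [← ENNReal.rpow_natCast, ← ENNReal.rpow_mul]; norm_num
  rw [e, e] at h2
  simpa using h2

lemma lintegral_sq_le {α : Type*} [MeasurableSpace α] {μ : Measure α} {f : α → ℝ≥0∞}
    (hf : AEMeasurable f μ) :
    (∫⁻ x, f x ∂μ) ^ 2 ≤ μ Set.univ * ∫⁻ x, f x ^ 2 ∂μ := by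
  simpa using lintegral_mul_sq_le (μ := μ) (f := fun _ => 1) (g := f) aemeasurable_const hf

lemma enorm_integral_mul_sq_le {α : Type*} [MeasurableSpace α] {μ : Measure α} {f g : α → ℝ}
    (hf : AEStronglyMeasurable f μ) (hg : AEStronglyMeasurable g μ) :
    ‖∫ x, f x * g x ∂μ‖ₑ ^ 2 ≤ (∫⁻ x, ‖f x‖ₑ ^ 2 ∂μ) * ∫⁻ x, ‖g x‖ₑ ^ 2 ∂μ := by
  refine (pow_le_pow_left' (enorm_integral_le_lintegral_enorm _) 2).trans ?_
  simp_rw [enorm_mul]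
  exact lintegral_mul_sq_le hf.enorm hg.enorm

/-- A kernel weight can be removed at the cost of its maximum. -/
lemma enorm_sq_le_div_mul {d k K : ℝ} (hk : k = 0 → d = 0) (hkK : k ≤ K) :
    ‖d‖ₑ ^ 2 ≤ ‖d‖ₑ ^ 2 / ENNReal.ofReal k * ENNReal.ofReal K ∨ k < 0 := by
  rcases lt_trichotomy k 0 with h | h | h
  · exact Or.inr h
  · left; simp [hk h]
  · left
    have h0 : ENNReal.ofReal k ≠ 0 := by simpa using h
    calc ‖d‖ₑ ^ 2 = ‖d‖ₑ ^ 2 / ENNReal.ofReal k * ENNReal.ofReal k :=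
          (ENNReal.div_mul_cancel h0 ENNReal.ofReal_ne_top).symm
      _ ≤ _ := by gcongr

/-! ### Functions on an interval -/

/-- Mean value over an interval. -/
noncomputable def mean (f : ℝ → ℝ) (a b : ℝ) : ℝ := (b - a)⁻¹ * ∫ x in a..b, f x

/-- The `H^σ` seminorm on an interval, as a real number. -/
noncomputable def sn (σ : ℝ) (f : ℝ → ℝ) (a b : ℝ) : ℝ :=
  √ (hsSemiSq₁ σ (Set.Ioo a b) f).toReal

lemma sn_nonneg (σ : ℝ) (f : ℝ → ℝ) (a b : ℝ) : 0 ≤ sn σ f a b := Real.sqrt_nonneg _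

lemma measurable_diff_kernel₁ {f : ℝ → ℝ} (hf : Measurable f) (σ : ℝ) :
    Measurable fun p : ℝ × ℝ =>
      ‖f p.1 - f p.2‖ₑ ^ 2 / ENNReal.ofReal (|p.1 - p.2| ^ (1 + 2 * σ)) := by
  have h1 : Measurable fun p : ℝ × ℝ => |p.1 - p.2| ^ (1 + 2 * σ) := by
    have : Measurable fun p : ℝ × ℝ => |p.1 - p.2| := by fun_prop
    exact this.pow_const _
  have h2 : Measurable fun p : ℝ × ℝ => f p.1 - f p.2 :=
    (hf.comp measurable_fst).sub (hf.comp measurable_snd)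
  exact (h2.enorm.pow_const 2).div h1.ennreal_ofReal

/-- Cauchy–Schwarz in each of the two variables costs `(b - a)²`, and `|x - y| ≤ b - a` lets the
singular kernel be inserted at the price `(b - a)^(1 + 2σ)`. -/
lemma lintegral_diff_sq_le {f : ℝ → ℝ} (hf : Measurable f) {σ a b : ℝ} (hσ : 0 < σ) (hab : a < b) :
    (∫⁻ x in Set.Ioo a b, ∫⁻ y in Set.Ioo a b, ‖f x - f y‖ₑ) ^ 2 ≤
      ENNReal.ofReal ((b - a) ^ (3 + 2 * σ)) * hsSemiSq₁ σ (Set.Ioo a b) f := by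
  have hm : Measurable fun p : ℝ × ℝ => ‖f p.1 - f p.2‖ₑ :=
    ((hf.comp measurable_fst).sub (hf.comp measurable_snd)).enorm
  have hI : volume (Set.Ioo a b) = ENNReal.ofReal (b - a) := Real.volume_Ioo
  have hba : 0 < b - a := sub_pos.2 hab
  have key : ∀ x ∈ Set.Ioo a b, ∀ y ∈ Set.Ioo a b, ‖f x - f y‖ₑ ^ 2 ≤
      ENNReal.ofReal ((b - a) ^ (1 + 2 * σ)) *
        (‖f x - f y‖ₑ ^ 2 / ENNReal.ofReal (|x - y| ^ (1 + 2 * σ))) := by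
    intro x hx y hy
    have hxy : |x - y| ≤ b - a := by
      rw [abs_le]; constructor <;> linarith [hx.1, hx.2, hy.1, hy.2]
    have h0 : |x - y| ^ (1 + 2 * σ) = 0 → f x - f y = 0 := by
      intro h
      rw [Real.rpow_eq_zero (abs_nonneg _) (by positivity)] at h
      rw [sub_eq_zero.1 (abs_eq_zero.1 h), sub_self]
    rcases enorm_sq_le_div_mul h0
      (Real.rpow_le_rpow (abs_nonneg _) hxy (by positivity : 0 ≤ 1 + 2 * σ)) with h | h
    · rwa [mul_comm]
    · exact absurd h (not_lt.2 (by positivity))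
  have e3 : (b - a) ^ (3 + 2 * σ) = (b - a) * (b - a) * (b - a) ^ (1 + 2 * σ) := by
    rw [show 3 + 2 * σ = 1 + 1 + (1 + 2 * σ) by ring, Real.rpow_add hba, Real.rpow_add hba,
      Real.rpow_one]
  calc (∫⁻ x in Set.Ioo a b, ∫⁻ y in Set.Ioo a b, ‖f x - f y‖ₑ) ^ 2
      ≤ ENNReal.ofReal (b - a) *
          ∫⁻ x in Set.Ioo a b, (∫⁻ y in Set.Ioo a b, ‖f x - f y‖ₑ) ^ 2 := by
        refine (lintegral_sq_le hm.lintegral_prod_right'.aemeasurable).trans ?_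
        rw [Measure.restrict_apply_univ, hI]
    _ ≤ ENNReal.ofReal (b - a) * ∫⁻ x in Set.Ioo a b, ENNReal.ofReal (b - a) *
          ∫⁻ y in Set.Ioo a b, ‖f x - f y‖ₑ ^ 2 := by
        gcongr with x
        refine (lintegral_sq_le (hm.comp measurable_prodMk_left).aemeasurable).trans ?_
        rw [Measure.restrict_apply_univ, hI]; rfl
    _ ≤ ENNReal.ofReal (b - a) * ∫⁻ x in Set.Ioo a b, ENNReal.ofReal (b - a) *
          ∫⁻ y in Set.Ioo a b, ENNReal.ofReal ((b - a) ^ (1 + 2 * σ)) *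
        (‖f x - f y‖ₑ ^ 2 / ENNReal.ofReal (|x - y| ^ (1 + 2 * σ))) := by
        refine mul_le_mul_right (setLIntegral_mono' measurableSet_Ioo fun x hx => ?_) _
        refine mul_le_mul_right ?_ _
        exact setLIntegral_mono' measurableSet_Ioo fun y hy => key x hx y hy
    _ = _ := by
        have := measurable_diff_kernel₁ hf σ
        rw [hsSemiSq₁, e3, lintegral_const_mul' _ _ ENNReal.ofReal_ne_top]
        simp_rw [lintegral_const_mul' _ _ ENNReal.ofReal_ne_top]
        rw [ENNReal.ofReal_mul (by positivity), ENNReal.ofReal_mul (by positivity)]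
        simp only [mul_assoc]

/-- A fractional Poincaré inequality in `L¹`: `f x` minus the mean is the average of `f x - f y`
over `y`, so the double integral of differences controls it. -/
lemma oscillation_le {f : ℝ → ℝ} (hf : Measurable f) {σ a b : ℝ} (hσ : 0 < σ) (hab : a < b)
    (hint : IntegrableOn f (Set.Ioo a b)) (hfin : hsSemiSq₁ σ (Set.Ioo a b) f ≠ ⊤) :
    ∫ x in a..b, |f x - mean f a b| ≤ (b - a) ^ (σ + 1 / 2) * sn σ f a b := by
  have hba : 0 < b - a := sub_pos.2 hab
  have hvol : volume.real (Set.Ioo a b) = b - a := by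
    rw [Measure.real, Real.volume_Ioo, ENNReal.toReal_ofReal hba.le]
  have : IsFiniteMeasure (volume.restrict (Set.Ioo a b)) := ⟨by simp⟩
  have hmean : ∀ x, f x - mean f a b = (b - a)⁻¹ * ∫ y in Set.Ioo a b, (f x - f y) := by
    intro x
    rw [integral_sub (integrable_const _) hint, mean, intervalIntegral.integral_of_le hab.le,
      integral_Ioc_eq_integral_Ioo]
    simp only [integral_const, smul_eq_mul, measureReal_restrict_apply_univ, hvol]
    field_simp
  set D := ∫⁻ x in Set.Ioo a b, ∫⁻ y in Set.Ioo a b, ‖f x - f y‖ₑ with hD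
  have h1 : ∫⁻ x in Set.Ioo a b, ‖f x - mean f a b‖ₑ ≤ ENNReal.ofReal (b - a)⁻¹ * D := by
    rw [hD, ← lintegral_const_mul' _ _ ENNReal.ofReal_ne_top]
    refine lintegral_mono fun x => ?_
    rw [hmean x, enorm_mul, Real.enorm_of_nonneg (inv_nonneg.2 hba.le)]
    gcongr
    exact enorm_integral_le_lintegral_enorm _
  have h2 := lintegral_diff_sq_le hf hσ hab
  have h3 : (∫⁻ x in Set.Ioo a b, ‖f x - mean f a b‖ₑ) ^ 2 ≤
      ENNReal.ofReal ((b - a) ^ (1 + 2 * σ)) * hsSemiSq₁ σ (Set.Ioo a b) f := by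
    refine (pow_le_pow_left' h1 2).trans ?_
    rw [mul_pow]
    refine (mul_le_mul_right h2 _).trans (le_of_eq ?_)
    rw [← mul_assoc, ← ENNReal.ofReal_pow (by positivity), ← ENNReal.ofReal_mul (by positivity)]
    congr 2
    rw [show 3 + 2 * σ = 1 + 1 + (1 + 2 * σ) by ring, Real.rpow_add hba, Real.rpow_add hba,
      Real.rpow_one]
    field_simp
  rw [intervalIntegral.integral_of_le hab.le, integral_Ioc_eq_integral_Ioo]
  have hX : ∫ x in Set.Ioo a b, |f x - mean f a b| =
      (∫⁻ x in Set.Ioo a b, ‖f x - mean f a b‖ₑ).toReal := by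
    simp_rw [← Real.norm_eq_abs]
    rw [integral_norm_eq_lintegral_enorm]
    exact (hf.sub_const _).aestronglyMeasurable
  rw [hX]
  have h4 := ENNReal.toReal_mono (ENNReal.mul_ne_top ENNReal.ofReal_ne_top hfin) h3
  rw [ENNReal.toReal_pow, ENNReal.toReal_mul, ENNReal.toReal_ofReal (by positivity)] at h4
  have e : (b - a) ^ (σ + 1 / 2) = √ ((b - a) ^ (1 + 2 * σ)) := by
    rw [Real.sqrt_eq_rpow, ← Real.rpow_mul hba.le]; ring_nf
  rw [e, sn, ← Real.sqrt_mul (by positivity)]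
  exact Real.le_sqrt_of_sq_le h4

/-- Means over an interval and over a part of at least half its length. -/
lemma abs_mean_sub_mean_le {f : ℝ → ℝ} (hf : Measurable f) {σ a b a' b' : ℝ} (hσ : 0 < σ)
    (hint : IntegrableOn f (Set.Ioo a b)) (hfin : hsSemiSq₁ σ (Set.Ioo a b) f ≠ ⊤)
    (ha : a ≤ a') (hab' : a' < b') (hb : b' ≤ b) (hlen : b - a ≤ 2 * (b' - a')) :
    |mean f a' b' - mean f a b| ≤ 2 * (b - a) ^ (σ - 1 / 2) * sn σ f a b := by
  have hab : a < b := by linarith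
  have hba : 0 < b - a := sub_pos.2 hab
  have hba' : 0 < b' - a' := sub_pos.2 hab'
  have ho := oscillation_le hf hσ hab hint hfin
  have hii : IntervalIntegrable f volume a b := by
    rw [intervalIntegrable_iff_integrableOn_Ioo_of_le hab.le]; exact hint
  have hii' : IntervalIntegrable f volume a' b' :=
    hii.mono_set (by rw [Set.uIcc_of_le hab.le, Set.uIcc_of_le hab'.le]; exact Set.Icc_subset_Icc ha hb)
  -- The difference of means is the average, over the smaller interval, of the oscillation on the
  -- larger one.
  have e1 : mean f a' b' - mean f a b = (b' - a')⁻¹ * ∫ x in a'..b', (f x - mean f a b) := by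
    rw [intervalIntegral.integral_sub hii' (by simp), intervalIntegral.integral_const]
    conv_lhs => rw [mean]
    simp only [smul_eq_mul]
    field_simp
  have h2 : |∫ x in a'..b', (f x - mean f a b)| ≤ ∫ x in a..b, |f x - mean f a b| := by
    refine (intervalIntegral.abs_integral_le_integral_abs hab'.le).trans ?_
    refine intervalIntegral.integral_mono_interval ha hab'.le hb ?_ ?_
    · exact Eventually.of_forall fun x => abs_nonneg _
    · exact (hii.sub (by simp)).abs
  rw [e1, abs_mul, abs_of_pos (inv_pos.2 hba')]
  have h3 : (b' - a')⁻¹ ≤ 2 * (b - a)⁻¹ := by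
    rw [← div_eq_mul_inv, inv_eq_one_div, div_le_div_iff₀ hba' hba]; linarith
  calc (b' - a')⁻¹ * |∫ x in a'..b', (f x - mean f a b)|
      ≤ 2 * (b - a)⁻¹ * ((b - a) ^ (σ + 1 / 2) * sn σ f a b) := by
        gcongr; exact h2.trans ho
    _ = _ := by
        rw [show σ + 1 / 2 = 1 + (σ - 1 / 2) by ring, Real.rpow_add hba, Real.rpow_one]
        field_simp

lemma hsSemiSq₁_mono {σ : ℝ} {f : ℝ → ℝ} {I J : Set ℝ} (h : I ⊆ J) :
    hsSemiSq₁ σ I f ≤ hsSemiSq₁ σ J f :=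
  lintegral_mono' (Measure.restrict_mono h le_rfl) fun _ =>
    lintegral_mono' (Measure.restrict_mono h le_rfl) fun _ => le_rfl

lemma sn_mono {σ : ℝ} {f : ℝ → ℝ} {a b a' b' : ℝ} (hfin : hsSemiSq₁ σ (Set.Ioo a b) f ≠ ⊤)
    (ha : a ≤ a') (hb : b' ≤ b) : sn σ f a' b' ≤ sn σ f a b :=
  Real.sqrt_le_sqrt (ENNReal.toReal_mono hfin (hsSemiSq₁_mono (Set.Ioo_subset_Ioo ha hb)))

/-- The squares over the two halves are disjoint parts of the square over the whole interval. This
superadditivity is what allows Cauchy–Schwarz to be used on every dyadic level without loss. -/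
lemma hsSemiSq₁_add_le {σ : ℝ} {f : ℝ → ℝ} {a m b : ℝ} (h1 : a ≤ m) (h2 : m ≤ b) :
    hsSemiSq₁ σ (Set.Ioo a m) f + hsSemiSq₁ σ (Set.Ioo m b) f ≤ hsSemiSq₁ σ (Set.Ioo a b) f := by
  have hd : Disjoint (Set.Ioo a m) (Set.Ioo m b) :=
    Set.disjoint_left.2 fun x hx hy => absurd hx.2 (not_lt.2 hy.1.le)
  have hsub : Set.Ioo a m ∪ Set.Ioo m b ⊆ Set.Ioo a b :=
    Set.union_subset (Set.Ioo_subset_Ioo le_rfl h2) (Set.Ioo_subset_Ioo h1 le_rfl)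
  calc _ ≤ (∫⁻ x in Set.Ioo a m, ∫⁻ y in Set.Ioo a b,
          ‖f x - f y‖ₑ ^ 2 / ENNReal.ofReal (|x - y| ^ (1 + 2 * σ))) +
        ∫⁻ x in Set.Ioo m b, ∫⁻ y in Set.Ioo a b,
          ‖f x - f y‖ₑ ^ 2 / ENNReal.ofReal (|x - y| ^ (1 + 2 * σ)) := by
        refine add_le_add ?_ ?_
        · exact lintegral_mono fun _ => lintegral_mono' (Measure.restrict_mono
            (Set.Ioo_subset_Ioo le_rfl h2) le_rfl) fun _ => le_rfl
        · exact lintegral_mono fun _ => lintegral_mono' (Measure.restrict_mono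
            (Set.Ioo_subset_Ioo h1 le_rfl) le_rfl) fun _ => le_rfl
    _ = ∫⁻ x in Set.Ioo a m ∪ Set.Ioo m b, ∫⁻ y in Set.Ioo a b,
          ‖f x - f y‖ₑ ^ 2 / ENNReal.ofReal (|x - y| ^ (1 + 2 * σ)) :=
        (lintegral_union measurableSet_Ioo hd).symm
    _ ≤ _ := lintegral_mono' (Measure.restrict_mono hsub le_rfl) fun _ => le_rfl

lemma sn_sq_add_le {σ : ℝ} {f : ℝ → ℝ} {a m b : ℝ} (h1 : a ≤ m) (h2 : m ≤ b)
    (hfin : hsSemiSq₁ σ (Set.Ioo a b) f ≠ ⊤) :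
    sn σ f a m ^ 2 + sn σ f m b ^ 2 ≤ sn σ f a b ^ 2 := by
  have hA : hsSemiSq₁ σ (Set.Ioo a m) f ≠ ⊤ :=
    ne_top_of_le_ne_top hfin (hsSemiSq₁_mono (Set.Ioo_subset_Ioo le_rfl h2))
  have hB : hsSemiSq₁ σ (Set.Ioo m b) f ≠ ⊤ :=
    ne_top_of_le_ne_top hfin (hsSemiSq₁_mono (Set.Ioo_subset_Ioo h1 le_rfl))
  simp only [sn, Real.sq_sqrt ENNReal.toReal_nonneg]
  rw [← ENNReal.toReal_add hA hB]
  exact ENNReal.toReal_mono hfin (hsSemiSq₁_add_le h1 h2)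

/-! ### The pairing of `H^{1/2}` with derivatives of `H^s` functions on an interval -/

lemma two_rpow_neg_lt_one {α : ℝ} (hα : 0 < α) : (2 : ℝ) ^ (-α) < 1 :=
  Real.rpow_lt_one_of_one_lt_of_neg one_lt_two (neg_lt_zero.2 hα)

lemma half_rpow {t α : ℝ} (ht : 0 ≤ t) : (t / 2) ^ α = 2 ^ (-α) * t ^ α := by
  rw [Real.div_rpow ht zero_le_two, Real.rpow_neg zero_le_two]; field_simp

lemma le_of_tail_tendsto {x A B q : ℝ} (hq0 : 0 ≤ q) (hq : q < 1) (h : ∀ n : ℕ, x ≤ A + B * q ^ n) :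
    x ≤ A := by
  have h1 : Tendsto (fun n : ℕ => A + B * q ^ n) atTop (𝓝 (A + B * 0)) :=
    ((tendsto_pow_atTop_nhds_zero_of_lt_one hq0 hq).const_mul B).const_add A
  simpa using ge_of_tendsto' h1 h

/-- Telescoping over halved lengths. -/
lemma telescope_le {E : ℝ → ℝ} {C M α ℓ : ℝ} (hα : 0 < α) (hℓ : 0 < ℓ) (hC : 0 ≤ C)
    (h1 : ∀ t, 0 < t → t ≤ ℓ → E t ≤ E (t / 2) + C * t ^ α)
    (h2 : ∀ t, 0 < t → t ≤ ℓ → E t ≤ M * t) :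
    E ℓ ≤ C / (1 - 2 ^ (-α)) * ℓ ^ α := by
  have hq : 0 < 1 - (2 : ℝ) ^ (-α) := sub_pos.2 (two_rpow_neg_lt_one hα)
  have key : ∀ n : ℕ, ∀ t, 0 < t → t ≤ ℓ →
      E t ≤ C / (1 - 2 ^ (-α)) * t ^ α + M * t * (1 / 2) ^ n := by
    intro n
    induction n with
    | zero =>
      intro t ht htl
      have := h2 t ht htl
      have h3 : 0 ≤ C / (1 - 2 ^ (-α)) * t ^ α := by positivity
      simp only [pow_zero, mul_one]; linarith
    | succ n ih =>
      intro t ht htl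
      have h3 := h1 t ht htl
      have h4 := ih (t / 2) (by positivity) (by linarith)
      rw [half_rpow ht.le] at h4
      -- The constant is the fixed point of `A ↦ 2 ^ (-α) * A + C`, the sum of the geometric series
      -- of corrections.
      have h5 : C / (1 - 2 ^ (-α)) * (2 ^ (-α) * t ^ α) + C * t ^ α =
          C / (1 - 2 ^ (-α)) * t ^ α := by field_simp; ring
      rw [pow_succ]
      linarith
  exact le_of_tail_tendsto (by norm_num) (by norm_num) fun n => key n ℓ hℓ le_rfl

/-- Summation over dyadic subdivisions of an interval. -/
lemma dyadic_le {E W Ψ : ℝ → ℝ → ℝ} {C M α a₀ b₀ : ℝ} (hα : 0 < α) (hC : 0 ≤ C) (hM : 0 ≤ M)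
    (hW0 : ∀ a b, 0 ≤ W a b) (hΨ0 : ∀ a b, 0 ≤ Ψ a b)
    (hW : ∀ a m b, a₀ ≤ a → a ≤ m → m ≤ b → b ≤ b₀ → W a m ^ 2 + W m b ^ 2 ≤ W a b ^ 2)
    (hΨ : ∀ a m b, a₀ ≤ a → a ≤ m → m ≤ b → b ≤ b₀ → Ψ a m ^ 2 + Ψ m b ^ 2 ≤ Ψ a b ^ 2)
    (h1 : ∀ a m b, a₀ ≤ a → a < b → b ≤ b₀ → m = (a + b) / 2 →
      E a b ≤ E a m + E m b + C * (b - a) ^ α * (W a b * Ψ a b))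
    (h2 : ∀ a b, a₀ ≤ a → a < b → b ≤ b₀ → E a b ≤ M * (b - a) * W a b) (hab : a₀ < b₀) :
    E a₀ b₀ ≤ C / (1 - 2 ^ (-α)) * (b₀ - a₀) ^ α * (W a₀ b₀ * Ψ a₀ b₀) := by
  have hq : 0 < 1 - (2 : ℝ) ^ (-α) := sub_pos.2 (two_rpow_neg_lt_one hα)
  set A := C / (1 - 2 ^ (-α)) with hA
  have hA0 : 0 ≤ A := by positivity
  have hs2 : (0 : ℝ) < √2 := by positivity
  have hs22 : √2 ^ 2 = (2 : ℝ) := Real.sq_sqrt zero_le_two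
  -- After `n` halvings the remainder comes from `2 ^ n` pieces of relative length `2 ^ (-n)`.
  -- Superadditivity of `W ^ 2` bounds the sum of `W` over them by `√2 ^ n` times `W`, so the crude
  -- bound `h2` decays like `(√2 / 2) ^ n`. The products `W * Ψ` do not grow under subdivision, and
  -- `(b - a) ^ α` gains `2 ^ (-α)` each time.
  have key : ∀ n : ℕ, ∀ a b, a₀ ≤ a → a < b → b ≤ b₀ →
      E a b ≤ A * (b - a) ^ α * (W a b * Ψ a b) + M * (b - a) * W a b * (√2 / 2) ^ n := by
    intro n
    induction n with
    | zero =>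
      intro a b ha hab hb
      have h3 : 0 ≤ A * (b - a) ^ α * (W a b * Ψ a b) := by
        have := hW0 a b
        have := hΨ0 a b
        have := sub_pos.2 hab
        positivity
      have := h2 a b ha hab hb
      simp only [pow_zero, mul_one]; linarith
    | succ n ih =>
      intro a b ha hab hb
      obtain ⟨m, hm⟩ : ∃ m, m = (a + b) / 2 := ⟨_, rfl⟩
      have hba : 0 < b - a := sub_pos.2 hab
      have ham : a < m := by linarith
      have hmb : m < b := by linarith
      have i1 := ih a m ha ham (by linarith)
      have i2 := ih m b (by linarith) hmb hb
      rw [show m - a = (b - a) / 2 by linarith, half_rpow hba.le] at i1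
      rw [show b - m = (b - a) / 2 by linarith, half_rpow hba.le] at i2
      have h3 := h1 a m b ha hab hb hm
      have w1 := hW0 a m
      have w2 := hW0 m b
      have w := hW0 a b
      have p1 := hΨ0 a m
      have p2 := hΨ0 m b
      have p := hΨ0 a b
      have hw := hW a m b ha ham.le hmb.le hb
      have hp := hΨ a m b ha ham.le hmb.le hb
      have c1 : W a m * Ψ a m + W m b * Ψ m b ≤ W a b * Ψ a b := by
        refine abs_le_of_sq_le_sq' ?_ (by positivity) |>.2
        nlinarith [sq_nonneg (W a m * Ψ m b - W m b * Ψ a m),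
          mul_le_mul hw hp (by positivity) (by positivity)]
      have c2 : W a m + W m b ≤ √2 * W a b := by
        refine abs_le_of_sq_le_sq' ?_ (by positivity) |>.2
        rw [mul_pow, hs22]
        nlinarith [sq_nonneg (W a m - W m b)]
      have d1 : A * (2 ^ (-α) * (b - a) ^ α) * (W a m * Ψ a m) +
          A * (2 ^ (-α) * (b - a) ^ α) * (W m b * Ψ m b) ≤
          A * (2 ^ (-α) * (b - a) ^ α) * (W a b * Ψ a b) := by
        rw [← mul_add]; gcongr
      have d2 : M * ((b - a) / 2) * W a m * (√2 / 2) ^ n + M * ((b - a) / 2) * W m b * (√2 / 2) ^ n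
          ≤ M * (b - a) * W a b * (√2 / 2) ^ (n + 1) := by
        calc _ = M * ((b - a) / 2) * (√2 / 2) ^ n * (W a m + W m b) := by ring
          _ ≤ M * ((b - a) / 2) * (√2 / 2) ^ n * (√2 * W a b) := by gcongr
          _ = _ := by rw [pow_succ]; ring
      have d3 : A * (2 ^ (-α) * (b - a) ^ α) * (W a b * Ψ a b) + C * (b - a) ^ α * (W a b * Ψ a b) =
          A * (b - a) ^ α * (W a b * Ψ a b) := by
        rw [hA]; field_simp; ring
      linarith
  refine le_of_tail_tendsto (q := √2 / 2) (by positivity) ?_ fun n => key n a₀ b₀ le_rfl hab le_rfl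
  rw [div_lt_one two_pos, Real.sqrt_lt' two_pos]; norm_num

lemma exists_lipschitz_bound {ψ : ℝ → ℝ} (hψ : ContDiff ℝ 1 ψ) (a b : ℝ) :
    ∃ M, 0 ≤ M ∧ (∀ x ∈ Set.Icc a b, |deriv ψ x| ≤ M) ∧
      ∀ x ∈ Set.Icc a b, ∀ y ∈ Set.Icc a b, |ψ x - ψ y| ≤ M * |x - y| := by
  obtain ⟨M, hM⟩ := (isCompact_Icc (a := a) (b := b)).exists_bound_of_continuousOn
    (hψ.continuous_deriv le_rfl).continuousOn
  refine ⟨max M 0, le_max_right _ _, fun x hx => (hM x hx).trans (le_max_left _ _), ?_⟩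
  intro x hx y hy
  exact (convex_Icc a b).norm_image_sub_le_of_norm_deriv_le
    (fun z _ => hψ.differentiable one_ne_zero z) (fun z hz => (hM z hz).trans (le_max_left _ _)) hy hx

lemma abs_sub_mean_le {ψ : ℝ → ℝ} (hψ : Continuous ψ) {a b c M ℓ : ℝ} (hab : a < b)
    (h : ∀ x ∈ Set.Icc a b, |c - ψ x| ≤ M * ℓ) : |c - mean ψ a b| ≤ M * ℓ := by
  have hba : 0 < b - a := sub_pos.2 hab
  have e : c - mean ψ a b = (b - a)⁻¹ * ∫ x in a..b, (c - ψ x) := by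
    rw [intervalIntegral.integral_sub (by simp) (hψ.intervalIntegrable _ _), mean,
      intervalIntegral.integral_const]
    simp only [smul_eq_mul]; field_simp
  have := intervalIntegral.norm_integral_le_of_norm_le_const (a := a) (b := b)
    (f := fun x => c - ψ x) (C := M * ℓ) fun x hx => h x (by
      rw [Set.uIoc_of_le hab.le] at hx; exact ⟨hx.1.le, hx.2⟩)
  rw [e, abs_mul, abs_of_pos (inv_pos.2 hba), inv_mul_le_iff₀ hba, mul_comm]
  rwa [Real.norm_eq_abs, abs_of_pos hba] at this

/-- Morrey's inequality in dimension one. -/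
lemma abs_sub_le_sn {s : ℝ} (hs : 1 / 2 < s) {ψ : ℝ → ℝ} (hψ : ContDiff ℝ 1 ψ) {a b : ℝ}
    (hab : a < b) (hfin : hsSemiSq₁ s (Set.Ioo a b) ψ ≠ ⊤) :
    |ψ b - ψ a| ≤ 4 / (1 - 2 ^ (-(s - 1 / 2))) * (b - a) ^ (s - 1 / 2) * sn s ψ a b := by
  have hα : 0 < s - 1 / 2 := sub_pos.2 hs
  have hba : 0 < b - a := sub_pos.2 hab
  obtain ⟨M, hM0, -, hM⟩ := exists_lipschitz_bound hψ a b
  have hint : IntegrableOn ψ (Set.Ioo a b) :=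
    (hψ.continuous.integrableOn_Icc).mono_set Set.Ioo_subset_Icc_self
  have hm := hψ.continuous.measurable
  have hfin' : ∀ {a' b'}, a ≤ a' → b' ≤ b → hsSemiSq₁ s (Set.Ioo a' b') ψ ≠ ⊤ := fun h1 h2 =>
    ne_top_of_le_ne_top hfin (hsSemiSq₁_mono (Set.Ioo_subset_Ioo h1 h2))
  have hint' : ∀ {a' b'}, a ≤ a' → b' ≤ b → IntegrableOn ψ (Set.Ioo a' b') := fun h1 h2 =>
    hint.mono_set (Set.Ioo_subset_Ioo h1 h2)
  have hS := sn_nonneg s ψ a b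
  -- The means over `(b - t, b)` are followed as `t` is halved. The smoothness of `ψ` enters only
  -- through `M`, to know that the means converge to `ψ b`; `M` is absent from the result. The same
  -- is done at `a`, and the two ends together produce the constant `4`.
  have hr := telescope_le (E := fun t => |ψ b - mean ψ (b - t) b|) (C := 2 * sn s ψ a b) (M := M)
    hα hba (by positivity)
    (by
      intro t ht htl
      have h1 := abs_mean_sub_mean_le hm (σ := s) (a := b - t) (b := b) (a' := b - t / 2) (b' := b)
        (by linarith) (hint' (by linarith) le_rfl) (hfin' (by linarith) le_rfl) (by linarith)
        (by linarith) le_rfl (by linarith)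
      have h2 := sn_mono hfin (a' := b - t) (b' := b) (by linarith) le_rfl
      have h3 : 2 * (b - (b - t)) ^ (s - 1 / 2) * sn s ψ (b - t) b ≤
          2 * sn s ψ a b * t ^ (s - 1 / 2) := by
        rw [sub_sub_cancel]
        calc _ ≤ 2 * t ^ (s - 1 / 2) * sn s ψ a b := by gcongr
          _ = _ := by ring
      have h4 := abs_sub_le (ψ b) (mean ψ (b - t / 2) b) (mean ψ (b - t) b)
      linarith)
    (by
      intro t ht htl
      refine abs_sub_mean_le hψ.continuous (by linarith) fun x hx => ?_
      refine (hM b ⟨hab.le, le_rfl⟩ x ⟨by linarith [hx.1], hx.2⟩).trans ?_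
      gcongr
      rw [abs_of_nonneg (by linarith [hx.2])]; linarith [hx.1])
  have hl := telescope_le (E := fun t => |ψ a - mean ψ a (a + t)|) (C := 2 * sn s ψ a b) (M := M)
    hα hba (by positivity)
    (by
      intro t ht htl
      have h1 := abs_mean_sub_mean_le hm (σ := s) (a := a) (b := a + t) (a' := a) (b' := a + t / 2)
        (by linarith) (hint' le_rfl (by linarith)) (hfin' le_rfl (by linarith)) le_rfl
        (by linarith) (by linarith) (by linarith)
      have h2 := sn_mono hfin (a' := a) (b' := a + t) le_rfl (by linarith)
      have h3 : 2 * (a + t - a) ^ (s - 1 / 2) * sn s ψ a (a + t) ≤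
          2 * sn s ψ a b * t ^ (s - 1 / 2) := by
        rw [add_sub_cancel_left]
        calc _ ≤ 2 * t ^ (s - 1 / 2) * sn s ψ a b := by gcongr
          _ = _ := by ring
      have h4 := abs_sub_le (ψ a) (mean ψ a (a + t / 2)) (mean ψ a (a + t))
      linarith)
    (by
      intro t ht htl
      refine abs_sub_mean_le hψ.continuous (by linarith) fun x hx => ?_
      refine (hM a ⟨le_rfl, hab.le⟩ x ⟨hx.1, by linarith [hx.2]⟩).trans ?_
      gcongr
      rw [abs_of_nonpos (by linarith [hx.1])]; linarith [hx.2])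
  simp only [sub_sub_cancel, add_sub_cancel] at hr hl
  have h4 := abs_sub_le (ψ b) (mean ψ a b) (ψ a)
  rw [abs_sub_comm (mean ψ a b)] at h4
  have : 4 / (1 - 2 ^ (-(s - 1 / 2))) * (b - a) ^ (s - 1 / 2) * sn s ψ a b =
    2 * (2 * sn s ψ a b / (1 - 2 ^ (-(s - 1 / 2))) * (b - a) ^ (s - 1 / 2)) := by ring
  linarith

/-- The pairing of the oscillation of an `H^{1/2}` function with a derivative. -/
lemma abs_integral_sub_mean_mul_deriv_le {s : ℝ} (hs : 1 / 2 < s) :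
    ∃ C, 0 ≤ C ∧ ∀ (w ψ : ℝ → ℝ) (a b : ℝ), Measurable w → ContDiff ℝ 1 ψ → a < b →
      IntegrableOn w (Set.Ioo a b) → hsSemiSq₁ (1 / 2) (Set.Ioo a b) w ≠ ⊤ →
      hsSemiSq₁ s (Set.Ioo a b) ψ ≠ ⊤ →
      |∫ x in a..b, (w x - mean w a b) * deriv ψ x| ≤
        C * (b - a) ^ (s - 1 / 2) * (sn (1 / 2) w a b * sn s ψ a b) := by
  have hα : 0 < s - 1 / 2 := sub_pos.2 hs
  have hq : 0 < 1 - (2 : ℝ) ^ (-(s - 1 / 2)) := sub_pos.2 (two_rpow_neg_lt_one hα)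
  set CM := 4 / (1 - (2 : ℝ) ^ (-(s - 1 / 2))) with hCM
  have hCM0 : 0 ≤ CM := by positivity
  refine ⟨4 * CM / (1 - 2 ^ (-(s - 1 / 2))), by positivity, ?_⟩
  intro w ψ a₀ b₀ hw hψ hab₀ hint hWf hΨf
  obtain ⟨M, hM0, hM, -⟩ := exists_lipschitz_bound hψ a₀ b₀
  have hdc : Continuous (deriv ψ) := hψ.continuous_deriv le_rfl
  have hint' : ∀ {a b}, a₀ ≤ a → b ≤ b₀ → IntegrableOn w (Set.Ioo a b) := fun h1 h2 =>
    hint.mono_set (Set.Ioo_subset_Ioo h1 h2)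
  have hWf' : ∀ {a b}, a₀ ≤ a → b ≤ b₀ → hsSemiSq₁ (1 / 2) (Set.Ioo a b) w ≠ ⊤ := fun h1 h2 =>
    ne_top_of_le_ne_top hWf (hsSemiSq₁_mono (Set.Ioo_subset_Ioo h1 h2))
  have hΨf' : ∀ {a b}, a₀ ≤ a → b ≤ b₀ → hsSemiSq₁ s (Set.Ioo a b) ψ ≠ ⊤ := fun h1 h2 =>
    ne_top_of_le_ne_top hΨf (hsSemiSq₁_mono (Set.Ioo_subset_Ioo h1 h2))
  have hii : ∀ {a b}, a₀ ≤ a → a < b → b ≤ b₀ → IntervalIntegrable w volume a b :=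
    fun h1 h h2 => by
      rw [intervalIntegrable_iff_integrableOn_Ioo_of_le h.le]; exact hint' h1 h2
  have hprod : ∀ {a b} (c : ℝ), a₀ ≤ a → a < b → b ≤ b₀ →
      IntervalIntegrable (fun x => (w x - c) * deriv ψ x) volume a b := fun c h1 h h2 =>
    ((hii h1 h h2).sub (by simp)).mul_continuousOn hdc.continuousOn
  refine dyadic_le (E := fun a b => |∫ x in a..b, (w x - mean w a b) * deriv ψ x|)
    (W := sn (1 / 2) w) (Ψ := sn s ψ) (M := M) hα (by positivity) hM0
    (fun _ _ => sn_nonneg _ _ _ _) (fun _ _ => sn_nonneg _ _ _ _) ?_ ?_ ?_ ?_ hab₀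
  · intro a m b h1 h2 h3 h4
    exact sn_sq_add_le h2 h3 (hWf' h1 h4)
  · intro a m b h1 h2 h3 h4
    exact sn_sq_add_le h2 h3 (hΨf' h1 h4)
  · intro a m b ha hab hb hm
    have hba : 0 < b - a := sub_pos.2 hab
    have ham : a < m := by linarith
    have hmb : m < b := by linarith
    have hW0 := sn_nonneg (1 / 2) w a b
    have hΨ0 := sn_nonneg s ψ a b
    have split : ∀ {p q : ℝ} (c d : ℝ), a₀ ≤ p → p < q → q ≤ b₀ →
        ∫ x in p..q, (w x - c) * deriv ψ x =
          (∫ x in p..q, (w x - d) * deriv ψ x) + (d - c) * (ψ q - ψ p) := by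
      intro p q c d h1 h h2
      rw [← intervalIntegral.integral_deriv_eq_sub
        (fun x _ => hψ.differentiable one_ne_zero x) (hdc.intervalIntegrable _ _),
        ← intervalIntegral.integral_const_mul, ← intervalIntegral.integral_add (hprod d h1 h h2)
          ((hdc.intervalIntegrable _ _).const_mul _)]
      congr 1; ext x; ring
    -- Replacing the mean over `(a, b)` by the mean over each half costs the difference of the means
    -- times the increment of `ψ`. The first factor is bounded by the `H^{1/2}` seminorm of `w`, the
    -- second by Morrey's inequality.
    have e : ∫ x in a..b, (w x - mean w a b) * deriv ψ x =
        (∫ x in a..m, (w x - mean w a m) * deriv ψ x) + (∫ x in m..b, (w x - mean w m b) * deriv ψ x)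
        + (mean w a m - mean w a b) * (ψ m - ψ a) + (mean w m b - mean w a b) * (ψ b - ψ m) := by
      rw [← intervalIntegral.integral_add_adjacent_intervals (hprod (mean w a b) ha ham (by linarith))
        (hprod (mean w a b) (by linarith) hmb hb), split (mean w a b) (mean w a m) ha ham (by linarith),
        split (mean w a b) (mean w m b) (by linarith) hmb hb]
      ring
    have m1 := abs_mean_sub_mean_le hw (σ := 1 / 2) (by norm_num) (hint' ha hb) (hWf' ha hb) le_rfl ham
      hmb.le (by linarith)
    have m2 := abs_mean_sub_mean_le hw (σ := 1 / 2) (by norm_num) (hint' ha hb) (hWf' ha hb) ham.le hmb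
      le_rfl (by linarith)
    simp only [sub_self, Real.rpow_zero, mul_one] at m1 m2
    have d1 := abs_sub_le_sn hs hψ ham (hΨf' ha (by linarith))
    have d2 := abs_sub_le_sn hs hψ hmb (hΨf' (by linarith) hb)
    have e1 : 4 / (1 - 2 ^ (-(s - 1 / 2))) * (m - a) ^ (s - 1 / 2) * sn s ψ a m ≤
        CM * (b - a) ^ (s - 1 / 2) * sn s ψ a b := by
      have := sn_mono (hΨf' ha hb) (a' := a) (b' := m) le_rfl hmb.le
      have := sn_nonneg s ψ a m
      have : 0 ≤ m - a := by linarith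
      gcongr
    have e2 : 4 / (1 - 2 ^ (-(s - 1 / 2))) * (b - m) ^ (s - 1 / 2) * sn s ψ m b ≤
        CM * (b - a) ^ (s - 1 / 2) * sn s ψ a b := by
      have := sn_mono (hΨf' ha hb) (a' := m) (b' := b) ham.le le_rfl
      have := sn_nonneg s ψ m b
      have : 0 ≤ b - m := by linarith
      gcongr
    have t1 : |(mean w a m - mean w a b) * (ψ m - ψ a)| ≤
        2 * sn (1 / 2) w a b * (CM * (b - a) ^ (s - 1 / 2) * sn s ψ a b) := by
      rw [abs_mul]
      exact mul_le_mul m1 (d1.trans e1) (abs_nonneg _) (by positivity)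
    have t2 : |(mean w m b - mean w a b) * (ψ b - ψ m)| ≤
        2 * sn (1 / 2) w a b * (CM * (b - a) ^ (s - 1 / 2) * sn s ψ a b) := by
      rw [abs_mul]
      exact mul_le_mul m2 (d2.trans e2) (abs_nonneg _) (by positivity)
    rw [e]
    have q1 := abs_add_le ((∫ x in a..m, (w x - mean w a m) * deriv ψ x) +
      (∫ x in m..b, (w x - mean w m b) * deriv ψ x) + (mean w a m - mean w a b) * (ψ m - ψ a))
      ((mean w m b - mean w a b) * (ψ b - ψ m))
    have q2 := abs_add_le ((∫ x in a..m, (w x - mean w a m) * deriv ψ x) +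
      (∫ x in m..b, (w x - mean w m b) * deriv ψ x)) ((mean w a m - mean w a b) * (ψ m - ψ a))
    have q3 := abs_add_le (∫ x in a..m, (w x - mean w a m) * deriv ψ x)
      (∫ x in m..b, (w x - mean w m b) * deriv ψ x)
    linarith
  -- The a priori bound with a Lipschitz constant of `ψ` serves only to make the remainder of the
  -- dyadic summation vanish.
  · intro a b ha hab hb
    have ho := oscillation_le hw (σ := 1 / 2) (by norm_num) hab (hint' ha hb) (hWf' ha hb)
    rw [show (1 / 2 + 1 / 2 : ℝ) = 1 by norm_num, Real.rpow_one] at ho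
    refine (intervalIntegral.abs_integral_le_integral_abs hab.le).trans ?_
    calc ∫ x in a..b, |(w x - mean w a b) * deriv ψ x|
        ≤ ∫ x in a..b, M * |w x - mean w a b| := by
          refine intervalIntegral.integral_mono_on hab.le (hprod _ ha hab hb).abs
            (((hii ha hab hb).sub (by simp)).abs.const_mul M) fun x hx => ?_
          rw [abs_mul, mul_comm]
          gcongr
          exact hM x ⟨ha.trans hx.1, hx.2.trans hb⟩
      _ = M * ∫ x in a..b, |w x - mean w a b| := intervalIntegral.integral_const_mul _ _
      _ ≤ M * ((b - a) * sn (1 / 2) w a b) := by gcongr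
      _ = _ := by ring

/-- Means over short intervals grow at most logarithmically. -/
lemma rpow_mul_abs_mean_le {α : ℝ} (hα : 0 < α) {w : ℝ → ℝ} (hw : Measurable w)
    (hint : IntegrableOn w (Set.Ioo 0 1)) (hfin : hsSemiSq₁ (1 / 2) (Set.Ioo 0 1) w ≠ ⊤) {a b : ℝ}
    (ha : 0 ≤ a) (hab : a < b) (hb : b ≤ 1) :
    (b - a) ^ α * |mean w a b| ≤ |mean w 0 1| + 2 / (1 - 2 ^ (-α)) * sn (1 / 2) w 0 1 := by
  have hq : 0 < 1 - (2 : ℝ) ^ (-α) := sub_pos.2 (two_rpow_neg_lt_one hα)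
  have hq0 : (0 : ℝ) < 2 ^ (-α) := by positivity
  have hW0 := sn_nonneg (1 / 2) w 0 1
  have hA : 2 ≤ 2 / (1 - (2 : ℝ) ^ (-α)) := by rw [le_div_iff₀ hq]; nlinarith
  have hint' : ∀ {a b}, 0 ≤ a → b ≤ 1 → IntegrableOn w (Set.Ioo a b) := fun h1 h2 =>
    hint.mono_set (Set.Ioo_subset_Ioo h1 h2)
  have hWf' : ∀ {a b}, 0 ≤ a → b ≤ 1 → hsSemiSq₁ (1 / 2) (Set.Ioo a b) w ≠ ⊤ := fun h1 h2 =>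
    ne_top_of_le_ne_top hfin (hsSemiSq₁_mono (Set.Ioo_subset_Ioo h1 h2))
  have step : ∀ {a b a' b' : ℝ}, 0 ≤ a → b ≤ 1 → a ≤ a' → a' < b' → b' ≤ b → b - a ≤ 2 * (b' - a') →
      |mean w a' b'| ≤ |mean w a b| + 2 * sn (1 / 2) w 0 1 := by
    intro a b a' b' h1 h2 h3 h4 h5 h6
    have := abs_mean_sub_mean_le hw (σ := 1 / 2) (by norm_num) (hint' h1 h2) (hWf' h1 h2) h3 h4 h5 h6
    simp only [sub_self, Real.rpow_zero, mul_one] at this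
    have h7 := sn_mono hfin h1 h2
    have h8 := abs_sub_abs_le_abs_sub (mean w a' b') (mean w a b)
    linarith
  -- Induction on the scale: an interval is enlarged to twice its length inside `(0, 1)`, to the
  -- right when there is room and otherwise to one ending at `1`. The mean changes by at most twice
  -- the seminorm, and the weight turns the sum of these changes into a geometric series.
  have key : ∀ n : ℕ, ∀ a b, 0 ≤ a → a < b → b ≤ 1 → (1 / 2) ^ (n + 1) ≤ b - a →
      (b - a) ^ α * |mean w a b| ≤ |mean w 0 1| + 2 / (1 - 2 ^ (-α)) * sn (1 / 2) w 0 1 := by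
    intro n
    induction n with
    | zero =>
      intro a b ha hab hb hl
      have h1 := step le_rfl le_rfl ha hab hb (by norm_num at hl; linarith)
      have h2 : (b - a) ^ α ≤ 1 := Real.rpow_le_one (by linarith) (by linarith) hα.le
      have h3 : (b - a) ^ α * |mean w a b| ≤ 1 * |mean w a b| := by gcongr
      nlinarith
    | succ n ih =>
      intro a b ha hab hb hl
      by_cases hl' : (1 / 2) ^ (n + 1) ≤ b - a
      · exact ih a b ha hab hb hl'
      push Not at hl'
      have hba : 0 < b - a := sub_pos.2 hab
      have hsmall : b - a ≤ 1 / 2 := by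
        have : ((1 : ℝ) / 2) ^ (n + 1) ≤ (1 / 2) ^ 1 :=
          pow_le_pow_of_le_one (by norm_num) (by norm_num) (by omega)
        linarith
      obtain ⟨a', b', h1, h2, h3, h4, h5⟩ : ∃ a' b', 0 ≤ a' ∧ a' ≤ a ∧ b ≤ b' ∧ b' ≤ 1 ∧
          b' - a' = 2 * (b - a) := by
        rcases le_total (2 * b - a) 1 with h | h
        · exact ⟨a, 2 * b - a, ha, le_rfl, by linarith, h, by ring⟩
        · exact ⟨1 - 2 * (b - a), 1, by linarith, by linarith, hb, le_rfl, by ring⟩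
      have h6 := ih a' b' h1 (by linarith) h4 (by rw [h5]; rw [pow_succ] at hl; linarith)
      have h7 := step h1 h4 h2 hab h3 h5.le
      have h8 : (b - a) ^ α = 2 ^ (-α) * (b' - a') ^ α := by
        rw [← half_rpow (by linarith), h5]; ring_nf
      have h9 : (b - a) ^ α ≤ 1 := Real.rpow_le_one (by linarith) (by linarith) hα.le
      calc (b - a) ^ α * |mean w a b| ≤ (b - a) ^ α * (|mean w a' b'| + 2 * sn (1 / 2) w 0 1) := by
            gcongr
        _ = 2 ^ (-α) * ((b' - a') ^ α * |mean w a' b'|) + (b - a) ^ α * (2 * sn (1 / 2) w 0 1) := by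
            rw [h8]; ring
        _ ≤ 2 ^ (-α) * (|mean w 0 1| + 2 / (1 - 2 ^ (-α)) * sn (1 / 2) w 0 1) +
            1 * (2 * sn (1 / 2) w 0 1) := by gcongr
        _ = 2 ^ (-α) * |mean w 0 1| + 2 / (1 - 2 ^ (-α)) * sn (1 / 2) w 0 1 := by
            field_simp; ring
        _ ≤ 1 * |mean w 0 1| + 2 / (1 - 2 ^ (-α)) * sn (1 / 2) w 0 1 := by
            gcongr; linarith
        _ = _ := by ring
  obtain ⟨n, hn⟩ := exists_pow_lt_of_lt_one (sub_pos.2 hab) (by norm_num : (1 / 2 : ℝ) < 1)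
  refine key n a b ha hab hb (le_trans ?_ hn.le)
  exact pow_le_pow_of_le_one (by norm_num) (by norm_num) (by omega)

lemma enorm_sq_eq_ofReal (x : ℝ) : ‖x‖ₑ ^ 2 = ENNReal.ofReal (x ^ 2) := by
  rw [Real.enorm_eq_ofReal_abs, ← ENNReal.ofReal_pow (abs_nonneg _), sq_abs]

lemma sn_sq (σ : ℝ) (f : ℝ → ℝ) (a b : ℝ) :
    sn σ f a b ^ 2 = (hsSemiSq₁ σ (Set.Ioo a b) f).toReal :=
  Real.sq_sqrt ENNReal.toReal_nonneg

lemma integrableOn_of_sq {w : ℝ → ℝ} (hw : Measurable w) {a b : ℝ}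
    (h : ∫⁻ x in Set.Ioo a b, ‖w x‖ₑ ^ 2 ≠ ⊤) : IntegrableOn w (Set.Ioo a b) := by
  refine ⟨hw.aestronglyMeasurable, ?_⟩
  have h1 := lintegral_sq_le (μ := volume.restrict (Set.Ioo a b)) hw.enorm.aemeasurable
  have h2 : volume.restrict (Set.Ioo a b) Set.univ * ∫⁻ x in Set.Ioo a b, ‖w x‖ₑ ^ 2 ≠ ⊤ :=
    ENNReal.mul_ne_top (by simp) h
  have h3 := ne_top_of_le_ne_top h2 h1
  rw [HasFiniteIntegral, lt_top_iff_ne_top]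
  simpa using h3

/-- The function `w` is split into its oscillation and its mean on `(a, b)`. The mean multiplies `ψ
b - ψ a`, where Morrey's inequality supplies `(b - a)^(s - 1/2)`, just what compensates the
logarithmic growth of means over short intervals. Taking norms of `w` on all of `(0, 1)` keeps the
constant independent of the length of `(a, b)`, which matters for the short slices of a triangle. -/
lemma enorm_integral_mul_deriv_sq_le {s : ℝ} (hs : 1 / 2 < s) :
    ∃ C : ℝ, 0 ≤ C ∧ ∀ (w ψ : ℝ → ℝ) (a b : ℝ), Measurable w → ContDiff ℝ 1 ψ → 0 ≤ a → a < b →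
      b ≤ 1 → ∫⁻ x in Set.Ioo 0 1, ‖w x‖ₑ ^ 2 ≠ ⊤ → hsSemiSq₁ (1 / 2) (Set.Ioo 0 1) w ≠ ⊤ →
      hsSemiSq₁ s (Set.Ioo a b) ψ ≠ ⊤ →
      ‖∫ x in Set.Ioo a b, w x * deriv ψ x‖ₑ ^ 2 ≤
        ENNReal.ofReal C * (((∫⁻ x in Set.Ioo 0 1, ‖w x‖ₑ ^ 2) +
          hsSemiSq₁ (1 / 2) (Set.Ioo 0 1) w) * hsSemiSq₁ s (Set.Ioo a b) ψ) := by
  have hα : 0 < s - 1 / 2 := sub_pos.2 hs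
  have hq : 0 < 1 - (2 : ℝ) ^ (-(s - 1 / 2)) := sub_pos.2 (two_rpow_neg_lt_one hα)
  obtain ⟨C₁, hC₁, h1⟩ := abs_integral_sub_mean_mul_deriv_le hs
  set A := 2 / (1 - (2 : ℝ) ^ (-(s - 1 / 2))) with hA
  have hA0 : 0 < A := by positivity
  set CM := 4 / (1 - (2 : ℝ) ^ (-(s - 1 / 2))) with hCM
  have hCM0 : 0 < CM := by positivity
  refine ⟨2 * (C₁ + CM * A + CM) ^ 2, by positivity, ?_⟩
  intro w ψ a b hw hψ ha hab hb hL hWf hΨf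
  have hint := integrableOn_of_sq hw hL
  have hba : 0 < b - a := sub_pos.2 hab
  have hba1 : (b - a) ^ (s - 1 / 2) ≤ 1 := Real.rpow_le_one hba.le (by linarith) hα.le
  have hint' : IntegrableOn w (Set.Ioo a b) := hint.mono_set (Set.Ioo_subset_Ioo ha hb)
  have hii : IntervalIntegrable w volume a b := by
    rw [intervalIntegrable_iff_integrableOn_Ioo_of_le hab.le]; exact hint'
  have hdc : Continuous (deriv ψ) := hψ.continuous_deriv le_rfl
  have hi1 := h1 w ψ a b hw hψ hab hint'
    (ne_top_of_le_ne_top hWf (hsSemiSq₁_mono (Set.Ioo_subset_Ioo ha hb))) hΨf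
  have hi2 := rpow_mul_abs_mean_le hα hw hint hWf ha hab hb
  have hi3 := abs_sub_le_sn hs hψ hab hΨf
  have hWm := sn_mono hWf ha hb
  have hW0 := sn_nonneg (1 / 2) w 0 1
  have hW0' := sn_nonneg (1 / 2) w a b
  have hΨ0 := sn_nonneg s ψ a b
  have e : ∫ x in Set.Ioo a b, w x * deriv ψ x =
      (∫ x in a..b, (w x - mean w a b) * deriv ψ x) + mean w a b * (ψ b - ψ a) := by
    rw [← intervalIntegral.integral_deriv_eq_sub
        (fun x _ => hψ.differentiable one_ne_zero x) (hdc.intervalIntegrable _ _),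
        ← intervalIntegral.integral_const_mul, ← intervalIntegral.integral_add
          ((hii.sub (by simp)).mul_continuousOn hdc.continuousOn)
          ((hdc.intervalIntegrable _ _).const_mul _), intervalIntegral.integral_of_le hab.le,
        integral_Ioc_eq_integral_Ioo]
    congr 1; ext x; ring
  have t1 : |mean w a b * (ψ b - ψ a)| ≤
      (|mean w 0 1| + A * sn (1 / 2) w 0 1) * (CM * sn s ψ a b) := by
    rw [abs_mul]
    calc |mean w a b| * |ψ b - ψ a| ≤
        |mean w a b| * (CM * (b - a) ^ (s - 1 / 2) * sn s ψ a b) := by gcongr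
      _ = ((b - a) ^ (s - 1 / 2) * |mean w a b|) * (CM * sn s ψ a b) := by ring
      _ ≤ _ := by gcongr
  have t2 : |∫ x in a..b, (w x - mean w a b) * deriv ψ x| ≤
      C₁ * (sn (1 / 2) w 0 1 * sn s ψ a b) := by
    refine hi1.trans ?_
    calc _ ≤ C₁ * 1 * (sn (1 / 2) w 0 1 * sn s ψ a b) := by gcongr
      _ = _ := by ring
  have t3 : |∫ x in Set.Ioo a b, w x * deriv ψ x| ≤
      (C₁ + CM * A + CM) * ((|mean w 0 1| + sn (1 / 2) w 0 1) * sn s ψ a b) := by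
    rw [e]
    refine (abs_add_le _ _).trans ?_
    have p1 : 0 ≤ |mean w 0 1| * sn s ψ a b := by positivity
    have p2 : 0 ≤ sn (1 / 2) w 0 1 * sn s ψ a b := by positivity
    have p3 : 0 ≤ CM * A * (|mean w 0 1| * sn s ψ a b) := by positivity
    have p4 : 0 ≤ C₁ * (|mean w 0 1| * sn s ψ a b) := by positivity
    have p5 : 0 ≤ CM * (sn (1 / 2) w 0 1 * sn s ψ a b) := by positivity
    linarith
  have hm : mean w 0 1 ^ 2 ≤ (∫⁻ x in Set.Ioo 0 1, ‖w x‖ₑ ^ 2).toReal := by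
    have hh := lintegral_sq_le (μ := volume.restrict (Set.Ioo (0 : ℝ) 1)) hw.enorm.aemeasurable
    have hh2 : ‖mean w 0 1‖ₑ ^ 2 ≤ ∫⁻ x in Set.Ioo 0 1, ‖w x‖ₑ ^ 2 := by
      have : mean w 0 1 = ∫ x in Set.Ioo 0 1, w x := by
        rw [mean, intervalIntegral.integral_of_le zero_le_one, integral_Ioc_eq_integral_Ioo]; simp
      rw [this]
      refine (pow_le_pow_left' (enorm_integral_le_lintegral_enorm _) 2).trans (hh.trans ?_)
      simp
    rw [enorm_sq_eq_ofReal] at hh2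
    exact (ENNReal.ofReal_le_iff_le_toReal hL).1 hh2
  have hfin : ENNReal.ofReal (2 * (C₁ + CM * A + CM) ^ 2) * (((∫⁻ x in Set.Ioo 0 1, ‖w x‖ₑ ^ 2) +
          hsSemiSq₁ (1 / 2) (Set.Ioo 0 1) w) * hsSemiSq₁ s (Set.Ioo a b) ψ) ≠ ⊤ :=
    ENNReal.mul_ne_top ENNReal.ofReal_ne_top (ENNReal.mul_ne_top (ENNReal.add_ne_top.2 ⟨hL, hWf⟩) hΨf)
  rw [enorm_sq_eq_ofReal, ENNReal.ofReal_le_iff_le_toReal hfin, ENNReal.toReal_mul,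
    ENNReal.toReal_mul, ENNReal.toReal_add hL hWf, ENNReal.toReal_ofReal (by positivity),
    ← sn_sq, ← sn_sq, ← sq_abs]
  refine (pow_le_pow_left₀ (abs_nonneg _) t3 2).trans ?_
  rw [mul_pow, mul_pow]
  have : (|mean w 0 1| + sn (1 / 2) w 0 1) ^ 2 ≤
      2 * ((∫⁻ x in Set.Ioo 0 1, ‖w x‖ₑ ^ 2).toReal + sn (1 / 2) w 0 1 ^ 2) := by
    have := sq_abs (mean w 0 1)
    nlinarith [sq_nonneg (|mean w 0 1| - sn (1 / 2) w 0 1)]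
  calc _ ≤ (C₁ + CM * A + CM) ^ 2 *
        ((2 * ((∫⁻ x in Set.Ioo 0 1, ‖w x‖ₑ ^ 2).toReal + sn (1 / 2) w 0 1 ^ 2)) *
          sn s ψ a b ^ 2) := by gcongr
    _ = _ := by ring

/-- If `ψ` takes equal values at the ends, only the oscillation of `w` matters. -/
lemma enorm_integral_mul_deriv_sq_le_of_eq {s : ℝ} (hs : 1 / 2 < s) :
    ∃ C : ℝ, 0 ≤ C ∧ ∀ (w ψ : ℝ → ℝ) (a b : ℝ), Measurable w → ContDiff ℝ 1 ψ → 0 ≤ a → a < b →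
      b ≤ 1 → ∫⁻ x in Set.Ioo a b, ‖w x‖ₑ ^ 2 ≠ ⊤ → hsSemiSq₁ (1 / 2) (Set.Ioo a b) w ≠ ⊤ →
      hsSemiSq₁ s (Set.Ioo a b) ψ ≠ ⊤ → ψ a = ψ b →
      ‖∫ x in Set.Ioo a b, w x * deriv ψ x‖ₑ ^ 2 ≤
        ENNReal.ofReal C * (hsSemiSq₁ (1 / 2) (Set.Ioo a b) w * hsSemiSq₁ s (Set.Ioo a b) ψ) := by
  have hα : 0 < s - 1 / 2 := sub_pos.2 hs
  obtain ⟨C₁, hC₁, h1⟩ := abs_integral_sub_mean_mul_deriv_le hs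
  refine ⟨C₁ ^ 2, by positivity, ?_⟩
  intro w ψ a b hw hψ ha hab hb hL hWf hΨf hψab
  have hint := integrableOn_of_sq hw hL
  have hba : 0 < b - a := sub_pos.2 hab
  have hba1 : (b - a) ^ (s - 1 / 2) ≤ 1 := Real.rpow_le_one hba.le (by linarith) hα.le
  have hii : IntervalIntegrable w volume a b := by
    rw [intervalIntegrable_iff_integrableOn_Ioo_of_le hab.le]; exact hint
  have hdc : Continuous (deriv ψ) := hψ.continuous_deriv le_rfl
  have hi1 := h1 w ψ a b hw hψ hab hint hWf hΨf
  have hW0 := sn_nonneg (1 / 2) w a b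
  have hΨ0 := sn_nonneg s ψ a b
  have e : ∫ x in Set.Ioo a b, w x * deriv ψ x = ∫ x in a..b, (w x - mean w a b) * deriv ψ x := by
    have hz : ∫ x in a..b, mean w a b * deriv ψ x = 0 := by
      rw [intervalIntegral.integral_const_mul, intervalIntegral.integral_deriv_eq_sub
        (fun x _ => hψ.differentiable one_ne_zero x) (hdc.intervalIntegrable _ _), hψab, sub_self,
        mul_zero]
    rw [← add_zero (∫ x in a..b, (w x - mean w a b) * deriv ψ x), ← hz,
      ← intervalIntegral.integral_add ((hii.sub (by simp)).mul_continuousOn hdc.continuousOn)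
          ((hdc.intervalIntegrable _ _).const_mul _), intervalIntegral.integral_of_le hab.le,
        integral_Ioc_eq_integral_Ioo]
    congr 1; ext x; ring
  have hfin : ENNReal.ofReal (C₁ ^ 2) *
      (hsSemiSq₁ (1 / 2) (Set.Ioo a b) w * hsSemiSq₁ s (Set.Ioo a b) ψ) ≠ ⊤ :=
    ENNReal.mul_ne_top ENNReal.ofReal_ne_top (ENNReal.mul_ne_top hWf hΨf)
  rw [enorm_sq_eq_ofReal, ENNReal.ofReal_le_iff_le_toReal hfin, ENNReal.toReal_mul,
    ENNReal.toReal_mul, ENNReal.toReal_ofReal (by positivity), ← sn_sq, ← sn_sq, ← sq_abs, e]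
  have hi2 : |∫ x in a..b, (w x - mean w a b) * deriv ψ x| ≤
      C₁ * 1 * (sn (1 / 2) w a b * sn s ψ a b) := hi1.trans (by gcongr)
  refine (pow_le_pow_left₀ (abs_nonneg _) hi2 2).trans ?_
  rw [mul_one, mul_pow, mul_pow]

/-! ### Slices of functions in `H^s` -/

lemma eucl_le_dist (x y : ℝ × ℝ) : eucl x y ≤ √2 * dist x y := by
  have h1 : |x.1 - y.1| ≤ dist x y := by rw [Prod.dist_eq, ← Real.dist_eq]; exact le_max_left _ _
  have h2 : |x.2 - y.2| ≤ dist x y := by rw [Prod.dist_eq, ← Real.dist_eq]; exact le_max_right _ _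
  rw [eucl, Real.sqrt_le_left (by positivity), mul_pow, Real.sq_sqrt zero_le_two]
  have := sq_le_sq' (by linarith [neg_abs_le (x.1 - y.1)]) ((le_abs_self _).trans h1)
  have := sq_le_sq' (by linarith [neg_abs_le (x.2 - y.2)]) ((le_abs_self _).trans h2)
  linarith

lemma dist_le_eucl (x y : ℝ × ℝ) : dist x y ≤ eucl x y := by
  rw [Prod.dist_eq, Real.dist_eq, Real.dist_eq, eucl]
  refine max_le (Real.abs_le_sqrt ?_) (Real.abs_le_sqrt ?_) <;> nlinarith [sq_nonneg (x.1 - y.1), sq_nonneg (x.2 - y.2)]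

lemma eucl_nonneg (x y : ℝ × ℝ) : 0 ≤ eucl x y := Real.sqrt_nonneg _

lemma eucl_pos {x y : ℝ × ℝ} (h : x ≠ y) : 0 < eucl x y :=
  (dist_pos.2 h).trans_le (dist_le_eucl x y)

lemma lintegral_Ici_rpow {ρ p : ℝ} (hρ : 0 < ρ) (hp : 1 < p) :
    ∫⁻ t in Set.Ici ρ, (ENNReal.ofReal (|t| ^ p))⁻¹ = ENNReal.ofReal (ρ ^ (1 - p) / (p - 1)) := by
  have h1 := integral_Ioi_rpow_of_lt (a := -p) (by linarith) hρ
  have h2 : ρ ^ (1 - p) / (p - 1) = ∫ t in Set.Ioi ρ, t ^ (-p) := by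
    rw [h1, show -p + 1 = 1 - p by ring, show p - 1 = -(1 - p) by ring, div_neg, neg_div]
  rw [h2, ofReal_integral_eq_lintegral_ofReal (integrableOn_Ioi_rpow_of_lt (by linarith) hρ)
    ((ae_restrict_iff' measurableSet_Ioi).2 (Eventually.of_forall fun t ht =>
      Real.rpow_nonneg (hρ.trans ht).le _)), setLIntegral_congr Ioi_ae_eq_Ici.symm]
  refine setLIntegral_congr_fun measurableSet_Ioi fun t ht => ?_
  have ht0 : 0 < t := hρ.trans ht
  rw [abs_of_pos ht0, ← ENNReal.ofReal_inv_of_pos (by positivity), Real.rpow_neg ht0.le]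

lemma lintegral_abs_ge_rpow {ρ p : ℝ} (hρ : 0 < ρ) (hp : 1 < p) (t : ℝ) :
    ∫⁻ t', Set.indicator {t' | ρ ≤ |t - t'|} (fun t' => (ENNReal.ofReal (|t - t'| ^ p))⁻¹) t' ≤
      ENNReal.ofReal (2 * (ρ ^ (1 - p) / (p - 1))) := by
  set g : ℝ → ℝ≥0∞ := fun τ => (ENNReal.ofReal (|τ| ^ p))⁻¹ with hg
  have h0 : ∫⁻ t', Set.indicator {t' | ρ ≤ |t - t'|} (fun t' => g (t - t')) t' =
      ∫⁻ τ, Set.indicator {τ | ρ ≤ |τ|} g τ :=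
    lintegral_sub_left_eq_self (fun τ => Set.indicator {τ | ρ ≤ |τ|} g τ) t
  have hset : {τ : ℝ | ρ ≤ |τ|} = Set.Ici ρ ∪ Set.Iic (-ρ) := by
    ext τ; simp only [Set.mem_ofPred_eq, le_abs, Set.mem_union, Set.mem_Ici, Set.mem_Iic]
    constructor <;> rintro (h | h) <;> first | (left; linarith) | (right; linarith)
  have hn : ∫⁻ τ in Set.Iic (-ρ), g τ = ∫⁻ τ in Set.Ici ρ, g τ := by
    rw [← lintegral_indicator measurableSet_Iic, ← lintegral_indicator measurableSet_Ici,
      ← lintegral_neg_eq_self]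
    refine lintegral_congr fun τ => ?_
    by_cases h : ρ ≤ τ
    · rw [Set.indicator_of_mem (by simpa using h), Set.indicator_of_mem (by simpa using h)]
      simp [hg]
    · rw [Set.indicator_of_notMem (by simpa using h), Set.indicator_of_notMem (by simpa using h)]
  change ∫⁻ t', Set.indicator {t' | ρ ≤ |t - t'|} (fun t' => g (t - t')) t' ≤ _
  rw [h0, hset, lintegral_indicator (measurableSet_Ici.union measurableSet_Iic)]
  refine (lintegral_union_le _ _ _).trans ?_
  rw [hn, lintegral_Ici_rpow hρ hp, two_mul, ENNReal.ofReal_add] <;>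
  · have : 0 < p - 1 := by linarith
    positivity

lemma measurable_eucl : Measurable fun p : (ℝ × ℝ) × (ℝ × ℝ) => eucl p.1 p.2 := by
  unfold eucl; fun_prop

lemma measurable_diff_sq {v : ℝ × ℝ → ℝ} (hv : Measurable v) :
    Measurable fun p : (ℝ × ℝ) × (ℝ × ℝ) => ‖v p.1 - v p.2‖ₑ ^ 2 :=
  ((hv.comp measurable_fst).sub (hv.comp measurable_snd)).enorm.pow_const 2

lemma measurable_diff_kernel {v : ℝ × ℝ → ℝ} (hv : Measurable v) (s : ℝ) :
    Measurable fun p : (ℝ × ℝ) × (ℝ × ℝ) =>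
      ‖v p.1 - v p.2‖ₑ ^ 2 / ENNReal.ofReal (eucl p.1 p.2 ^ (2 + 2 * s)) :=
  (measurable_diff_sq hv).div ((measurable_eucl.pow_const _).ennreal_ofReal)

/-- The two values are compared through every point of the copy of `K` shrunk towards `(a, t)` by
the ratio `r = |t - t'|`. By convexity the copy lies in `K`; its area is `r²` times that of `K`, and
its points are within `2 r` of both `(a, t)` and `(a, t')`. -/
lemma volume_mul_diff_sq_le {K : Set (ℝ × ℝ)} (hK : Convex ℝ K) (hKm : MeasurableSet K)
    (hK01 : K ⊆ Set.Icc 0 1 ×ˢ Set.Icc 0 1) {v : ℝ × ℝ → ℝ} (hv : Measurable v) {a t t' : ℝ}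
    (hx : (a, t) ∈ K) (hx' : (a, t') ∈ K) :
    ENNReal.ofReal (|t - t'| ^ 2) * volume K * ‖v (a, t) - v (a, t')‖ₑ ^ 2 ≤
      2 * ((∫⁻ y in K, Set.indicator {y | dist (a, t) y ≤ 2 * |t - t'|}
          (fun y => ‖v (a, t) - v y‖ₑ ^ 2) y) +
        ∫⁻ y in K, Set.indicator {y | dist (a, t') y ≤ 2 * |t' - t|}
          (fun y => ‖v (a, t') - v y‖ₑ ^ 2) y) := by
  set r := |t - t'| with hr
  have hr0 : 0 ≤ r := abs_nonneg _
  have hr1 : r ≤ 1 := by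
    have h1 := (hK01 hx).2
    have h2 := (hK01 hx').2
    simp only [Set.mem_Icc] at h1 h2
    rw [hr, abs_le]; constructor <;> linarith
  set S := AffineMap.homothety (a, t) r '' K with hS
  have hSvol : volume S = ENNReal.ofReal (r ^ 2) * volume K := by
    rw [hS, Measure.addHaar_image_homothety]
    simp [abs_of_nonneg (pow_nonneg hr0 2)]
  have hSK : S ⊆ K := by
    rintro _ ⟨z, hz, rfl⟩
    rw [AffineMap.homothety_apply, vsub_eq_sub, vadd_eq_add]
    have := hK hx hz (a := 1 - r) (b := r) (by linarith) hr0 (by ring)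
    convert this using 1
    rw [smul_sub, sub_smul, one_smul]; abel
  have hd1 : ∀ y ∈ S, dist (a, t) y ≤ r := by
    rintro _ ⟨z, hz, rfl⟩
    rw [dist_comm, AffineMap.homothety_apply, vsub_eq_sub, vadd_eq_add, dist_eq_norm,
      add_sub_cancel_right, norm_smul, Real.norm_eq_abs, abs_of_nonneg hr0]
    have h1 := hK01 hx
    have h2 := hK01 hz
    simp only [Set.mem_prod, Set.mem_Icc] at h1 h2
    have : ‖z - (a, t)‖ ≤ 1 := by
      rw [Prod.norm_def]
      simp only [Prod.fst_sub, Prod.snd_sub, Real.norm_eq_abs]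
      refine max_le (abs_le.2 ?_) (abs_le.2 ?_) <;> constructor <;> linarith
    nlinarith
  have hd2 : ∀ y ∈ S, dist (a, t') y ≤ 2 * r := by
    intro y hy
    have h3 : dist ((a, t') : ℝ × ℝ) (a, t) = r := by
      rw [Prod.dist_eq]; simp [Real.dist_eq, hr, abs_sub_comm]
    linarith [dist_triangle ((a, t') : ℝ × ℝ) (a, t) y, hd1 y hy]
  have hm1 : Measurable fun y => ‖v (a, t) - v y‖ₑ ^ 2 := (hv.const_sub _).enorm.pow_const 2
  have hm2 : Measurable fun y => ‖v (a, t') - v y‖ₑ ^ 2 := (hv.const_sub _).enorm.pow_const 2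
  have hSm : MeasurableSet S := by
    rcases eq_or_ne r 0 with h0 | h0
    · have : S ⊆ {(a, t)} := by
        rintro _ ⟨z, hz, rfl⟩
        simp [h0]
      exact (Set.subsingleton_singleton.anti this).measurableSet
    · have : S = (fun y => r⁻¹ • (y - (a, t)) + (a, t)) ⁻¹' K := by
        ext y
        constructor
        · rintro ⟨z, hz, rfl⟩
          simp only [Set.mem_preimage, AffineMap.homothety_apply, vsub_eq_sub, vadd_eq_add,
            add_sub_cancel_right, smul_smul, inv_mul_cancel₀ h0, one_smul, sub_add_cancel]
          exact hz
        · intro hy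
          refine ⟨_, hy, ?_⟩
          simp only [AffineMap.homothety_apply, vsub_eq_sub, vadd_eq_add,
            add_sub_cancel_right, smul_smul, mul_inv_cancel₀ h0, one_smul, sub_add_cancel]
      rw [this]
      exact (by fun_prop : Measurable fun y : ℝ × ℝ => r⁻¹ • (y - (a, t)) + (a, t)) hKm
  calc ENNReal.ofReal (r ^ 2) * volume K * ‖v (a, t) - v (a, t')‖ₑ ^ 2
      = ∫⁻ _ in S, ‖v (a, t) - v (a, t')‖ₑ ^ 2 := by
        rw [setLIntegral_const, hSvol, mul_comm]
    _ ≤ ∫⁻ y in S, 2 * (‖v (a, t) - v y‖ₑ ^ 2 + ‖v (a, t') - v y‖ₑ ^ 2) := by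
        refine lintegral_mono fun y => ?_
        rw [show v (a, t) - v (a, t') = (v (a, t) - v y) - (v (a, t') - v y) by ring]
        exact enorm_sub_sq_le _ _
    _ = 2 * ((∫⁻ y in S, ‖v (a, t) - v y‖ₑ ^ 2) + ∫⁻ y in S, ‖v (a, t') - v y‖ₑ ^ 2) := by
        rw [lintegral_const_mul' _ _ (by simp), lintegral_add_left hm1]
    _ ≤ _ := by
        gcongr 2 * (?_ + ?_)
        · calc _ = ∫⁻ y in S, Set.indicator {y | dist (a, t) y ≤ 2 * r}
                (fun y => ‖v (a, t) - v y‖ₑ ^ 2) y := by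
                refine setLIntegral_congr_fun hSm fun y hy => ?_
                rw [Set.indicator_of_mem]
                have := hd1 y hy
                simp only [Set.mem_ofPred_eq]; linarith
            _ ≤ _ := lintegral_mono' (Measure.restrict_mono hSK le_rfl) le_rfl
        · calc _ = ∫⁻ y in S, Set.indicator {y | dist (a, t') y ≤ 2 * |t' - t|}
                (fun y => ‖v (a, t') - v y‖ₑ ^ 2) y := by
                refine setLIntegral_congr_fun hSm fun y hy => ?_
                rw [Set.indicator_of_mem]
                have := hd2 y hy
                simp only [Set.mem_ofPred_eq]; rwa [abs_sub_comm t' t]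
            _ ≤ _ := lintegral_mono' (Measure.restrict_mono hSK le_rfl) le_rfl

/-- By Tonelli the integral over `t'` is done first. For fixed `y` it runs over `|t - t'| ≥ dist /
2`, so the power `-(3 + 2s)` integrates to the power `-(2 + 2s)` of the distance, which is the
kernel of the planar seminorm. -/
lemma lintegral_near_le {K : Set (ℝ × ℝ)} {v : ℝ × ℝ → ℝ} (hv : Measurable v) {s : ℝ} (hs : 0 < s)
    (a t : ℝ) :
    ∫⁻ t', (∫⁻ y in K, Set.indicator {y | dist (a, t) y ≤ 2 * |t - t'|}
          (fun y => ‖v (a, t) - v y‖ₑ ^ 2) y) * (ENNReal.ofReal (|t - t'| ^ (3 + 2 * s)))⁻¹ ≤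
      ENNReal.ofReal (2 * (2 * √2) ^ (2 + 2 * s)) *
        ∫⁻ y in K, ‖v (a, t) - v y‖ₑ ^ 2 / ENNReal.ofReal (eucl (a, t) y ^ (2 + 2 * s)) := by
  have hmG : Measurable fun y => ‖v (a, t) - v y‖ₑ ^ 2 := (hv.const_sub _).enorm.pow_const 2
  have hset : MeasurableSet {q : ℝ × (ℝ × ℝ) | dist (a, t) q.2 ≤ 2 * |t - q.1|} :=
    measurableSet_le (by fun_prop) (by fun_prop)
  have hmF : Measurable fun q : ℝ × (ℝ × ℝ) =>
      Set.indicator {y | dist (a, t) y ≤ 2 * |t - q.1|} (fun y => ‖v (a, t) - v y‖ₑ ^ 2) q.2 := by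
    exact (hmG.comp measurable_snd).indicator hset
  have hmk : Measurable fun t' : ℝ => (ENNReal.ofReal (|t - t'| ^ (3 + 2 * s)))⁻¹ := by
    have : Measurable fun t' : ℝ => |t - t'| := by fun_prop
    exact (this.pow_const _).ennreal_ofReal.inv
  calc _ = ∫⁻ t', ∫⁻ y in K, Set.indicator {y | dist (a, t) y ≤ 2 * |t - t'|}
          (fun y => ‖v (a, t) - v y‖ₑ ^ 2) y * (ENNReal.ofReal (|t - t'| ^ (3 + 2 * s)))⁻¹ := by
        refine lintegral_congr fun t' => ?_
        have hmF' : Measurable fun y =>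
          Set.indicator {y | dist (a, t) y ≤ 2 * |t - t'|} (fun y => ‖v (a, t) - v y‖ₑ ^ 2) y :=
          hmF.comp measurable_prodMk_left
        rw [lintegral_mul_const _ hmF']
    _ = ∫⁻ y in K, ∫⁻ t', Set.indicator {y | dist (a, t) y ≤ 2 * |t - t'|}
          (fun y => ‖v (a, t) - v y‖ₑ ^ 2) y * (ENNReal.ofReal (|t - t'| ^ (3 + 2 * s)))⁻¹ := by
        refine lintegral_lintegral_swap ?_
        exact (hmF.mul (hmk.comp measurable_fst)).aemeasurable
    _ ≤ ∫⁻ y in K, ENNReal.ofReal (2 * (2 * √2) ^ (2 + 2 * s)) *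
          (‖v (a, t) - v y‖ₑ ^ 2 / ENNReal.ofReal (eucl (a, t) y ^ (2 + 2 * s))) := by
        refine lintegral_mono fun y => ?_
        by_cases hy : (a, t) = y
        · have : ∀ t', Set.indicator {y | dist (a, t) y ≤ 2 * |t - t'|}
              (fun y => ‖v (a, t) - v y‖ₑ ^ 2) y = 0 := fun t' => by
            simp [hy]
          simp [this]
        have hρ : 0 < dist (a, t) y / 2 := half_pos (dist_pos.2 hy)
        have he : 0 < eucl (a, t) y := eucl_pos hy
        calc _ = ∫⁻ t', ‖v (a, t) - v y‖ₑ ^ 2 *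
              Set.indicator {t' | dist (a, t) y / 2 ≤ |t - t'|}
                (fun t' => (ENNReal.ofReal (|t - t'| ^ (3 + 2 * s)))⁻¹) t' := by
              refine lintegral_congr fun t' => ?_
              by_cases h : dist (a, t) y ≤ 2 * |t - t'|
              · rw [Set.indicator_of_mem (by exact h), Set.indicator_of_mem]
                simp only [Set.mem_ofPred_eq]; linarith
              · rw [Set.indicator_of_notMem (by exact h), Set.indicator_of_notMem]
                · simp
                · simp only [Set.mem_ofPred_eq]; intro h'; exact h (by linarith)
          _ = ‖v (a, t) - v y‖ₑ ^ 2 * ∫⁻ t', Set.indicator {t' | dist (a, t) y / 2 ≤ |t - t'|}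
                (fun t' => (ENNReal.ofReal (|t - t'| ^ (3 + 2 * s)))⁻¹) t' :=
              lintegral_const_mul' _ _ (by simp)
          _ ≤ ‖v (a, t) - v y‖ₑ ^ 2 * ENNReal.ofReal
                (2 * ((dist (a, t) y / 2) ^ (1 - (3 + 2 * s)) / (3 + 2 * s - 1))) := by
              gcongr
              exact lintegral_abs_ge_rpow hρ (by linarith) t
          _ ≤ ‖v (a, t) - v y‖ₑ ^ 2 * ENNReal.ofReal
                (2 * (2 * √2) ^ (2 + 2 * s) * (eucl (a, t) y ^ (2 + 2 * s))⁻¹) := by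
              refine mul_le_mul_right (ENNReal.ofReal_le_ofReal ?_) _
              rw [mul_assoc]
              refine mul_le_mul_of_nonneg_left ?_ zero_le_two
              have h1 : eucl (a, t) y / (2 * √2) ≤ dist (a, t) y / 2 := by
                rw [div_le_div_iff₀ (by positivity) two_pos]
                nlinarith [eucl_le_dist (a, t) y]
              have h2 : (dist (a, t) y / 2) ^ (1 - (3 + 2 * s)) ≤
                  (eucl (a, t) y / (2 * √2)) ^ (1 - (3 + 2 * s)) :=
                Real.rpow_le_rpow_of_nonpos (by positivity) h1 (by linarith)
              have h3 : (eucl (a, t) y / (2 * √2)) ^ (1 - (3 + 2 * s)) =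
                  (2 * √2) ^ (2 + 2 * s) * (eucl (a, t) y ^ (2 + 2 * s))⁻¹ := by
                rw [show 1 - (3 + 2 * s) = -(2 + 2 * s) by ring, Real.rpow_neg (by positivity),
                  Real.div_rpow he.le (by positivity), inv_div, div_eq_mul_inv]
              rw [← h3]
              refine (div_le_self (by positivity) (by linarith)).trans h2
          _ = _ := by
              rw [ENNReal.ofReal_mul (by positivity), ENNReal.ofReal_inv_of_pos (by positivity),
                div_eq_mul_inv]
              ring
    _ = _ := lintegral_const_mul' _ _ ENNReal.ofReal_ne_top

lemma volume_eq_prod' : (volume : Measure (ℝ × ℝ)) = (volume : Measure ℝ).prod volume := rfl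

/-- Iterated integration over a measurable subset of the plane. -/
lemma setLIntegral_slices {K : Set (ℝ × ℝ)} (hKm : MeasurableSet K) {f : ℝ × ℝ → ℝ≥0∞}
    (hf : Measurable f) : ∫⁻ x in K, f x = ∫⁻ a, ∫⁻ t in {t | (a, t) ∈ K}, f (a, t) := by
  rw [← lintegral_indicator hKm, volume_eq_prod', lintegral_prod _ (hf.indicator hKm).aemeasurable]
  refine lintegral_congr fun a => ?_
  exact lintegral_indicator (measurable_prodMk_left hKm) fun t => f (a, t)

/-- The oscillation of `v` around `(a, t)` at the scale `|t - t'|`, weighted. -/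
noncomputable def nearOsc (K : Set (ℝ × ℝ)) (v : ℝ × ℝ → ℝ) (s a t t' : ℝ) : ℝ≥0∞ :=
  (∫⁻ y in K, Set.indicator {y | dist (a, t) y ≤ 2 * |t - t'|}
    (fun y => ‖v (a, t) - v y‖ₑ ^ 2) y) * (ENNReal.ofReal (|t - t'| ^ (3 + 2 * s)))⁻¹

lemma measurable_nearOsc (K : Set (ℝ × ℝ)) {v : ℝ × ℝ → ℝ} (hv : Measurable v) (s a : ℝ) :
    Measurable (Function.uncurry (nearOsc K v s a)) := by
  have hset : MeasurableSet {q : (ℝ × ℝ) × (ℝ × ℝ) | dist (a, q.1.1) q.2 ≤ 2 * |q.1.1 - q.1.2|} :=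
    measurableSet_le (by fun_prop) (by fun_prop)
  have hG : Measurable fun q : (ℝ × ℝ) × (ℝ × ℝ) => ‖v (a, q.1.1) - v q.2‖ₑ ^ 2 := by
    have h : Measurable fun q : (ℝ × ℝ) × (ℝ × ℝ) => (((a, q.1.1), q.2) : (ℝ × ℝ) × (ℝ × ℝ)) := by
      fun_prop
    exact (measurable_diff_sq hv).comp h
  have h1 : Measurable fun q : (ℝ × ℝ) × (ℝ × ℝ) =>
      Set.indicator {y | dist (a, q.1.1) y ≤ 2 * |q.1.1 - q.1.2|}
        (fun y => ‖v (a, q.1.1) - v y‖ₑ ^ 2) q.2 := hG.indicator hset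
  have h2 : Measurable fun q : ℝ × ℝ => |q.1 - q.2| ^ (3 + 2 * s) :=
    (by fun_prop : Measurable fun q : ℝ × ℝ => |q.1 - q.2|).pow_const _
  exact h1.lintegral_prod_right'.mul h2.ennreal_ofReal.inv

lemma diff_kernel_le_nearOsc {K : Set (ℝ × ℝ)} (hK : Convex ℝ K) (hKm : MeasurableSet K)
    (hK01 : K ⊆ Set.Icc 0 1 ×ˢ Set.Icc 0 1) (hpos : volume K ≠ 0) (hfinK : volume K ≠ ⊤) (s : ℝ)
    {v : ℝ × ℝ → ℝ} (hv : Measurable v) {a t t' : ℝ} (hx : (a, t) ∈ K) (hx' : (a, t') ∈ K) :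
    ‖v (a, t) - v (a, t')‖ₑ ^ 2 / ENNReal.ofReal (|t - t'| ^ (1 + 2 * s)) ≤
        (volume K)⁻¹ * (2 * (nearOsc K v s a t t' + nearOsc K v s a t' t)) := by
  by_cases htt : t = t'
  · simp [htt]
  have hr : 0 < |t - t'| := abs_pos.2 (sub_ne_zero.2 htt)
  have h1 := volume_mul_diff_sq_le hK hKm hK01 hv hx hx'
  -- The area of the shrunk copy contributes the factor `|t - t'| ^ 2`, which raises the exponent of
  -- the weight from `1 + 2s` to `3 + 2s`.
  have e1 : (ENNReal.ofReal (|t - t'| ^ (1 + 2 * s)))⁻¹ =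
      ENNReal.ofReal (|t - t'| ^ 2) * (ENNReal.ofReal (|t - t'| ^ (3 + 2 * s)))⁻¹ := by
    rw [← ENNReal.ofReal_inv_of_pos (by positivity), ← ENNReal.ofReal_inv_of_pos (by positivity),
      ← ENNReal.ofReal_mul (by positivity)]
    congr 1
    rw [show 3 + 2 * s = (1 + 2 * s) + (2 : ℕ) by push_cast; ring,
      Real.rpow_add hr (1 + 2 * s), Real.rpow_natCast]
    field_simp
  have e2 : nearOsc K v s a t' t = (∫⁻ y in K, Set.indicator {y | dist (a, t') y ≤ 2 * |t' - t|}
        (fun y => ‖v (a, t') - v y‖ₑ ^ 2) y) * (ENNReal.ofReal (|t - t'| ^ (3 + 2 * s)))⁻¹ := by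
    rw [nearOsc, abs_sub_comm t' t]
  rw [e2, nearOsc, ← add_mul, div_eq_mul_inv, e1, ← mul_assoc 2]
  have hone : (volume K)⁻¹ * volume K = 1 := ENNReal.inv_mul_cancel hpos hfinK
  calc _ = ((volume K)⁻¹ * volume K) * (‖v (a, t) - v (a, t')‖ₑ ^ 2 * (ENNReal.ofReal (|t - t'| ^ 2)
            * (ENNReal.ofReal (|t - t'| ^ (3 + 2 * s)))⁻¹)) := by rw [hone, one_mul]
    _ = (volume K)⁻¹ * ((ENNReal.ofReal (|t - t'| ^ 2) * volume K * ‖v (a, t) - v (a, t')‖ₑ ^ 2) *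
        (ENNReal.ofReal (|t - t'| ^ (3 + 2 * s)))⁻¹) := by ring
    _ ≤ _ := by gcongr

/-- Restriction to lines costs no derivatives once the result is integrated over all parallel lines:
each difference along a slice is averaged over nearby points of the plane, and Tonelli returns the
planar seminorm of the same order. -/
lemma ahSemiSq_one_le {K : Set (ℝ × ℝ)} (hK : Convex ℝ K) (hKm : MeasurableSet K)
    (hK01 : K ⊆ Set.Icc 0 1 ×ˢ Set.Icc 0 1) (hpos : volume K ≠ 0) {s : ℝ} (hs : 0 < s) :
    ∃ C : ℝ≥0, ∀ v : ℝ × ℝ → ℝ, Measurable v → ahSemiSq s K 1 v ≤ C * hsSemiSq s K v := by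
  have hfinK : volume K ≠ ⊤ :=
    ne_top_of_le_ne_top (by
      rw [volume_eq_prod', Measure.prod_prod]; simp) (measure_mono hK01)
  set c₀ := ENNReal.ofReal (2 * (2 * √2) ^ (2 + 2 * s)) with hc₀
  have hc₀t : c₀ ≠ ⊤ := ENNReal.ofReal_ne_top
  have hKi : (volume K)⁻¹ ≠ ⊤ := ENNReal.inv_ne_top.2 hpos
  clear_value c₀
  refine ⟨((volume K)⁻¹ * (4 * c₀)).toNNReal, fun v hv => ?_⟩
  rw [ENNReal.coe_toNNReal (ENNReal.mul_ne_top hKi (ENNReal.mul_ne_top (by simp) hc₀t))]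
  have hFm := fun a => measurable_nearOsc K hv s a
  have hslice : ∀ a, MeasurableSet {t | (a, t) ∈ K} := fun a => measurable_prodMk_left hKm
  have step1 : ahSemiSq s K 1 v ≤ ∫⁻ a, ∫⁻ t in {t | (a, t) ∈ K}, ∫⁻ t' in {t | (a, t) ∈ K},
      (volume K)⁻¹ * (2 * (nearOsc K v s a t t' + nearOsc K v s a t' t)) := by
    refine lintegral_mono fun a => ?_
    refine setLIntegral_mono' (hslice a) fun t ht => ?_
    exact setLIntegral_mono' (hslice a) fun t' ht' =>
      diff_kernel_le_nearOsc hK hKm hK01 hpos hfinK s hv ht ht'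
  have step2 : ∀ a, (∫⁻ t in {t | (a, t) ∈ K}, ∫⁻ t' in {t | (a, t) ∈ K},
      (volume K)⁻¹ * (2 * (nearOsc K v s a t t' + nearOsc K v s a t' t))) =
      (volume K)⁻¹ * (4 * ∫⁻ t in {t | (a, t) ∈ K}, ∫⁻ t' in {t | (a, t) ∈ K}, nearOsc K v s a t t') := by
    intro a
    -- The two oscillation terms, around `t` and around `t'`, have equal double integrals by
    -- symmetry.
    have hsw : ∫⁻ t in {t | (a, t) ∈ K}, ∫⁻ t' in {t | (a, t) ∈ K}, nearOsc K v s a t' t =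
        ∫⁻ t in {t | (a, t) ∈ K}, ∫⁻ t' in {t | (a, t) ∈ K}, nearOsc K v s a t t' :=
      (lintegral_lintegral_swap (f := nearOsc K v s a) (hFm a).aemeasurable).symm
    have hm1 : ∀ t, Measurable (nearOsc K v s a t) := fun t => (hFm a).comp measurable_prodMk_left
    have i1 : ∀ t, ∫⁻ t' in {t | (a, t) ∈ K},
        (volume K)⁻¹ * (2 * (nearOsc K v s a t t' + nearOsc K v s a t' t)) =
        (volume K)⁻¹ * (2 * ((∫⁻ t' in {t | (a, t) ∈ K}, nearOsc K v s a t t') +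
          ∫⁻ t' in {t | (a, t) ∈ K}, nearOsc K v s a t' t)) := fun t => by
      rw [lintegral_const_mul' _ _ hKi, lintegral_const_mul' _ _ (by simp),
        lintegral_add_left (hm1 t)]
    have hm3 : Measurable fun t => ∫⁻ t' in {t | (a, t) ∈ K}, nearOsc K v s a t t' :=
      (hFm a).lintegral_prod_right'
    simp_rw [i1]
    rw [lintegral_const_mul' _ _ hKi, lintegral_const_mul' _ _ (by simp),
      lintegral_add_left hm3, hsw]
    ring
  have step3 : ∀ a, (volume K)⁻¹ * (4 * ∫⁻ t in {t | (a, t) ∈ K}, ∫⁻ t' in {t | (a, t) ∈ K},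
      nearOsc K v s a t t') ≤ (volume K)⁻¹ * (4 * c₀) * ∫⁻ t in {t | (a, t) ∈ K},
          ∫⁻ y in K, ‖v (a, t) - v y‖ₑ ^ 2 / ENNReal.ofReal (eucl (a, t) y ^ (2 + 2 * s)) := by
    intro a
    rw [mul_assoc, mul_assoc 4, ← lintegral_const_mul' c₀ _ hc₀t]
    refine mul_le_mul_right (mul_le_mul_right (lintegral_mono fun t => ?_) _) _
    rw [hc₀]
    exact (lintegral_mono' Measure.restrict_le_self le_rfl).trans (lintegral_near_le hv hs a t)
  refine step1.trans ((lintegral_mono fun a => (step2 a).le.trans (step3 a)).trans (le_of_eq ?_))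
  rw [lintegral_const_mul' _ _ (ENNReal.mul_ne_top hKi (ENNReal.mul_ne_top (by simp) hc₀t)), hsSemiSq,
    setLIntegral_slices hKm (measurable_diff_kernel hv s).lintegral_prod_right']

/-! ### The pairing with partial derivatives in the plane -/

/-- Cauchy–Schwarz for the product of the square roots of `N` and `Ψ`. It assembles bounds on single
slices into a planar bound. -/
lemma sq_lintegral_le_of_ae_sq_le {α : Type*} [MeasurableSpace α] {μ : Measure α}
    {g N Ψ : α → ℝ≥0∞} (hN : AEMeasurable N μ) (hΨ : AEMeasurable Ψ μ)
    (h : ∀ᵐ x ∂μ, g x ^ 2 ≤ N x * Ψ x) :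
    (∫⁻ x, g x ∂μ) ^ 2 ≤ (∫⁻ x, N x ∂μ) * ∫⁻ x, Ψ x ∂μ := by
  have e : ∀ x : ℝ≥0∞, (x ^ (1 / (2 : ℝ))) ^ 2 = x := fun x => by
    rw [← ENNReal.rpow_natCast, ← ENNReal.rpow_mul]; norm_num
  have h1 : ∫⁻ x, g x ∂μ ≤ ∫⁻ x, N x ^ (1 / (2 : ℝ)) * Ψ x ^ (1 / (2 : ℝ)) ∂μ := by
    refine lintegral_mono_ae (h.mono fun x hx => ?_)
    rw [← ENNReal.mul_rpow_of_nonneg _ _ (by norm_num)]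
    have := ENNReal.rpow_le_rpow hx (by norm_num : (0 : ℝ) ≤ 1 / 2)
    rw [← ENNReal.rpow_natCast, ← ENNReal.rpow_mul] at this
    simpa using this
  refine (pow_le_pow_left' h1 2).trans ?_
  refine (lintegral_mul_sq_le (hN.pow_const _) (hΨ.pow_const _)).trans (le_of_eq ?_)
  simp_rw [e]

lemma measurable_hsSemiSq₁_slice {K : Set (ℝ × ℝ)} (hKm : MeasurableSet K) {v : ℝ × ℝ → ℝ}
    (hv : Measurable v) (s : ℝ) :
    Measurable fun a => hsSemiSq₁ s {t | (a, t) ∈ K} fun t => v (a, t) := by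
  have hm : ∀ a, MeasurableSet {t | (a, t) ∈ K} := fun a => measurable_prodMk_left hKm
  have e : ∀ a, hsSemiSq₁ s {t | (a, t) ∈ K} (fun t => v (a, t)) =
      ∫⁻ t, ∫⁻ t', Set.indicator K 1 (a, t) * (Set.indicator K 1 (a, t') *
        (‖v (a, t) - v (a, t')‖ₑ ^ 2 / ENNReal.ofReal (|t - t'| ^ (1 + 2 * s)))) := by
    intro a
    rw [hsSemiSq₁, ← lintegral_indicator (hm a)]
    refine lintegral_congr fun t => ?_
    by_cases ht : (a, t) ∈ K
    · rw [Set.indicator_of_mem (by exact ht), ← lintegral_indicator (hm a)]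
      refine lintegral_congr fun t' => ?_
      by_cases ht' : (a, t') ∈ K
      · rw [Set.indicator_of_mem (by exact ht')]; simp [ht, ht']
      · rw [Set.indicator_of_notMem (by exact ht')]; simp [ht']
    · rw [Set.indicator_of_notMem (by exact ht)]; simp [ht]
  simp_rw [e]
  have h1 : Measurable fun q : (ℝ × ℝ) × ℝ => Set.indicator K (1 : ℝ × ℝ → ℝ≥0∞) (q.1.1, q.1.2) :=
    (measurable_one.indicator hKm).comp (by fun_prop)
  have h2 : Measurable fun q : (ℝ × ℝ) × ℝ => Set.indicator K (1 : ℝ × ℝ → ℝ≥0∞) (q.1.1, q.2) :=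
    (measurable_one.indicator hKm).comp (by fun_prop)
  have h3 : Measurable fun q : (ℝ × ℝ) × ℝ => v (q.1.1, q.1.2) - v (q.1.1, q.2) :=
    (hv.comp (by fun_prop)).sub (hv.comp (by fun_prop))
  have h4 : Measurable fun q : (ℝ × ℝ) × ℝ => |q.1.2 - q.2| ^ (1 + 2 * s) :=
    (by fun_prop : Measurable fun q : (ℝ × ℝ) × ℝ => |q.1.2 - q.2|).pow_const _
  have h5 := h1.mul (h2.mul ((h3.enorm.pow_const 2).div h4.ennreal_ofReal))
  exact h5.lintegral_prod_right'.lintegral_prod_right'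

/-- The part of the strip `0 < x₁ < 1` between two graphs. -/
def slab (A B : ℝ → ℝ) : Set (ℝ × ℝ) := {x | 0 < x.1 ∧ x.1 < 1 ∧ A x.1 < x.2 ∧ x.2 < B x.1}

/-- Graphs inside the unit square. -/
structure IsSlab (A B : ℝ → ℝ) : Prop where
  measA : Measurable A
  measB : Measurable B
  nonneg : ∀ a, 0 < a → a < 1 → 0 ≤ A a
  lt : ∀ a, 0 < a → a < 1 → A a < B a
  le_one : ∀ a, 0 < a → a < 1 → B a ≤ 1

lemma measurableSet_slab {A B : ℝ → ℝ} (h : IsSlab A B) : MeasurableSet (slab A B) := by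
  have hA := h.measA
  have hB := h.measB
  refine (measurableSet_lt measurable_const measurable_fst).inter
    ((measurableSet_lt measurable_fst measurable_const).inter
      ((measurableSet_lt (hA.comp measurable_fst) measurable_snd).inter
        (measurableSet_lt measurable_snd (hB.comp measurable_fst))))

lemma slab_subset {A B : ℝ → ℝ} (h : IsSlab A B) : slab A B ⊆ Set.Icc 0 1 ×ˢ Set.Icc 0 1 := by
  rintro ⟨a, t⟩ ⟨h1, h2, h3, h4⟩
  simp only at h1 h2 h3 h4
  have := h.nonneg a h1 h2
  have := h.le_one a h1 h2
  exact ⟨⟨h1.le, h2.le⟩, ⟨by simp only; linarith, by simp only; linarith⟩⟩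

lemma slab_slice {A B : ℝ → ℝ} {a : ℝ} (h0 : 0 < a) (h1 : a < 1) :
    {t | (a, t) ∈ slab A B} = Set.Ioo (A a) (B a) := by
  ext t; simp [slab, h0, h1]

lemma setLIntegral_slab {A B : ℝ → ℝ} (h : IsSlab A B) {f : ℝ × ℝ → ℝ≥0∞} (hf : Measurable f) :
    ∫⁻ x in slab A B, f x = ∫⁻ a in Set.Ioo 0 1, ∫⁻ t in Set.Ioo (A a) (B a), f (a, t) := by
  rw [setLIntegral_slices (measurableSet_slab h) hf, ← lintegral_indicator measurableSet_Ioo]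
  refine lintegral_congr fun a => ?_
  by_cases ha : a ∈ Set.Ioo (0 : ℝ) 1
  · rw [Set.indicator_of_mem ha, slab_slice ha.1 ha.2]
  · rw [Set.indicator_of_notMem ha]
    have : {t | (a, t) ∈ slab A B} = ∅ := by
      ext t; simp only [slab, Set.mem_ofPred_eq, Set.mem_empty_iff_false, iff_false]
      exact fun h => ha ⟨h.1, h.2.1⟩
    rw [this]; simp

lemma ahSemiSq_slab {A B : ℝ → ℝ} (v : ℝ × ℝ → ℝ) (s : ℝ) :
    ahSemiSq s (slab A B) 1 v =
      ∫⁻ a in Set.Ioo 0 1, hsSemiSq₁ s (Set.Ioo (A a) (B a)) fun t => v (a, t) := by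
  rw [← lintegral_indicator measurableSet_Ioo]
  refine lintegral_congr fun a => ?_
  by_cases ha : a ∈ Set.Ioo (0 : ℝ) 1
  · rw [Set.indicator_of_mem ha, slab_slice ha.1 ha.2]
  · rw [Set.indicator_of_notMem ha]
    have : {t | (a, t) ∈ slab A B} = ∅ := by
      ext t; simp only [slab, Set.mem_ofPred_eq, Set.mem_empty_iff_false, iff_false]
      exact fun h => ha ⟨h.1, h.2.1⟩
    rw [this]; simp [hsSemiSq₁]

lemma setIntegral_slab {A B : ℝ → ℝ} (h : IsSlab A B) {f : ℝ × ℝ → ℝ}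
    (hf : IntegrableOn f (slab A B)) :
    ∫ x in slab A B, f x = ∫ a in Set.Ioo 0 1, ∫ t in Set.Ioo (A a) (B a), f (a, t) := by
  have hm := measurableSet_slab h
  rw [← integral_indicator hm, volume_eq_prod', integral_prod _
    (by rw [← volume_eq_prod']; exact (integrable_indicator_iff hm).2 hf),
    ← integral_indicator measurableSet_Ioo]
  congr 1
  ext a
  by_cases ha : a ∈ Set.Ioo (0 : ℝ) 1
  · rw [Set.indicator_of_mem ha, ← slab_slice (A := A) (B := B) ha.1 ha.2]
    exact integral_indicator (μ := volume) (f := fun t => f (a, t)) (measurable_prodMk_left hm)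
  · rw [Set.indicator_of_notMem ha]
    have : ∀ t, Set.indicator (slab A B) f (a, t) = 0 := fun t =>
      Set.indicator_of_notMem (fun h => ha ⟨h.1, h.2.1⟩) _
    simp [this]

/-- Functions on `K` extend to the unit square with control of the `H^{1/2}` norm. -/
def HasExtension (K : Set (ℝ × ℝ)) : Prop :=
  ∀ w : ℝ × ℝ → ℝ, Measurable w → ∃ w' : ℝ × ℝ → ℝ, Measurable w' ∧ (∀ x ∈ K, w' x = w x) ∧
    hsNormSq (1 / 2) (slab 0 1) w' ≤ 4 * hsNormSq (1 / 2) K w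

lemma isSlab_square : IsSlab 0 1 :=
  ⟨measurable_zero, measurable_one, by simp, by simp, by simp⟩

lemma slab_square : slab 0 1 = Set.Ioo 0 1 ×ˢ Set.Ioo 0 1 := by
  ext x; simp [slab, and_assoc]

lemma convex_slab_square : Convex ℝ (slab 0 1) := by
  rw [slab_square]; exact (convex_Ioo _ _).prod (convex_Ioo _ _)

lemma volume_slab_square : volume (slab 0 1) = 1 := by
  rw [slab_square, volume_eq_prod', Measure.prod_prod]; simp

lemma partialD_one (ψ : ℝ × ℝ → ℝ) (x : ℝ × ℝ) : partialD 1 ψ x = fderiv ℝ ψ x (0, 1) := rfl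

lemma partialD_zero (ψ : ℝ × ℝ → ℝ) (x : ℝ × ℝ) : partialD 0 ψ x = fderiv ℝ ψ x (1, 0) := rfl

lemma deriv_slice {ψ : ℝ × ℝ → ℝ} (hψ : ContDiff ℝ ∞ ψ) (a t : ℝ) :
    deriv (fun t => ψ (a, t)) t = partialD 1 ψ (a, t) := by
  have h1 : HasFDerivAt ψ (fderiv ℝ ψ (a, t)) (a, t) :=
    (hψ.differentiable (by simp) _).hasFDerivAt
  have h2 : HasDerivAt (fun t : ℝ => (a, t)) ((0 : ℝ), (1 : ℝ)) t :=
    (hasDerivAt_const t a).prodMk (hasDerivAt_id t)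
  exact (h1.comp_hasDerivAt t h2).deriv

lemma contDiff_slice {ψ : ℝ × ℝ → ℝ} (hψ : ContDiff ℝ ∞ ψ) (a : ℝ) :
    ContDiff ℝ 1 fun t => ψ (a, t) :=
  (hψ.comp (contDiff_prodMk_right a)).of_le (by exact_mod_cast le_top)

lemma continuous_partialD {ψ : ℝ × ℝ → ℝ} (hψ : ContDiff ℝ ∞ ψ) (l : Fin 2) :
    Continuous (partialD l ψ) :=
  (hψ.continuous_fderiv (by simp)).clm_apply continuous_const

lemma memLp_two_of_l2sq {K : Set (ℝ × ℝ)} {w : ℝ × ℝ → ℝ}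
    (hw : AEStronglyMeasurable w (volume.restrict K))
    (h : l2sq K w ≠ ⊤) : MemLp w 2 (volume.restrict K) := by
  refine ⟨hw, ?_⟩
  rw [eLpNorm_lt_top_iff_lintegral_rpow_enorm_lt_top (by simp) (by simp)]
  simpa [l2sq, lt_top_iff_ne_top] using h

lemma memLp_two_of_continuous {K : Set (ℝ × ℝ)} (hKb : K ⊆ Set.Icc 0 1 ×ˢ Set.Icc 0 1)
    {f : ℝ × ℝ → ℝ} (hf : Continuous f) : MemLp f 2 (volume.restrict K) := by
  have hc : IsCompact (Set.Icc (0 : ℝ) 1 ×ˢ Set.Icc (0 : ℝ) 1) := isCompact_Icc.prod isCompact_Icc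
  obtain ⟨M, hM⟩ := hc.exists_bound_of_continuousOn hf.continuousOn
  have : IsFiniteMeasure (volume.restrict (Set.Icc (0 : ℝ) 1 ×ˢ Set.Icc (0 : ℝ) 1)) :=
    ⟨by rw [Measure.restrict_apply_univ]; exact hc.measure_lt_top⟩
  refine (MemLp.of_bound hf.aestronglyMeasurable M ?_).mono_measure (Measure.restrict_mono hKb le_rfl)
  exact (ae_restrict_iff' hc.measurableSet).2 (Eventually.of_forall hM)

lemma integrableOn_mul_continuous {K : Set (ℝ × ℝ)} (hKb : K ⊆ Set.Icc 0 1 ×ˢ Set.Icc 0 1)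
    {w f : ℝ × ℝ → ℝ} (hw : AEStronglyMeasurable w (volume.restrict K)) (h : l2sq K w ≠ ⊤)
    (hf : Continuous f) : IntegrableOn (fun x => w x * f x) K :=
  (memLp_two_of_l2sq hw h).integrable_mul (memLp_two_of_continuous hKb hf)

lemma enorm_integral_mul_partialD_le_slices {A B : ℝ → ℝ} (h : IsSlab A B) {w : ℝ × ℝ → ℝ}
    (hw : Measurable w) (hw2 : l2sq (slab A B) w ≠ ⊤) {ψ : ℝ × ℝ → ℝ} (hψ : ContDiff ℝ ∞ ψ) :
    ‖∫ x in slab A B, w x * partialD 1 ψ x‖ₑ ≤ ∫⁻ a in Set.Ioo 0 1,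
      ‖∫ t in Set.Ioo (A a) (B a), w (a, t) * deriv (fun t => ψ (a, t)) t‖ₑ := by
  rw [setIntegral_slab h (integrableOn_mul_continuous (slab_subset h) hw.aestronglyMeasurable hw2
    (continuous_partialD hψ 1))]
  simp_rw [deriv_slice hψ]
  exact enorm_integral_le_lintegral_enorm _

/-- On almost every slice the one-dimensional pairing applies to the extension `w'` of `w` to the
unit square, whose slices all have length one; Cauchy–Schwarz over the slices finishes. Without the
extension the means of `w` over the short slices near a vertex would not be controlled. -/
lemma pairing_slab {A B : ℝ → ℝ} (h : IsSlab A B) (hconv : Convex ℝ (slab A B))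
    (hpos : volume (slab A B) ≠ 0) (hext : HasExtension (slab A B)) {s : ℝ} (hs : 1 / 2 < s) :
    ∃ C : ℝ≥0, ∀ w ψ : ℝ × ℝ → ℝ, Measurable w → ContDiff ℝ ∞ ψ →
      hsNormSq (1 / 2) (slab A B) w ≠ ⊤ → hsSemiSq s (slab A B) ψ ≠ ⊤ →
      ‖∫ x in slab A B, w x * partialD 1 ψ x‖ₑ ^ 2 ≤
        C * (hsNormSq (1 / 2) (slab A B) w * hsSemiSq s (slab A B) ψ) := by
  obtain ⟨C₁, hC₁, h1⟩ := enorm_integral_mul_deriv_sq_le hs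
  obtain ⟨C₂, h2⟩ := ahSemiSq_one_le hconv (measurableSet_slab h) (slab_subset h) hpos
    (by linarith : 0 < s)
  obtain ⟨C₃, h3⟩ := ahSemiSq_one_le convex_slab_square (measurableSet_slab isSlab_square)
    (slab_subset isSlab_square) (by rw [volume_slab_square]; simp) (by norm_num : (0 : ℝ) < 1 / 2)
  refine ⟨C₁.toNNReal * ((1 + C₃) * 4) * C₂, fun w ψ hw hψ hwf hψf => ?_⟩
  obtain ⟨w', hw', hww', hle⟩ := hext w hw
  have hw'f : hsNormSq (1 / 2) (slab 0 1) w' ≠ ⊤ :=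
    ne_top_of_le_ne_top (ENNReal.mul_ne_top (by simp) hwf) hle
  set N : ℝ → ℝ≥0∞ := fun a => (∫⁻ t in Set.Ioo 0 1, ‖w' (a, t)‖ₑ ^ 2) +
    hsSemiSq₁ (1 / 2) (Set.Ioo 0 1) fun t => w' (a, t) with hN
  set Ψ : ℝ → ℝ≥0∞ := fun a => hsSemiSq₁ s {t | (a, t) ∈ slab A B} fun t => ψ (a, t) with hΨ
  have hNm1 : Measurable fun a => ∫⁻ t in Set.Ioo (0 : ℝ) 1, ‖w' (a, t)‖ₑ ^ 2 :=
    (hw'.enorm.pow_const 2).lintegral_prod_right'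
  have hNm2 : Measurable fun a => hsSemiSq₁ (1 / 2) (Set.Ioo 0 1) fun t => w' (a, t) := by
    have hms : MeasurableSet (Set.univ ×ˢ Set.Ioo 0 1 : Set (ℝ × ℝ)) :=
      MeasurableSet.univ.prod measurableSet_Ioo
    have hI : ∀ a : ℝ, {t | (a, t) ∈ (Set.univ ×ˢ Set.Ioo 0 1 : Set (ℝ × ℝ))} = Set.Ioo 0 1 :=
      fun a => by ext t; simp
    simpa only [hI] using measurable_hsSemiSq₁_slice hms hw' (1 / 2)
  have hNm : Measurable N := hNm1.add hNm2
  have hΨm : Measurable Ψ := measurable_hsSemiSq₁_slice (measurableSet_slab h) hψ.continuous.measurable s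
  have hNint : ∫⁻ a in Set.Ioo 0 1, N a ≤ (1 + C₃) * (4 * hsNormSq (1 / 2) (slab A B) w) := by
    have e1 : ∫⁻ a in Set.Ioo 0 1, N a =
        l2sq (slab 0 1) w' + ahSemiSq (1 / 2) (slab 0 1) 1 w' := by
      rw [hN, lintegral_add_left hNm1, l2sq, setLIntegral_slab isSlab_square (hw'.enorm.pow_const 2),
        ahSemiSq_slab]
      rfl
    rw [e1]
    calc _ ≤ hsNormSq (1 / 2) (slab 0 1) w' + C₃ * hsNormSq (1 / 2) (slab 0 1) w' := by
          gcongr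
          · exact le_self_add
          · exact (h3 w' hw').trans (by gcongr; exact le_add_self)
      _ = (1 + C₃) * hsNormSq (1 / 2) (slab 0 1) w' := by ring
      _ ≤ _ := by gcongr
  have hΨint : ∫⁻ a in Set.Ioo 0 1, Ψ a ≤ C₂ * hsSemiSq s (slab A B) ψ := by
    refine le_trans ?_ (h2 ψ hψ.continuous.measurable)
    exact lintegral_mono' Measure.restrict_le_self le_rfl
  have hNae : ∀ᵐ a ∂volume.restrict (Set.Ioo 0 1), N a < ⊤ := by
    refine ae_lt_top hNm (ne_top_of_le_ne_top ?_ hNint)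
    exact ENNReal.mul_ne_top (by simp) (ENNReal.mul_ne_top (by simp) hwf)
  have hΨae : ∀ᵐ a ∂volume.restrict (Set.Ioo 0 1), Ψ a < ⊤ :=
    ae_lt_top hΨm (ne_top_of_le_ne_top (ENNReal.mul_ne_top (by simp) hψf) hΨint)
  have hw2 : l2sq (slab A B) w ≠ ⊤ := ne_top_of_le_ne_top hwf le_self_add
  refine (pow_le_pow_left' (enorm_integral_mul_partialD_le_slices h hw hw2 hψ) 2).trans ?_
  refine (sq_lintegral_le_of_ae_sq_le (N := fun a => ENNReal.ofReal C₁ * N a) (Ψ := Ψ)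
    (hNm.const_mul _).aemeasurable hΨm.aemeasurable ?_).trans ?_
  · filter_upwards [hNae, hΨae, ae_restrict_mem measurableSet_Ioo] with a hNa hΨa ha
    have e1 : ∫ t in Set.Ioo (A a) (B a), w (a, t) * deriv (fun t => ψ (a, t)) t =
        ∫ t in Set.Ioo (A a) (B a), w' (a, t) * deriv (fun t => ψ (a, t)) t := by
      refine setIntegral_congr_fun measurableSet_Ioo fun t ht => ?_
      rw [hww' (a, t) ⟨ha.1, ha.2, ht.1, ht.2⟩]
    have hΨa' : Ψ a = hsSemiSq₁ s (Set.Ioo (A a) (B a)) fun t => ψ (a, t) := by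
      simp only [hΨ]; rw [slab_slice ha.1 ha.2]
    rw [e1, mul_assoc, hΨa']
    rw [hΨa'] at hΨa
    have hNa' := ENNReal.add_lt_top.1 hNa
    exact h1 (fun t => w' (a, t)) (fun t => ψ (a, t)) (A a) (B a) (hw'.comp measurable_prodMk_left)
      (contDiff_slice hψ a) (h.nonneg a ha.1 ha.2) (h.lt a ha.1 ha.2) (h.le_one a ha.1 ha.2)
      hNa'.1.ne hNa'.2.ne hΨa.ne
  · rw [lintegral_const_mul' _ _ ENNReal.ofReal_ne_top]
    calc _ ≤ ENNReal.ofReal C₁ * ((1 + C₃) * (4 * hsNormSq (1 / 2) (slab A B) w)) *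
          (C₂ * hsSemiSq s (slab A B) ψ) := by gcongr
      _ = _ := by push_cast; rw [ENNReal.ofReal]; ring

/-- Since `ψ` has equal values at the ends of each slice, the slice means of `w` do not contribute.
No extension is needed, and of `w` only the seminorm in the slice direction enters the bound. -/
lemma pairing_slab_of_eq {A B : ℝ → ℝ} (h : IsSlab A B) (hconv : Convex ℝ (slab A B))
    (hpos : volume (slab A B) ≠ 0) {s : ℝ} (hs : 1 / 2 < s) :
    ∃ C : ℝ≥0, ∀ w ψ : ℝ × ℝ → ℝ, Measurable w → ContDiff ℝ ∞ ψ →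
      l2sq (slab A B) w ≠ ⊤ → ahSemiSq (1 / 2) (slab A B) 1 w ≠ ⊤ → hsSemiSq s (slab A B) ψ ≠ ⊤ →
      (∀ a, 0 < a → a < 1 → ψ (a, A a) = ψ (a, B a)) →
      ‖∫ x in slab A B, w x * partialD 1 ψ x‖ₑ ^ 2 ≤
        C * (ahSemiSq (1 / 2) (slab A B) 1 w * hsSemiSq s (slab A B) ψ) := by
  obtain ⟨C₁, hC₁, h1⟩ := enorm_integral_mul_deriv_sq_le_of_eq hs
  obtain ⟨C₂, h2⟩ := ahSemiSq_one_le hconv (measurableSet_slab h) (slab_subset h) hpos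
    (by linarith : 0 < s)
  refine ⟨C₁.toNNReal * C₂, fun w ψ hw hψ hw2 hwf hψf hends => ?_⟩
  set N : ℝ → ℝ≥0∞ := fun a => hsSemiSq₁ (1 / 2) {t | (a, t) ∈ slab A B} fun t => w (a, t) with hN
  set Ψ : ℝ → ℝ≥0∞ := fun a => hsSemiSq₁ s {t | (a, t) ∈ slab A B} fun t => ψ (a, t) with hΨ
  have hms := measurableSet_slab h
  have hNm : Measurable N := measurable_hsSemiSq₁_slice hms hw _
  have hΨm : Measurable Ψ := measurable_hsSemiSq₁_slice hms hψ.continuous.measurable s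
  have hLm : Measurable fun a => ∫⁻ t in {t | (a, t) ∈ slab A B}, ‖w (a, t)‖ₑ ^ 2 := by
    have := ((hw.enorm.pow_const 2).indicator hms).lintegral_prod_right' (ν := volume)
    convert this using 2 with a
    exact (lintegral_indicator (measurable_prodMk_left hms) fun t => ‖w (a, t)‖ₑ ^ 2).symm
  -- Square integrability on almost every slice is used only qualitatively, to make sense of the
  -- slice integrals.
  have hLae : ∀ᵐ a, ∫⁻ t in {t | (a, t) ∈ slab A B}, ‖w (a, t)‖ₑ ^ 2 < ⊤ := by
    refine ae_lt_top hLm ?_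
    rwa [← setLIntegral_slices hms (hw.enorm.pow_const 2)]
  have hNint : ∫⁻ a in Set.Ioo 0 1, N a ≤ ahSemiSq (1 / 2) (slab A B) 1 w :=
    lintegral_mono' Measure.restrict_le_self le_rfl
  have hΨint : ∫⁻ a in Set.Ioo 0 1, Ψ a ≤ C₂ * hsSemiSq s (slab A B) ψ := by
    refine le_trans ?_ (h2 ψ hψ.continuous.measurable)
    exact lintegral_mono' Measure.restrict_le_self le_rfl
  have hNae : ∀ᵐ a ∂volume.restrict (Set.Ioo 0 1), N a < ⊤ :=
    ae_lt_top hNm (ne_top_of_le_ne_top hwf hNint)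
  have hΨae : ∀ᵐ a ∂volume.restrict (Set.Ioo 0 1), Ψ a < ⊤ :=
    ae_lt_top hΨm (ne_top_of_le_ne_top (ENNReal.mul_ne_top (by simp) hψf) hΨint)
  refine (pow_le_pow_left' (enorm_integral_mul_partialD_le_slices h hw hw2 hψ) 2).trans ?_
  refine (sq_lintegral_le_of_ae_sq_le (N := fun a => ENNReal.ofReal C₁ * N a) (Ψ := Ψ)
    (hNm.const_mul _).aemeasurable hΨm.aemeasurable ?_).trans ?_
  · filter_upwards [hNae, hΨae, ae_restrict_mem measurableSet_Ioo, ae_restrict_of_ae hLae]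
      with a hNa hΨa ha hLa
    simp only [hN, hΨ] at hNa hΨa ⊢
    rw [slab_slice ha.1 ha.2] at hNa hΨa hLa ⊢
    rw [mul_assoc]
    exact h1 (fun t => w (a, t)) (fun t => ψ (a, t)) (A a) (B a) (hw.comp measurable_prodMk_left)
      (contDiff_slice hψ a) (h.nonneg a ha.1 ha.2) (h.lt a ha.1 ha.2) (h.le_one a ha.1 ha.2)
      hLa.ne hNa.ne hΨa.ne (hends a ha.1 ha.2)
  · rw [lintegral_const_mul' _ _ ENNReal.ofReal_ne_top]
    calc _ ≤ ENNReal.ofReal C₁ * ahSemiSq (1 / 2) (slab A B) 1 w *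
          (C₂ * hsSemiSq s (slab A B) ψ) := by gcongr
      _ = _ := by push_cast; rw [ENNReal.ofReal]; ring

/-! ### The reference elements -/

lemma slab_id_one : slab id 1 = Prod.swap ⁻¹' slab 0 id := by
  ext x
  simp only [slab, id, Pi.one_apply, Pi.zero_apply, Set.mem_preimage, Set.mem_ofPred_eq,
    Prod.fst_swap, Prod.snd_swap]
  constructor
  · rintro ⟨h1, h2, h3, h4⟩; exact ⟨by linarith, h4, h1, h3⟩
  · rintro ⟨h1, h2, h3, h4⟩; exact ⟨h3, by linarith, h4, h2⟩

lemma swap_slab_square : Prod.swap ⁻¹' slab 0 1 = slab 0 1 := by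
  ext x
  simp only [slab, Pi.one_apply, Pi.zero_apply, Set.mem_preimage, Set.mem_ofPred_eq,
    Prod.fst_swap, Prod.snd_swap]
  tauto

lemma element_triangle : element .triangle 1 1 = slab 0 id := by
  ext x; simp [element, slab]

lemma element_rectangle : element .rectangle 1 1 = slab 0 1 := by
  ext x; simp [element, slab]

lemma isSlab_triangle : IsSlab 0 id :=
  ⟨measurable_zero, measurable_id, by simp, fun a h _ => h, fun a _ h => h.le⟩

lemma isSlab_triangle_swap : IsSlab id 1 :=
  ⟨measurable_id, measurable_one, fun a h _ => h.le, fun a _ h => h, by simp⟩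

lemma isOpen_slab {A B : ℝ → ℝ} (hA : Continuous A) (hB : Continuous B) : IsOpen (slab A B) := by
  refine (isOpen_lt continuous_const continuous_fst).inter
    ((isOpen_lt continuous_fst continuous_const).inter
      ((isOpen_lt (hA.comp continuous_fst) continuous_snd).inter
        (isOpen_lt continuous_snd (hB.comp continuous_fst))))

lemma convex_slab_triangle : Convex ℝ (slab 0 id) := by
  have : slab 0 id = {x : ℝ × ℝ | 0 < x.1} ∩ {x | x.1 < 1} ∩ {x | 0 < x.2} ∩ {x | x.2 - x.1 < 0} := by
    ext x; simp [slab, and_assoc]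
  rw [this]
  refine (((convex_halfSpace_gt ⟨fun _ _ => rfl, fun _ _ => rfl⟩ 0).inter
    (convex_halfSpace_lt ⟨fun _ _ => rfl, fun _ _ => rfl⟩ 1)).inter
    (convex_halfSpace_gt ⟨fun _ _ => rfl, fun _ _ => rfl⟩ 0)).inter
    (convex_halfSpace_lt ⟨fun _ _ => ?_, fun _ _ => ?_⟩ 0)
  · simp only [Prod.fst_add, Prod.snd_add]; ring
  · simp only [Prod.smul_fst, Prod.smul_snd, smul_eq_mul]; ring

lemma convex_slab_triangle_swap : Convex ℝ (slab id 1) := by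
  rw [slab_id_one]
  exact convex_slab_triangle.linear_preimage (LinearEquiv.prodComm ℝ ℝ ℝ).toLinearMap

/-! ### Exchange of the two coordinates -/

lemma measurePreserving_swap' : MeasurePreserving (Prod.swap : ℝ × ℝ → ℝ × ℝ) volume volume :=
  Measure.measurePreserving_swap

lemma measurableEmbedding_swap : MeasurableEmbedding (Prod.swap : ℝ × ℝ → ℝ × ℝ) :=
  (MeasurableEquiv.prodComm : ℝ × ℝ ≃ᵐ ℝ × ℝ).measurableEmbedding

lemma setLIntegral_swap (K : Set (ℝ × ℝ)) (f : ℝ × ℝ → ℝ≥0∞) :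
    ∫⁻ x in Prod.swap ⁻¹' K, f x.swap = ∫⁻ x in K, f x :=
  measurePreserving_swap'.setLIntegral_comp_preimage_emb measurableEmbedding_swap f K

lemma setIntegral_swap (K : Set (ℝ × ℝ)) (f : ℝ × ℝ → ℝ) :
    ∫ x in Prod.swap ⁻¹' K, f x.swap = ∫ x in K, f x :=
  measurePreserving_swap'.setIntegral_preimage_emb measurableEmbedding_swap f K

lemma eucl_swap (x y : ℝ × ℝ) : eucl x.swap y.swap = eucl x y := by
  simp only [eucl, Prod.fst_swap, Prod.snd_swap]; rw [add_comm]

lemma hsSemiSq_swap (s : ℝ) (K : Set (ℝ × ℝ)) (v : ℝ × ℝ → ℝ) :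
    hsSemiSq s (Prod.swap ⁻¹' K) (fun x => v x.swap) = hsSemiSq s K v := by
  unfold hsSemiSq
  rw [← setLIntegral_swap K]
  refine lintegral_congr fun x => ?_
  rw [← setLIntegral_swap K]
  refine lintegral_congr fun y => ?_
  rw [eucl_swap]

lemma l2sq_swap (K : Set (ℝ × ℝ)) (v : ℝ × ℝ → ℝ) :
    l2sq (Prod.swap ⁻¹' K) (fun x => v x.swap) = l2sq K v :=
  setLIntegral_swap K fun x => ‖v x‖ₑ ^ 2

lemma hsNormSq_swap (s : ℝ) (K : Set (ℝ × ℝ)) (v : ℝ × ℝ → ℝ) :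
    hsNormSq s (Prod.swap ⁻¹' K) (fun x => v x.swap) = hsNormSq s K v := by
  rw [hsNormSq, hsNormSq, l2sq_swap, hsSemiSq_swap]

lemma ahSemiSq_swap (s : ℝ) (K : Set (ℝ × ℝ)) (v : ℝ × ℝ → ℝ) :
    ahSemiSq s (Prod.swap ⁻¹' K) 1 (fun x => v x.swap) = ahSemiSq s K 0 v := rfl

lemma partialD_swap {ψ : ℝ × ℝ → ℝ} (hψ : ContDiff ℝ ∞ ψ) (x : ℝ × ℝ) :
    partialD 1 (fun x => ψ x.swap) x = partialD 0 ψ x.swap := by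
  have h1 : HasFDerivAt ψ (fderiv ℝ ψ x.swap) x.swap :=
    (hψ.differentiable (by simp) _).hasFDerivAt
  have h2 : HasFDerivAt (Prod.swap : ℝ × ℝ → ℝ × ℝ)
      (ContinuousLinearEquiv.prodComm ℝ ℝ ℝ : ℝ × ℝ →L[ℝ] ℝ × ℝ) x :=
    (ContinuousLinearEquiv.prodComm ℝ ℝ ℝ : ℝ × ℝ →L[ℝ] ℝ × ℝ).hasFDerivAt
  have h3 := (h1.comp x h2).fderiv
  rw [partialD_one, partialD_zero]
  change fderiv ℝ (ψ ∘ Prod.swap) x (0, 1) = _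
  rw [h3]; rfl

lemma contDiff_swap {ψ : ℝ × ℝ → ℝ} (hψ : ContDiff ℝ ∞ ψ) : ContDiff ℝ ∞ fun x : ℝ × ℝ => ψ x.swap :=
  hψ.comp (contDiff_snd.prodMk contDiff_fst)

/-! ### Extension from the triangle to the square -/

lemma hasExtension_square : HasExtension (slab 0 1) := fun w hw =>
  ⟨w, hw, fun _ _ => rfl, le_mul_of_one_le_left' (by norm_num)⟩

/-- Folding the square along its diagonal. -/
def fold (x : ℝ × ℝ) : ℝ × ℝ := (max x.1 x.2, min x.1 x.2)

lemma measurable_fold : Measurable fold := by unfold fold; fun_prop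

/-- Folding is the identity on one side of the diagonal and the reflection on the other. It
preserves distances on each side and brings points on opposite sides closer. -/
lemma eucl_fold_le (x y : ℝ × ℝ) : eucl (fold x) (fold y) ≤ eucl x y := by
  refine Real.sqrt_le_sqrt ?_
  obtain ⟨a, b⟩ := x
  obtain ⟨c, d⟩ := y
  simp only [fold]
  rcases le_total a b with h | h <;> rcases le_total c d with h' | h' <;>
    simp only [max_eq_left, max_eq_right, min_eq_left, min_eq_right, h, h'] <;>
    nlinarith [mul_nonneg (sub_nonneg.2 h) (sub_nonneg.2 h')]

lemma volume_diagonal : volume {x : ℝ × ℝ | x.1 = x.2} = 0 := by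
  rw [volume_eq_prod', Measure.measure_prod_null (measurableSet_eq_fun measurable_fst measurable_snd)]
  refine Eventually.of_forall fun a => ?_
  have : Prod.mk a ⁻¹' {x : ℝ × ℝ | x.1 = x.2} = {a} := by ext t; simp [eq_comm]
  simp only [this]; simp

lemma setLIntegral_fold_le (f : ℝ × ℝ → ℝ≥0∞) :
    ∫⁻ x in slab 0 1, f (fold x) ≤ 2 * ∫⁻ x in slab 0 id, f x := by
  have hsub : slab 0 1 ⊆ (slab 0 id ∪ slab id 1) ∪ {x | x.1 = x.2} := by
    rintro ⟨a, b⟩ ⟨h1, h2, h3, h4⟩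
    simp only [Pi.zero_apply, Pi.one_apply] at *
    rcases lt_trichotomy a b with h | h | h
    · exact Or.inl (Or.inr ⟨h1, h2, h, h4⟩)
    · exact Or.inr h
    · exact Or.inl (Or.inl ⟨h1, h2, h3, h⟩)
  have e1 : ∫⁻ x in slab 0 id, f (fold x) = ∫⁻ x in slab 0 id, f x := by
    refine setLIntegral_congr_fun (measurableSet_slab isSlab_triangle) fun x hx => ?_
    have : x.2 < x.1 := hx.2.2.2
    rw [fold, max_eq_left this.le, min_eq_right this.le]
  have e2 : ∫⁻ x in slab id 1, f (fold x) = ∫⁻ x in slab 0 id, f x := by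
    rw [← setLIntegral_swap (slab 0 id), ← slab_id_one]
    refine setLIntegral_congr_fun (measurableSet_slab isSlab_triangle_swap) fun x hx => ?_
    have : x.1 < x.2 := hx.2.2.1
    rw [fold, max_eq_right this.le, min_eq_left this.le]; rfl
  calc _ ≤ ∫⁻ x in (slab 0 id ∪ slab id 1) ∪ {x | x.1 = x.2}, f (fold x) :=
        lintegral_mono_set hsub
    _ ≤ (∫⁻ x in slab 0 id, f (fold x)) + (∫⁻ x in slab id 1, f (fold x)) +
          ∫⁻ x in {x | x.1 = x.2}, f (fold x) :=
        (lintegral_union_le _ _ _).trans (by gcongr; exact lintegral_union_le _ _ _)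
    _ = _ := by
        rw [e1, e2, setLIntegral_measure_zero _ _ volume_diagonal, add_zero, two_mul]

/-- Even reflection across the hypotenuse. Since folding does not increase distances, the kernel of
the seminorm only grows under it; each of the two integrals over the square is at most twice the
integral over the triangle, hence the factor `4`. -/
lemma hasExtension_triangle : HasExtension (slab 0 id) := by
  intro w hw
  refine ⟨fun x => w (fold x), hw.comp measurable_fold, fun x hx => ?_, ?_⟩
  · have : x.2 < x.1 := hx.2.2.2
    change w (fold x) = w x
    rw [fold, max_eq_left this.le, min_eq_right this.le]
  have h1 : l2sq (slab 0 1) (fun x => w (fold x)) ≤ 4 * l2sq (slab 0 id) w :=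
    (setLIntegral_fold_le fun x => ‖w x‖ₑ ^ 2).trans (by rw [l2sq]; gcongr; norm_num)
  have h2 : hsSemiSq (1 / 2) (slab 0 1) (fun x => w (fold x)) ≤ 4 * hsSemiSq (1 / 2) (slab 0 id) w := by
    calc _ ≤ ∫⁻ x in slab 0 1, ∫⁻ y in slab 0 1, ‖w (fold x) - w (fold y)‖ₑ ^ 2 /
          ENNReal.ofReal (eucl (fold x) (fold y) ^ (2 + 2 * (1 / 2 : ℝ))) := by
          unfold hsSemiSq
          gcongr with x y
          · exact eucl_nonneg _ _
          · exact eucl_fold_le x y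
      _ ≤ ∫⁻ x in slab 0 1, 2 * ∫⁻ y in slab 0 id, ‖w (fold x) - w y‖ₑ ^ 2 /
          ENNReal.ofReal (eucl (fold x) y ^ (2 + 2 * (1 / 2 : ℝ))) := by
          gcongr with x
          exact setLIntegral_fold_le fun y => ‖w (fold x) - w y‖ₑ ^ 2 /
            ENNReal.ofReal (eucl (fold x) y ^ (2 + 2 * (1 / 2 : ℝ)))
      _ = 2 * ∫⁻ x in slab 0 1, ∫⁻ y in slab 0 id, ‖w (fold x) - w y‖ₑ ^ 2 /
          ENNReal.ofReal (eucl (fold x) y ^ (2 + 2 * (1 / 2 : ℝ))) := lintegral_const_mul' _ _ (by simp)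
      _ ≤ 2 * (2 * hsSemiSq (1 / 2) (slab 0 id) w) := by
          gcongr
          exact setLIntegral_fold_le fun x => ∫⁻ y in slab 0 id, ‖w x - w y‖ₑ ^ 2 /
            ENNReal.ofReal (eucl x y ^ (2 + 2 * (1 / 2 : ℝ)))
      _ = _ := by rw [← mul_assoc]; norm_num
  rw [hsNormSq, hsNormSq, mul_add]
  exact add_le_add h1 h2

lemma hasExtension_triangle_swap : HasExtension (slab id 1) := by
  intro w hw
  obtain ⟨w', hw', h1, h2⟩ := hasExtension_triangle (fun x => w x.swap) (hw.comp measurable_swap)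
  refine ⟨fun x => w' x.swap, hw'.comp measurable_swap, fun x hx => ?_, ?_⟩
  · rw [slab_id_one] at hx
    have := h1 _ hx
    simpa using this
  · rw [← swap_slab_square, hsNormSq_swap]
    refine h2.trans (le_of_eq ?_)
    rw [← hsNormSq_swap, ← slab_id_one]
    simp

lemma volume_slab_ne_zero {A B : ℝ → ℝ} (hA : Continuous A) (hB : Continuous B)
    (hne : (slab A B).Nonempty) : volume (slab A B) ≠ 0 :=
  ((isOpen_slab hA hB).measure_pos volume hne).ne'

/-- The lower end of the segment in direction `l` through the reference element, at height `a`. -/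
def sliceLo (κ : Shape) (l : Fin 2) (a : ℝ) : ℝ × ℝ :=
  match κ, l with
  | .triangle, 0 => (a, a)
  | .triangle, 1 => (a, 0)
  | .rectangle, 0 => (0, a)
  | .rectangle, 1 => (a, 0)

/-- The upper end of the segment in direction `l` through the reference element, at height `a`. -/
def sliceHi (κ : Shape) (l : Fin 2) (a : ℝ) : ℝ × ℝ :=
  match κ, l with
  | .triangle, 0 => (1, a)
  | .triangle, 1 => (a, a)
  | .rectangle, 0 => (1, a)
  | .rectangle, 1 => (a, 1)

/-- In both directions a reference element is a slab. -/
lemma exists_slab (κ : Shape) (l : Fin 2) : ∃ A B : ℝ → ℝ, Continuous A ∧ Continuous B ∧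
    IsSlab A B ∧ Convex ℝ (slab A B) ∧ volume (slab A B) ≠ 0 ∧ HasExtension (slab A B) ∧
    (l = 1 → element κ 1 1 = slab A B ∧ ∀ a, sliceLo κ l a = (a, A a) ∧ sliceHi κ l a = (a, B a)) ∧
    (l = 0 → Prod.swap ⁻¹' element κ 1 1 = slab A B ∧
      ∀ a, sliceLo κ l a = (A a, a) ∧ sliceHi κ l a = (B a, a)) := by
  have hsq : volume (slab 0 1) ≠ 0 := by rw [volume_slab_square]; simp
  cases κ
  · fin_cases l
    · exact ⟨id, 1, continuous_id, continuous_one, isSlab_triangle_swap, convex_slab_triangle_swap,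
        volume_slab_ne_zero continuous_id continuous_one ⟨(1 / 3, 2 / 3), by norm_num [slab]⟩,
        hasExtension_triangle_swap, by simp,
        fun _ => ⟨by rw [element_triangle, slab_id_one], fun a => ⟨rfl, rfl⟩⟩⟩
    · exact ⟨0, id, continuous_zero, continuous_id, isSlab_triangle, convex_slab_triangle,
        volume_slab_ne_zero continuous_zero continuous_id ⟨(2 / 3, 1 / 3), by norm_num [slab]⟩,
        hasExtension_triangle, fun _ => ⟨element_triangle, fun a => ⟨rfl, rfl⟩⟩, by simp⟩
  · fin_cases l
    · exact ⟨0, 1, continuous_zero, continuous_one, isSlab_square, convex_slab_square, hsq,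
        hasExtension_square, by simp,
        fun _ => ⟨by rw [element_rectangle, swap_slab_square], fun a => ⟨rfl, rfl⟩⟩⟩
    · exact ⟨0, 1, continuous_zero, continuous_one, isSlab_square, convex_slab_square, hsq,
        hasExtension_square, fun _ => ⟨element_rectangle, fun a => ⟨rfl, rfl⟩⟩, by simp⟩

/-- The pairing of `H^{1/2}` with derivatives of smooth functions, bounded in `H^s`, `s > 1/2`. -/
theorem pairing_le (κ : Shape) (l : Fin 2) {s : ℝ} (hs : 1 / 2 < s) :
    ∃ C : ℝ≥0, ∀ w ψ : ℝ × ℝ → ℝ, Measurable w → ContDiff ℝ ∞ ψ →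
      hsNormSq (1 / 2) (element κ 1 1) w ≠ ⊤ → hsSemiSq s (element κ 1 1) ψ ≠ ⊤ →
      ‖∫ x in element κ 1 1, w x * partialD l ψ x‖ₑ ^ 2 ≤
        C * (hsNormSq (1 / 2) (element κ 1 1) w * hsSemiSq s (element κ 1 1) ψ) := by
  obtain ⟨A, B, hA, hB, h, hconv, hpos, hext, h1, h0⟩ := exists_slab κ l
  obtain ⟨C, hC⟩ := pairing_slab h hconv hpos hext hs
  refine ⟨C, fun w ψ hw hψ hwf hψf => ?_⟩
  fin_cases l
  · have hK := (h0 rfl).1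
    have := hC (fun x => w x.swap) (fun x => ψ x.swap) (hw.comp measurable_swap) (contDiff_swap hψ)
    rw [← hK, hsNormSq_swap, hsSemiSq_swap] at this
    simp_rw [partialD_swap hψ] at this
    rw [setIntegral_swap _ fun x => w x * partialD 0 ψ x] at this
    exact this hwf hψf
  · have hK := (h1 rfl).1
    rw [hK] at hwf hψf ⊢
    exact hC w ψ hw hψ hwf hψf

theorem pairing_le_of_ends (κ : Shape) (l : Fin 2) {s : ℝ} (hs : 1 / 2 < s) :
    ∃ C : ℝ≥0, ∀ w ψ : ℝ × ℝ → ℝ, Measurable w → ContDiff ℝ ∞ ψ →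
      l2sq (element κ 1 1) w ≠ ⊤ → ahSemiSq (1 / 2) (element κ 1 1) l w ≠ ⊤ →
      hsSemiSq s (element κ 1 1) ψ ≠ ⊤ →
      (∀ a, 0 < a → a < 1 → ψ (sliceLo κ l a) = ψ (sliceHi κ l a)) →
      ‖∫ x in element κ 1 1, w x * partialD l ψ x‖ₑ ^ 2 ≤
        C * (ahSemiSq (1 / 2) (element κ 1 1) l w * hsSemiSq s (element κ 1 1) ψ) := by
  obtain ⟨A, B, hA, hB, h, hconv, hpos, hext, h1, h0⟩ := exists_slab κ l
  obtain ⟨C, hC⟩ := pairing_slab_of_eq h hconv hpos hs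
  refine ⟨C, fun w ψ hw hψ hw2 hwf hψf hends => ?_⟩
  fin_cases l
  · have hK := (h0 rfl).1
    have := hC (fun x => w x.swap) (fun x => ψ x.swap) (hw.comp measurable_swap) (contDiff_swap hψ)
    rw [← hK, l2sq_swap, hsSemiSq_swap, ahSemiSq_swap] at this
    simp_rw [partialD_swap hψ] at this
    rw [setIntegral_swap _ fun x => w x * partialD 0 ψ x] at this
    refine this hw2 hwf hψf fun a ha ha1 => ?_
    have := hends a ha ha1
    rwa [((h0 rfl).2 a).1, ((h0 rfl).2 a).2] at this
  · have hK := (h1 rfl).1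
    rw [hK] at hw2 hwf hψf ⊢
    refine hC w ψ hw hψ hw2 hwf hψf fun a ha ha1 => ?_
    have := hends a ha ha1
    rwa [((h1 rfl).2 a).1, ((h1 rfl).2 a).2] at this

/-- Integration of a partial derivative over a reference element. -/
theorem integral_partialD (κ : Shape) (l : Fin 2) {ψ : ℝ × ℝ → ℝ} (hψ : ContDiff ℝ ∞ ψ) :
    ∫ x in element κ 1 1, partialD l ψ x =
      ∫ a in (0 : ℝ)..1, (ψ (sliceHi κ l a) - ψ (sliceLo κ l a)) := by
  obtain ⟨A, B, hA, hB, h, -, -, -, h1, h0⟩ := exists_slab κ l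
  have key : ∀ ψ : ℝ × ℝ → ℝ, ContDiff ℝ ∞ ψ → ∫ x in slab A B, partialD 1 ψ x =
      ∫ a in (0 : ℝ)..1, (ψ (a, B a) - ψ (a, A a)) := by
    intro ψ hψ
    have hfin : IsFiniteMeasure (volume.restrict (slab A B)) :=
      ⟨by
        rw [Measure.restrict_apply_univ]
        refine (measure_mono (slab_subset h)).trans_lt ?_
        rw [volume_eq_prod', Measure.prod_prod]; simp⟩
    have hint : IntegrableOn (partialD 1 ψ) (slab A B) :=
      (memLp_two_of_continuous (slab_subset h) (continuous_partialD hψ 1)).integrable (by norm_num)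
    rw [setIntegral_slab h hint, intervalIntegral.integral_of_le zero_le_one,
      integral_Ioc_eq_integral_Ioo]
    refine setIntegral_congr_fun measurableSet_Ioo fun a ha => ?_
    have hs := contDiff_slice hψ a
    simp_rw [← deriv_slice hψ]
    rw [← integral_Ioc_eq_integral_Ioo, ← intervalIntegral.integral_of_le (h.lt a ha.1 ha.2).le,
      intervalIntegral.integral_deriv_eq_sub (fun x _ => hs.differentiable one_ne_zero x)
        ((hs.continuous_deriv le_rfl).intervalIntegrable _ _)]
  fin_cases l
  · have := key _ (contDiff_swap hψ)
    rw [← (h0 rfl).1] at this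
    simp_rw [partialD_swap hψ] at this
    rw [setIntegral_swap _ fun x => partialD 0 ψ x] at this
    refine this.trans ?_
    congr 1; ext a
    rw [((h0 rfl).2 a).1, ((h0 rfl).2 a).2]; rfl
  · have := key _ hψ
    rw [← (h1 rfl).1] at this
    refine this.trans ?_
    congr 1; ext a
    rw [((h1 rfl).2 a).1, ((h1 rfl).2 a).2]

/-! ### Functions with trace one on an edge and zero on the others -/

/-- Regularization of a function of the angle at a corner: zero on the leg `Y = 0`, one on `X = 0`. -/
noncomputable def corner (δ X Y : ℝ) : ℝ := Y ^ 2 / (X ^ 2 + Y ^ 2 + δ ^ 2)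

lemma corner_nonneg (δ X Y : ℝ) : 0 ≤ corner δ X Y := by unfold corner; positivity

lemma corner_le_one (δ X Y : ℝ) : corner δ X Y ≤ 1 := by
  unfold corner
  exact div_le_one_of_le₀ (by nlinarith [sq_nonneg X, sq_nonneg δ]) (by positivity)

lemma abs_corner_sub_le_one (δ X Y X' Y' : ℝ) : |corner δ X Y - corner δ X' Y'| ≤ 1 := by
  rw [abs_le]
  constructor <;>
    linarith [corner_nonneg δ X Y, corner_le_one δ X Y, corner_nonneg δ X' Y', corner_le_one δ X' Y']

/-- The gradient of `corner` is of order one over the distance `R = |X| + |Y|` to the vertex,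
uniformly in `δ`. If the displacement `d` exceeds `R`, the bound follows from values in `[0, 1]`.
Otherwise the quotients are compared after multiplication by `D ≥ R² / 2`, and `6 d R` against `R² /
2` gives the constant `12`. -/
lemma abs_corner_sub_le (δ X Y X' Y' : ℝ) :
    |corner δ X' Y' - corner δ X Y| * (|X| + |Y|) ≤ 12 * (|X' - X| + |Y' - Y|) := by
  set R := |X| + |Y| with hR
  set d := |X' - X| + |Y' - Y| with hd
  have hR0 : 0 ≤ R := by positivity
  have hd0 : 0 ≤ d := by positivity
  rcases le_total R d with h | h
  · have := abs_corner_sub_le_one δ X' Y' X Y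
    nlinarith
  rcases eq_or_lt_of_le hR0 with h0 | h0
  · rw [← h0]; simp; positivity
  have hD : R ^ 2 / 2 ≤ X ^ 2 + Y ^ 2 + δ ^ 2 := by
    have := sq_abs X
    have := sq_abs Y
    nlinarith [sq_nonneg (|X| - |Y|), sq_nonneg δ]
  set D := X ^ 2 + Y ^ 2 + δ ^ 2 with hDd
  set D' := X' ^ 2 + Y' ^ 2 + δ ^ 2 with hDd'
  have hD0 : 0 < D := by have : 0 < R ^ 2 / 2 := by positivity
                         linarith
  have hYR : |Y| ≤ R := by simp [hR]
  have hXR : |X| ≤ R := by simp [hR]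
  have hdX : |X' - X| ≤ d := by simp [hd]
  have hdY : |Y' - Y| ≤ d := by simp [hd]
  have hX' : |X'| ≤ R + d := by
    have := abs_add_le X (X' - X); rw [add_sub_cancel] at this; linarith
  have hY' : |Y'| ≤ R + d := by
    have := abs_add_le Y (Y' - Y); rw [add_sub_cancel] at this; linarith
  have hsqX : |X' ^ 2 - X ^ 2| ≤ |X' - X| * (3 * R) := by
    rw [show X' ^ 2 - X ^ 2 = (X' - X) * (X' + X) by ring, abs_mul]
    gcongr
    have := abs_add_le X' X; linarith
  have hsqY : |Y' ^ 2 - Y ^ 2| ≤ |Y' - Y| * (3 * R) := by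
    rw [show Y' ^ 2 - Y ^ 2 = (Y' - Y) * (Y' + Y) by ring, abs_mul]
    gcongr
    have := abs_add_le Y' Y; linarith
  have hDD : |D - D'| ≤ d * (3 * R) := by
    rw [show D - D' = -((X' ^ 2 - X ^ 2) + (Y' ^ 2 - Y ^ 2)) by rw [hDd, hDd']; ring, abs_neg]
    refine (abs_add_le _ _).trans ?_
    rw [hd]; linarith
  have hc0 := corner_nonneg δ X' Y'
  have hc1 := corner_le_one δ X' Y'
  have e : (corner δ X' Y' - corner δ X Y) * D = corner δ X' Y' * (D - D') + (Y' ^ 2 - Y ^ 2) := by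
    have h1 : corner δ X Y * D = Y ^ 2 := div_mul_cancel₀ _ hD0.ne'
    have h2 : corner δ X' Y' * D' = Y' ^ 2 := by
      -- For `δ = 0` the denominator vanishes at the vertex. The identity survives because the
      -- numerator vanishes there too.
      by_cases hz : D' = 0
      · have : Y' = 0 := by
          have : Y' ^ 2 ≤ 0 := by rw [hDd'] at hz; nlinarith [sq_nonneg X', sq_nonneg δ]
          exact pow_eq_zero_iff two_ne_zero |>.1 (le_antisymm this (sq_nonneg _))
        rw [hz, this]; ring
      · exact div_mul_cancel₀ _ hz
    linear_combination h2 - h1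
  have h3 : |corner δ X' Y' - corner δ X Y| * D ≤ 6 * d * R := by
    rw [← abs_of_pos hD0, ← abs_mul, e]
    refine (abs_add_le _ _).trans ?_
    rw [abs_mul, abs_of_nonneg hc0]
    have : |Y' - Y| * (3 * R) ≤ d * (3 * R) := by gcongr
    nlinarith [abs_nonneg (D - D')]
  have h4 : |corner δ X' Y' - corner δ X Y| * (R ^ 2 / 2) ≤ 6 * d * R :=
    (mul_le_mul_of_nonneg_left hD (abs_nonneg _)).trans h3
  nlinarith

lemma contDiff_corner {δ : ℝ} (hδ : δ ≠ 0) {X Y : ℝ × ℝ → ℝ} (hX : ContDiff ℝ ∞ X)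
    (hY : ContDiff ℝ ∞ Y) : ContDiff ℝ ∞ fun x => corner δ (X x) (Y x) := by
  unfold corner
  refine ContDiff.div (hY.pow 2) (((hX.pow 2).add (hY.pow 2)).add contDiff_const) fun x => ?_
  positivity

lemma measurable_corner {δ : ℝ} {X Y : ℝ × ℝ → ℝ} (hX : Measurable X) (hY : Measurable Y) :
    Measurable fun x => corner δ (X x) (Y x) :=
  (hY.pow_const 2).div (((hX.pow_const 2).add (hY.pow_const 2)).add_const _)

lemma tendsto_corner {X Y : ℝ} (h : X ≠ 0 ∨ Y ≠ 0) {δ : ℕ → ℝ} (hδ : Tendsto δ atTop (𝓝 0)) :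
    Tendsto (fun n => corner (δ n) X Y) atTop (𝓝 (corner 0 X Y)) := by
  unfold corner
  refine Tendsto.div tendsto_const_nhds (tendsto_const_nhds.add (hδ.pow 2)) ?_
  rcases h with h | h <;> positivity

/-- `X` vanishes on the edge, `Y` and `V` on its neighbours, `O` on the opposite edge, if any. -/
noncomputable def edgeFn (X Y V O : ℝ × ℝ → ℝ) (δ : ℝ) (x : ℝ × ℝ) : ℝ :=
  O x * (corner δ (X x) (Y x) * corner δ (X x) (V x))

/-- What the linear functions that define an edge function on `K` have to satisfy; `p` and `q` are the
end points of the edge. -/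
structure EdgeData (K : Set (ℝ × ℝ)) (X Y V O : ℝ × ℝ → ℝ) (p q : ℝ × ℝ) : Prop where
  smoothX : ContDiff ℝ ∞ X
  smoothY : ContDiff ℝ ∞ Y
  smoothV : ContDiff ℝ ∞ V
  smoothO : ContDiff ℝ ∞ O
  lipX : ∀ x y, |X x - X y| ≤ 2 * dist x y
  lipY : ∀ x y, |Y x - Y y| ≤ 2 * dist x y
  lipV : ∀ x y, |V x - V y| ≤ 2 * dist x y
  lipO : ∀ x y, |O x - O y| ≤ 2 * dist x y
  cornerY : ∀ x, dist x p ≤ |X x| + |Y x|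
  cornerV : ∀ x, dist x q ≤ |X x| + |V x|
  O_le : ∀ x ∈ K, |O x| ≤ 1
  X_ne : ∀ x ∈ K, X x ≠ 0
  subset : K ⊆ Set.Icc 0 1 ×ˢ Set.Icc 0 1
  meas : MeasurableSet K
  p_mem : p ∈ Set.Icc (0 : ℝ) 1 ×ˢ Set.Icc (0 : ℝ) 1
  q_mem : q ∈ Set.Icc (0 : ℝ) 1 ×ˢ Set.Icc (0 : ℝ) 1
  p_notMem : p ∉ K
  q_notMem : q ∉ K

lemma dist_le_one {x y : ℝ × ℝ} (hx : x ∈ Set.Icc (0 : ℝ) 1 ×ˢ Set.Icc (0 : ℝ) 1)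
    (hy : y ∈ Set.Icc (0 : ℝ) 1 ×ˢ Set.Icc (0 : ℝ) 1) : dist x y ≤ 1 := by
  simp only [Set.mem_prod, Set.mem_Icc] at hx hy
  rw [Prod.dist_eq, Real.dist_eq, Real.dist_eq]
  refine max_le (abs_le.2 ?_) (abs_le.2 ?_) <;> constructor <;> linarith

/-- For a quantity bounded both by `1` and by `z`, the exponent `2` may be traded for any smaller
one. This weakens the singularity at a corner to an integrable power. -/
lemma sq_le_rpow_of_le {a z r : ℝ} (ha : 0 ≤ a) (ha1 : a ≤ 1) (haz : a ≤ z) (hr : r ≤ 2) (hr0 : 0 ≤ r) :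
    a ^ 2 ≤ z ^ r := by
  rcases eq_or_lt_of_le ha with rfl | ha'
  · have : 0 ≤ z ^ r := Real.rpow_nonneg haz _
    simpa using this
  calc a ^ 2 = a ^ (2 : ℝ) := by norm_cast
    _ ≤ a ^ r := Real.rpow_le_rpow_of_exponent_ge ha' ha1 hr
    _ ≤ z ^ r := Real.rpow_le_rpow ha haz hr0

section
variable {K : Set (ℝ × ℝ)} {X Y V O : ℝ × ℝ → ℝ} {p q : ℝ × ℝ}

lemma abs_edgeFn_le_one (h : EdgeData K X Y V O p q) (δ : ℝ) {x : ℝ × ℝ} (hx : x ∈ K) :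
    |edgeFn X Y V O δ x| ≤ 1 := by
  rw [edgeFn, abs_mul, abs_mul, abs_of_nonneg (corner_nonneg _ _ _), abs_of_nonneg (corner_nonneg _ _ _)]
  have h1 := corner_le_one δ (X x) (Y x)
  have h2 := corner_le_one δ (X x) (V x)
  have h3 := corner_nonneg δ (X x) (V x)
  exact mul_le_one₀ (h.O_le x hx) (mul_nonneg (corner_nonneg _ _ _) h3) (mul_le_one₀ h1 h3 h2)

/-- The exponent `r = 7/4` is chosen between `3/2` and `2`: against the kernel of order `-7/2` of
the `H^{3/4}` seminorm, both `|x - y|^(r - 7/2)` and `|x - p|^(-r)` have to be integrable in the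
plane. The constant is `48²`, where `48 = 12 * (2 + 2)` contains the two Lipschitz constants. -/
lemma sq_corner_sub_le {X Y : ℝ × ℝ → ℝ} {p : ℝ × ℝ} (hX : ∀ x y, |X x - X y| ≤ 2 * dist x y)
    (hY : ∀ x y, |Y x - Y y| ≤ 2 * dist x y) (hp : ∀ x, dist x p ≤ |X x| + |Y x|) (δ : ℝ)
    {x y : ℝ × ℝ} (hxp : x ≠ p) :
    (corner δ (X y) (Y y) - corner δ (X x) (Y x)) ^ 2 ≤
      2304 * (dist x y ^ (7 / 4 : ℝ) / dist x p ^ (7 / 4 : ℝ)) := by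
  have hP : 0 < dist x p := dist_pos.2 hxp
  have h1 := abs_corner_sub_le δ (X x) (Y x) (X y) (Y y)
  have h2 : |corner δ (X y) (Y y) - corner δ (X x) (Y x)| ≤ 48 * dist x y / dist x p := by
    rw [le_div_iff₀ hP]
    have h3 := hX y x
    have h4 := hY y x
    rw [dist_comm y x] at h3 h4
    have h5 := mul_le_mul_of_nonneg_left (hp x) (abs_nonneg (corner δ (X y) (Y y) - corner δ (X x) (Y x)))
    linarith
  have h3 := sq_le_rpow_of_le (abs_nonneg _) (abs_corner_sub_le_one δ (X y) (Y y) (X x) (Y x)) h2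
    (by norm_num : (7 / 4 : ℝ) ≤ 2) (by norm_num)
  rw [sq_abs] at h3
  refine h3.trans ?_
  rw [Real.div_rpow (by positivity) hP.le, Real.mul_rpow (by norm_num) dist_nonneg, mul_div_assoc]
  gcongr
  calc (48 : ℝ) ^ (7 / 4 : ℝ) ≤ 48 ^ (2 : ℝ) :=
        Real.rpow_le_rpow_of_exponent_le (by norm_num) (by norm_num)
    _ = 2304 := by norm_num

/-- The difference of the triple product is telescoped into three terms, in each of which all but
one factor are bounded by one. The square of the sum of three terms costs `3`, and `6924 = 3 * (2304
+ 4)`. -/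
lemma sq_edgeFn_sub_le (h : EdgeData K X Y V O p q) (δ : ℝ) {x y : ℝ × ℝ} (hx : x ∈ K) (hy : y ∈ K) :
    (edgeFn X Y V O δ y - edgeFn X Y V O δ x) ^ 2 ≤
      6924 * (dist x y ^ (7 / 4 : ℝ) *
        ((dist x p ^ (7 / 4 : ℝ))⁻¹ + (dist x q ^ (7 / 4 : ℝ))⁻¹)) := by
  have hxp : x ≠ p := fun e => h.p_notMem (e ▸ hx)
  have hxq : x ≠ q := fun e => h.q_notMem (e ▸ hx)
  have hY := sq_corner_sub_le h.lipX h.lipY h.cornerY δ (y := y) hxp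
  have hV := sq_corner_sub_le h.lipX h.lipV h.cornerV δ (y := y) hxq
  have hP : 0 < dist x p := dist_pos.2 hxp
  have hP1 : dist x p ≤ 1 := dist_le_one (h.subset hx) h.p_mem
  have hd1 : dist x y ≤ 1 := dist_le_one (h.subset hx) (h.subset hy)
  have hO : (O y - O x) ^ 2 ≤ 4 * (dist x y ^ (7 / 4 : ℝ) * (dist x p ^ (7 / 4 : ℝ))⁻¹) := by
    have h1 := h.lipO y x
    rw [dist_comm] at h1
    have h2 := sq_le_rpow_of_le dist_nonneg hd1 le_rfl (by norm_num : (7 / 4 : ℝ) ≤ 2) (by norm_num)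
    have h3 : (O y - O x) ^ 2 ≤ (2 * dist x y) ^ 2 := by
      rw [← sq_abs]; gcongr
    have h4 : 1 ≤ (dist x p ^ (7 / 4 : ℝ))⁻¹ :=
      (one_le_inv₀ (by positivity)).2 (Real.rpow_le_one hP.le hP1 (by norm_num))
    have h5 : 0 ≤ dist x y ^ (7 / 4 : ℝ) := by positivity
    nlinarith [mul_le_mul_of_nonneg_left h4 h5]
  set a := corner δ (X y) (Y y) with ha
  set b := corner δ (X y) (V y) with hb
  set a' := corner δ (X x) (Y x) with ha'
  set b' := corner δ (X x) (V x) with hb'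
  have ha0 : 0 ≤ a := corner_nonneg _ _ _
  have hb0 : 0 ≤ b := corner_nonneg _ _ _
  have ha1 : a ≤ 1 := corner_le_one _ _ _
  have hb1 : b ≤ 1 := corner_le_one _ _ _
  have ha0' : 0 ≤ a' := corner_nonneg _ _ _
  have ha1' : a' ≤ 1 := corner_le_one _ _ _
  have hOx := h.O_le x hx
  have e : edgeFn X Y V O δ y - edgeFn X Y V O δ x =
      (O y - O x) * (a * b) + (O x * b) * (a - a') + (O x * a') * (b - b') := by
    simp only [edgeFn]; ring
  have hab : (a * b) ^ 2 ≤ 1 := by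
    have : a * b ≤ 1 := mul_le_one₀ ha1 hb0 hb1
    exact pow_le_one₀ (mul_nonneg ha0 hb0) this
  have hO2 : O x ^ 2 ≤ 1 := by rw [← sq_abs]; exact pow_le_one₀ (abs_nonneg _) hOx
  have hOb : (O x * b) ^ 2 ≤ 1 := by
    rw [mul_pow]; exact mul_le_one₀ hO2 (sq_nonneg _) (pow_le_one₀ hb0 hb1)
  have hOa : (O x * a') ^ 2 ≤ 1 := by
    rw [mul_pow]; exact mul_le_one₀ hO2 (sq_nonneg _) (pow_le_one₀ ha0' ha1')
  have three : ∀ r s t : ℝ, (r + s + t) ^ 2 ≤ 3 * (r ^ 2 + s ^ 2 + t ^ 2) := fun r s t => by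
    nlinarith [sq_nonneg (r - s), sq_nonneg (s - t), sq_nonneg (r - t)]
  rw [e]
  refine (three _ _ _).trans ?_
  have i1 : ((O y - O x) * (a * b)) ^ 2 ≤ (O y - O x) ^ 2 := by
    rw [mul_pow]; exact mul_le_of_le_one_right (sq_nonneg _) hab
  have i2 : ((O x * b) * (a - a')) ^ 2 ≤ (a - a') ^ 2 := by
    rw [mul_pow]; exact mul_le_of_le_one_left (sq_nonneg _) hOb
  have i3 : ((O x * a') * (b - b')) ^ 2 ≤ (b - b') ^ 2 := by
    rw [mul_pow]; exact mul_le_of_le_one_left (sq_nonneg _) hOa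
  rw [div_eq_mul_inv] at hY hV
  have n1 : 0 ≤ dist x y ^ (7 / 4 : ℝ) * (dist x q ^ (7 / 4 : ℝ))⁻¹ := by positivity
  linarith

/-- Singular kernel that dominates the difference quotients of edge functions. -/
noncomputable def cornerKernel (p : ℝ × ℝ) (z : (ℝ × ℝ) × (ℝ × ℝ)) : ℝ≥0∞ :=
  (ENNReal.ofReal (dist z.1 z.2 ^ (7 / 4 : ℝ)))⁻¹ * (ENNReal.ofReal (dist z.1 p ^ (7 / 4 : ℝ)))⁻¹

lemma edgeFn_kernel_le (h : EdgeData K X Y V O p q) (δ : ℝ) {x y : ℝ × ℝ} (hx : x ∈ K) (hy : y ∈ K) :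
    ‖edgeFn X Y V O δ x - edgeFn X Y V O δ y‖ₑ ^ 2 / ENNReal.ofReal (eucl x y ^ (2 + 2 * (3 / 4) : ℝ)) ≤
      6924 * (cornerKernel p (x, y) + cornerKernel q (x, y)) := by
  by_cases hxy : x = y
  · simp [hxy]
  have hxp : x ≠ p := fun e => h.p_notMem (e ▸ hx)
  have hxq : x ≠ q := fun e => h.q_notMem (e ▸ hx)
  have hd : 0 < dist x y := dist_pos.2 hxy
  have hP : 0 < dist x p := dist_pos.2 hxp
  have hQ : 0 < dist x q := dist_pos.2 hxq
  have he : 0 < eucl x y := eucl_pos hxy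
  have h1 := sq_edgeFn_sub_le h δ hx hy
  rw [← neg_sub, neg_sq] at h1
  have e1 : cornerKernel p (x, y) + cornerKernel q (x, y) =
      ENNReal.ofReal ((dist x y ^ (7 / 4 : ℝ))⁻¹ *
        ((dist x p ^ (7 / 4 : ℝ))⁻¹ + (dist x q ^ (7 / 4 : ℝ))⁻¹)) := by
    simp only [cornerKernel]
    rw [← mul_add, ← ENNReal.ofReal_inv_of_pos (by positivity), ← ENNReal.ofReal_inv_of_pos (by positivity),
      ← ENNReal.ofReal_inv_of_pos (by positivity), ← ENNReal.ofReal_add (by positivity) (by positivity),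
      ← ENNReal.ofReal_mul (by positivity)]
  rw [e1, enorm_sq_eq_ofReal, ← ENNReal.ofReal_div_of_pos (by positivity),
    show (6924 : ℝ≥0∞) = ENNReal.ofReal 6924 by simp, ← ENNReal.ofReal_mul (by norm_num)]
  refine ENNReal.ofReal_le_ofReal ?_
  rw [div_le_iff₀ (by positivity)]
  refine h1.trans ?_
  rw [mul_assoc]
  refine mul_le_mul_of_nonneg_left ?_ (by norm_num)
  -- The kernel exponent `2 + 2 * (3/4) = 7/2` is exactly twice `7/4`, so what is left of it is
  -- again the power `-7/4` of the distance.
  have h3 : dist x y ^ (7 / 4 : ℝ) ≤ (dist x y ^ (7 / 4 : ℝ))⁻¹ * eucl x y ^ (2 + 2 * (3 / 4) : ℝ) := by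
    rw [inv_mul_eq_div, le_div_iff₀ (by positivity), ← Real.rpow_add hd]
    norm_num
    exact Real.rpow_le_rpow dist_nonneg (dist_le_eucl x y) (by norm_num)
  calc _ ≤ ((dist x y ^ (7 / 4 : ℝ))⁻¹ * eucl x y ^ (2 + 2 * (3 / 4) : ℝ)) *
        ((dist x p ^ (7 / 4 : ℝ))⁻¹ + (dist x q ^ (7 / 4 : ℝ))⁻¹) := by gcongr
    _ = _ := by ring

end

/-! ### Integrability of the corner kernel -/

lemma lintegral_abs_sub_rpow_le {c : ℝ} (hc : c ∈ Set.Icc (0 : ℝ) 1) :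
    ∫⁻ t in Set.Icc (0 : ℝ) 1, (ENNReal.ofReal (|t - c| ^ (7 / 8 : ℝ)))⁻¹ ≤ 16 := by
  set g : ℝ → ℝ≥0∞ := fun τ => (ENNReal.ofReal (|τ| ^ (7 / 8 : ℝ)))⁻¹ with hg
  have h1 : ∫⁻ t in Set.Icc (0 : ℝ) 1, g (t - c) ≤ ∫⁻ τ in Set.Icc (-1 : ℝ) 1, g τ := by
    rw [← lintegral_indicator measurableSet_Icc, ← lintegral_indicator measurableSet_Icc,
      ← lintegral_sub_right_eq_self (fun τ => (Set.Icc (-1 : ℝ) 1).indicator g τ) c]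
    refine lintegral_mono fun t => ?_
    by_cases ht : t ∈ Set.Icc (0 : ℝ) 1
    · rw [Set.indicator_of_mem ht, Set.indicator_of_mem]
      exact ⟨by linarith [ht.1, hc.2], by linarith [ht.2, hc.1]⟩
    · rw [Set.indicator_of_notMem ht]; exact zero_le
  have h2 : ∫⁻ τ in Set.Ioc (0 : ℝ) 1, g τ = 8 := by
    have h3 : ∫ τ in (0 : ℝ)..1, τ ^ (-(7 / 8) : ℝ) = 8 := by
      rw [integral_rpow (Or.inl (by norm_num))]; norm_num
    have h4 : IntervalIntegrable (fun τ : ℝ => τ ^ (-(7 / 8) : ℝ)) volume 0 1 :=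
      intervalIntegral.intervalIntegrable_rpow' (by norm_num)
    rw [intervalIntegral.integral_of_le zero_le_one] at h3
    rw [intervalIntegrable_iff_integrableOn_Ioc_of_le zero_le_one] at h4
    have h5 := ofReal_integral_eq_lintegral_ofReal h4
      ((ae_restrict_iff' measurableSet_Ioc).2 (Eventually.of_forall fun t ht =>
        Real.rpow_nonneg ht.1.le _))
    rw [h3] at h5
    rw [show (8 : ℝ≥0∞) = ENNReal.ofReal 8 by simp, h5]
    refine setLIntegral_congr_fun measurableSet_Ioc fun t ht => ?_
    have ht0 : 0 < t := ht.1
    simp only [hg]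
    rw [abs_of_pos ht0, ← ENNReal.ofReal_inv_of_pos (by positivity), Real.rpow_neg ht0.le]
  have h3 : ∫⁻ τ in Set.Ico (-1 : ℝ) 0, g τ = 8 := by
    rw [← h2, ← lintegral_indicator measurableSet_Ico, ← lintegral_indicator measurableSet_Ioc,
      ← lintegral_neg_eq_self]
    refine lintegral_congr fun τ => ?_
    by_cases hτ : τ ∈ Set.Ioc (0 : ℝ) 1
    · rw [Set.indicator_of_mem hτ, Set.indicator_of_mem]
      · simp [hg]
      · exact ⟨by linarith [hτ.2], by linarith [hτ.1]⟩
    · rw [Set.indicator_of_notMem hτ, Set.indicator_of_notMem]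
      rintro ⟨h1, h2⟩
      exact hτ ⟨by linarith, by linarith⟩
  have hset : Set.Icc (-1 : ℝ) 1 ⊆ (Set.Ico (-1 : ℝ) 0 ∪ Set.Ioc 0 1) ∪ {0} := by
    intro t ht
    rcases lt_trichotomy t 0 with h | h | h
    · exact Or.inl (Or.inl ⟨ht.1, h⟩)
    · exact Or.inr h
    · exact Or.inl (Or.inr ⟨h, ht.2⟩)
  refine h1.trans ((lintegral_mono_set hset).trans ((lintegral_union_le _ _ _).trans ?_))
  rw [setLIntegral_measure_zero {0} g (by simp), add_zero]
  refine (lintegral_union_le _ _ _).trans ?_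
  rw [h2, h3]; norm_num

/-- The maximum distance dominates both coordinate differences, so half of the exponent can be given
to each. The planar integral then factors into two convergent integrals on the line. -/
lemma inv_dist_rpow_le (x y : ℝ × ℝ) : (ENNReal.ofReal (dist x y ^ (7 / 4 : ℝ)))⁻¹ ≤
    (ENNReal.ofReal (|x.1 - y.1| ^ (7 / 8 : ℝ)))⁻¹ * (ENNReal.ofReal (|x.2 - y.2| ^ (7 / 8 : ℝ)))⁻¹ := by
  rw [← ENNReal.mul_inv (Or.inr ENNReal.ofReal_ne_top) (Or.inl ENNReal.ofReal_ne_top),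
    ← ENNReal.ofReal_mul (by positivity)]
  refine ENNReal.inv_le_inv.2 (ENNReal.ofReal_le_ofReal ?_)
  have h1 : |x.1 - y.1| ≤ dist x y := by rw [Prod.dist_eq, ← Real.dist_eq]; exact le_max_left _ _
  have h2 : |x.2 - y.2| ≤ dist x y := by rw [Prod.dist_eq, ← Real.dist_eq]; exact le_max_right _ _
  calc _ ≤ dist x y ^ (7 / 8 : ℝ) * dist x y ^ (7 / 8 : ℝ) := by gcongr
    _ = _ := by rw [← Real.mul_rpow dist_nonneg dist_nonneg, ← sq, ← Real.rpow_natCast,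
                  ← Real.rpow_mul dist_nonneg]; norm_num

lemma lintegral_inv_dist_le {c : ℝ × ℝ} (hc : c ∈ Set.Icc (0 : ℝ) 1 ×ˢ Set.Icc (0 : ℝ) 1) :
    ∫⁻ x in Set.Icc (0 : ℝ) 1 ×ˢ Set.Icc (0 : ℝ) 1, (ENNReal.ofReal (dist x c ^ (7 / 4 : ℝ)))⁻¹ ≤ 256 := by
  have hm : ∀ a : ℝ, Measurable fun t : ℝ => (ENNReal.ofReal (|t - a| ^ (7 / 8 : ℝ)))⁻¹ := fun a => by
    have : Measurable fun t : ℝ => |t - a| := by fun_prop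
    exact (this.pow_const _).ennreal_ofReal.inv
  refine (lintegral_mono fun x => inv_dist_rpow_le x c).trans ?_
  rw [volume_eq_prod', ← Measure.prod_restrict,
    lintegral_prod_mul (f := fun t => (ENNReal.ofReal (|t - c.1| ^ (7 / 8 : ℝ)))⁻¹)
      (g := fun t => (ENNReal.ofReal (|t - c.2| ^ (7 / 8 : ℝ)))⁻¹)
      (hm _).aemeasurable (hm _).aemeasurable]
  calc _ ≤ (16 : ℝ≥0∞) * 16 := by
        gcongr
        · exact lintegral_abs_sub_rpow_le hc.1
        · exact lintegral_abs_sub_rpow_le hc.2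
    _ = 256 := by norm_num

lemma measurable_cornerKernel (p : ℝ × ℝ) : Measurable (cornerKernel p) := by
  have h1 : Measurable fun z : (ℝ × ℝ) × (ℝ × ℝ) => dist z.1 z.2 := by fun_prop
  have h2 : Measurable fun z : (ℝ × ℝ) × (ℝ × ℝ) => dist z.1 p := by fun_prop
  exact (h1.pow_const _).ennreal_ofReal.inv.mul (h2.pow_const _).ennreal_ofReal.inv

lemma lintegral_cornerKernel_le {K : Set (ℝ × ℝ)} (hK : K ⊆ Set.Icc (0 : ℝ) 1 ×ˢ Set.Icc (0 : ℝ) 1)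
    {p : ℝ × ℝ} (hp : p ∈ Set.Icc (0 : ℝ) 1 ×ˢ Set.Icc (0 : ℝ) 1) :
    ∫⁻ z, cornerKernel p z ∂(volume.restrict K).prod (volume.restrict K) ≤ 65536 := by
  set Q := Set.Icc (0 : ℝ) 1 ×ˢ Set.Icc (0 : ℝ) 1 with hQ
  have hQm : MeasurableSet Q := measurableSet_Icc.prod measurableSet_Icc
  have hm1 : ∀ c, Measurable fun x : ℝ × ℝ => (ENNReal.ofReal (dist x c ^ (7 / 4 : ℝ)))⁻¹ := fun c => by
    have : Measurable fun x : ℝ × ℝ => dist x c := by fun_prop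
    exact (this.pow_const _).ennreal_ofReal.inv
  rw [lintegral_prod _ (measurable_cornerKernel p).aemeasurable]
  calc _ ≤ ∫⁻ x in Q, ∫⁻ y in Q, cornerKernel p (x, y) :=
        lintegral_mono' (Measure.restrict_mono hK le_rfl) fun x =>
          lintegral_mono' (Measure.restrict_mono hK le_rfl) le_rfl
    _ ≤ ∫⁻ x in Q, 256 * (ENNReal.ofReal (dist x p ^ (7 / 4 : ℝ)))⁻¹ := by
        refine setLIntegral_mono' hQm fun x hx => ?_
        simp only [cornerKernel]
        rw [lintegral_mul_const]
        · gcongr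
          simp_rw [dist_comm x]
          exact lintegral_inv_dist_le hx
        · simp_rw [dist_comm x]; exact hm1 x
    _ = 256 * ∫⁻ x in Q, (ENNReal.ofReal (dist x p ^ (7 / 4 : ℝ)))⁻¹ := lintegral_const_mul' _ _ (by simp)
    _ ≤ 256 * 256 := by gcongr; exact lintegral_inv_dist_le hp
    _ = _ := by norm_num

lemma hsSemiSq_eq_prod {K : Set (ℝ × ℝ)} {v : ℝ × ℝ → ℝ} (hv : Measurable v) (s : ℝ) :
    hsSemiSq s K v = ∫⁻ z, ‖v z.1 - v z.2‖ₑ ^ 2 / ENNReal.ofReal (eucl z.1 z.2 ^ (2 + 2 * s))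
      ∂(volume.restrict K).prod (volume.restrict K) := by
  rw [lintegral_prod _ (measurable_diff_kernel hv s).aemeasurable]; rfl

section
variable {K : Set (ℝ × ℝ)} {X Y V O : ℝ × ℝ → ℝ} {p q : ℝ × ℝ}

lemma measurable_edgeFn (h : EdgeData K X Y V O p q) (δ : ℝ) : Measurable (edgeFn X Y V O δ) :=
  h.smoothO.continuous.measurable.mul
    ((measurable_corner h.smoothX.continuous.measurable h.smoothY.continuous.measurable).mul
      (measurable_corner h.smoothX.continuous.measurable h.smoothV.continuous.measurable))

lemma contDiff_edgeFn (h : EdgeData K X Y V O p q) {δ : ℝ} (hδ : δ ≠ 0) :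
    ContDiff ℝ ∞ (edgeFn X Y V O δ) :=
  h.smoothO.mul ((contDiff_corner hδ h.smoothX h.smoothY).mul (contDiff_corner hδ h.smoothX h.smoothV))

lemma volume_unit_le {K : Set (ℝ × ℝ)} (hK : K ⊆ Set.Icc (0 : ℝ) 1 ×ˢ Set.Icc (0 : ℝ) 1) :
    volume K ≤ 1 := by
  refine (measure_mono hK).trans ?_
  rw [volume_eq_prod', Measure.prod_prod]; simp

lemma ae_prod_mem {K : Set (ℝ × ℝ)} (hK : MeasurableSet K) :
    ∀ᵐ z ∂(volume.restrict K).prod (volume.restrict K), z.1 ∈ K ∧ z.2 ∈ K := by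
  rw [Measure.prod_restrict]
  exact (ae_restrict_iff' (hK.prod hK)).2 (Eventually.of_forall fun z hz => hz)

lemma memHs_edgeFn (h : EdgeData K X Y V O p q) (δ : ℝ) : MemHs (3 / 4) K (edgeFn X Y V O δ) := by
  refine ⟨(measurable_edgeFn h δ).aestronglyMeasurable, ?_⟩
  rw [hsNormSq, ENNReal.add_lt_top]
  constructor
  · calc l2sq K (edgeFn X Y V O δ) ≤ ∫⁻ _ in K, 1 := by
          refine setLIntegral_mono' h.meas fun x hx => ?_
          rw [enorm_sq_eq_ofReal, ← ENNReal.ofReal_one]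
          refine ENNReal.ofReal_le_ofReal ?_
          rw [← sq_abs]; exact pow_le_one₀ (abs_nonneg _) (abs_edgeFn_le_one h δ hx)
      _ ≤ 1 := by rw [setLIntegral_one]; exact volume_unit_le h.subset
      _ < ⊤ := by simp
  · rw [hsSemiSq_eq_prod (measurable_edgeFn h δ)]
    calc _ ≤ ∫⁻ z, 6924 * (cornerKernel p z + cornerKernel q z)
          ∂(volume.restrict K).prod (volume.restrict K) := by
          refine lintegral_mono_ae ?_
          filter_upwards [ae_prod_mem h.meas] with z hz
          exact edgeFn_kernel_le h δ hz.1 hz.2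
      _ = 6924 * ((∫⁻ z, cornerKernel p z ∂(volume.restrict K).prod (volume.restrict K)) +
            ∫⁻ z, cornerKernel q z ∂(volume.restrict K).prod (volume.restrict K)) := by
          rw [lintegral_const_mul' _ _ (by simp), lintegral_add_left (measurable_cornerKernel p)]
      _ ≤ 6924 * (65536 + 65536) := by
          gcongr
          · exact lintegral_cornerKernel_le h.subset h.p_mem
          · exact lintegral_cornerKernel_le h.subset h.q_mem
      _ < ⊤ := by norm_num

lemma tendsto_edgeFn (h : EdgeData K X Y V O p q) {δ : ℕ → ℝ} (hδ : Tendsto δ atTop (𝓝 0))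
    {x : ℝ × ℝ} (hx : x ∈ K) :
    Tendsto (fun n => edgeFn X Y V O (δ n) x) atTop (𝓝 (edgeFn X Y V O 0 x)) :=
  ((tendsto_corner (Or.inl (h.X_ne x hx)) hδ).mul
    (tendsto_corner (Or.inl (h.X_ne x hx)) hδ)).const_mul _

/-- Dominated convergence: the corner estimates are uniform in `δ`, so one multiple of the corner
kernels majorizes all difference quotients, and the edge functions converge pointwise on `K`, where
`X` does not vanish. -/
lemma tendsto_hsNormSq_edgeFn (h : EdgeData K X Y V O p q) {δ : ℕ → ℝ}
    (hδ : Tendsto δ atTop (𝓝 0)) :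
    Tendsto (fun n => hsNormSq (3 / 4) K fun x => edgeFn X Y V O (δ n) x - edgeFn X Y V O 0 x)
      atTop (𝓝 0) := by
  have hm : ∀ n, Measurable fun x => edgeFn X Y V O (δ n) x - edgeFn X Y V O 0 x := fun n =>
    (measurable_edgeFn h _).sub (measurable_edgeFn h _)
  have hlim : ∀ x ∈ K, Tendsto (fun n => edgeFn X Y V O (δ n) x - edgeFn X Y V O 0 x) atTop (𝓝 0) :=
    fun x hx => by simpa using (tendsto_edgeFn h hδ hx).sub_const (edgeFn X Y V O 0 x)
  rw [show (0 : ℝ≥0∞) = 0 + 0 by simp]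
  refine Tendsto.add ?_ ?_
  · rw [show (0 : ℝ≥0∞) = ∫⁻ _ in K, 0 by simp]
    refine tendsto_lintegral_of_dominated_convergence (fun _ => 4)
      (fun n => (hm n).enorm.pow_const 2) ?_ ?_ ?_
    · intro n
      filter_upwards [ae_restrict_mem h.meas] with x hx
      rw [enorm_sq_eq_ofReal, show (4 : ℝ≥0∞) = ENNReal.ofReal 4 by simp]
      refine ENNReal.ofReal_le_ofReal ?_
      have h1 := abs_le.1 (abs_edgeFn_le_one h (δ n) hx)
      have h2 := abs_le.1 (abs_edgeFn_le_one h 0 hx)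
      nlinarith
    · rw [setLIntegral_const]
      exact ENNReal.mul_ne_top (by simp) (ne_top_of_le_ne_top (by simp) (volume_unit_le h.subset))
    · filter_upwards [ae_restrict_mem h.meas] with x hx
      have := (hlim x hx).enorm
      simpa [Function.comp_def] using ((ENNReal.continuous_pow 2).tendsto _).comp this
  · simp_rw [fun n => hsSemiSq_eq_prod (K := K) (hm n) (3 / 4)]
    rw [show (0 : ℝ≥0∞) = ∫⁻ _, 0 ∂(volume.restrict K).prod (volume.restrict K) by simp]
    refine tendsto_lintegral_of_dominated_convergence
      (fun z => 4 * (6924 * (cornerKernel p z + cornerKernel q z)))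
      (fun n => measurable_diff_kernel (hm n) _) ?_ ?_ ?_
    · intro n
      filter_upwards [ae_prod_mem h.meas] with z hz
      have h1 := edgeFn_kernel_le h (δ n) hz.1 hz.2
      have h2 := edgeFn_kernel_le h 0 hz.1 hz.2
      calc _ ≤ 2 * (‖edgeFn X Y V O (δ n) z.1 - edgeFn X Y V O (δ n) z.2‖ₑ ^ 2 +
              ‖edgeFn X Y V O 0 z.1 - edgeFn X Y V O 0 z.2‖ₑ ^ 2) /
              ENNReal.ofReal (eucl z.1 z.2 ^ (2 + 2 * (3 / 4) : ℝ)) := by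
            gcongr
            refine le_trans (le_of_eq ?_) (enorm_sub_sq_le _ _)
            congr 2; ring
        _ = 2 * (‖edgeFn X Y V O (δ n) z.1 - edgeFn X Y V O (δ n) z.2‖ₑ ^ 2 /
              ENNReal.ofReal (eucl z.1 z.2 ^ (2 + 2 * (3 / 4) : ℝ)) +
              ‖edgeFn X Y V O 0 z.1 - edgeFn X Y V O 0 z.2‖ₑ ^ 2 /
              ENNReal.ofReal (eucl z.1 z.2 ^ (2 + 2 * (3 / 4) : ℝ))) := by
            rw [mul_div_assoc, ENNReal.add_div]
        _ ≤ 2 * (6924 * (cornerKernel p z + cornerKernel q z) +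
              6924 * (cornerKernel p z + cornerKernel q z)) := by gcongr
        _ = _ := by ring
    · rw [lintegral_const_mul' _ _ (by simp), lintegral_const_mul' _ _ (by simp),
        lintegral_add_left (measurable_cornerKernel p)]
      refine ENNReal.mul_ne_top (by simp) (ENNReal.mul_ne_top (by simp) (ENNReal.add_ne_top.2 ⟨?_, ?_⟩))
      · exact ne_top_of_le_ne_top (by simp) (lintegral_cornerKernel_le h.subset h.p_mem)
      · exact ne_top_of_le_ne_top (by simp) (lintegral_cornerKernel_le h.subset h.q_mem)
    · filter_upwards [ae_prod_mem h.meas] with z hz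
      by_cases hzz : z.1 = z.2
      · simp [hzz]
      have he := eucl_pos hzz
      have h1 := ((hlim z.1 hz.1).sub (hlim z.2 hz.2)).enorm
      have h2 := ((ENNReal.continuous_pow 2).tendsto _).comp h1
      have h3 := ENNReal.Tendsto.div_const h2 (b := ENNReal.ofReal (eucl z.1 z.2 ^ (2 + 2 * (3 / 4) : ℝ)))
        (Or.inr (by simp only [ne_eq, ENNReal.ofReal_eq_zero, not_le]; positivity))
      simpa [Function.comp_def] using h3

end

/-- Affine functions in the plane. -/
def aff (α β γ : ℝ) (x : ℝ × ℝ) : ℝ := α * x.1 + β * x.2 + γ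

lemma contDiff_aff (α β γ : ℝ) : ContDiff ℝ ∞ (aff α β γ) := by
  unfold aff; fun_prop

lemma abs_aff_sub_le {α β : ℝ} (γ : ℝ) (hα : |α| ≤ 1) (hβ : |β| ≤ 1) (x y : ℝ × ℝ) :
    |aff α β γ x - aff α β γ y| ≤ 2 * dist x y := by
  have h1 : |x.1 - y.1| ≤ dist x y := by rw [Prod.dist_eq, ← Real.dist_eq]; exact le_max_left _ _
  have h2 : |x.2 - y.2| ≤ dist x y := by rw [Prod.dist_eq, ← Real.dist_eq]; exact le_max_right _ _
  have e : aff α β γ x - aff α β γ y = α * (x.1 - y.1) + β * (x.2 - y.2) := by unfold aff; ring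
  rw [e]
  refine (abs_add_le _ _).trans ?_
  rw [abs_mul, abs_mul]
  have i1 : |α| * |x.1 - y.1| ≤ 1 * dist x y := by gcongr
  have i2 : |β| * |x.2 - y.2| ≤ 1 * dist x y := by gcongr
  linarith

lemma EdgeData.of_aff {K : Set (ℝ × ℝ)} {a b c a' b' c' a'' b'' c'' f g k : ℝ} {p q : ℝ × ℝ}
    (ha : |a| ≤ 1) (hb : |b| ≤ 1) (ha' : |a'| ≤ 1) (hb' : |b'| ≤ 1) (ha'' : |a''| ≤ 1)
    (hb'' : |b''| ≤ 1) (hf : |f| ≤ 1) (hg : |g| ≤ 1)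
    (cornerY : ∀ x : ℝ × ℝ, |x.1 - p.1| ≤ |aff a b c x| + |aff a' b' c' x| ∧
      |x.2 - p.2| ≤ |aff a b c x| + |aff a' b' c' x|)
    (cornerV : ∀ x : ℝ × ℝ, |x.1 - q.1| ≤ |aff a b c x| + |aff a'' b'' c'' x| ∧
      |x.2 - q.2| ≤ |aff a b c x| + |aff a'' b'' c'' x|)
    (O_le : ∀ x ∈ K, |aff f g k x| ≤ 1) (X_ne : ∀ x ∈ K, aff a b c x ≠ 0)
    (subset : K ⊆ Set.Icc 0 1 ×ˢ Set.Icc 0 1) (meas : MeasurableSet K)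
    (p_mem : p ∈ Set.Icc (0 : ℝ) 1 ×ˢ Set.Icc (0 : ℝ) 1)
    (q_mem : q ∈ Set.Icc (0 : ℝ) 1 ×ˢ Set.Icc (0 : ℝ) 1) (hp : aff a b c p = 0)
    (hq : aff a b c q = 0) :
    EdgeData K (aff a b c) (aff a' b' c') (aff a'' b'' c'') (aff f g k) p q where
  smoothX := contDiff_aff _ _ _
  smoothY := contDiff_aff _ _ _
  smoothV := contDiff_aff _ _ _
  smoothO := contDiff_aff _ _ _
  lipX := abs_aff_sub_le _ ha hb
  lipY := abs_aff_sub_le _ ha' hb'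
  lipV := abs_aff_sub_le _ ha'' hb''
  lipO := abs_aff_sub_le _ hf hg
  cornerY x := by
    rw [Prod.dist_eq, Real.dist_eq, Real.dist_eq]; exact max_le (cornerY x).1 (cornerY x).2
  cornerV x := by
    rw [Prod.dist_eq, Real.dist_eq, Real.dist_eq]; exact max_le (cornerV x).1 (cornerV x).2
  O_le := O_le
  X_ne := X_ne
  subset := subset
  meas := meas
  p_mem := p_mem
  q_mem := q_mem
  p_notMem h := X_ne p h hp
  q_notMem h := X_ne q h hq

/-- On the edge `X = 0` and `O = 1`, so each corner factor is of the form `Y² / (Y² + δ²)`. It tends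
to `1` except at the end points, which are negligible, and boundedness gives convergence in `L²`. -/
lemma tendsto_l2sq_edgeFn {K : Set (ℝ × ℝ)} {X Y V O : ℝ × ℝ → ℝ} {p q : ℝ × ℝ}
    (h : EdgeData K X Y V O p q) {e : Edge} (hX : ∀ t, X (e.point t) = 0)
    (hO : ∀ t, O (e.point t) = 1) (hY : ∀ t ∈ Set.Ioo (0 : ℝ) 1, Y (e.point t) ≠ 0)
    (hV : ∀ t ∈ Set.Ioo (0 : ℝ) 1, V (e.point t) ≠ 0) {δ : ℕ → ℝ} (hδ : Tendsto δ atTop (𝓝 0)) :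
    Tendsto (fun n => e.l2sq fun x => edgeFn X Y V O (δ n) x - 1) atTop (𝓝 0) := by
  have hpt : Measurable fun t => e.point t := by unfold Edge.point; fun_prop
  have hae : ∀ᵐ t : ℝ ∂volume.restrict (Set.Icc 0 1), t ∈ Set.Ioo (0 : ℝ) 1 := by
    rw [← restrict_Ioo_eq_restrict_Icc]
    exact ae_restrict_mem measurableSet_Ioo
  unfold Edge.l2sq
  rw [← mul_zero (ENNReal.ofReal e.length)]
  refine ENNReal.Tendsto.const_mul ?_ (Or.inr ENNReal.ofReal_ne_top)
  rw [show (0 : ℝ≥0∞) = ∫⁻ _ in Set.Icc (0 : ℝ) 1, 0 by simp]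
  refine tendsto_lintegral_of_dominated_convergence (fun _ => 1) ?_ ?_ ?_ ?_
  · exact fun n => (((measurable_edgeFn h (δ n)).comp hpt).sub_const 1).enorm.pow_const 2
  · intro n
    refine Eventually.of_forall fun t => ?_
    simp only
    rw [enorm_sq_eq_ofReal, ← ENNReal.ofReal_one]
    refine ENNReal.ofReal_le_ofReal ?_
    rw [edgeFn, hO, one_mul]
    have h1 := corner_nonneg (δ n) (X (e.point t)) (Y (e.point t))
    have h2 := corner_nonneg (δ n) (X (e.point t)) (V (e.point t))
    have h3 := mul_le_one₀ (corner_le_one (δ n) (X (e.point t)) (Y (e.point t))) h2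
      (corner_le_one (δ n) (X (e.point t)) (V (e.point t)))
    have h4 := mul_nonneg h1 h2
    nlinarith
  · simp
  · filter_upwards [hae] with t ht
    have h1 : ∀ {z : ℝ}, z ≠ 0 → corner 0 0 z = 1 := fun hz => by
      unfold corner; rw [div_eq_one_iff_eq] <;> [ring; positivity]
    have h2 := (tendsto_corner (X := X (e.point t)) (Or.inr (hY t ht)) hδ).mul
      (tendsto_corner (X := X (e.point t)) (Or.inr (hV t ht)) hδ)
    rw [hX, h1 (hY t ht), h1 (hV t ht), one_mul] at h2
    have h3 := ((ENNReal.continuous_pow 2).tendsto _).comp (h2.sub_const 1).enorm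
    simpa [Function.comp_def, edgeFn, hO, hX] using h3

lemma edgeFn_eq_zero {X Y V O : ℝ × ℝ → ℝ} {x : ℝ × ℝ} (h : Y x = 0 ∨ V x = 0 ∨ O x = 0) (δ : ℝ) :
    edgeFn X Y V O δ x = 0 := by
  rcases h with h | h | h <;> simp [edgeFn, corner, h]

/-- Smooth functions with traces one on `e` and zero on the other edges in the limit. -/
structure EdgeSequence (κ : Shape) (e : Edge) (φ : ℝ × ℝ → ℝ) (ψ : ℕ → ℝ × ℝ → ℝ) : Prop where
  smooth : ∀ n, ContDiff ℝ ∞ (ψ n)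
  memHs : MemHs (3 / 4) (element κ 1 1) φ
  meas : Measurable φ
  tendsto : Tendsto (fun n => hsNormSq (3 / 4) (element κ 1 1) fun x => ψ n x - φ x) atTop (𝓝 0)
  trace : Tendsto (fun n => e.l2sq fun x => ψ n x - 1) atTop (𝓝 0)
  vanish : ∀ e' ∈ edges κ 1 1, e' ≠ e → ∀ n t, ψ n (e'.point t) = 0

lemma EdgeData.edgeSequence {κ : Shape} {X Y V O : ℝ × ℝ → ℝ} {p q : ℝ × ℝ}
    (h : EdgeData (element κ 1 1) X Y V O p q) {e : Edge} (hX : ∀ t, X (e.point t) = 0)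
    (hO : ∀ t, O (e.point t) = 1) (hY : ∀ t ∈ Set.Ioo (0 : ℝ) 1, Y (e.point t) ≠ 0)
    (hV : ∀ t ∈ Set.Ioo (0 : ℝ) 1, V (e.point t) ≠ 0)
    (hv : ∀ e' ∈ edges κ 1 1, e' ≠ e → ∀ t,
      Y (e'.point t) = 0 ∨ V (e'.point t) = 0 ∨ O (e'.point t) = 0) :
    ∃ φ ψ, EdgeSequence κ e φ ψ := by
  have hδ : Tendsto (fun n : ℕ => 1 / ((n : ℝ) + 1)) atTop (𝓝 0) := tendsto_one_div_add_atTop_nhds_zero_nat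
  exact ⟨edgeFn X Y V O 0, fun n => edgeFn X Y V O (1 / ((n : ℝ) + 1)),
    fun n => contDiff_edgeFn h (by positivity), memHs_edgeFn h 0, measurable_edgeFn h 0,
    tendsto_hsNormSq_edgeFn h hδ, tendsto_l2sq_edgeFn h hX hO hY hV hδ,
    fun e' he' hne n t => edgeFn_eq_zero (hv e' he' hne t) _⟩

/-! ### Edge functions on the reference elements -/

lemma element_subset (κ : Shape) : element κ 1 1 ⊆ Set.Icc 0 1 ×ˢ Set.Icc 0 1 := by
  cases κ
  · rw [element_triangle]; exact slab_subset isSlab_triangle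
  · rw [element_rectangle]; exact slab_subset isSlab_square

lemma isOpen_element (κ : Shape) : IsOpen (element κ 1 1) := by
  cases κ
  · rw [element_triangle]; exact isOpen_slab continuous_zero continuous_id
  · rw [element_rectangle]; exact isOpen_slab continuous_zero continuous_one

lemma convex_element (κ : Shape) : Convex ℝ (element κ 1 1) := by
  cases κ
  · rw [element_triangle]; exact convex_slab_triangle
  · rw [element_rectangle]; exact convex_slab_square

lemma measurableSet_element (κ : Shape) : MeasurableSet (element κ 1 1) :=
  (isOpen_element κ).measurableSet

lemma edgeSequence_of_aff {κ : Shape} {e : Edge} (X Y V O : Fin 3 → ℝ) (p q : ℝ × ℝ)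
    (hX1 : |X 0| ≤ 1 ∧ |X 1| ≤ 1) (hY1 : |Y 0| ≤ 1 ∧ |Y 1| ≤ 1) (hV1 : |V 0| ≤ 1 ∧ |V 1| ≤ 1)
    (hO1 : |O 0| ≤ 1 ∧ |O 1| ≤ 1)
    (cornerY : ∀ x : ℝ × ℝ, |x.1 - p.1| ≤ |aff (X 0) (X 1) (X 2) x| + |aff (Y 0) (Y 1) (Y 2) x| ∧
      |x.2 - p.2| ≤ |aff (X 0) (X 1) (X 2) x| + |aff (Y 0) (Y 1) (Y 2) x|)
    (cornerV : ∀ x : ℝ × ℝ, |x.1 - q.1| ≤ |aff (X 0) (X 1) (X 2) x| + |aff (V 0) (V 1) (V 2) x| ∧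
      |x.2 - q.2| ≤ |aff (X 0) (X 1) (X 2) x| + |aff (V 0) (V 1) (V 2) x|)
    (O_le : ∀ x : ℝ × ℝ, 0 ≤ x.1 → x.1 ≤ 1 → 0 ≤ x.2 → x.2 ≤ 1 → |aff (O 0) (O 1) (O 2) x| ≤ 1)
    (X_ne : ∀ x ∈ element κ 1 1, aff (X 0) (X 1) (X 2) x ≠ 0)
    (p_mem : (0 ≤ p.1 ∧ p.1 ≤ 1) ∧ 0 ≤ p.2 ∧ p.2 ≤ 1) (q_mem : (0 ≤ q.1 ∧ q.1 ≤ 1) ∧ 0 ≤ q.2 ∧ q.2 ≤ 1)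
    (hpq : aff (X 0) (X 1) (X 2) p = 0 ∧ aff (X 0) (X 1) (X 2) q = 0)
    (hX : ∀ t, aff (X 0) (X 1) (X 2) (e.point t) = 0)
    (hO : ∀ t, aff (O 0) (O 1) (O 2) (e.point t) = 1)
    (hY : ∀ t, 0 < t → t < 1 → aff (Y 0) (Y 1) (Y 2) (e.point t) ≠ 0)
    (hV : ∀ t, 0 < t → t < 1 → aff (V 0) (V 1) (V 2) (e.point t) ≠ 0)
    (hv : ∀ e' ∈ edges κ 1 1, e' = e ∨ (∀ t, aff (Y 0) (Y 1) (Y 2) (e'.point t) = 0) ∨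
      (∀ t, aff (V 0) (V 1) (V 2) (e'.point t) = 0) ∨ ∀ t, aff (O 0) (O 1) (O 2) (e'.point t) = 0) :
    ∃ φ ψ, EdgeSequence κ e φ ψ := by
  have h := EdgeData.of_aff (c := X 2) (c' := Y 2) (c'' := V 2) (k := O 2) hX1.1 hX1.2 hY1.1 hY1.2
    hV1.1 hV1.2 hO1.1 hO1.2 cornerY cornerV
    (fun x hx => by
      have := element_subset κ hx
      exact O_le x this.1.1 this.1.2 this.2.1 this.2.2) X_ne (element_subset κ)
    (measurableSet_element κ) p_mem q_mem hpq.1 hpq.2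
  refine h.edgeSequence hX hO (fun t ht => hY t ht.1 ht.2) (fun t ht => hV t ht.1 ht.2) ?_
  intro e' he' hne t
  rcases hv e' he' with h | h | h | h
  · exact absurd h hne
  · exact Or.inl (h t)
  · exact Or.inr (Or.inl (h t))
  · exact Or.inr (Or.inr (h t))

lemma abs_le_abs_add_abs {z A B : ℝ} (h : z = A ∨ z = -A ∨ z = B ∨ z = -B ∨ z = A + B ∨ z = -(A + B)) :
    |z| ≤ |A| + |B| := by
  have h1 := abs_nonneg A
  have h2 := abs_nonneg B
  have h3 := abs_add_le A B
  rcases h with h | h | h | h | h | h <;> rw [h] <;> (try rw [abs_neg]) <;> linarith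

-- The vectors list the coefficients of the affine functions `X` (zero on the edge), `Y` and `V`
-- (zero on its two neighbours) and `O`. On the triangle no edge is opposite and `O = 1`; on the
-- square `O` vanishes on the opposite edge and equals one on the edge itself.
set_option maxHeartbeats 4000000 in
lemma exists_edgeSequence (κ : Shape) : ∀ e ∈ edges κ 1 1, ∃ φ ψ, EdgeSequence κ e φ ψ := by
  cases κ
  · simp only [edges, List.mem_cons, List.not_mem_nil, or_false, forall_eq_or_imp, forall_eq]
    refine ⟨edgeSequence_of_aff ![0, 1, 0] ![-1, 0, 1] ![1, -1, 0] ![0, 0, 1] (1, 0) (0, 0) ?_ ?_ ?_ ?_ ?_ ?_ ?_ ?_ ?_ ?_ ?_ ?_ ?_ ?_ ?_ ?_,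
      edgeSequence_of_aff ![-1, 0, 1] ![0, 1, 0] ![1, -1, 0] ![0, 0, 1] (1, 0) (1, 1) ?_ ?_ ?_ ?_ ?_ ?_ ?_ ?_ ?_ ?_ ?_ ?_ ?_ ?_ ?_ ?_,
      edgeSequence_of_aff ![1, -1, 0] ![0, 1, 0] ![-1, 0, 1] ![0, 0, 1] (0, 0) (1, 1) ?_ ?_ ?_ ?_ ?_ ?_ ?_ ?_ ?_ ?_ ?_ ?_ ?_ ?_ ?_ ?_⟩
    all_goals first
      | (intro x
         refine ⟨abs_le_abs_add_abs ?_, abs_le_abs_add_abs ?_⟩ <;> simp [aff] <;> grind)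
      | (intro x h1 h2 h3 h4
         rw [abs_le]
         simp only [aff, Matrix.cons_val]
         constructor <;> linarith)
      | (intro x hx h
         simp only [element, Set.mem_ofPred_eq] at hx
         simp only [aff, Matrix.cons_val] at h
         linarith)
      | (intro t h0 h1 h
         simp only [aff, Edge.point, Matrix.cons_val, Prod.mk_sub_mk, Prod.smul_mk, Prod.mk_add_mk,
           smul_eq_mul] at h
         linarith)
      | (intro t
         simp [aff, Edge.point]; done)
      | (simp [edges, aff, Edge.point]; done)
  · simp only [edges, List.mem_cons, List.not_mem_nil, or_false, forall_eq_or_imp, forall_eq]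
    refine ⟨edgeSequence_of_aff ![0, 1, 0] ![1, 0, 0] ![-1, 0, 1] ![0, -1, 1] (0, 0) (1, 0) ?_ ?_ ?_ ?_ ?_ ?_ ?_ ?_ ?_ ?_ ?_ ?_ ?_ ?_ ?_ ?_,
      edgeSequence_of_aff ![-1, 0, 1] ![0, 1, 0] ![0, -1, 1] ![1, 0, 0] (1, 0) (1, 1) ?_ ?_ ?_ ?_ ?_ ?_ ?_ ?_ ?_ ?_ ?_ ?_ ?_ ?_ ?_ ?_,
      edgeSequence_of_aff ![0, -1, 1] ![1, 0, 0] ![-1, 0, 1] ![0, 1, 0] (0, 1) (1, 1) ?_ ?_ ?_ ?_ ?_ ?_ ?_ ?_ ?_ ?_ ?_ ?_ ?_ ?_ ?_ ?_,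
      edgeSequence_of_aff ![1, 0, 0] ![0, 1, 0] ![0, -1, 1] ![-1, 0, 1] (0, 0) (0, 1) ?_ ?_ ?_ ?_ ?_ ?_ ?_ ?_ ?_ ?_ ?_ ?_ ?_ ?_ ?_ ?_⟩
    all_goals first
      | (intro x
         refine ⟨abs_le_abs_add_abs ?_, abs_le_abs_add_abs ?_⟩ <;> simp [aff] <;> grind)
      | (intro x h1 h2 h3 h4
         rw [abs_le]
         simp only [aff, Matrix.cons_val]
         constructor <;> linarith)
      | (intro x hx h
         simp only [element, Set.mem_ofPred_eq] at hx
         simp only [aff, Matrix.cons_val] at h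
         linarith)
      | (intro t h0 h1 h
         simp only [aff, Edge.point, Matrix.cons_val, Prod.mk_sub_mk, Prod.smul_mk, Prod.mk_add_mk,
           smul_eq_mul] at h
         linarith)
      | (intro t
         simp [aff, Edge.point]; done)
      | (simp [edges, aff, Edge.point]; done)

/-! ### Mollification inside a convex set -/

/-- A smooth density with compact support in `K`. -/
structure IsMollifier (K : Set (ℝ × ℝ)) (ρ : ℝ × ℝ → ℝ) : Prop where
  smooth : ContDiff ℝ ∞ ρ
  nonneg : ∀ z, 0 ≤ ρ z
  hasCompactSupport : HasCompactSupport ρ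
  tsupport_subset : tsupport ρ ⊆ K
  integral_eq : ∫ z, ρ z = 1

lemma exists_isMollifier (κ : Shape) : ∃ ρ, IsMollifier (element κ 1 1) ρ := by
  -- The centre is the centroid of the triangle. The closed ball of radius `1/8` about it, a square
  -- in the maximum distance, fits into both reference elements.
  let b : ContDiffBump ((2 / 3, 1 / 3) : ℝ × ℝ) := ⟨1 / 16, 1 / 8, by norm_num, by norm_num⟩
  refine ⟨b.normed volume, b.contDiff_normed, b.nonneg_normed, b.hasCompactSupport_normed, ?_,
    b.integral_normed⟩
  rw [b.tsupport_normed_eq]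
  rintro ⟨x, y⟩ h
  have h' : dist (x, y) ((2 / 3, 1 / 3) : ℝ × ℝ) ≤ 1 / 8 := h
  rw [Prod.dist_eq, max_le_iff, Real.dist_eq, Real.dist_eq, abs_le, abs_le] at h'
  cases κ
  · simp only [element, Set.mem_ofPred_eq]
    refine ⟨by linarith, by linarith, by linarith, by simp; linarith⟩
  · simp only [element, Set.mem_ofPred_eq]
    refine ⟨by linarith, by linarith, by linarith, by linarith⟩

lemma lintegral_comp_add_smul (f : ℝ × ℝ → ℝ≥0∞) (a : ℝ × ℝ) {r : ℝ} (hr : 0 < r) :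
    ∫⁻ z, f (a + r • z) = ENNReal.ofReal ((r ^ 2)⁻¹) * ∫⁻ z, f z := by
  have h1 : ∫⁻ z, f (a + r • z) = ∫⁻ z, f (a + z) ∂(Measure.map (r • ·) (volume : Measure (ℝ × ℝ))) :=
    (lintegral_map_equiv (fun z => f (a + z)) (Homeomorph.smul (Units.mk0 r hr.ne')).toMeasurableEquiv).symm
  rw [h1, Measure.map_addHaar_smul volume hr.ne', lintegral_smul_measure, lintegral_add_left_eq_self]
  simp [abs_of_pos hr]

lemma integral_comp_add_smul (f : ℝ × ℝ → ℝ) (a : ℝ × ℝ) (r : ℝ) :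
    ∫ z, f (a + r • z) = (r ^ 2)⁻¹ * ∫ z, f z := by
  rw [Measure.integral_comp_smul volume (fun z => f (a + z)) r, integral_add_left_eq_self]
  simp

/-- Averages of `u` over shrunk copies of the support of `ρ`. -/
noncomputable def moll (ρ : ℝ × ℝ → ℝ) (δ : ℝ) (u : ℝ × ℝ → ℝ) (x : ℝ × ℝ) : ℝ :=
  ∫ z, ρ z * u ((1 - δ) • x + δ • z)

section
variable {K : Set (ℝ × ℝ)} {ρ : ℝ × ℝ → ℝ}

lemma IsMollifier.lintegral_eq (h : IsMollifier K ρ) : ∫⁻ z, ENNReal.ofReal (ρ z) = 1 := by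
  rw [← ofReal_integral_eq_lintegral_ofReal
    (h.smooth.continuous.integrable_of_hasCompactSupport h.hasCompactSupport)
    (Eventually.of_forall h.nonneg), h.integral_eq]; simp

lemma IsMollifier.eq_zero (h : IsMollifier K ρ) {z : ℝ × ℝ} (hz : z ∉ K) : ρ z = 0 := by
  by_contra h0
  exact hz (h.tsupport_subset (subset_tsupport _ h0))

lemma IsMollifier.exists_le (h : IsMollifier K ρ) : ∃ M : ℝ≥0, ∀ z, ENNReal.ofReal (ρ z) ≤ M := by
  obtain ⟨C, hC⟩ := h.hasCompactSupport.exists_bound_of_continuous h.smooth.continuous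
  refine ⟨C.toNNReal, fun z => ?_⟩
  exact ENNReal.ofReal_le_ofReal ((le_abs_self _).trans (hC z))

/-- The kernel in the substituted variable. -/
lemma moll_eq_convolution (ρ u : ℝ × ℝ → ℝ) {δ : ℝ} (hδ : 0 < δ) (x : ℝ × ℝ) :
    moll ρ δ u x = (δ ^ 2)⁻¹ *
      (convolution u (fun v => ρ (-(δ⁻¹ • v))) (ContinuousLinearMap.mul ℝ ℝ) volume) ((1 - δ) • x) := by
  rw [moll, convolution_def, ← integral_comp_add_smul _ ((1 - δ) • x) δ]
  refine integral_congr_ae (Eventually.of_forall fun z => ?_)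
  simp only [ContinuousLinearMap.mul_apply']
  rw [mul_comm]
  congr 2
  rw [sub_add_cancel_left, smul_neg, neg_neg, smul_smul, inv_mul_cancel₀ hδ.ne', one_smul]

lemma hasCompactSupport_scaled (h : IsMollifier K ρ) {δ : ℝ} (hδ : 0 < δ) :
    HasCompactSupport fun v => ρ (-(δ⁻¹ • v)) := by
  have := h.hasCompactSupport.comp_homeomorph
    ((Homeomorph.smul (Units.mk0 δ⁻¹ (inv_ne_zero hδ.ne'))).trans (Homeomorph.neg (ℝ × ℝ)))
  exact this

lemma contDiff_scaled (h : IsMollifier K ρ) (δ : ℝ) : ContDiff ℝ ∞ fun v => ρ (-(δ⁻¹ • v)) :=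
  h.smooth.comp (by fun_prop)

lemma contDiff_moll (h : IsMollifier K ρ) {u : ℝ × ℝ → ℝ} (hu : Integrable u) {δ : ℝ} (hδ : 0 < δ) :
    ContDiff ℝ ∞ (moll ρ δ u) := by
  have e : moll ρ δ u = _ := funext (moll_eq_convolution ρ u hδ)
  rw [e]
  have h1 := (hasCompactSupport_scaled h hδ).contDiff_convolution_right (ContinuousLinearMap.mul ℝ ℝ)
    hu.locallyIntegrable (contDiff_scaled h δ)
  exact contDiff_const.mul (h1.comp (by fun_prop))

/-- The derivative falls on the kernel. It is written as a derivative in the integration variable,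
so that the sum over `i` becomes the weak divergence tested with the kernel; the factor `1 - δ` is
from the chain rule. -/
lemma partialD_moll (h : IsMollifier K ρ) {u : ℝ × ℝ → ℝ} (hu : Integrable u) {δ : ℝ} (hδ : 0 < δ)
    (i : Fin 2) (x : ℝ × ℝ) :
    partialD i (moll ρ δ u) x = -((δ ^ 2)⁻¹ * (1 - δ)) *
      ∫ t, u t * partialD i (fun v => ρ (-(δ⁻¹ • ((1 - δ) • x - v)))) t := by
  set g : ℝ × ℝ → ℝ := fun v => ρ (-(δ⁻¹ • v)) with hg
  have hgs : ContDiff ℝ ∞ g := contDiff_scaled h δ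
  set e : ℝ × ℝ := (![(1, 0), (0, 1)] : Fin 2 → ℝ × ℝ) i with he
  have h1 := (hasCompactSupport_scaled h hδ).hasFDerivAt_convolution_right (ContinuousLinearMap.mul ℝ ℝ)
    hu.locallyIntegrable (hgs.of_le (by simp)) ((1 - δ) • x)
  have h2 : HasFDerivAt (fun y : ℝ × ℝ => (1 - δ) • y) ((1 - δ) • ContinuousLinearMap.id ℝ (ℝ × ℝ)) x :=
    (hasFDerivAt_id x).const_smul (1 - δ)
  have h3 := (HasFDerivAt.comp x h1 h2).const_mul ((δ ^ 2)⁻¹)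
  have e1 : moll ρ δ u = _ := funext (moll_eq_convolution ρ u hδ)
  have h4 := h3.fderiv
  change fderiv ℝ (fun y => (δ ^ 2)⁻¹ * (convolution u (fun v => ρ (-(δ⁻¹ • v)))
    (ContinuousLinearMap.mul ℝ ℝ) volume) ((1 - δ) • y)) x = _ at h4
  rw [← e1] at h4
  have h5 : ∀ t, partialD i (fun v => g ((1 - δ) • x - v)) t = -(fderiv ℝ g ((1 - δ) • x - t) e) := by
    intro t
    have := (hgs.differentiable (by simp) ((1 - δ) • x - t)).hasFDerivAt
    have h6 : HasFDerivAt (fun v : ℝ × ℝ => (1 - δ) • x - v) (-ContinuousLinearMap.id ℝ (ℝ × ℝ)) t :=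
      (hasFDerivAt_id t).const_sub _
    have h7 := (HasFDerivAt.comp t this h6).fderiv
    rw [partialD]
    erw [h7]
    simp [he]
  change _ = _ * ∫ t, u t * partialD i (fun v => g ((1 - δ) • x - v)) t
  simp_rw [h5]
  rw [partialD, h4]
  simp only [smul_apply, ContinuousLinearMap.comp_apply, ContinuousLinearMap.id_apply,
    map_smul, smul_eq_mul]
  rw [convolution_precompR_apply _ hu.locallyIntegrable ((hasCompactSupport_scaled h hδ).fderiv ℝ)
    (hgs.continuous_fderiv (by simp)), convolution_def]
  simp only [ContinuousLinearMap.mul_apply', mul_neg, integral_neg]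
  ring

/-- By convexity, for `x ∈ K` the rescaled kernel is supported in `(1 - δ) x + δ supp ρ ⊆ K` and is
thus an admissible test function. The mollified field is therefore controlled up to the boundary,
and its divergence is constant on all of `K`. -/
lemma sum_partialD_moll (h : IsMollifier K ρ) (hK : Convex ℝ K) {u : Fin 2 → ℝ × ℝ → ℝ} {c : ℝ}
    (hu : ∀ i, Integrable (u i)) (hu0 : ∀ i, ∀ x ∉ K, u i x = 0)
    (hdiv : HasWeakDiv K u fun _ => c) {δ : ℝ} (hδ : 0 < δ) (hδ1 : δ < 1) {x : ℝ × ℝ} (hx : x ∈ K) :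
    ∑ i, partialD i (moll ρ δ (u i)) x = (1 - δ) * c := by
  set φ : ℝ × ℝ → ℝ := fun v => ρ (-(δ⁻¹ • ((1 - δ) • x - v))) with hφ
  have e1 : ∀ v, φ v = ρ (δ⁻¹ • (v - (1 - δ) • x)) := fun v => by
    rw [hφ]; simp only; rw [← smul_neg, neg_sub]
  have hφs : ContDiff ℝ ∞ φ := h.smooth.comp (by fun_prop)
  have hφc : HasCompactSupport φ := by
    have := (hasCompactSupport_scaled h hδ).comp_homeomorph (Homeomorph.subLeft ((1 - δ) • x))
    exact this
  have hφK : ∀ v, v ∉ K → φ v = 0 := by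
    intro v hv
    by_contra h0
    rw [e1] at h0
    have h2 : δ⁻¹ • (v - (1 - δ) • x) ∈ K := by
      by_contra h3; exact h0 (h.eq_zero h3)
    have h3 := hK hx h2 (by linarith : 0 ≤ 1 - δ) hδ.le (by ring)
    rw [smul_smul, mul_inv_cancel₀ hδ.ne', one_smul, add_sub_cancel] at h3
    exact hv h3
  have hts : tsupport φ ⊆ K := by
    have h2 : tsupport φ ⊆ (fun v => δ⁻¹ • (v - (1 - δ) • x)) ⁻¹' tsupport ρ := by
      refine closure_minimal ?_ ((isClosed_tsupport _).preimage (by fun_prop))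
      intro v hv
      have : φ v ≠ 0 := hv
      rw [e1] at this
      exact subset_tsupport _ this
    intro v hv
    have h3 := hK hx (h.tsupport_subset (h2 hv)) (by linarith : 0 ≤ 1 - δ) hδ.le (by ring)
    simp only at h3
    rwa [smul_smul, mul_inv_cancel₀ hδ.ne', one_smul, add_sub_cancel] at h3
  have hd := hdiv φ hφs hφc hts
  have hpc : ∀ i, Continuous (partialD i φ) := fun i => continuous_partialD hφs i
  have hpcs : ∀ i, HasCompactSupport (partialD i φ) := fun i =>
    (hφc.fderiv ℝ).comp_left (g := fun L : ℝ × ℝ →L[ℝ] ℝ => L ((![(1, 0), (0, 1)] : Fin 2 → ℝ × ℝ) i)) (by simp)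
  have hint : ∀ i, Integrable fun t => u i t * partialD i φ t := by
    intro i
    obtain ⟨C, hC⟩ := (hpcs i).exists_bound_of_continuous (hpc i)
    exact (hu i).mul_bdd (hpc i).aestronglyMeasurable (Eventually.of_forall hC)
  -- Because `u` vanishes outside `K`, the convolution over the plane is the pairing over `K`.
  have h5 : ∑ i, ∫ t, u i t * partialD i φ t = gradPairing K u φ := by
    rw [gradPairing, setIntegral_eq_integral_of_forall_compl_eq_zero, integral_finsetSum _ fun i _ => hint i]
    intro v hv
    exact Finset.sum_eq_zero fun i _ => by rw [hu0 i v hv, zero_mul]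
  have h6 : ∫ v in K, c * φ v = c * δ ^ 2 := by
    rw [setIntegral_eq_integral_of_forall_compl_eq_zero fun v hv => by rw [hφK v hv, mul_zero],
      integral_const_mul]
    congr 1
    have h7 := integral_comp_add_smul φ ((1 - δ) • x) δ
    have h8 : ∀ z, φ ((1 - δ) • x + δ • z) = ρ z := fun z => by
      rw [e1, add_sub_cancel_left, smul_smul, inv_mul_cancel₀ hδ.ne', one_smul]
    simp_rw [h8] at h7
    rw [h.integral_eq] at h7
    field_simp at h7
    exact h7.symm
  simp_rw [partialD_moll h (hu _) hδ]
  rw [← Finset.mul_sum, h5, hd, h6]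
  field_simp

/-- Jensen's inequality for the probability density `ρ`, from Cauchy–Schwarz. -/
lemma enorm_integral_mul_sq_le_of_density (h : IsMollifier K ρ) {f : ℝ × ℝ → ℝ} (hf : Measurable f) :
    ‖∫ z, ρ z * f z‖ₑ ^ 2 ≤ ∫⁻ z, ENNReal.ofReal (ρ z) * ‖f z‖ₑ ^ 2 := by
  have h1 : ‖∫ z, ρ z * f z‖ₑ ≤ ∫⁻ z, ENNReal.ofReal (ρ z) * ‖f z‖ₑ := by
    refine (enorm_integral_le_lintegral_enorm _).trans (lintegral_mono fun z => ?_)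
    rw [enorm_mul, Real.enorm_of_nonneg (h.nonneg z)]
  have hm : Measurable fun z => ENNReal.ofReal (ρ z) := h.smooth.continuous.measurable.ennreal_ofReal
  refine (pow_le_pow_left' h1 2).trans ?_
  refine (sq_lintegral_le_of_ae_sq_le hm.aemeasurable (hm.mul (hf.enorm.pow_const 2)).aemeasurable
    (Eventually.of_forall fun z => ?_)).trans ?_
  · exact le_of_eq (by simp only [Pi.mul_apply]; ring)
  · rw [h.lintegral_eq, one_mul]; rfl

lemma integrable_comp_add_smul {u : ℝ × ℝ → ℝ} (hu : Integrable u) (a : ℝ × ℝ) {δ : ℝ} (hδ : 0 < δ) :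
    Integrable fun z => u (a + δ • z) :=
  (hu.comp_add_left a).comp_smul hδ.ne'

lemma IsMollifier.integrable_mul (h : IsMollifier K ρ) {f : ℝ × ℝ → ℝ} (hf : Integrable f) :
    Integrable fun z => ρ z * f z := by
  obtain ⟨C, hC⟩ := h.hasCompactSupport.exists_bound_of_continuous h.smooth.continuous
  exact hf.bdd_mul h.smooth.continuous.aestronglyMeasurable (Eventually.of_forall hC)

lemma moll_sub_eq (h : IsMollifier K ρ) {u : ℝ × ℝ → ℝ} (hu : Integrable u) {δ : ℝ} (hδ : 0 < δ)
    (x : ℝ × ℝ) : moll ρ δ u x - u x = ∫ z, ρ z * (u ((1 - δ) • x + δ • z) - u x) := by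
  have h1 : Integrable fun z => ρ z * u x :=
    (h.smooth.continuous.integrable_of_hasCompactSupport h.hasCompactSupport).mul_const _
  simp_rw [mul_sub]
  rw [integral_sub (h.integrable_mul (integrable_comp_add_smul hu _ hδ)) h1, integral_mul_const,
    h.integral_eq, one_mul, moll]

lemma moll_sub_moll_eq (h : IsMollifier K ρ) {u : ℝ × ℝ → ℝ} (hu : Integrable u) {δ : ℝ} (hδ : 0 < δ)
    (x y : ℝ × ℝ) : moll ρ δ u x - moll ρ δ u y =
      ∫ z, ρ z * (u ((1 - δ) • x + δ • z) - u ((1 - δ) • y + δ • z)) := by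
  simp_rw [mul_sub]
  rw [integral_sub (h.integrable_mul (integrable_comp_add_smul hu _ hδ))
    (h.integrable_mul (integrable_comp_add_smul hu _ hδ)), moll, moll]

lemma eucl_smul_add (r : ℝ) (hr : 0 ≤ r) (x y z : ℝ × ℝ) :
    eucl (r • x + z) (r • y + z) = r * eucl x y := by
  simp only [eucl, Prod.fst_add, Prod.snd_add, Prod.smul_fst, Prod.smul_snd, smul_eq_mul]
  rw [← Real.sqrt_sq hr, ← Real.sqrt_mul (sq_nonneg _)]
  congr 1
  rw [Real.sqrt_sq hr]; ring

/-- A point value difference is controlled by the kernel of the `H^{1/2}` seminorm. -/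
lemma enorm_sub_sq_le_kernel (u : ℝ × ℝ → ℝ) {x y : ℝ × ℝ} {r : ℝ} (hr : eucl x y ≤ r) :
    ‖u x - u y‖ₑ ^ 2 ≤ ENNReal.ofReal (r ^ 3) *
      (‖u x - u y‖ₑ ^ 2 / ENNReal.ofReal (eucl x y ^ (2 + 2 * (1 / 2 : ℝ)))) := by
  rcases eq_or_ne x y with rfl | hxy
  · simp
  have h0 := eucl_pos hxy
  have e : eucl x y ^ (2 + 2 * (1 / 2 : ℝ)) = eucl x y ^ 3 := by
    rw [← Real.rpow_natCast]; norm_num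
  rw [e, div_eq_mul_inv, mul_comm, mul_assoc]
  conv_lhs => rw [← mul_one (‖u x - u y‖ₑ ^ 2)]
  refine mul_le_mul' le_rfl ?_
  have h1 : ENNReal.ofReal (eucl x y ^ 3) ≠ 0 := by simp; positivity
  rw [← ENNReal.inv_mul_cancel h1 ENNReal.ofReal_ne_top]
  gcongr

/-- For `x`, `z` in `K` the points `x` and `(1 - δ) x + δ z` are at distance at most `2 δ`, so
inserting the kernel costs `(2 δ)³`. Substituting the second point as variable returns `δ⁻²`, which
leaves `8 M δ`. The value `δ = 1` is allowed and yields a Poincaré inequality later. -/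
lemma l2sq_moll_sub_le (h : IsMollifier K ρ) (hK : Convex ℝ K) (hKm : MeasurableSet K)
    (hKb : K ⊆ Set.Icc 0 1 ×ˢ Set.Icc 0 1) : ∃ C : ℝ≥0, ∀ u : ℝ × ℝ → ℝ, Measurable u → Integrable u →
    ∀ δ : ℝ, 0 < δ → δ ≤ 1 →
      l2sq K (fun x => moll ρ δ u x - u x) ≤ C * ENNReal.ofReal δ * hsSemiSq (1 / 2) K u := by
  obtain ⟨M, hM⟩ := h.exists_le
  refine ⟨8 * M, fun u hum hu δ hδ hδ1 => ?_⟩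
  set k : ℝ × ℝ → ℝ × ℝ → ℝ≥0∞ := fun x y =>
    ‖u x - u y‖ₑ ^ 2 / ENNReal.ofReal (eucl x y ^ (2 + 2 * (1 / 2 : ℝ))) with hk
  have key : ∀ x ∈ K, ‖moll ρ δ u x - u x‖ₑ ^ 2 ≤ 8 * M * ENNReal.ofReal δ * ∫⁻ y in K, k x y := by
    intro x hx
    rw [moll_sub_eq h hu hδ]
    refine (enorm_integral_mul_sq_le_of_density h (by fun_prop)).trans ?_
    have hz : ∀ z, ENNReal.ofReal (ρ z) * ‖u ((1 - δ) • x + δ • z) - u x‖ₑ ^ 2 ≤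
        (M * ENNReal.ofReal ((2 * δ) ^ 3)) * K.indicator (k x) ((1 - δ) • x + δ • z) := by
      intro z
      by_cases hzK : z ∈ K
      · have hy := hK hx hzK (by linarith : 0 ≤ 1 - δ) hδ.le (by ring)
        rw [Set.indicator_of_mem hy, mul_assoc, ← enorm_neg, neg_sub]
        refine mul_le_mul' (hM z) (enorm_sub_sq_le_kernel u ?_)
        have e1 : x = δ • x + (1 - δ) • x := by rw [← add_smul]; simp
        rw [add_comm ((1 - δ) • x)]
        conv_lhs => enter [1]; rw [e1]
        rw [eucl_smul_add δ hδ.le, mul_comm 2]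
        refine mul_le_mul_of_nonneg_left ?_ hδ.le
        have h2 : √2 ≤ 2 := by rw [Real.sqrt_le_left (by norm_num)]; norm_num
        have := dist_le_one (hKb hx) (hKb hzK)
        calc eucl x z ≤ √2 * dist x z := eucl_le_dist _ _
          _ ≤ 2 * 1 := by gcongr
          _ = 2 := by norm_num
      · rw [h.eq_zero hzK]; simp
    refine (lintegral_mono hz).trans ?_
    rw [lintegral_const_mul' _ _ (ENNReal.mul_ne_top ENNReal.coe_ne_top ENNReal.ofReal_ne_top),
      lintegral_comp_add_smul _ _ hδ, lintegral_indicator hKm, ← mul_assoc]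
    refine mul_le_mul' ?_ le_rfl
    rw [mul_assoc, ← ENNReal.ofReal_mul (by positivity), mul_comm (8 : ℝ≥0∞), mul_assoc]
    refine mul_le_mul' le_rfl ?_
    rw [show (8 : ℝ≥0∞) = ENNReal.ofReal 8 by simp, ← ENNReal.ofReal_mul (by norm_num)]
    refine ENNReal.ofReal_le_ofReal (le_of_eq ?_)
    field_simp; norm_num
  refine (setLIntegral_mono' hKm key).trans (le_of_eq ?_)
  rw [lintegral_const_mul' _ _ (by finiteness)]
  push_cast
  rfl

/-- The mollification averages compositions of `u` with the contractions `x ↦ δ z + (1 - δ) x` of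
`K` into itself. These shrink distances, which only increases the kernel, and each of the two
substitutions costs `(1 - δ)⁻² ≤ 4`. -/
lemma hsSemiSq_moll_le (h : IsMollifier K ρ) (hK : Convex ℝ K) (hKm : MeasurableSet K)
    {u : ℝ × ℝ → ℝ} (hum : Measurable u) (hu : Integrable u) {δ : ℝ} (hδ : 0 < δ) (hδ1 : δ ≤ 1 / 2) :
    hsSemiSq (1 / 2) K (moll ρ δ u) ≤ 16 * hsSemiSq (1 / 2) K u := by
  set k : (ℝ × ℝ) × (ℝ × ℝ) → ℝ≥0∞ := fun p =>
    ‖u p.1 - u p.2‖ₑ ^ 2 / ENNReal.ofReal (eucl p.1 p.2 ^ (2 + 2 * (1 / 2 : ℝ))) with hk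
  have hkm : Measurable k := measurable_diff_kernel hum (1 / 2)
  have hr : 0 < 1 - δ := by linarith
  have e3 : ∀ x y : ℝ × ℝ, eucl x y ^ (2 + 2 * (1 / 2 : ℝ)) = eucl x y ^ 3 := fun x y => by
    rw [← Real.rpow_natCast]; norm_num
  set T : (ℝ × ℝ) → (ℝ × ℝ) → (ℝ × ℝ) := fun z x => δ • z + (1 - δ) • x with hT
  have hρm : Measurable fun z => ENNReal.ofReal (ρ z) := h.smooth.continuous.measurable.ennreal_ofReal
  have key : ∀ x y, ‖moll ρ δ u x - moll ρ δ u y‖ₑ ^ 2 / ENNReal.ofReal (eucl x y ^ (2 + 2 * (1 / 2 : ℝ))) ≤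
      ∫⁻ z, ENNReal.ofReal (ρ z) * k (T z x, T z y) := by
    intro x y
    rcases eq_or_ne x y with rfl | hxy
    · simp
    have h0 := eucl_pos hxy
    have h0' : ENNReal.ofReal (eucl x y ^ (2 + 2 * (1 / 2 : ℝ))) ≠ 0 := by
      rw [e3]; simp; positivity
    rw [moll_sub_moll_eq h hu hδ, div_eq_mul_inv]
    refine (mul_le_mul_left (enorm_integral_mul_sq_le_of_density h (by fun_prop)) _).trans ?_
    rw [← lintegral_mul_const' _ _ (ENNReal.inv_ne_top.2 h0')]
    refine lintegral_mono fun z => ?_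
    rw [mul_assoc, hk, hT]
    simp only
    rw [add_comm (δ • z), add_comm (δ • z), eucl_smul_add _ hr.le, div_eq_mul_inv]
    have := h0.le
    refine mul_le_mul' le_rfl (mul_le_mul' le_rfl (ENNReal.inv_le_inv.2 (ENNReal.ofReal_le_ofReal
      (Real.rpow_le_rpow (by positivity) ?_ (by norm_num)))))
    exact mul_le_of_le_one_left this (sub_le_self 1 hδ.le)
  have hm3 : Measurable fun q : (ℝ × ℝ) × ((ℝ × ℝ) × (ℝ × ℝ)) =>
      ENNReal.ofReal (ρ q.1) * k (T q.1 q.2.1, T q.1 q.2.2) :=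
    (hρm.comp measurable_fst).mul (hkm.comp (by fun_prop))
  have hin : ∀ z, ∫⁻ p, ENNReal.ofReal (ρ z) * k (T z p.1, T z p.2) ∂(volume.restrict K).prod (volume.restrict K) ≤
      ENNReal.ofReal (ρ z) * (16 * hsSemiSq (1 / 2) K u) := by
    intro z
    rw [lintegral_const_mul' _ _ ENNReal.ofReal_ne_top]
    by_cases hz : z ∈ K
    swap
    · rw [h.eq_zero hz]; simp
    refine mul_le_mul' le_rfl ?_
    have hTK : ∀ x ∈ K, T z x ∈ K := fun x hx => hK hz hx hδ.le hr.le (by ring)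
    have hkT : Measurable fun p : (ℝ × ℝ) × (ℝ × ℝ) => k (T z p.1, T z p.2) := hkm.comp (by fun_prop)
    rw [lintegral_prod _ hkT.aemeasurable]
    have h16 : ENNReal.ofReal (((1 - δ) ^ 2)⁻¹) ≤ 4 := by
      rw [show (4 : ℝ≥0∞) = ENNReal.ofReal 4 by simp]
      refine ENNReal.ofReal_le_ofReal ?_
      rw [inv_le_comm₀ (by positivity) (by norm_num)]
      nlinarith
    have gen : ∀ f : ℝ × ℝ → ℝ≥0∞, ∫⁻ x in K, f (T z x) ≤ 4 * ∫⁻ x in K, f x := by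
      intro f
      calc ∫⁻ x in K, f (T z x) ≤ ∫⁻ x in K, K.indicator f (T z x) :=
            setLIntegral_mono' hKm fun x hx => by rw [Set.indicator_of_mem (hTK x hx)]
        _ ≤ ∫⁻ x, K.indicator f (T z x) := setLIntegral_le_lintegral _ _
        _ = _ := lintegral_comp_add_smul _ _ hr
        _ ≤ _ := by rw [lintegral_indicator hKm]; gcongr
    calc ∫⁻ x in K, ∫⁻ y in K, k (T z x, T z y) ≤ ∫⁻ x in K, 4 * ∫⁻ y in K, k (T z x, y) :=
          lintegral_mono fun x => gen fun y => k (T z x, y)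
      _ ≤ 4 * ∫⁻ x in K, 4 * ∫⁻ y in K, k (x, y) := gen fun x => 4 * ∫⁻ y in K, k (x, y)
      _ = _ := by
          rw [lintegral_const_mul' _ _ (by simp), ← mul_assoc]; norm_num; rfl
  calc hsSemiSq (1 / 2) K (moll ρ δ u) ≤ ∫⁻ x in K, ∫⁻ y in K, ∫⁻ z, ENNReal.ofReal (ρ z) * k (T z x, T z y) :=
        lintegral_mono fun x => lintegral_mono fun y => key x y
    _ = ∫⁻ p : (ℝ × ℝ) × (ℝ × ℝ), (∫⁻ z : ℝ × ℝ, ENNReal.ofReal (ρ z) * k (T z p.1, T z p.2)) ∂(volume.restrict K).prod (volume.restrict K) := by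
        rw [lintegral_prod]
        exact (hm3.lintegral_prod_left').aemeasurable
    _ = ∫⁻ z : ℝ × ℝ, ∫⁻ p : (ℝ × ℝ) × (ℝ × ℝ), ENNReal.ofReal (ρ z) * k (T z p.1, T z p.2) ∂(volume.restrict K).prod (volume.restrict K) :=
        lintegral_lintegral_swap (hm3.comp measurable_swap).aemeasurable
    _ ≤ ∫⁻ z, ENNReal.ofReal (ρ z) * (16 * hsSemiSq (1 / 2) K u) := lintegral_mono hin
    _ = _ := by rw [lintegral_mul_const _ hρm, h.lintegral_eq, one_mul]

end

lemma hsSemiSq_sub_le (s : ℝ) (K : Set (ℝ × ℝ)) {f g : ℝ × ℝ → ℝ} (hf : Measurable f) (hg : Measurable g) :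
    hsSemiSq s K (fun x => f x - g x) ≤ 2 * (hsSemiSq s K f + hsSemiSq s K g) := by
  rw [hsSemiSq_eq_prod hf, hsSemiSq_eq_prod hg, hsSemiSq_eq_prod (show Measurable fun x => f x - g x from hf.sub hg),
    ← lintegral_add_left (measurable_diff_kernel hf s), ← lintegral_const_mul' _ _ (by simp)]
  refine lintegral_mono fun z => ?_
  simp only [div_eq_mul_inv]
  rw [← add_mul, ← mul_assoc]
  gcongr
  rw [show f z.1 - g z.1 - (f z.2 - g z.2) = (f z.1 - f z.2) - (g z.1 - g z.2) by ring]
  exact enorm_sub_sq_le _ _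

lemma l2sq_sub_le {K : Set (ℝ × ℝ)} {f g : ℝ × ℝ → ℝ} (hf : Measurable f) :
    l2sq K (fun x => f x - g x) ≤ 2 * (l2sq K f + l2sq K g) := by
  rw [l2sq, l2sq, l2sq, ← lintegral_add_left (hf.enorm.pow_const 2), ← lintegral_const_mul' _ _ (by simp)]
  exact lintegral_mono fun z => enorm_sub_sq_le _ _

lemma hsNormSq_sub_le (s : ℝ) (K : Set (ℝ × ℝ)) {f g : ℝ × ℝ → ℝ} (hf : Measurable f) (hg : Measurable g) :
    hsNormSq s K (fun x => f x - g x) ≤ 2 * (hsNormSq s K f + hsNormSq s K g) := by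
  refine (add_le_add (l2sq_sub_le hf) (hsSemiSq_sub_le s K hf hg)).trans (le_of_eq ?_)
  simp only [hsNormSq]; ring

lemma l2sq_sub_comm (K : Set (ℝ × ℝ)) (f g : ℝ × ℝ → ℝ) :
    l2sq K (fun x => f x - g x) = l2sq K fun x => g x - f x := by
  simp only [l2sq, fun x => enorm_sub_rev (f x) (g x)]

lemma integrable_of_memHs {κ : Shape} {u : ℝ × ℝ → ℝ} (hum : Measurable u)
    (h0 : ∀ x ∉ element κ 1 1, u x = 0) (hu : l2sq (element κ 1 1) u ≠ ⊤) : Integrable u := by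
  have h1 : IntegrableOn (fun x => u x * 1) (element κ 1 1) :=
    integrableOn_mul_continuous (element_subset κ) hum.aestronglyMeasurable hu continuous_const
  simp only [mul_one] at h1
  rw [← integrableOn_univ]
  exact h1.of_forall_sdiff_eq_zero MeasurableSet.univ fun x hx => h0 x hx.2

/-- Smooth approximation keeping the divergence constant. -/
theorem exists_approximation (κ : Shape) {u : Fin 2 → ℝ × ℝ → ℝ} {c : ℝ} (hum : ∀ i, Measurable (u i))
    (h0 : ∀ i, ∀ x ∉ element κ 1 1, u i x = 0) (hu : ∀ i, hsNormSq (1 / 2) (element κ 1 1) (u i) < ⊤)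
    (hdiv : HasWeakDiv (element κ 1 1) u fun _ => c) :
    ∃ (U : ℕ → Fin 2 → ℝ × ℝ → ℝ) (d : ℕ → ℝ) (B : ℝ≥0), (∀ n i, ContDiff ℝ ∞ (U n i)) ∧
      (∀ n, ∀ x ∈ element κ 1 1, ∑ i, partialD i (U n i) x = d n) ∧ Tendsto d atTop (𝓝 c) ∧
      (∀ i, Tendsto (fun n => l2sq (element κ 1 1) fun x => U n i x - u i x) atTop (𝓝 0)) ∧
      ∀ n i, hsNormSq (1 / 2) (element κ 1 1) (U n i) ≤ B := by
  obtain ⟨ρ, hρ⟩ := exists_isMollifier κ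
  have hc := convex_element κ
  have hm := measurableSet_element κ
  have hu' : ∀ i, l2sq (element κ 1 1) (u i) ≠ ⊤ ∧ hsSemiSq (1 / 2) (element κ 1 1) (u i) ≠ ⊤ := fun i => by
    have := (hu i).ne
    rwa [hsNormSq, ENNReal.add_ne_top] at this
  have hint : ∀ i, Integrable (u i) := fun i => integrable_of_memHs (hum i) (h0 i) (hu' i).1
  obtain ⟨C, hC⟩ := l2sq_moll_sub_le hρ hc hm (element_subset κ)
  set δ : ℕ → ℝ := fun n => 1 / ((n : ℝ) + 2) with hδ
  have hδ0 : ∀ n, 0 < δ n := fun n => by rw [hδ]; positivity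
  have hδ2 : ∀ n, δ n ≤ 1 / 2 := fun n => by
    rw [hδ]; simp only; gcongr; linarith [n.cast_nonneg (α := ℝ)]
  have hδt : Tendsto δ atTop (𝓝 0) := by
    have := (tendsto_one_div_add_atTop_nhds_zero_nat (𝕜 := ℝ)).comp (tendsto_add_atTop_nat 1)
    refine this.congr fun n => ?_
    simp only [Function.comp, hδ]; push_cast; ring
  have hl : ∀ n i, l2sq (element κ 1 1) (fun x => moll ρ (δ n) (u i) x - u i x) ≤
      C * ENNReal.ofReal (δ n) * hsSemiSq (1 / 2) (element κ 1 1) (u i) := fun n i =>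
    hC _ (hum i) (hint i) _ (hδ0 n) (by linarith [hδ2 n])
  set S : ℝ≥0∞ := ∑ i, hsSemiSq (1 / 2) (element κ 1 1) (u i) with hS
  have hSt : S ≠ ⊤ := by
    rw [hS]; exact ENNReal.sum_ne_top.2 fun i _ => (hu' i).2
  have hiS : ∀ i, hsSemiSq (1 / 2) (element κ 1 1) (u i) ≤ S := fun i =>
    Finset.single_le_sum (f := fun i => hsSemiSq (1 / 2) (element κ 1 1) (u i)) (fun _ _ => zero_le) (Finset.mem_univ i)
  set T : ℝ≥0∞ := ∑ i, l2sq (element κ 1 1) (u i) with hT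
  have hTt : T ≠ ⊤ := by
    rw [hT]; exact ENNReal.sum_ne_top.2 fun i _ => (hu' i).1
  have hiT : ∀ i, l2sq (element κ 1 1) (u i) ≤ T := fun i =>
    Finset.single_le_sum (f := fun i => l2sq (element κ 1 1) (u i)) (fun _ _ => zero_le) (Finset.mem_univ i)
  have hB : 2 * (T + C * S) + 16 * S ≠ ⊤ := by finiteness
  refine ⟨fun n i => moll ρ (δ n) (u i), fun n => (1 - δ n) * c, (2 * (T + C * S) + 16 * S).toNNReal, ?_, ?_, ?_, ?_, ?_⟩
  · exact fun n i => contDiff_moll hρ (hint i) (hδ0 n)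
  · exact fun n x hx => sum_partialD_moll hρ hc hint h0 hdiv (hδ0 n) (by linarith [hδ2 n]) hx
  · have : Tendsto (fun n => (1 - δ n) * c) atTop (𝓝 ((1 - 0) * c)) := (tendsto_const_nhds.sub hδt).mul_const c
    simpa using this
  · intro i
    refine tendsto_of_tendsto_of_tendsto_of_le_of_le tendsto_const_nhds ?_ (fun _ => zero_le) (fun n => hl n i)
    have h1 : Tendsto (fun n => ENNReal.ofReal (δ n)) atTop (𝓝 0) := by
      simpa using ENNReal.tendsto_ofReal hδt
    have h2 := ENNReal.Tendsto.mul_const (ENNReal.Tendsto.const_mul h1 (Or.inr (ENNReal.coe_ne_top (r := C))))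
      (Or.inr (hu' i).2)
    simpa using h2
  · intro n i
    rw [ENNReal.coe_toNNReal hB, hsNormSq]
    refine add_le_add ?_ ?_
    · change l2sq _ (moll ρ (δ n) (u i)) ≤ _
      have e : moll ρ (δ n) (u i) = fun x => u i x - (u i x - moll ρ (δ n) (u i) x) := by
        funext x; ring
      rw [e]
      refine (l2sq_sub_le (hum i)).trans ?_
      rw [l2sq_sub_comm]
      gcongr
      · exact hiT i
      · refine (hl n i).trans ?_
        refine mul_le_mul' ?_ (hiS i)
        calc (C : ℝ≥0∞) * ENNReal.ofReal (δ n) ≤ C * 1 := by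
              gcongr
              exact ENNReal.ofReal_le_one.2 (by linarith [hδ2 n])
          _ = C := mul_one _
    · exact (hsSemiSq_moll_le hρ hc hm (hum i) (hint i) (hδ0 n) (hδ2 n)).trans (by gcongr; exact hiS i)

/-! ### Weak normal fluxes on the reference elements -/

/-- The reference elements have diameter at most `√2`, and `s' ≤ s + 1` keeps the factor `√2 ^ (2 *
(s' - s))` below `2`. -/
lemma hsSemiSq_le_of_le {κ : Shape} {s s' : ℝ} (h : s ≤ s') (h1 : s' ≤ s + 1) (f : ℝ × ℝ → ℝ) :
    hsSemiSq s (element κ 1 1) f ≤ 2 * hsSemiSq s' (element κ 1 1) f := by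
  rw [hsSemiSq, hsSemiSq, ← lintegral_const_mul' _ _ (by simp)]
  refine setLIntegral_mono' (measurableSet_element κ) fun x hx => ?_
  rw [← lintegral_const_mul' _ _ (by simp)]
  refine setLIntegral_mono' (measurableSet_element κ) fun y hy => ?_
  rcases eq_or_ne x y with rfl | hxy
  · simp
  have h0 := eucl_pos hxy
  have h2 : eucl x y ≤ √2 := by
    have := dist_le_one (element_subset κ hx) (element_subset κ hy)
    calc eucl x y ≤ √2 * dist x y := eucl_le_dist _ _
      _ ≤ √2 * 1 := by gcongr
      _ = √2 := mul_one _
  have h3 : eucl x y ^ (2 + 2 * s') ≤ 2 * eucl x y ^ (2 + 2 * s) := by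
    have e : 2 + 2 * s' = 2 * (s' - s) + (2 + 2 * s) := by ring
    rw [e, Real.rpow_add h0]
    refine mul_le_mul_of_nonneg_right ?_ (by positivity)
    calc eucl x y ^ (2 * (s' - s)) ≤ √2 ^ (2 * (s' - s)) :=
          Real.rpow_le_rpow h0.le h2 (by linarith)
      _ ≤ √2 ^ (2 : ℝ) := Real.rpow_le_rpow_of_exponent_le (by
          rw [Real.one_le_sqrt]; norm_num) (by linarith)
      _ = 2 := by norm_num
  have h4 : ENNReal.ofReal (eucl x y ^ (2 + 2 * s')) ≤ 2 * ENNReal.ofReal (eucl x y ^ (2 + 2 * s)) := by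
    rw [show (2 : ℝ≥0∞) = ENNReal.ofReal 2 by simp, ← ENNReal.ofReal_mul (by norm_num)]
    exact ENNReal.ofReal_le_ofReal h3
  have h5 : ENNReal.ofReal (eucl x y ^ (2 + 2 * s)) ≠ 0 := by simp; positivity
  rw [div_eq_mul_inv, div_eq_mul_inv, mul_left_comm]
  gcongr
  rw [ENNReal.inv_le_iff_inv_le, ENNReal.mul_inv (by simp) (by simp), inv_inv]
  rw [mul_comm, ← div_eq_mul_inv]
  exact ENNReal.div_le_of_le_mul' h4

lemma hsNormSq_le_of_le {κ : Shape} {s s' : ℝ} (h : s ≤ s') (h1 : s' ≤ s + 1) (f : ℝ × ℝ → ℝ) :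
    hsNormSq s (element κ 1 1) f ≤ 2 * hsNormSq s' (element κ 1 1) f := by
  rw [hsNormSq, hsNormSq, mul_add]
  exact add_le_add (le_mul_of_one_le_left zero_le (by norm_num)) (hsSemiSq_le_of_le h h1 f)

/-- The functional `ψ ↦ (u, ∇ψ) + ∫ c ψ`. -/
noncomputable def flux (κ : Shape) (u : Fin 2 → ℝ × ℝ → ℝ) (c : ℝ) (ψ : ℝ × ℝ → ℝ) : ℝ :=
  gradPairing (element κ 1 1) u ψ + ∫ x in element κ 1 1, c * ψ x

section
variable {κ : Shape} {u : Fin 2 → ℝ × ℝ → ℝ} {c : ℝ} {ψ χ : ℝ × ℝ → ℝ}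

lemma integrableOn_of_continuous (κ : Shape) {f : ℝ × ℝ → ℝ} (hf : Continuous f) :
    IntegrableOn f (element κ 1 1) :=
  (hf.continuousOn.integrableOn_compact (isCompact_Icc.prod isCompact_Icc)).mono_set (element_subset κ)

lemma l2sq_ne_top_of_continuous (κ : Shape) {f : ℝ × ℝ → ℝ} (hf : Continuous f) :
    l2sq (element κ 1 1) f ≠ ⊤ := by
  have := (memLp_two_of_continuous (element_subset κ) hf).2
  rw [eLpNorm_lt_top_iff_lintegral_rpow_enorm_lt_top (by simp) (by simp)] at this
  simpa [l2sq, lt_top_iff_ne_top] using this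

lemma gradPairing_eq (hum : ∀ i, Measurable (u i)) (hu : ∀ i, l2sq (element κ 1 1) (u i) ≠ ⊤)
    (hψ : ContDiff ℝ ∞ ψ) :
    gradPairing (element κ 1 1) u ψ = ∑ i, ∫ x in element κ 1 1, u i x * partialD i ψ x :=
  integral_finsetSum _ fun i _ => integrableOn_mul_continuous (element_subset κ)
    (hum i).aestronglyMeasurable (hu i) (continuous_partialD hψ i)

lemma partialD_sub (hψ : ContDiff ℝ ∞ ψ) (hχ : ContDiff ℝ ∞ χ) (i : Fin 2) (x : ℝ × ℝ) :
    partialD i (fun x => ψ x - χ x) x = partialD i ψ x - partialD i χ x := by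
  rw [partialD, fderiv_fun_sub (hψ.differentiable (by simp) x) (hχ.differentiable (by simp) x)]; rfl

lemma flux_sub (hum : ∀ i, Measurable (u i)) (hu : ∀ i, l2sq (element κ 1 1) (u i) ≠ ⊤)
    (hψ : ContDiff ℝ ∞ ψ) (hχ : ContDiff ℝ ∞ χ) :
    flux κ u c (fun x => ψ x - χ x) = flux κ u c ψ - flux κ u c χ := by
  have h1 : ∀ i {f : ℝ × ℝ → ℝ}, ContDiff ℝ ∞ f →
      IntegrableOn (fun x => u i x * partialD i f x) (element κ 1 1) := fun i f hf =>
    integrableOn_mul_continuous (element_subset κ) (hum i).aestronglyMeasurable (hu i) (continuous_partialD hf i)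
  have h2 : ∀ {f : ℝ × ℝ → ℝ}, ContDiff ℝ ∞ f → IntegrableOn (fun x => c * f x) (element κ 1 1) := fun hf =>
    integrableOn_of_continuous κ (continuous_const.mul hf.continuous)
  rw [flux, flux, flux, gradPairing_eq hum hu hψ, gradPairing_eq hum hu hχ, gradPairing_eq hum hu (hψ.sub hχ)]
  simp_rw [partialD_sub hψ hχ, mul_sub]
  rw [integral_sub (h2 hψ) (h2 hχ)]
  simp_rw [fun i => integral_sub (h1 i hψ) (h1 i hχ)]
  rw [Finset.sum_sub_distrib]; ring

lemma enorm_setIntegral_const_mul_sq_le (c : ℝ) (hψ : Continuous ψ) :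
    ‖∫ x in element κ 1 1, c * ψ x‖ₑ ^ 2 ≤ ‖c‖ₑ ^ 2 * l2sq (element κ 1 1) ψ := by
  refine (enorm_integral_mul_sq_le aestronglyMeasurable_const hψ.aestronglyMeasurable).trans ?_
  rw [lintegral_const, Measure.restrict_apply_univ]
  exact mul_le_mul' (mul_le_of_le_one_right zero_le (volume_unit_le (element_subset κ))) le_rfl

end

/-- The flux functional is continuous in the `H^s` norm of the test function, `s > 1/2`, uniformly
over fields bounded in `H^{1/2}` with bounded divergence. This uniformity permits the exchange of
limits in `tendsto_flux_zero`. -/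
theorem flux_bound (κ : Shape) {s : ℝ} (hs : 1 / 2 < s) : ∃ C : ℝ≥0, ∀ (u : Fin 2 → ℝ × ℝ → ℝ) (c : ℝ)
    (ψ : ℝ × ℝ → ℝ), (∀ i, Measurable (u i)) → (∀ i, hsNormSq (1 / 2) (element κ 1 1) (u i) ≠ ⊤) →
    ContDiff ℝ ∞ ψ → hsNormSq s (element κ 1 1) ψ ≠ ⊤ →
    ‖flux κ u c ψ‖ₑ ^ 2 ≤ C * ((∑ i, hsNormSq (1 / 2) (element κ 1 1) (u i)) + ‖c‖ₑ ^ 2) *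
      hsNormSq s (element κ 1 1) ψ := by
  obtain ⟨C0, h0⟩ := pairing_le κ 0 hs
  obtain ⟨C1, h1⟩ := pairing_le κ 1 hs
  refine ⟨4 * (C0 + C1 + 1), fun u c ψ hum hu hψ hψf => ?_⟩
  have hl : ∀ i, l2sq (element κ 1 1) (u i) ≠ ⊤ := fun i => ((ENNReal.add_ne_top.1 (hu i)).1)
  have hψf' := (ENNReal.add_ne_top.1 hψf).2
  rw [flux, gradPairing_eq hum hl hψ, Fin.sum_univ_two, Fin.sum_univ_two]
  set N := hsNormSq s (element κ 1 1) ψ with hN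
  have hSN : hsSemiSq s (element κ 1 1) ψ ≤ N := le_add_self
  have hLN : l2sq (element κ 1 1) ψ ≤ N := le_self_add
  have b0 := (h0 (u 0) ψ (hum 0) hψ (hu 0) hψf').trans (mul_le_mul' le_rfl (mul_le_mul' le_rfl hSN))
  have b1 := (h1 (u 1) ψ (hum 1) hψ (hu 1) hψf').trans (mul_le_mul' le_rfl (mul_le_mul' le_rfl hSN))
  have b2 := (enorm_setIntegral_const_mul_sq_le (κ := κ) c hψ.continuous).trans (mul_le_mul' le_rfl hLN)
  set A0 := hsNormSq (1 / 2) (element κ 1 1) (u 0)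
  set A1 := hsNormSq (1 / 2) (element κ 1 1) (u 1)
  refine (enorm_add_sq_le _ _).trans ?_
  refine (mul_le_mul' le_rfl (add_le_add (enorm_add_sq_le _ _) le_rfl)).trans ?_
  refine (mul_le_mul' le_rfl (add_le_add (mul_le_mul' le_rfl (add_le_add b0 b1)) b2)).trans ?_
  push_cast
  -- The nonnegative terms added here complete the sum of products to a product of sums.
  calc 2 * (2 * (↑C0 * (A0 * N) + ↑C1 * (A1 * N)) + ‖c‖ₑ ^ 2 * N)
      ≤ 2 * (2 * (↑C0 * (A0 * N) + ↑C1 * (A1 * N)) + ‖c‖ₑ ^ 2 * N) +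
        (4 * (C0 * (A1 + ‖c‖ₑ ^ 2) + C1 * (A0 + ‖c‖ₑ ^ 2) + A0 + A1) + 2 * ‖c‖ₑ ^ 2) * N := le_self_add
    _ = _ := by ring

lemma tendsto_zero_of_enorm_sq {x : ℕ → ℝ} (h : Tendsto (fun n => ‖x n‖ₑ ^ 2) atTop (𝓝 0)) :
    Tendsto x atTop (𝓝 0) := by
  have h1 := (ENNReal.tendsto_toReal (a := 0) (by simp)).comp h
  have h2 := (Real.continuous_sqrt.tendsto _).comp h1
  rw [tendsto_zero_iff_norm_tendsto_zero]
  refine (h2.congr fun n => ?_).trans_eq ?_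
  · simp [Function.comp, Real.sqrt_sq_eq_abs]
  · simp

lemma tendsto_zero_of_enorm_sq_le {x : ℕ → ℝ} {b : ℕ → ℝ≥0∞} (hb : Tendsto b atTop (𝓝 0))
    (h : ∀ n, ‖x n‖ₑ ^ 2 ≤ b n) : Tendsto x atTop (𝓝 0) :=
  tendsto_zero_of_enorm_sq
    (tendsto_of_tendsto_of_tendsto_of_le_of_le tendsto_const_nhds hb (fun _ => zero_le) h)

/-! #### Boundary integrals -/

/-- Every end of the slices runs along an edge. -/
def AlongEdge (κ : Shape) (γ : ℝ → ℝ × ℝ) : Prop :=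
  ∃ e ∈ edges κ 1 1, 1 ≤ e.length ∧ ((∀ a, γ a = e.point a) ∨ ∀ a, γ a = e.point (1 - a))

lemma alongEdge_slice (κ : Shape) (l : Fin 2) : AlongEdge κ (sliceLo κ l) ∧ AlongEdge κ (sliceHi κ l) := by
  cases κ
  · have hyp : AlongEdge .triangle fun a => (a, a) :=
      ⟨((1, 1), (0, 0)), by simp [edges], by norm_num [Edge.length, eucl],
        Or.inr fun a => by simp [Edge.point]⟩
    have bot : AlongEdge .triangle fun a => (a, 0) :=
      ⟨((0, 0), (1, 0)), by simp [edges], by norm_num [Edge.length, eucl], Or.inl fun a => by simp [Edge.point]⟩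
    have rig : AlongEdge .triangle fun a => (1, a) :=
      ⟨((1, 0), (1, 1)), by simp [edges], by norm_num [Edge.length, eucl], Or.inl fun a => by simp [Edge.point]⟩
    fin_cases l
    exacts [⟨hyp, rig⟩, ⟨bot, hyp⟩]
  · have top : AlongEdge .rectangle fun a => (a, 1) :=
      ⟨((1, 1), (0, 1)), by simp [edges], by norm_num [Edge.length, eucl], Or.inr fun a => by simp [Edge.point]⟩
    have lef : AlongEdge .rectangle fun a => (0, a) :=
      ⟨((0, 1), (0, 0)), by simp [edges], by norm_num [Edge.length, eucl], Or.inr fun a => by simp [Edge.point]⟩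
    have bot : AlongEdge .rectangle fun a => (a, 0) :=
      ⟨((0, 0), (1, 0)), by simp [edges], by norm_num [Edge.length, eucl], Or.inl fun a => by simp [Edge.point]⟩
    have rig : AlongEdge .rectangle fun a => (1, a) :=
      ⟨((1, 0), (1, 1)), by simp [edges], by norm_num [Edge.length, eucl], Or.inl fun a => by simp [Edge.point]⟩
    fin_cases l
    exacts [⟨lef, rig⟩, ⟨bot, top⟩]

lemma AlongEdge.integral_eq {κ : Shape} {γ : ℝ → ℝ × ℝ} (h : AlongEdge κ γ) :
    ∃ e ∈ edges κ 1 1, 1 ≤ e.length ∧ ∀ f : ℝ × ℝ → ℝ,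
      ∫ a in (0 : ℝ)..1, f (γ a) = ∫ a in (0 : ℝ)..1, f (e.point a) := by
  obtain ⟨e, he, hl, h | h⟩ := h
  · exact ⟨e, he, hl, fun f => by simp_rw [h]⟩
  · refine ⟨e, he, hl, fun f => ?_⟩
    simp_rw [h]
    rw [intervalIntegral.integral_comp_sub_left (fun a => f (e.point a))]; simp

lemma continuous_point (e : Edge) : Continuous e.point := by
  unfold Edge.point; fun_prop

/-- Cauchy–Schwarz on the edge along which `γ` runs. Parametrization by `[0, 1]` instead of arc
length does no harm, as every edge has length at least one. -/
lemma tendsto_integral_mul_along {κ : Shape} {γ : ℝ → ℝ × ℝ} (h : AlongEdge κ γ) {F : ℝ × ℝ → ℝ}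
    (hF : Continuous F) {χ : ℕ → ℝ × ℝ → ℝ} (hχ : ∀ n, Continuous (χ n))
    (ht : ∀ e ∈ edges κ 1 1, Tendsto (fun n => e.l2sq (χ n)) atTop (𝓝 0)) :
    Tendsto (fun n => ∫ a in (0 : ℝ)..1, χ n (γ a) * F (γ a)) atTop (𝓝 0) := by
  obtain ⟨e, he, hl, hf⟩ := h.integral_eq
  simp_rw [fun n => hf fun x => χ n x * F x]
  have hpc := continuous_point e
  have hFf : ∫⁻ a in Set.Icc (0 : ℝ) 1, ‖F (e.point a)‖ₑ ^ 2 ≠ ⊤ := by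
    obtain ⟨M, hM⟩ := (isCompact_Icc (a := (0 : ℝ)) (b := 1)).exists_bound_of_continuousOn (hF.comp hpc).continuousOn
    refine ne_top_of_le_ne_top (b := ∫⁻ a in Set.Icc (0 : ℝ) 1, ENNReal.ofReal M ^ 2) (by simp) ?_
    refine setLIntegral_mono' measurableSet_Icc fun a ha => ?_
    gcongr
    rw [← ofReal_norm]
    exact ENNReal.ofReal_le_ofReal (hM a ha)
  have hb := ENNReal.Tendsto.mul_const (ht e he) (Or.inr hFf)
  rw [zero_mul] at hb
  refine tendsto_zero_of_enorm_sq_le hb fun n => ?_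
  rw [intervalIntegral.integral_of_le zero_le_one, ← integral_Icc_eq_integral_Ioc]
  refine (enorm_integral_mul_sq_le ((hχ n).comp hpc).aestronglyMeasurable
    (hF.comp hpc).aestronglyMeasurable).trans (mul_le_mul' ?_ le_rfl)
  rw [Edge.l2sq]
  exact le_mul_of_one_le_left zero_le (ENNReal.one_le_ofReal.2 hl)

lemma partialD_mul {f g : ℝ × ℝ → ℝ} (hf : ContDiff ℝ ∞ f) (hg : ContDiff ℝ ∞ g) (i : Fin 2) (x : ℝ × ℝ) :
    partialD i (fun x => f x * g x) x = f x * partialD i g x + g x * partialD i f x := by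
  rw [partialD, fderiv_fun_mul (hf.differentiable (by simp) x) (hg.differentiable (by simp) x)]; rfl

/-- For smooth `U` with divergence `d` the integrand is the divergence of `χ U`, which is integrated
one coordinate at a time along slices. -/
lemma flux_eq_boundary {κ : Shape} {U : Fin 2 → ℝ × ℝ → ℝ} {d : ℝ} (hU : ∀ i, ContDiff ℝ ∞ (U i))
    (hd : ∀ x ∈ element κ 1 1, ∑ i, partialD i (U i) x = d) {χ : ℝ × ℝ → ℝ} (hχ : ContDiff ℝ ∞ χ) :
    flux κ U d χ = ∑ i, ((∫ a in (0 : ℝ)..1, χ (sliceHi κ i a) * U i (sliceHi κ i a)) -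
      ∫ a in (0 : ℝ)..1, χ (sliceLo κ i a) * U i (sliceLo κ i a)) := by
  have hcont : ∀ i, Continuous (sliceHi κ i) ∧ Continuous (sliceLo κ i) := by
    intro i
    cases κ <;> fin_cases i <;> exact ⟨by unfold sliceHi; fun_prop, by unfold sliceLo; fun_prop⟩
  have e1 : ∀ i, (∫ a in (0 : ℝ)..1, χ (sliceHi κ i a) * U i (sliceHi κ i a)) -
      ∫ a in (0 : ℝ)..1, χ (sliceLo κ i a) * U i (sliceLo κ i a) =
      ∫ x in element κ 1 1, partialD i (fun x => χ x * U i x) x := by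
    intro i
    rw [integral_partialD κ i (hχ.mul (hU i)), intervalIntegral.integral_sub]
    · exact ((hχ.continuous.comp (hcont i).1).mul ((hU i).continuous.comp (hcont i).1)).intervalIntegrable _ _
    · exact ((hχ.continuous.comp (hcont i).2).mul ((hU i).continuous.comp (hcont i).2)).intervalIntegrable _ _
  simp_rw [e1]
  rw [← integral_finsetSum _ fun i _ => integrableOn_of_continuous κ (continuous_partialD (hχ.mul (hU i)) i),
    flux, gradPairing, ← integral_add]
  · refine setIntegral_congr_fun (measurableSet_element κ) fun x hx => ?_
    simp_rw [partialD_mul hχ (hU _)]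
    rw [Finset.sum_add_distrib, ← Finset.mul_sum, hd x hx]; ring
  · exact integrableOn_of_continuous κ (continuous_finsetSum _ fun i _ =>
      (hU i).continuous.mul (continuous_partialD hχ i))
  · exact integrableOn_of_continuous κ (continuous_const.mul hχ.continuous)

/-- A Cauchy sequence in `H^s`. -/
def CauchyHs (s : ℝ) (K : Set (ℝ × ℝ)) (χ : ℕ → ℝ × ℝ → ℝ) : Prop :=
  ∀ ε : ℝ≥0∞, 0 < ε → ∃ N, ∀ m ≥ N, ∀ k ≥ N, hsNormSq s K (fun x => χ m x - χ k x) ≤ ε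

lemma tendsto_flux_of_l2 {κ : Shape} {U : ℕ → Fin 2 → ℝ × ℝ → ℝ} {u : Fin 2 → ℝ × ℝ → ℝ} {d : ℕ → ℝ} {c : ℝ}
    (hum : ∀ i, Measurable (u i)) (hu : ∀ i, l2sq (element κ 1 1) (u i) ≠ ⊤)
    (hU : ∀ n i, ContDiff ℝ ∞ (U n i)) (hd : Tendsto d atTop (𝓝 c))
    (hl : ∀ i, Tendsto (fun n => l2sq (element κ 1 1) fun x => U n i x - u i x) atTop (𝓝 0))
    {ψ : ℝ × ℝ → ℝ} (hψ : ContDiff ℝ ∞ ψ) :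
    Tendsto (fun n => flux κ (U n) (d n) ψ) atTop (𝓝 (flux κ u c ψ)) := by
  have hUl : ∀ n i, l2sq (element κ 1 1) (U n i) ≠ ⊤ := fun n i =>
    l2sq_ne_top_of_continuous κ (hU n i).continuous
  refine Tendsto.add ?_ ?_
  · simp_rw [fun n => gradPairing_eq (fun i => (hU n i).continuous.measurable) (hUl n) hψ,
      gradPairing_eq hum hu hψ]
    refine tendsto_finsetSum _ fun i _ => ?_
    rw [← tendsto_sub_nhds_zero_iff]
    have hp2 := l2sq_ne_top_of_continuous κ (continuous_partialD hψ i)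
    have hb := ENNReal.Tendsto.mul_const (hl i) (Or.inr hp2)
    rw [zero_mul] at hb
    refine tendsto_zero_of_enorm_sq_le hb fun n => ?_
    rw [← integral_sub]
    · simp_rw [← sub_mul]
      exact enorm_integral_mul_sq_le ((hU n i).continuous.measurable.sub (hum i)).aestronglyMeasurable
        (continuous_partialD hψ i).aestronglyMeasurable
    · exact integrableOn_mul_continuous (element_subset κ) (hU n i).continuous.measurable.aestronglyMeasurable
        (hUl n i) (continuous_partialD hψ i)
    · exact integrableOn_mul_continuous (element_subset κ) (hum i).aestronglyMeasurable
        (hu i) (continuous_partialD hψ i)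
  · simp_rw [integral_const_mul]
    exact hd.mul_const _

/-- An exchange of two limits. For each smooth approximation of `u` the flux is a boundary integral
and tends to zero with the traces of `χ`. The bound in `H^s` makes this uniform over the
approximations. Only the Cauchy property of `χ` is used, so neither a limit function nor a trace
theorem is needed. -/
theorem tendsto_flux_zero {κ : Shape} {u : Fin 2 → ℝ × ℝ → ℝ} {c : ℝ} (hum : ∀ i, Measurable (u i))
    (h0 : ∀ i, ∀ x ∉ element κ 1 1, u i x = 0) (hu : ∀ i, hsNormSq (1 / 2) (element κ 1 1) (u i) < ⊤)
    (hdiv : HasWeakDiv (element κ 1 1) u fun _ => c) {s : ℝ} (hs : 1 / 2 < s) {χ : ℕ → ℝ × ℝ → ℝ}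
    (hχ : ∀ n, ContDiff ℝ ∞ (χ n)) (hc : CauchyHs s (element κ 1 1) χ)
    (ht : ∀ e ∈ edges κ 1 1, Tendsto (fun n => e.l2sq (χ n)) atTop (𝓝 0)) :
    Tendsto (fun n => flux κ u c (χ n)) atTop (𝓝 0) := by
  obtain ⟨U, d, B, hU, hdU, hd, hl, hB⟩ := exists_approximation κ hum h0 hu hdiv
  have hul : ∀ i, l2sq (element κ 1 1) (u i) ≠ ⊤ := fun i => (ENNReal.add_ne_top.1 (hu i).ne).1
  have hBt : ∀ n i, hsNormSq (1 / 2) (element κ 1 1) (U n i) ≠ ⊤ := fun n i =>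
    ne_top_of_le_ne_top ENNReal.coe_ne_top (hB n i)
  obtain ⟨C, hC⟩ := flux_bound κ hs
  obtain ⟨D, hD⟩ := (Metric.isBounded_range_of_tendsto d hd).exists_norm_le
  set A : ℝ≥0∞ := C * (2 * B + ENNReal.ofReal D ^ 2) with hA
  have hAt : A ≠ ⊤ := by finiteness
  have hLn : ∀ n ψ, ContDiff ℝ ∞ ψ → hsNormSq s (element κ 1 1) ψ ≠ ⊤ →
      ‖flux κ (U n) (d n) ψ‖ₑ ^ 2 ≤ A * hsNormSq s (element κ 1 1) ψ := by
    intro n ψ hψ hψf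
    refine (hC (U n) (d n) ψ (fun i => (hU n i).continuous.measurable) (hBt n) hψ hψf).trans ?_
    refine mul_le_mul' (mul_le_mul' le_rfl (add_le_add ?_ ?_)) le_rfl
    · rw [Fin.sum_univ_two, two_mul]; exact add_le_add (hB n 0) (hB n 1)
    · gcongr
      rw [← ofReal_norm]; exact ENNReal.ofReal_le_ofReal (hD _ ⟨n, rfl⟩)
  have hLχ : ∀ n, Tendsto (fun k => flux κ (U n) (d n) (χ k)) atTop (𝓝 0) := by
    intro n
    simp_rw [fun k => flux_eq_boundary (hU n) (hdU n) (hχ k)]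
    have h := tendsto_finsetSum Finset.univ fun (i : Fin 2) _ =>
      (tendsto_integral_mul_along (alongEdge_slice κ i).2 (hU n i).continuous (fun k => (hχ k).continuous) ht).sub
        (tendsto_integral_mul_along (alongEdge_slice κ i).1 (hU n i).continuous (fun k => (hχ k).continuous) ht)
    simpa only [sub_zero, Finset.sum_const_zero] using h
  have hen : Continuous fun x : ℝ => ‖x‖ₑ ^ 2 := (ENNReal.continuous_pow 2).comp continuous_enorm
  -- For fixed `n`, the flux of `χ m` is the limit over `k` of the flux of `χ m - χ k`, whose square
  -- is at most `A * ε`. This bound does not depend on `n` and passes to the limit `n → ∞`.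
  have main : ∀ ε : ℝ≥0∞, 0 < ε → ε ≠ ⊤ → ∃ N, ∀ m ≥ N, ‖flux κ u c (χ m)‖ₑ ^ 2 ≤ A * ε := by
    intro ε hε hεt
    obtain ⟨N, hN⟩ := hc ε hε
    refine ⟨N, fun m hm => ?_⟩
    have h1 : ∀ n, ‖flux κ (U n) (d n) (χ m)‖ₑ ^ 2 ≤ A * ε := by
      intro n
      have h2 := (hen.tendsto _).comp (tendsto_const_nhds.sub (hLχ n) (a := flux κ (U n) (d n) (χ m)))
      rw [sub_zero] at h2
      refine le_of_tendsto h2 (eventually_atTop.2 ⟨N, fun k hk => ?_⟩)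
      have h3 := hN m hm k hk
      have h4 := flux_sub (κ := κ) (c := d n) (fun i => (hU n i).continuous.measurable)
        (fun i => l2sq_ne_top_of_continuous κ (hU n i).continuous) (hχ m) (hχ k)
      simp only [Function.comp]
      rw [← h4]
      exact (hLn n _ ((hχ m).sub (hχ k)) (ne_top_of_le_ne_top hεt h3)).trans (mul_le_mul' le_rfl h3)
    exact le_of_tendsto ((hen.tendsto _).comp (tendsto_flux_of_l2 hum hul hU hd hl (hχ m)))
      (Eventually.of_forall h1)
  refine tendsto_zero_of_enorm_sq (ENNReal.tendsto_nhds_zero.2 fun ε hε => ?_)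
  rcases eq_or_ne ε ⊤ with rfl | hεt
  · exact Eventually.of_forall fun _ => le_top
  obtain ⟨N, hN⟩ := main (ε / (A + 1)) (ENNReal.div_pos hε.ne' (by finiteness))
    (ENNReal.div_ne_top hεt (by simp))
  refine eventually_atTop.2 ⟨N, fun m hm => (hN m hm).trans ?_⟩
  calc A * (ε / (A + 1)) ≤ (A + 1) * (ε / (A + 1)) := by gcongr; exact le_self_add
    _ ≤ ε := ENNReal.mul_div_le

/-! ### Existence of the normal fluxes -/

/-- Measurable fields in `H^{1/2}`, extended by zero, with constant divergence. -/
structure IsField (κ : Shape) (u : Fin 2 → ℝ × ℝ → ℝ) (c : ℝ) : Prop where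
  meas : ∀ i, Measurable (u i)
  zero : ∀ i, ∀ x ∉ element κ 1 1, u i x = 0
  fin : ∀ i, hsNormSq (1 / 2) (element κ 1 1) (u i) < ⊤
  div : HasWeakDiv (element κ 1 1) u fun _ => c

section congr
variable {K : Set (ℝ × ℝ)} {f g : ℝ × ℝ → ℝ}

lemma l2sq_congr (h : f =ᵐ[volume.restrict K] g) : l2sq K f = l2sq K g :=
  lintegral_congr_ae (h.mono fun x hx => by simp only [hx])

lemma hsSemiSq_congr (h : f =ᵐ[volume.restrict K] g) (s : ℝ) : hsSemiSq s K f = hsSemiSq s K g :=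
  lintegral_congr_ae (h.mono fun x hx => lintegral_congr_ae (h.mono fun y hy => by simp only [hx, hy]))

lemma hsNormSq_congr (h : f =ᵐ[volume.restrict K] g) (s : ℝ) : hsNormSq s K f = hsNormSq s K g := by
  rw [hsNormSq, hsNormSq, l2sq_congr h, hsSemiSq_congr h]

lemma hsNormSq_sub_comm (s : ℝ) (K : Set (ℝ × ℝ)) (f g : ℝ × ℝ → ℝ) :
    hsNormSq s K (fun x => f x - g x) = hsNormSq s K fun x => g x - f x := by
  rw [hsNormSq, hsNormSq, l2sq_sub_comm]
  congr 1
  refine lintegral_congr fun x => lintegral_congr fun y => ?_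
  rw [← enorm_neg]; congr 3; ring

end congr

/-! ### Cauchy sequences in `H^s` -/

lemma cauchyHs_of_tendsto {s : ℝ} {K : Set (ℝ × ℝ)} {χ : ℕ → ℝ × ℝ → ℝ} {φ : ℝ × ℝ → ℝ}
    (hχ : ∀ n, Measurable (χ n)) (hφ : AEStronglyMeasurable φ (volume.restrict K))
    (h : Tendsto (fun n => hsNormSq s K fun x => χ n x - φ x) atTop (𝓝 0)) : CauchyHs s K χ := by
  obtain ⟨φ', hm, he⟩ := hφ
  have e : ∀ n, hsNormSq s K (fun x => χ n x - φ x) = hsNormSq s K fun x => χ n x - φ' x := fun n =>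
    hsNormSq_congr (he.mono fun x hx => by simp only [hx]) s
  simp_rw [e] at h
  intro ε hε
  have h4 : 0 < ε / 4 := ENNReal.div_pos hε.ne' (by simp)
  obtain ⟨N, hN⟩ := eventually_atTop.1 (ENNReal.tendsto_nhds_zero.1 h (ε / 4) h4)
  refine ⟨N, fun m hm' k hk => ?_⟩
  have e2 : (fun x => χ m x - χ k x) = fun x => (χ m x - φ' x) - (χ k x - φ' x) := by
    funext x; ring
  rw [e2]
  refine (hsNormSq_sub_le s K ((hχ m).sub hm.measurable) ((hχ k).sub hm.measurable)).trans ?_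
  calc 2 * (hsNormSq s K (χ m - φ') + hsNormSq s K (χ k - φ')) ≤ 2 * (ε / 4 + ε / 4) := by
        gcongr
        exacts [hN m hm', hN k hk]
    _ = 4 * (ε / 4) := by ring
    _ ≤ ε := ENNReal.mul_div_le

lemma CauchyHs.sub {s : ℝ} {K : Set (ℝ × ℝ)} {χ η : ℕ → ℝ × ℝ → ℝ} (h : CauchyHs s K χ) (h' : CauchyHs s K η)
    (hχ : ∀ n, Measurable (χ n)) (hη : ∀ n, Measurable (η n)) :
    CauchyHs s K fun n x => χ n x - η n x := by
  intro ε hε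
  have h4 : 0 < ε / 4 := ENNReal.div_pos hε.ne' (by simp)
  obtain ⟨N, hN⟩ := h (ε / 4) h4
  obtain ⟨N', hN'⟩ := h' (ε / 4) h4
  refine ⟨max N N', fun m hm k hk => ?_⟩
  have e2 : (fun x => (χ m x - η m x) - (χ k x - η k x)) = fun x => (χ m x - χ k x) - (η m x - η k x) := by
    funext x; ring
  rw [e2]
  refine (hsNormSq_sub_le s K ((hχ m).sub (hχ k)) ((hη m).sub (hη k))).trans ?_
  calc 2 * (hsNormSq s K (χ m - χ k) + hsNormSq s K (η m - η k)) ≤ 2 * (ε / 4 + ε / 4) := by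
        gcongr
        exacts [hN m (le_of_max_le_left hm) k (le_of_max_le_left hk),
          hN' m (le_of_max_le_right hm) k (le_of_max_le_right hk)]
    _ = 4 * (ε / 4) := by ring
    _ ≤ ε := ENNReal.mul_div_le

lemma cauchyHs_const (s : ℝ) (K : Set (ℝ × ℝ)) (f : ℝ × ℝ → ℝ) : CauchyHs s K fun _ => f :=
  fun ε _ => ⟨0, fun _ _ _ _ => by simp [hsNormSq, l2sq, hsSemiSq]⟩

lemma CauchyHs.of_le {κ : Shape} {s s' : ℝ} (hs : s ≤ s') (h1 : s' ≤ s + 1) {χ : ℕ → ℝ × ℝ → ℝ}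
    (h : CauchyHs s' (element κ 1 1) χ) : CauchyHs s (element κ 1 1) χ := by
  intro ε hε
  obtain ⟨N, hN⟩ := h (ε / 2) (ENNReal.div_pos hε.ne' (by simp))
  exact ⟨N, fun m hm k hk => (hsNormSq_le_of_le hs h1 _).trans
    ((mul_le_mul' le_rfl (hN m hm k hk)).trans ENNReal.mul_div_le)⟩

lemma Edge.l2sq_sub_le (e : Edge) {f g : ℝ × ℝ → ℝ} (hf : Continuous f) :
    e.l2sq (fun x => f x - g x) ≤ 2 * (e.l2sq f + e.l2sq g) := by
  have hm : Measurable fun t => ‖f (e.point t)‖ₑ ^ 2 :=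
    (hf.comp (continuous_point e)).measurable.enorm.pow_const 2
  rw [Edge.l2sq, Edge.l2sq, Edge.l2sq, ← mul_add, ← lintegral_add_left hm, mul_left_comm,
    ← lintegral_const_mul' 2 _ (by simp)]
  exact mul_le_mul' le_rfl (lintegral_mono fun t => enorm_sub_sq_le _ _)

lemma Edge.l2sq_congr (e : Edge) {f g : ℝ × ℝ → ℝ} (h : ∀ t, f (e.point t) = g (e.point t)) :
    e.l2sq f = e.l2sq g := by
  simp only [Edge.l2sq, h]

namespace EdgeSequence
variable {κ : Shape} {e : Edge} {φ : ℝ × ℝ → ℝ} {ψ : ℕ → ℝ × ℝ → ℝ}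

lemma cauchyHs (h : EdgeSequence κ e φ ψ) : CauchyHs (3 / 4) (element κ 1 1) ψ :=
  cauchyHs_of_tendsto (fun n => (h.smooth n).continuous.measurable) h.meas.aestronglyMeasurable h.tendsto

lemma exists_bound (h : EdgeSequence κ e φ ψ) :
    ∃ M : ℝ≥0, ∀ᶠ n in atTop, hsNormSq (3 / 4) (element κ 1 1) (ψ n) ≤ M := by
  have hf : 2 * (hsNormSq (3 / 4) (element κ 1 1) φ + 1) ≠ ⊤ := by
    have := h.memHs.2.ne
    finiteness
  refine ⟨(2 * (hsNormSq (3 / 4) (element κ 1 1) φ + 1)).toNNReal, ?_⟩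
  rw [ENNReal.coe_toNNReal hf]
  filter_upwards [ENNReal.tendsto_nhds_zero.1 h.tendsto 1 one_pos] with n hn
  have e : ψ n = fun x => φ x - (φ x - ψ n x) := by funext x; ring
  rw [hsNormSq_sub_comm] at hn
  rw [e]
  refine (hsNormSq_sub_le _ _ h.meas (h.meas.sub (h.smooth n).continuous.measurable)).trans ?_
  gcongr
  exact hn

/-- An edge sequence is an admissible approximation with `ε = 1/4`. Its existence keeps the
universally quantified definition of the flux from being vacuous and hence fixes the value. -/
lemma unique (h : EdgeSequence κ e φ ψ) {u : Fin 2 → ℝ × ℝ → ℝ}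
    {d : ℝ × ℝ → ℝ} {f f' : ℝ} (hf : HasNormalFlux κ 1 1 u d e f) (hf' : HasNormalFlux κ 1 1 u d e f') :
    f = f' := by
  have hv : ∀ e' ∈ edges κ 1 1, e' ≠ e → Tendsto (fun n => e'.l2sq (ψ n)) atTop (𝓝 0) := by
    intro e' he' hne
    have : ∀ n, e'.l2sq (ψ n) = 0 := fun n => by
      simp [Edge.l2sq, h.vanish e' he' hne n]
    simp_rw [this]; exact tendsto_const_nhds
  have e34 : (1 : ℝ) - 1 / 4 = 3 / 4 := by norm_num
  have hm := h.memHs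
  have ht := h.tendsto
  rw [← e34] at hm ht
  exact tendsto_nhds_unique
    (hf (1 / 4) (by norm_num) (by norm_num) φ hm ψ h.smooth ht h.trace hv)
    (hf' (1 / 4) (by norm_num) (by norm_num) φ hm ψ h.smooth ht h.trace hv)

lemma tendsto_flux (h : EdgeSequence κ e φ ψ) {u : Fin 2 → ℝ × ℝ → ℝ} {c f : ℝ}
    (hf : HasNormalFlux κ 1 1 u (fun _ => c) e f) : Tendsto (fun n => flux κ u c (ψ n)) atTop (𝓝 f) := by
  have hv : ∀ e' ∈ edges κ 1 1, e' ≠ e → Tendsto (fun n => e'.l2sq (ψ n)) atTop (𝓝 0) := by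
    intro e' he' hne
    have : ∀ n, e'.l2sq (ψ n) = 0 := fun n => by
      simp [Edge.l2sq, h.vanish e' he' hne n]
    simp_rw [this]; exact tendsto_const_nhds
  have e34 : (1 : ℝ) - 1 / 4 = 3 / 4 := by norm_num
  have hm := h.memHs
  have ht := h.tendsto
  rw [← e34] at hm ht
  exact hf (1 / 4) (by norm_num) (by norm_num) φ hm ψ h.smooth ht h.trace hv

lemma exists_flux (h : EdgeSequence κ e φ ψ) {u : Fin 2 → ℝ × ℝ → ℝ} {c : ℝ} (hu : IsField κ u c) :
    ∃ f, Tendsto (fun n => flux κ u c (ψ n)) atTop (𝓝 f) := by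
  obtain ⟨C, hC⟩ := flux_bound κ (s := 3 / 4) (by norm_num)
  have hul : ∀ i, l2sq (element κ 1 1) (u i) ≠ ⊤ := fun i => (ENNReal.add_ne_top.1 (hu.fin i).ne).1
  set A : ℝ≥0∞ := C * ((∑ i, hsNormSq (1 / 2) (element κ 1 1) (u i)) + ‖c‖ₑ ^ 2) with hA
  have hAt : A ≠ ⊤ := by
    refine ENNReal.mul_ne_top ENNReal.coe_ne_top (ENNReal.add_ne_top.2 ⟨?_, by finiteness⟩)
    exact ENNReal.sum_ne_top.2 fun i _ => (hu.fin i).ne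
  refine cauchySeq_tendsto_of_complete (Metric.cauchySeq_iff.2 fun ε hε => ?_)
  have hδ : 0 < ENNReal.ofReal (ε ^ 2 / 2) / (A + 1) :=
    ENNReal.div_pos (by simp; positivity) (by finiteness)
  have hδt : ENNReal.ofReal (ε ^ 2 / 2) / (A + 1) ≠ ⊤ := ENNReal.div_ne_top (by simp) (by simp)
  obtain ⟨N, hN⟩ := h.cauchyHs _ hδ
  refine ⟨N, fun m hm k hk => ?_⟩
  rw [Real.dist_eq, ← flux_sub hu.meas hul (h.smooth m) (h.smooth k)]
  have h1 := (hC u c _ hu.meas (fun i => (hu.fin i).ne) ((h.smooth m).sub (h.smooth k))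
    (ne_top_of_le_ne_top hδt (hN m hm k hk))).trans (mul_le_mul' le_rfl (hN m hm k hk))
  rw [← hA, enorm_sq_eq_ofReal] at h1
  have h2 : A * (ENNReal.ofReal (ε ^ 2 / 2) / (A + 1)) ≤ ENNReal.ofReal (ε ^ 2 / 2) :=
    calc _ ≤ (A + 1) * (ENNReal.ofReal (ε ^ 2 / 2) / (A + 1)) := by gcongr; exact le_self_add
      _ ≤ _ := ENNReal.mul_div_le
  have h3 := (ENNReal.ofReal_le_ofReal_iff (by positivity)).1 (h1.trans h2)
  refine abs_lt_of_sq_lt_sq (h3.trans_lt ?_) hε.le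
  have : 0 < ε ^ 2 := by positivity
  linarith

/-- An arbitrary admissible sequence differs from the given edge sequence by one that is Cauchy in
`H^s` and whose traces tend to zero on all edges. Thus the limit along a single edge sequence is the
limit along all. -/
theorem hasNormalFlux (h : EdgeSequence κ e φ ψ) {u : Fin 2 → ℝ × ℝ → ℝ} {c f : ℝ}
    (hu : IsField κ u c) (hf : Tendsto (fun n => flux κ u c (ψ n)) atTop (𝓝 f)) :
    HasNormalFlux κ 1 1 u (fun _ => c) e f := by
  intro ε hε hε2 φ' hφ' ψ' hψ' ht htr hv
  have hul : ∀ i, l2sq (element κ 1 1) (u i) ≠ ⊤ := fun i => (ENNReal.add_ne_top.1 (hu.fin i).ne).1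
  -- The two sequences converge in `H^{1-ε}` and in `H^{3/4}`; the smaller order is still above
  -- `1/2`.
  set s := min (1 - ε) (3 / 4) with hs
  have hs2 : 1 / 2 < s := lt_min (by linarith) (by norm_num)
  have hc : CauchyHs s (element κ 1 1) fun n x => ψ' n x - ψ n x := by
    refine CauchyHs.sub ?_ ?_ (fun n => (hψ' n).continuous.measurable) fun n => (h.smooth n).continuous.measurable
    · exact (cauchyHs_of_tendsto (fun n => (hψ' n).continuous.measurable) hφ'.1 ht).of_le (min_le_left _ _)
        (by linarith)
    · exact h.cauchyHs.of_le (min_le_right _ _) (by linarith)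
  have hlim := tendsto_flux_zero hu.meas hu.zero hu.fin hu.div hs2 (fun n => (hψ' n).sub (h.smooth n)) hc ?_
  · have := hlim.add hf
    rw [zero_add] at this
    refine this.congr fun n => ?_
    rw [flux_sub hu.meas hul (hψ' n) (h.smooth n), sub_add_cancel]; rfl
  · intro e' he'
    by_cases hne : e' = e
    · subst hne
      have hb : Tendsto (fun n => 2 * (e'.l2sq (fun x => ψ' n x - 1) + e'.l2sq fun x => ψ n x - 1)) atTop (𝓝 0) := by
        have := ENNReal.Tendsto.const_mul (htr.add h.trace) (Or.inr (by simp : (2 : ℝ≥0∞) ≠ ⊤))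
        simpa using this
      refine tendsto_of_tendsto_of_tendsto_of_le_of_le tendsto_const_nhds hb (fun _ => zero_le) fun n => ?_
      have e : (fun x => ψ' n x - ψ n x) = fun x => (ψ' n x - 1) - (ψ n x - 1) := by funext x; ring
      change e'.l2sq (fun x => ψ' n x - ψ n x) ≤ _
      rw [e]
      exact e'.l2sq_sub_le ((hψ' n).continuous.sub continuous_const)
    · refine (hv e' he' hne).congr fun n => e'.l2sq_congr fun t => ?_
      rw [h.vanish e' he' hne n, sub_zero]

end EdgeSequence

lemma exists_hasNormalFlux {κ : Shape} {u : Fin 2 → ℝ × ℝ → ℝ} {c : ℝ} (hu : IsField κ u c) {e : Edge}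
    (he : e ∈ edges κ 1 1) : ∃ f, HasNormalFlux κ 1 1 u (fun _ => c) e f := by
  obtain ⟨φ, ψ, h⟩ := exists_edgeSequence κ e he
  obtain ⟨f, hf⟩ := h.exists_flux hu
  exact ⟨f, h.hasNormalFlux hu hf⟩

lemma HasNormalFlux.unique {κ : Shape} {u : Fin 2 → ℝ × ℝ → ℝ} {d : ℝ × ℝ → ℝ} {e : Edge}
    (he : e ∈ edges κ 1 1) {f f' : ℝ} (hf : HasNormalFlux κ 1 1 u d e f)
    (hf' : HasNormalFlux κ 1 1 u d e f') : f = f' := by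
  obtain ⟨φ, ψ, h⟩ := exists_edgeSequence κ e he
  exact h.unique hf hf'

lemma partialD_const (a : ℝ) (i : Fin 2) (x : ℝ × ℝ) : partialD i (fun _ => a) x = 0 := by
  simp [partialD]

lemma integral_element_triangle (c : ℝ) : ∫ _ in element .triangle 1 1, c = c / 2 := by
  have h := integral_partialD .triangle 0 (ψ := fun x => x.1) contDiff_fst
  have e : ∀ x : ℝ × ℝ, partialD 0 (fun x : ℝ × ℝ => x.1) x = 1 := fun x => by
    rw [partialD, (hasFDerivAt_fst (p := x)).fderiv]; simp
  simp_rw [e] at h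
  have h2 : ∫ _ in element .triangle 1 1, c = c * ∫ _ in element .triangle 1 1, (1 : ℝ) := by
    rw [← integral_const_mul, mul_one]
  rw [h2, h]
  simp only [sliceHi, sliceLo]
  rw [intervalIntegral.integral_sub (by simp) (by simp)]
  simp
  ring

/-- The fluxes through the boundary of the triangle sum up to the integral of the divergence. -/
lemma sum_flux_triangle {u : Fin 2 → ℝ × ℝ → ℝ} {c : ℝ} (hu : IsField .triangle u c) {f g k : ℝ}
    (hf : HasNormalFlux .triangle 1 1 u (fun _ => c) ((0, 0), (1, 0)) f)
    (hg : HasNormalFlux .triangle 1 1 u (fun _ => c) ((1, 0), (1, 1)) g)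
    (hk : HasNormalFlux .triangle 1 1 u (fun _ => c) ((1, 1), (0, 0)) k) : f + g + k = c / 2 := by
  obtain ⟨φ₁, ψ₁, h₁⟩ := exists_edgeSequence .triangle ((0, 0), (1, 0)) (by simp [edges])
  obtain ⟨φ₂, ψ₂, h₂⟩ := exists_edgeSequence .triangle ((1, 0), (1, 1)) (by simp [edges])
  obtain ⟨φ₃, ψ₃, h₃⟩ := exists_edgeSequence .triangle ((1, 1), (0, 0)) (by simp [edges])
  have hul : ∀ i, l2sq (element .triangle 1 1) (u i) ≠ ⊤ := fun i => (ENNReal.add_ne_top.1 (hu.fin i).ne).1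
  have s1 : ContDiff ℝ ∞ fun _ : ℝ × ℝ => (1 : ℝ) := contDiff_const
  have sa : ∀ n, ContDiff ℝ ∞ fun x => 1 - ψ₂ n x := fun n => s1.sub (h₂.smooth n)
  have sb : ∀ n, ContDiff ℝ ∞ fun x => 1 - ψ₂ n x - ψ₃ n x := fun n => (sa n).sub (h₃.smooth n)
  have sc : ∀ n, ContDiff ℝ ∞ fun x => ψ₁ n x - (1 - ψ₂ n x - ψ₃ n x) := fun n => (h₁.smooth n).sub (sb n)
  -- The sum `ψ₁ + ψ₂ + ψ₃ - 1` has vanishing traces in the limit; it is written with differences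
  -- only. The flux functional of the constant `1` is `c` times the area `1/2`.
  have hc : CauchyHs (3 / 4) (element .triangle 1 1) fun n x => ψ₁ n x - (1 - ψ₂ n x - ψ₃ n x) :=
    h₁.cauchyHs.sub (((cauchyHs_const _ _ _).sub h₂.cauchyHs (fun n => measurable_const)
      fun n => (h₂.smooth n).continuous.measurable).sub h₃.cauchyHs (fun n => (sa n).continuous.measurable)
      fun n => (h₃.smooth n).continuous.measurable) (fun n => (h₁.smooth n).continuous.measurable)
      fun n => (sb n).continuous.measurable
  have hlim := tendsto_flux_zero hu.meas hu.zero hu.fin hu.div (by norm_num) sc hc ?_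
  · have e1 : flux .triangle u c (fun _ => 1) = c / 2 := by
      simp [flux, gradPairing, partialD_const]
      simpa using integral_element_triangle c
    have e2 : ∀ n, flux .triangle u c (fun x => ψ₁ n x - (1 - ψ₂ n x - ψ₃ n x)) =
        flux .triangle u c (ψ₁ n) - (c / 2 - flux .triangle u c (ψ₂ n) - flux .triangle u c (ψ₃ n)) := by
      intro n
      rw [flux_sub hu.meas hul (h₁.smooth n) (sb n), flux_sub hu.meas hul (sa n) (h₃.smooth n),
        flux_sub hu.meas hul s1 (h₂.smooth n), e1]
    simp_rw [e2] at hlim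
    have h3 := (h₁.tendsto_flux hf).sub ((tendsto_const_nhds.sub (h₂.tendsto_flux hg) (a := c / 2)).sub
      (h₃.tendsto_flux hk))
    have := tendsto_nhds_unique hlim h3
    linarith
  · intro e he
    simp only [edges, List.mem_cons, List.not_mem_nil, or_false] at he
    have n12 : (((0, 0), (1, 0)) : Edge) ≠ ((1, 0), (1, 1)) := by simp
    have n13 : (((0, 0), (1, 0)) : Edge) ≠ ((1, 1), (0, 0)) := by simp
    have n23 : (((1, 0), (1, 1)) : Edge) ≠ ((1, 1), (0, 0)) := by simp
    rcases he with rfl | rfl | rfl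
    · refine h₁.trace.congr fun n => Edge.l2sq_congr _ fun t => ?_
      rw [h₂.vanish _ (by simp [edges]) n12, h₃.vanish _ (by simp [edges]) n13]; ring
    · refine h₂.trace.congr fun n => Edge.l2sq_congr _ fun t => ?_
      rw [h₁.vanish _ (by simp [edges]) n12.symm, h₃.vanish _ (by simp [edges]) n23]; ring
    · refine h₃.trace.congr fun n => Edge.l2sq_congr _ fun t => ?_
      rw [h₁.vanish _ (by simp [edges]) n13.symm, h₂.vanish _ (by simp [edges]) n23.symm]; ring

/-! ### Estimates on the reference elements -/

/-- With `δ = 1` the mollification of `u` is the constant `∫ ρ u`, so the mollification error bound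
is a Poincaré inequality. -/
lemma exists_const_approx (κ : Shape) : ∃ C : ℝ≥0, ∀ u : ℝ × ℝ → ℝ, Measurable u → Integrable u →
    ∃ k : ℝ, l2sq (element κ 1 1) (fun x => u x - k) ≤ C * hsSemiSq (1 / 2) (element κ 1 1) u := by
  obtain ⟨ρ, hρ⟩ := exists_isMollifier κ
  obtain ⟨C, hC⟩ := l2sq_moll_sub_le hρ (convex_element κ) (measurableSet_element κ) (element_subset κ)
  refine ⟨C, fun u hum hu => ⟨∫ z, ρ z * u z, ?_⟩⟩
  have h := hC u hum hu 1 one_pos le_rfl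
  have e : ∀ x, moll ρ 1 u x = ∫ z, ρ z * u z := fun x => by simp [moll]
  simp_rw [e] at h
  rw [l2sq_sub_comm]
  simpa using h

/-- The function is Lipschitz, so the integrand is at most a multiple of `dist^(-3/2)`. As distances
are at most one, this lies below the power `-7/4`, whose integral is already bounded. -/
lemma hsSemiSq_ne_top_of_hasCompactSupport (κ : Shape) {ρ : ℝ × ℝ → ℝ} (h : ContDiff ℝ ∞ ρ)
    (hc : HasCompactSupport ρ) : hsSemiSq (3 / 4) (element κ 1 1) ρ ≠ ⊤ := by
  obtain ⟨L, hL⟩ := h.lipschitzWith_of_hasCompactSupport hc (by simp)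
  set Q : Set (ℝ × ℝ) := Set.Icc 0 1 ×ˢ Set.Icc 0 1 with hQ
  have key : ∀ x ∈ element κ 1 1, ∀ y ∈ element κ 1 1,
      ‖ρ y - ρ x‖ₑ ^ 2 / ENNReal.ofReal (eucl y x ^ (2 + 2 * (3 / 4 : ℝ))) ≤
        (L : ℝ≥0∞) ^ 2 * (ENNReal.ofReal (dist y x ^ (7 / 4 : ℝ)))⁻¹ := by
    intro x hx y hy
    rcases eq_or_ne y x with rfl | hxy
    · simp
    have hd : 0 < dist y x := dist_pos.2 hxy
    have hd1 := dist_le_one (element_subset κ hy) (element_subset κ hx)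
    have h1 : ‖ρ y - ρ x‖ₑ ^ 2 ≤ (L : ℝ≥0∞) ^ 2 * ENNReal.ofReal (dist y x ^ 2) := by
      rw [ENNReal.ofReal_pow hd.le, ← mul_pow]
      gcongr
      rw [← edist_eq_enorm_sub, ← edist_dist]
      exact hL y x
    rw [div_eq_mul_inv]
    refine (mul_le_mul' h1 le_rfl).trans ?_
    rw [mul_assoc]
    refine mul_le_mul' le_rfl ?_
    rw [← div_eq_mul_inv, ← ENNReal.ofReal_div_of_pos (by have := eucl_pos hxy; positivity),
      ← ENNReal.ofReal_inv_of_pos (by positivity)]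
    refine ENNReal.ofReal_le_ofReal ?_
    rw [div_le_iff₀ (by have := eucl_pos hxy; positivity), ← div_eq_inv_mul, le_div_iff₀ (by positivity)]
    calc dist y x ^ 2 * dist y x ^ (7 / 4 : ℝ) = dist y x ^ (2 + 7 / 4 : ℝ) := by
          rw [Real.rpow_add hd]; norm_num
      _ ≤ dist y x ^ (2 + 2 * (3 / 4 : ℝ)) := Real.rpow_le_rpow_of_exponent_ge hd hd1 (by norm_num)
      _ ≤ eucl y x ^ (2 + 2 * (3 / 4 : ℝ)) := Real.rpow_le_rpow hd.le (dist_le_eucl _ _) (by norm_num)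
  have h2 : hsSemiSq (3 / 4) (element κ 1 1) ρ ≤ ∫⁻ x in element κ 1 1, (L : ℝ≥0∞) ^ 2 * 256 := by
    refine setLIntegral_mono' (measurableSet_element κ) fun x hx => ?_
    calc _ ≤ ∫⁻ y in element κ 1 1, (L : ℝ≥0∞) ^ 2 * (ENNReal.ofReal (dist y x ^ (7 / 4 : ℝ)))⁻¹ := by
          refine setLIntegral_mono' (measurableSet_element κ) fun y hy => ?_
          exact (key y hy x hx).trans_eq (by rw [dist_comm])
      _ ≤ ∫⁻ y in Q, (L : ℝ≥0∞) ^ 2 * (ENNReal.ofReal (dist y x ^ (7 / 4 : ℝ)))⁻¹ :=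
          lintegral_mono_set (element_subset κ)
      _ = (L : ℝ≥0∞) ^ 2 * ∫⁻ y in Q, (ENNReal.ofReal (dist y x ^ (7 / 4 : ℝ)))⁻¹ :=
          lintegral_const_mul' _ _ (by finiteness)
      _ ≤ _ := mul_le_mul' le_rfl (lintegral_inv_dist_le (element_subset κ hx))
  refine ne_top_of_le_ne_top ?_ h2
  rw [lintegral_const, Measure.restrict_apply_univ]
  have := (volume_unit_le (element_subset κ)).trans_lt ENNReal.one_lt_top
  finiteness

lemma sum_shift (f : Fin 2 → ℝ) (l : Fin 2) : ∑ i, f i = f l + f (l + 1) := by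
  fin_cases l
  · simp [Fin.sum_univ_two]
  · simp [Fin.sum_univ_two, add_comm]

lemma hsSemiSq_sub_const (s : ℝ) (K : Set (ℝ × ℝ)) (f : ℝ × ℝ → ℝ) (k : ℝ) :
    hsSemiSq s K (fun x => f x - k) = hsSemiSq s K f := by
  simp [hsSemiSq]

/-- After subtracting `k` from `u l`, the first pairing is bounded by the norm of `u l - k`. In the
second the test function has equal values at the ends of the slices, so of `u (l + 1)` only its own
directional seminorm survives. -/
theorem flux_gap_le (κ : Shape) (l : Fin 2) : ∃ C : ℝ≥0, ∀ (u : Fin 2 → ℝ × ℝ → ℝ) (c k : ℝ) (ψ : ℝ × ℝ → ℝ),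
    (∀ i, Measurable (u i)) → (∀ i, hsNormSq (1 / 2) (element κ 1 1) (u i) < ⊤) →
    ahSemiSq (1 / 2) (element κ 1 1) (l + 1) (u (l + 1)) ≠ ⊤ →
    ContDiff ℝ ∞ ψ → hsNormSq (3 / 4) (element κ 1 1) ψ ≠ ⊤ →
    (∀ a, 0 < a → a < 1 → ψ (sliceLo κ (l + 1) a) = ψ (sliceHi κ (l + 1) a)) →
    ‖flux κ u c ψ - k * ∫ x in element κ 1 1, partialD l ψ x‖ₑ ^ 2 ≤
      C * (hsNormSq (1 / 2) (element κ 1 1) (fun x => u l x - k) +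
        ahSemiSq (1 / 2) (element κ 1 1) (l + 1) (u (l + 1)) + ‖c‖ₑ ^ 2) *
      hsNormSq (3 / 4) (element κ 1 1) ψ := by
  obtain ⟨C0, h0⟩ := pairing_le κ l (s := 3 / 4) (by norm_num)
  obtain ⟨C1, h1⟩ := pairing_le_of_ends κ (l + 1) (s := 3 / 4) (by norm_num)
  refine ⟨4 * (C0 + C1 + 1), fun u c k ψ hum hu hah hψ hψf hends => ?_⟩
  have hul : ∀ i, l2sq (element κ 1 1) (u i) ≠ ⊤ := fun i => (ENNReal.add_ne_top.1 (hu i).ne).1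
  have hψf' := (ENNReal.add_ne_top.1 hψf).2
  set N := hsNormSq (3 / 4) (element κ 1 1) ψ with hN
  have hSN : hsSemiSq (3 / 4) (element κ 1 1) ψ ≤ N := le_add_self
  have hLN : l2sq (element κ 1 1) ψ ≤ N := le_self_add
  have hwm : Measurable fun x => u l x - k := (hum l).sub measurable_const
  have hkl : l2sq (element κ 1 1) (fun _ => k) ≠ ⊤ := l2sq_ne_top_of_continuous κ continuous_const
  have hwf : hsNormSq (1 / 2) (element κ 1 1) (fun x => u l x - k) ≠ ⊤ := by
    rw [hsNormSq, hsSemiSq_sub_const]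
    refine ENNReal.add_ne_top.2 ⟨ne_top_of_le_ne_top ?_ (l2sq_sub_le (hum l)), (ENNReal.add_ne_top.1 (hu l).ne).2⟩
    exact ENNReal.mul_ne_top (by simp) (ENNReal.add_ne_top.2 ⟨hul l, hkl⟩)
  have b0 := (h0 _ ψ hwm hψ hwf hψf').trans (mul_le_mul' le_rfl (mul_le_mul' le_rfl hSN))
  have b1 := (h1 (u (l + 1)) ψ (hum _) hψ (hul _) hah hψf' hends).trans
    (mul_le_mul' le_rfl (mul_le_mul' le_rfl hSN))
  have b2 := (enorm_setIntegral_const_mul_sq_le (κ := κ) c hψ.continuous).trans (mul_le_mul' le_rfl hLN)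
  have e : flux κ u c ψ - k * ∫ x in element κ 1 1, partialD l ψ x =
      (∫ x in element κ 1 1, (u l x - k) * partialD l ψ x) +
      (∫ x in element κ 1 1, u (l + 1) x * partialD (l + 1) ψ x) + ∫ x in element κ 1 1, c * ψ x := by
    rw [flux, gradPairing_eq hum hul hψ, sum_shift _ l]
    simp_rw [sub_mul]
    rw [integral_sub, integral_const_mul k]
    · ring
    · exact integrableOn_mul_continuous (element_subset κ) (hum l).aestronglyMeasurable (hul l)
        (continuous_partialD hψ l)
    · exact integrableOn_of_continuous κ (continuous_const.mul (continuous_partialD hψ l))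
  rw [e]
  set A0 := hsNormSq (1 / 2) (element κ 1 1) (fun x => u l x - k)
  set A1 := ahSemiSq (1 / 2) (element κ 1 1) (l + 1) (u (l + 1))
  refine (enorm_add_sq_le _ _).trans ?_
  refine (mul_le_mul' le_rfl (add_le_add (enorm_add_sq_le _ _) le_rfl)).trans ?_
  refine (mul_le_mul' le_rfl (add_le_add (mul_le_mul' le_rfl (add_le_add b0 b1)) b2)).trans ?_
  push_cast
  calc 2 * (2 * (↑C0 * (A0 * N) + ↑C1 * (A1 * N)) + ‖c‖ₑ ^ 2 * N)
      ≤ 2 * (2 * (↑C0 * (A0 * N) + ↑C1 * (A1 * N)) + ‖c‖ₑ ^ 2 * N) +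
        (4 * (C0 * (A1 + ‖c‖ₑ ^ 2) + C1 * (A0 + ‖c‖ₑ ^ 2) + A0 + A1) + 2 * ‖c‖ₑ ^ 2) * N := le_self_add
    _ = _ := by ring

lemma slice_notMem (κ : Shape) (l : Fin 2) (a : ℝ) :
    sliceLo κ l a ∉ element κ 1 1 ∧ sliceHi κ l a ∉ element κ 1 1 := by
  cases κ <;> fin_cases l <;> simp [sliceLo, sliceHi, element]

/-- The right-hand side of the error estimate. -/
noncomputable def errSq (κ : Shape) (u : Fin 2 → ℝ × ℝ → ℝ) (l : Fin 2) : ℝ≥0∞ :=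
  hsSemiSq (1 / 2) (element κ 1 1) (u l) + ahSemiSq (1 / 2) (element κ 1 1) (l + 1) (u (l + 1))

/-- A component is close to a constant, and the divergence is controlled. -/
lemma exists_const_div (κ : Shape) (l : Fin 2) : ∃ C : ℝ≥0, ∀ u c, IsField κ u c → errSq κ u l ≠ ⊤ →
    ∃ k : ℝ, hsNormSq (1 / 2) (element κ 1 1) (fun x => u l x - k) ≤ C * errSq κ u l ∧
      ‖c‖ₑ ^ 2 ≤ C * errSq κ u l := by
  obtain ⟨C0, h0⟩ := exists_const_approx κ
  obtain ⟨C1, h1⟩ := flux_gap_le κ l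
  obtain ⟨ρ, hρ⟩ := exists_isMollifier κ
  have hf : hsNormSq (3 / 4) (element κ 1 1) ρ ≠ ⊤ :=
    ENNReal.add_ne_top.2 ⟨l2sq_ne_top_of_continuous κ hρ.smooth.continuous,
      hsSemiSq_ne_top_of_hasCompactSupport κ hρ.smooth hρ.hasCompactSupport⟩
  set M : ℝ≥0 := (hsNormSq (3 / 4) (element κ 1 1) ρ).toNNReal with hM
  have hMe : (M : ℝ≥0∞) = hsNormSq (3 / 4) (element κ 1 1) ρ := ENNReal.coe_toNNReal hf
  refine ⟨(C0 + 1) + C1 * (C0 + 2) * M, fun u c hu herr => ?_⟩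
  have hah := (ENNReal.add_ne_top.1 herr).2
  have hul : ∀ i, l2sq (element κ 1 1) (u i) ≠ ⊤ := fun i => (ENNReal.add_ne_top.1 (hu.fin i).ne).1
  obtain ⟨k, hk⟩ := h0 (u l) (hu.meas l) (integrable_of_memHs (hu.meas l) (hu.zero l) (hul l))
  have hk' : hsNormSq (1 / 2) (element κ 1 1) (fun x => u l x - k) ≤ (C0 + 1) * errSq κ u l := by
    rw [hsNormSq, hsSemiSq_sub_const, add_mul, one_mul]
    exact add_le_add (hk.trans (mul_le_mul' le_rfl le_self_add)) le_self_add
  have hz : ∀ l a, ρ (sliceLo κ l a) = 0 ∧ ρ (sliceHi κ l a) = 0 := fun l a =>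
    ⟨hρ.eq_zero (slice_notMem κ l a).1, hρ.eq_zero (slice_notMem κ l a).2⟩
  -- The bump `ρ` has compact support in the element and integral one. With the value `0` in place
  -- of the divergence, the flux functional at `ρ` is the weak divergence tested with `ρ`, that is
  -- `-c`. This bounds `c` by the two seminorms alone.
  have h2 := h1 u 0 k ρ hu.meas hu.fin hah hρ.smooth hf fun a _ _ => by rw [(hz _ a).1, (hz _ a).2]
  have e1 : ∫ x in element κ 1 1, partialD l ρ x = 0 := by
    rw [integral_partialD κ l hρ.smooth]
    simp [(hz l _).1, (hz l _).2]
  have e2 : flux κ u 0 ρ = -c := by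
    have e3 : ∫ x in element κ 1 1, c * ρ x = c := by
      rw [setIntegral_eq_integral_of_forall_compl_eq_zero fun v hv => by rw [hρ.eq_zero hv, mul_zero],
        integral_const_mul, hρ.integral_eq, mul_one]
    rw [flux, hu.div ρ hρ.smooth hρ.hasCompactSupport hρ.tsupport_subset, e3]
    simp
  rw [e1, e2, mul_zero, sub_zero, enorm_neg, ← hMe] at h2
  refine ⟨k, hk'.trans ?_, h2.trans ?_⟩
  · push_cast
    exact mul_le_mul' le_self_add le_rfl
  · push_cast
    calc _ ≤ C1 * ((C0 + 1) * errSq κ u l + errSq κ u l + ‖(0 : ℝ)‖ₑ ^ 2) * M := by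
          refine mul_le_mul' (mul_le_mul' le_rfl (add_le_add (add_le_add hk' ?_) le_rfl)) le_rfl
          exact le_add_self
      _ = (C1 * (C0 + 2) * M) * errSq κ u l := by simp; ring
      _ ≤ _ := mul_le_mul' le_add_self le_rfl

/-- The edge `e` has the normal `σ` times the unit vector in direction `l`. -/
structure EdgeAxis (κ : Shape) (e : Edge) (l : Fin 2) (σ : ℝ) : Prop where
  mem : e ∈ edges κ 1 1
  length : e.length = 1
  abs : σ = 1 ∨ σ = -1
  transverse : ∀ ψ : ℝ × ℝ → ℝ, (∀ e' ∈ edges κ 1 1, e' ≠ e → ∀ t, ψ (e'.point t) = 0) → ∀ a,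
    ψ (sliceLo κ (l + 1) a) = ψ (sliceHi κ (l + 1) a)
  integral : ∀ ψ : ℝ × ℝ → ℝ, (∀ e' ∈ edges κ 1 1, e' ≠ e → ∀ t, ψ (e'.point t) = 0) →
    ∫ a in (0 : ℝ)..1, (ψ (sliceHi κ l a) - ψ (sliceLo κ l a)) = σ * ∫ a in (0 : ℝ)..1, ψ (e.point a)

lemma tendsto_integral_point {e : Edge} (he : e.length = 1) {ψ : ℕ → ℝ × ℝ → ℝ} (hψ : ∀ n, Continuous (ψ n))
    (h : Tendsto (fun n => e.l2sq fun x => ψ n x - 1) atTop (𝓝 0)) :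
    Tendsto (fun n => ∫ a in (0 : ℝ)..1, ψ n (e.point a)) atTop (𝓝 1) := by
  have hpc := continuous_point e
  rw [← tendsto_sub_nhds_zero_iff]
  refine tendsto_zero_of_enorm_sq_le h fun n => ?_
  have e1 : (∫ a in (0 : ℝ)..1, ψ n (e.point a)) - 1 = ∫ a in Set.Icc (0 : ℝ) 1, (ψ n (e.point a) - 1) * 1 := by
    rw [integral_Icc_eq_integral_Ioc, ← intervalIntegral.integral_of_le zero_le_one]
    simp_rw [mul_one]
    rw [intervalIntegral.integral_sub (f := fun a => ψ n (e.point a)) (g := fun _ => 1)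
      (((hψ n).comp hpc).intervalIntegrable _ _) intervalIntegrable_const]
    simp
  rw [e1]
  refine (enorm_integral_mul_sq_le (((hψ n).comp hpc).sub continuous_const).aestronglyMeasurable
    aestronglyMeasurable_const).trans ?_
  simp [Edge.l2sq, he]

/-- The estimate `flux_gap_le` is applied along an edge sequence: the fluxes tend to `f`, and the
integrals of `∂_l ψ n` reduce to integrals over the edge and tend to `σ`. The norms of the test
functions stay bounded, so the estimate survives in the limit. -/
lemma exists_flux_close {κ : Shape} {l : Fin 2} {e : Edge} {σ : ℝ} (h : EdgeAxis κ e l σ) :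
    ∃ C : ℝ≥0, ∀ u c k, IsField κ u c → errSq κ u l ≠ ⊤ → ∀ f, HasNormalFlux κ 1 1 u (fun _ => c) e f →
      ‖σ * f - k‖ₑ ^ 2 ≤ C * (hsNormSq (1 / 2) (element κ 1 1) (fun x => u l x - k) + errSq κ u l + ‖c‖ₑ ^ 2) := by
  obtain ⟨φ, ψ, hψ⟩ := exists_edgeSequence κ e h.mem
  obtain ⟨M, hM⟩ := hψ.exists_bound
  obtain ⟨C, hC⟩ := flux_gap_le κ l
  refine ⟨C * M, fun u c k hu herr f hf => ?_⟩
  have hah := (ENNReal.add_ne_top.1 herr).2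
  have hv : ∀ n, ∀ e' ∈ edges κ 1 1, e' ≠ e → ∀ t, ψ n (e'.point t) = 0 := fun n e' he' hne t =>
    hψ.vanish e' he' hne n t
  have h1 : Tendsto (fun n => ∫ x in element κ 1 1, partialD l (ψ n) x) atTop (𝓝 (σ * 1)) := by
    simp_rw [fun n => integral_partialD κ l (hψ.smooth n), fun n => h.integral (ψ n) (hv n)]
    exact (tendsto_integral_point h.length (fun n => (hψ.smooth n).continuous) hψ.trace).const_mul σ
  have h2 := (hψ.tendsto_flux hf).sub (h1.const_mul k)
  have hen : Continuous fun x : ℝ => ‖x‖ₑ ^ 2 := (ENNReal.continuous_pow 2).comp continuous_enorm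
  have h3 := (hen.tendsto _).comp h2
  have e1 : ‖σ * f - k‖ₑ = ‖f - k * (σ * 1)‖ₑ := by
    rcases h.abs with rfl | rfl
    · simp
    · rw [← enorm_neg]; congr 1; ring
  rw [e1]
  refine le_of_tendsto h3 ?_
  filter_upwards [hM] with n hn
  refine (hC u c k (ψ n) hu.meas hu.fin hah (hψ.smooth n) (ne_top_of_le_ne_top ENNReal.coe_ne_top hn)
    fun a _ _ => h.transverse _ (hv n) a).trans ?_
  push_cast
  rw [mul_right_comm]
  refine mul_le_mul' (mul_le_mul' le_rfl hn) (add_le_add (add_le_add le_rfl ?_) le_rfl)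
  exact le_add_self

/-- The fluxes through the edges parallel to an axis are close to the component of the field. -/
theorem exists_flux_estimate {κ : Shape} {l : Fin 2} (E : List (Edge × ℝ)) (hE : ∀ e ∈ E, EdgeAxis κ e.1 l e.2) :
    ∃ C : ℝ≥0, ∀ u c, IsField κ u c → errSq κ u l ≠ ⊤ →
      ∃ k : ℝ, l2sq (element κ 1 1) (fun x => u l x - k) ≤ C * errSq κ u l ∧ ‖c‖ₑ ^ 2 ≤ C * errSq κ u l ∧
        ∀ e ∈ E, ∀ f, HasNormalFlux κ 1 1 u (fun _ => c) e.1 f → ‖e.2 * f - k‖ₑ ^ 2 ≤ C * errSq κ u l := by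
  obtain ⟨C0, h0⟩ := exists_const_div κ l
  choose! D hD using fun e (he : e ∈ E) => exists_flux_close (hE e he)
  set S : ℝ≥0 := ∑ e ∈ E.toFinset, D e with hS
  refine ⟨C0 + S * (2 * C0 + 1), fun u c hu herr => ?_⟩
  obtain ⟨k, hk, hc⟩ := h0 u c hu herr
  have hC0 : (C0 : ℝ≥0∞) * errSq κ u l ≤ ((C0 + S * (2 * C0 + 1) : ℝ≥0) : ℝ≥0∞) * errSq κ u l := by
    push_cast
    exact mul_le_mul' le_self_add le_rfl
  refine ⟨k, (le_self_add.trans hk).trans hC0, hc.trans hC0, fun e he f hf => ?_⟩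
  refine (hD e he u c k hu herr f hf).trans ?_
  have hDS : D e ≤ S := Finset.single_le_sum (f := D) (fun _ _ => zero_le) (List.mem_toFinset.2 he)
  calc (D e : ℝ≥0∞) * _ ≤ S * (C0 * errSq κ u l + errSq κ u l + C0 * errSq κ u l) := by
        gcongr
    _ = (S * (2 * C0 + 1)) * errSq κ u l := by ring
    _ ≤ _ := by push_cast; exact mul_le_mul' le_add_self le_rfl

/-! ### The interpolant on the reference elements -/

/-- The length in the arc-length measure cancels the one in the unit normal, so no square roots
enter the flux computations. -/
lemma Edge.integral_normal {e : Edge} (he : e.length ≠ 0) (p : Fin 2 → ℝ × ℝ → ℝ) :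
    e.integral (fun x => ∑ i, p i x * e.normal i) =
      ∫ t in (0 : ℝ)..1, (p 0 (e.point t) * (e.2.2 - e.1.2) - p 1 (e.point t) * (e.2.1 - e.1.1)) := by
  rw [Edge.integral, ← intervalIntegral.integral_const_mul]
  refine intervalIntegral.integral_congr fun t _ => ?_
  simp only [Fin.sum_univ_two, Edge.normal, Matrix.cons_val_zero, Matrix.cons_val_one]
  field_simp
  ring

/-- Both ends of each vertical slice lie on the bottom edge and on the hypotenuse, where the test
function vanishes. Of each horizontal slice only the right end contributes. -/
lemma edgeAxis_triangle_right : EdgeAxis .triangle ((1, 0), (1, 1)) 0 1 where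
  mem := by simp [edges]
  length := by norm_num [Edge.length, eucl]
  abs := Or.inl rfl
  transverse ψ h a := by
    have h1 := h ((0, 0), (1, 0)) (by simp [edges]) (by simp) a
    have h2 := h ((1, 1), (0, 0)) (by simp [edges]) (by simp) (1 - a)
    simp only [Edge.point] at h1 h2
    change ψ (a, 0) = ψ (a, a)
    norm_num at h1 h2
    rw [h1, h2]
  integral ψ h := by
    have h2 : ∀ a, ψ (a, a) = 0 := fun a => by
      have := h ((1, 1), (0, 0)) (by simp [edges]) (by simp) (1 - a)
      simpa [Edge.point] using this
    simp [sliceLo, sliceHi, h2, Edge.point]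

lemma edgeAxis_triangle_bottom : EdgeAxis .triangle ((0, 0), (1, 0)) 1 (-1) where
  mem := by simp [edges]
  length := by norm_num [Edge.length, eucl]
  abs := Or.inr rfl
  transverse ψ h a := by
    have h1 := h ((1, 0), (1, 1)) (by simp [edges]) (by simp) a
    have h2 := h ((1, 1), (0, 0)) (by simp [edges]) (by simp) (1 - a)
    simp only [Edge.point] at h1 h2
    change ψ (a, a) = ψ (1, a)
    norm_num at h1 h2
    rw [h1, h2]
  integral ψ h := by
    have h2 : ∀ a, ψ (a, a) = 0 := fun a => by
      have := h ((1, 1), (0, 0)) (by simp [edges]) (by simp) (1 - a)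
      simpa [Edge.point] using this
    simp [sliceLo, sliceHi, h2, Edge.point]

section rectangle
variable {ψ : ℝ × ℝ → ℝ} {e : Edge}

lemma rectangle_bottom (h : ∀ e' ∈ edges .rectangle 1 1, e' ≠ e → ∀ t, ψ (e'.point t) = 0)
    (he : e ≠ ((0, 0), (1, 0))) (a : ℝ) : ψ (a, 0) = 0 := by
  simpa [Edge.point] using h ((0, 0), (1, 0)) (by simp [edges]) he.symm a

lemma rectangle_right (h : ∀ e' ∈ edges .rectangle 1 1, e' ≠ e → ∀ t, ψ (e'.point t) = 0)
    (he : e ≠ ((1, 0), (1, 1))) (a : ℝ) : ψ (1, a) = 0 := by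
  simpa [Edge.point] using h ((1, 0), (1, 1)) (by simp [edges]) he.symm a

lemma rectangle_top (h : ∀ e' ∈ edges .rectangle 1 1, e' ≠ e → ∀ t, ψ (e'.point t) = 0)
    (he : e ≠ ((1, 1), (0, 1))) (a : ℝ) : ψ (a, 1) = 0 := by
  simpa [Edge.point] using h ((1, 1), (0, 1)) (by simp [edges]) he.symm (1 - a)

lemma rectangle_left (h : ∀ e' ∈ edges .rectangle 1 1, e' ≠ e → ∀ t, ψ (e'.point t) = 0)
    (he : e ≠ ((0, 1), (0, 0))) (a : ℝ) : ψ (0, a) = 0 := by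
  simpa [Edge.point] using h ((0, 1), (0, 0)) (by simp [edges]) he.symm (1 - a)

end rectangle

lemma integral_one_sub (f : ℝ → ℝ) : ∫ a in (0 : ℝ)..1, f (1 - a) = ∫ a in (0 : ℝ)..1, f a := by
  rw [intervalIntegral.integral_comp_sub_left f]; simp

lemma edgeAxis_rectangle_right : EdgeAxis .rectangle ((1, 0), (1, 1)) 0 1 where
  mem := by simp [edges]
  length := by norm_num [Edge.length, eucl]
  abs := Or.inl rfl
  transverse ψ h a := by
    change ψ (a, 0) = ψ (a, 1)
    rw [rectangle_bottom h (by simp), rectangle_top h (by simp)]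
  integral ψ h := by
    simp [sliceLo, sliceHi, rectangle_left h (by simp), Edge.point]

lemma edgeAxis_rectangle_left : EdgeAxis .rectangle ((0, 1), (0, 0)) 0 (-1) where
  mem := by simp [edges]
  length := by norm_num [Edge.length, eucl]
  abs := Or.inr rfl
  transverse ψ h a := by
    change ψ (a, 0) = ψ (a, 1)
    rw [rectangle_bottom h (by simp), rectangle_top h (by simp)]
  integral ψ h := by
    have := integral_one_sub fun a => ψ (0, a)
    simp [sliceLo, sliceHi, rectangle_right h (by simp), Edge.point, ← sub_eq_add_neg, this]

lemma edgeAxis_rectangle_bottom : EdgeAxis .rectangle ((0, 0), (1, 0)) 1 (-1) where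
  mem := by simp [edges]
  length := by norm_num [Edge.length, eucl]
  abs := Or.inr rfl
  transverse ψ h a := by
    change ψ (0, a) = ψ (1, a)
    rw [rectangle_left h (by simp), rectangle_right h (by simp)]
  integral ψ h := by
    simp [sliceLo, sliceHi, rectangle_top h (by simp), Edge.point]

lemma edgeAxis_rectangle_top : EdgeAxis .rectangle ((1, 1), (0, 1)) 1 1 where
  mem := by simp [edges]
  length := by norm_num [Edge.length, eucl]
  abs := Or.inl rfl
  transverse ψ h a := by
    change ψ (0, a) = ψ (1, a)
    rw [rectangle_left h (by simp), rectangle_right h (by simp)]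
  integral ψ h := by
    have := integral_one_sub fun a => ψ (a, 1)
    simp [sliceLo, sliceHi, rectangle_bottom h (by simp), Edge.point, ← sub_eq_add_neg, this]

/-- The fluxes of a Raviart–Thomas field on the reference triangle. -/
lemma fluxes_triangle {p : Fin 2 → ℝ × ℝ → ℝ} {a b g : ℝ} (hp : ∀ x : ℝ × ℝ, p 0 x = a + g * x.1 ∧ p 1 x = b + g * x.2) :
    Edge.integral ((0, 0), (1, 0)) (fun x => ∑ i, p i x * Edge.normal ((0, 0), (1, 0)) i) = -b ∧
    Edge.integral ((1, 0), (1, 1)) (fun x => ∑ i, p i x * Edge.normal ((1, 0), (1, 1)) i) = a + g ∧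
    Edge.integral ((1, 1), (0, 0)) (fun x => ∑ i, p i x * Edge.normal ((1, 1), (0, 0)) i) = b - a := by
  refine ⟨?_, ?_, ?_⟩ <;>
    rw [Edge.integral_normal (by norm_num [Edge.length, eucl])] <;>
    simp [Edge.point, hp]
  ring

/-- The fluxes of a Raviart–Thomas field on the reference square. -/
lemma fluxes_rectangle {p : Fin 2 → ℝ × ℝ → ℝ} {a b g k : ℝ}
    (hp : ∀ x : ℝ × ℝ, p 0 x = a + g * x.1 ∧ p 1 x = b + k * x.2) :
    Edge.integral ((0, 0), (1, 0)) (fun x => ∑ i, p i x * Edge.normal ((0, 0), (1, 0)) i) = -b ∧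
    Edge.integral ((1, 0), (1, 1)) (fun x => ∑ i, p i x * Edge.normal ((1, 0), (1, 1)) i) = a + g ∧
    Edge.integral ((1, 1), (0, 1)) (fun x => ∑ i, p i x * Edge.normal ((1, 1), (0, 1)) i) = b + k ∧
    Edge.integral ((0, 1), (0, 0)) (fun x => ∑ i, p i x * Edge.normal ((0, 1), (0, 0)) i) = -a := by
  refine ⟨?_, ?_, ?_, ?_⟩ <;>
    rw [Edge.integral_normal (by norm_num [Edge.length, eucl])] <;>
    simp [Edge.point, hp]

/-- Raviart–Thomas interpolants are unique. -/
lemma IsRTInterpolant.unique_reference {κ : Shape} {u : Fin 2 → ℝ × ℝ → ℝ} {d : ℝ × ℝ → ℝ} {p q : Fin 2 → ℝ × ℝ → ℝ}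
    (hp : IsRTInterpolant κ 1 1 u d p) (hq : IsRTInterpolant κ 1 1 u d q) : p = q := by
  have hf : ∀ e ∈ edges κ 1 1, e.integral (fun x => ∑ i, p i x * e.normal i) =
      e.integral (fun x => ∑ i, q i x * e.normal i) := fun e he => (hp.2 e he).unique he (hq.2 e he)
  cases κ
  · obtain ⟨a, b, g, hp'⟩ := hp.1
    obtain ⟨a', b', g', hq'⟩ := hq.1
    obtain ⟨f1, f2, f3⟩ := fluxes_triangle hp'
    obtain ⟨k1, k2, k3⟩ := fluxes_triangle hq'
    have h1 := hf _ (by simp [edges] : (((0, 0), (1, 0)) : Edge) ∈ _)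
    have h2 := hf _ (by simp [edges] : (((1, 0), (1, 1)) : Edge) ∈ _)
    have h3 := hf _ (by simp [edges] : (((1, 1), (0, 0)) : Edge) ∈ _)
    rw [f1, k1] at h1
    rw [f2, k2] at h2
    rw [f3, k3] at h3
    have ea : a = a' := by linarith
    have eb : b = b' := by linarith
    have eg : g = g' := by linarith
    funext i x
    fin_cases i
    · simp [(hp' x).1, (hq' x).1, ea, eg]
    · simp [(hp' x).2, (hq' x).2, eb, eg]
  · obtain ⟨a, b, g, m, hp'⟩ := hp.1
    obtain ⟨a', b', g', m', hq'⟩ := hq.1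
    obtain ⟨f1, f2, f3, f4⟩ := fluxes_rectangle hp'
    obtain ⟨k1, k2, k3, k4⟩ := fluxes_rectangle hq'
    have h1 := hf _ (by simp [edges] : (((0, 0), (1, 0)) : Edge) ∈ _)
    have h2 := hf _ (by simp [edges] : (((1, 0), (1, 1)) : Edge) ∈ _)
    have h3 := hf _ (by simp [edges] : (((1, 1), (0, 1)) : Edge) ∈ _)
    have h4 := hf _ (by simp [edges] : (((0, 1), (0, 0)) : Edge) ∈ _)
    rw [f1, k1] at h1
    rw [f2, k2] at h2
    rw [f3, k3] at h3
    rw [f4, k4] at h4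
    have ea : a = a' := by linarith
    have eb : b = b' := by linarith
    have eg : g = g' := by linarith
    have em : m = m' := by linarith
    funext i x
    fin_cases i
    · simp [(hp' x).1, (hq' x).1, ea, eg]
    · simp [(hp' x).2, (hq' x).2, eb, em]

/-- On the triangle the three fluxes of a Raviart–Thomas field add up to its slope, so the sum rule
forces the slope `c / 2` and the legs determine the rest; the hypotenuse is then matched by the same
rule. On the square the two directions decouple and each has two fluxes for two coefficients. -/
lemma exists_isRTInterpolant {κ : Shape} {u : Fin 2 → ℝ × ℝ → ℝ} {c : ℝ} (hu : IsField κ u c) :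
    ∃ p, IsRTInterpolant κ 1 1 u (fun _ => c) p := by
  cases κ
  · obtain ⟨f, hf⟩ := exists_hasNormalFlux hu (e := ((0, 0), (1, 0))) (by simp [edges])
    obtain ⟨g, hg⟩ := exists_hasNormalFlux hu (e := ((1, 0), (1, 1))) (by simp [edges])
    obtain ⟨k, hk⟩ := exists_hasNormalFlux hu (e := ((1, 1), (0, 0))) (by simp [edges])
    have hs := sum_flux_triangle hu hf hg hk
    set p : Fin 2 → ℝ × ℝ → ℝ := ![fun x => (g - c / 2) + c / 2 * x.1, fun x => -f + c / 2 * x.2] with hp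
    have hp' : ∀ x : ℝ × ℝ, p 0 x = (g - c / 2) + c / 2 * x.1 ∧ p 1 x = -f + c / 2 * x.2 := fun x => ⟨rfl, rfl⟩
    obtain ⟨f1, f2, f3⟩ := fluxes_triangle hp'
    refine ⟨p, ⟨_, _, _, hp'⟩, fun e he => ?_⟩
    simp only [edges, List.mem_cons, List.not_mem_nil, or_false] at he
    rcases he with rfl | rfl | rfl
    · rw [f1, neg_neg]; exact hf
    · rw [f2, sub_add_cancel]; exact hg
    · rw [f3, show -f - (g - c / 2) = k by linarith]; exact hk
  · obtain ⟨f, hf⟩ := exists_hasNormalFlux hu (e := ((0, 0), (1, 0))) (by simp [edges])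
    obtain ⟨g, hg⟩ := exists_hasNormalFlux hu (e := ((1, 0), (1, 1))) (by simp [edges])
    obtain ⟨k, hk⟩ := exists_hasNormalFlux hu (e := ((1, 1), (0, 1))) (by simp [edges])
    obtain ⟨m, hm⟩ := exists_hasNormalFlux hu (e := ((0, 1), (0, 0))) (by simp [edges])
    set p : Fin 2 → ℝ × ℝ → ℝ := ![fun x => -m + (g + m) * x.1, fun x => -f + (k + f) * x.2] with hp
    have hp' : ∀ x : ℝ × ℝ, p 0 x = -m + (g + m) * x.1 ∧ p 1 x = -f + (k + f) * x.2 := fun x => ⟨rfl, rfl⟩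
    obtain ⟨f1, f2, f3, f4⟩ := fluxes_rectangle hp'
    refine ⟨p, ⟨_, _, _, _, hp'⟩, fun e he => ?_⟩
    simp only [edges, List.mem_cons, List.not_mem_nil, or_false] at he
    rcases he with rfl | rfl | rfl | rfl
    · rw [f1, neg_neg]; exact hf
    · rw [f2, neg_add_eq_sub, add_sub_cancel_right]; exact hg
    · rw [f3, neg_add_eq_sub, add_sub_cancel_right]; exact hk
    · rw [f4, neg_neg]; exact hm

lemma l2sq_le_of_abs_le {κ : Shape} {f : ℝ × ℝ → ℝ} {α β : ℝ} (h : ∀ x ∈ element κ 1 1, |f x| ≤ |α| + |β|) :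
    l2sq (element κ 1 1) f ≤ 2 * (‖α‖ₑ ^ 2 + ‖β‖ₑ ^ 2) := by
  have h1 : ∀ x ∈ element κ 1 1, ‖f x‖ₑ ^ 2 ≤ 2 * (‖α‖ₑ ^ 2 + ‖β‖ₑ ^ 2) := by
    intro x hx
    have h2 := enorm_add_sq_le |α| |β|
    rw [enorm_sq_eq_ofReal |α|, enorm_sq_eq_ofReal |β|, sq_abs, sq_abs, ← enorm_sq_eq_ofReal,
      ← enorm_sq_eq_ofReal] at h2
    refine le_trans ?_ h2
    gcongr
    rw [Real.enorm_eq_ofReal_abs, Real.enorm_eq_ofReal (by positivity)]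
    exact ENNReal.ofReal_le_ofReal (h x hx)
  refine (setLIntegral_mono' (measurableSet_element κ) h1).trans ?_
  rw [lintegral_const, Measure.restrict_apply_univ]
  exact mul_le_of_le_one_right zero_le (volume_unit_le (element_subset κ))

/-- The estimate follows from the closeness of `p l` to a constant. -/
lemma l2sq_sub_le_of_close {κ : Shape} {v q : ℝ × ℝ → ℝ} (hv : Measurable v) {k α β : ℝ} {C : ℝ≥0} {S : ℝ≥0∞}
    (h1 : l2sq (element κ 1 1) (fun x => v x - k) ≤ C * S) (hα : ‖α‖ₑ ^ 2 ≤ C * S) (hβ : ‖β‖ₑ ^ 2 ≤ C * S)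
    (h : ∀ x ∈ element κ 1 1, |q x - k| ≤ |α| + |β|) :
    l2sq (element κ 1 1) (fun x => v x - q x) ≤ 10 * C * S := by
  have e : (fun x => v x - q x) = fun x => (v x - k) - (q x - k) := by funext x; ring
  rw [e]
  refine (l2sq_sub_le (hv.sub measurable_const)).trans ?_
  -- The constant is `2 * (1 + 2 * (1 + 1)) = 10`.
  calc 2 * (l2sq (element κ 1 1) (v - fun _ => k) + l2sq (element κ 1 1) fun x => q x - k)
      ≤ 2 * (C * S + 2 * (C * S + C * S)) := by
        refine mul_le_mul' le_rfl (add_le_add h1 ((l2sq_le_of_abs_le h).trans ?_))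
        gcongr
    _ = 10 * C * S := by ring

lemma abs_affine_le {α β t : ℝ} (h0 : 0 ≤ t) (h1 : t ≤ 1) : |α * (1 - t) + β * t| ≤ |α| + |β| := by
  refine (abs_add_le _ _).trans (add_le_add ?_ ?_) <;> rw [abs_mul]
  · exact mul_le_of_le_one_right (abs_nonneg _) (by rw [abs_of_nonneg] <;> linarith)
  · exact mul_le_of_le_one_right (abs_nonneg _) (by rw [abs_of_nonneg] <;> linarith)

lemma unit_of_mem {κ : Shape} {x : ℝ × ℝ} (hx : x ∈ element κ 1 1) : (0 ≤ x.1 ∧ x.1 ≤ 1) ∧ 0 ≤ x.2 ∧ x.2 ≤ 1 :=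
  ⟨(element_subset κ hx).1, (element_subset κ hx).2⟩

lemma enorm_half_sq_le (c : ℝ) : ‖c / 2‖ₑ ^ 2 ≤ ‖c‖ₑ ^ 2 := by
  rw [enorm_sq_eq_ofReal, enorm_sq_eq_ofReal]
  refine ENNReal.ofReal_le_ofReal ?_
  nlinarith [sq_nonneg c]

lemma interpolant_triangle {u : Fin 2 → ℝ × ℝ → ℝ} {c : ℝ} {p : Fin 2 → ℝ × ℝ → ℝ} (hu : IsField .triangle u c)
    (hp : IsRTInterpolant .triangle 1 1 u (fun _ => c) p) :
    ∃ f g, HasNormalFlux .triangle 1 1 u (fun _ => c) ((0, 0), (1, 0)) f ∧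
      HasNormalFlux .triangle 1 1 u (fun _ => c) ((1, 0), (1, 1)) g ∧
      ∀ x : ℝ × ℝ, p 0 x = g + c / 2 * (x.1 - 1) ∧ p 1 x = -f + c / 2 * x.2 := by
  obtain ⟨a, b, g, hp'⟩ := hp.1
  obtain ⟨f1, f2, f3⟩ := fluxes_triangle hp'
  have h1 := hp.2 _ (by simp [edges] : (((0, 0), (1, 0)) : Edge) ∈ _)
  have h2 := hp.2 _ (by simp [edges] : (((1, 0), (1, 1)) : Edge) ∈ _)
  have h3 := hp.2 _ (by simp [edges] : (((1, 1), (0, 0)) : Edge) ∈ _)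
  rw [f1] at h1
  rw [f2] at h2
  rw [f3] at h3
  have hs := sum_flux_triangle hu h1 h2 h3
  have hg : g = c / 2 := by linarith
  exact ⟨_, _, h1, h2, fun x => ⟨by rw [(hp' x).1, ← hg]; ring, by rw [(hp' x).2, ← hg]; ring⟩⟩

lemma interpolant_rectangle {u : Fin 2 → ℝ × ℝ → ℝ} {c : ℝ} {p : Fin 2 → ℝ × ℝ → ℝ}
    (hp : IsRTInterpolant .rectangle 1 1 u (fun _ => c) p) :
    ∃ f g h k, HasNormalFlux .rectangle 1 1 u (fun _ => c) ((0, 0), (1, 0)) f ∧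
      HasNormalFlux .rectangle 1 1 u (fun _ => c) ((1, 0), (1, 1)) g ∧
      HasNormalFlux .rectangle 1 1 u (fun _ => c) ((1, 1), (0, 1)) h ∧
      HasNormalFlux .rectangle 1 1 u (fun _ => c) ((0, 1), (0, 0)) k ∧
      ∀ x : ℝ × ℝ, p 0 x = -k * (1 - x.1) + g * x.1 ∧ p 1 x = -f * (1 - x.2) + h * x.2 := by
  obtain ⟨a, b, g, m, hp'⟩ := hp.1
  obtain ⟨f1, f2, f3, f4⟩ := fluxes_rectangle hp'
  have h1 := hp.2 _ (by simp [edges] : (((0, 0), (1, 0)) : Edge) ∈ _)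
  have h2 := hp.2 _ (by simp [edges] : (((1, 0), (1, 1)) : Edge) ∈ _)
  have h3 := hp.2 _ (by simp [edges] : (((1, 1), (0, 1)) : Edge) ∈ _)
  have h4 := hp.2 _ (by simp [edges] : (((0, 1), (0, 0)) : Edge) ∈ _)
  rw [f1] at h1
  rw [f2] at h2
  rw [f3] at h3
  rw [f4] at h4
  exact ⟨_, _, _, _, h1, h2, h3, h4, fun x => ⟨by rw [(hp' x).1]; ring, by rw [(hp' x).2]; ring⟩⟩

/-- The error estimate for component `l` on the reference element of shape `κ`. -/
def ErrorEstimate (κ : Shape) (l : Fin 2) (C : ℝ≥0) : Prop :=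
  ∀ u c, IsField κ u c → errSq κ u l ≠ ⊤ → ∀ p, IsRTInterpolant κ 1 1 u (fun _ => c) p →
    l2sq (element κ 1 1) (fun x => u l x - p l x) ≤ 10 * C * errSq κ u l

/-- The deviation of the component from `k` consists of the deviation of the flux through the right
leg and a multiple of `c / 2`. The flux through the hypotenuse, whose normal mixes the components,
has been eliminated. -/
lemma errorEstimate_triangle_zero : ∃ C, ErrorEstimate .triangle 0 C := by
  obtain ⟨C, hC⟩ := exists_flux_estimate [(((1, 0), (1, 1)), 1)] (by simpa using edgeAxis_triangle_right)
  refine ⟨C, fun u c hu herr p hp => ?_⟩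
  obtain ⟨k, hk, hc, hf⟩ := hC u c hu herr
  obtain ⟨f, g, h1, h2, hpc⟩ := interpolant_triangle hu hp
  refine l2sq_sub_le_of_close (hu.meas 0) hk (hf (((1, 0), (1, 1)), 1) (by simp) _ h2) ((enorm_half_sq_le c).trans hc) fun x hx => ?_
  have hQ := (unit_of_mem hx).1
  rw [(hpc x).1, show g + c / 2 * (x.1 - 1) - k = (1 * g - k) + -(c / 2 * (1 - x.1)) by ring]
  refine (abs_add_le _ _).trans (add_le_add le_rfl ?_)
  rw [abs_neg, abs_mul]
  exact mul_le_of_le_one_right (abs_nonneg _) (by rw [abs_of_nonneg] <;> linarith)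

lemma errorEstimate_triangle_one : ∃ C, ErrorEstimate .triangle 1 C := by
  obtain ⟨C, hC⟩ := exists_flux_estimate [(((0, 0), (1, 0)), -1)] (by simpa using edgeAxis_triangle_bottom)
  refine ⟨C, fun u c hu herr p hp => ?_⟩
  obtain ⟨k, hk, hc, hf⟩ := hC u c hu herr
  obtain ⟨f, g, h1, h2, hpc⟩ := interpolant_triangle hu hp
  refine l2sq_sub_le_of_close (hu.meas 1) hk (hf (((0, 0), (1, 0)), -1) (by simp) _ h1) ((enorm_half_sq_le c).trans hc) fun x hx => ?_
  have hQ := (unit_of_mem hx).2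
  rw [(hpc x).2, show -f + c / 2 * x.2 - k = (-1 * f - k) + c / 2 * x.2 by ring]
  refine (abs_add_le _ _).trans (add_le_add le_rfl ?_)
  rw [abs_mul]
  exact mul_le_of_le_one_right (abs_nonneg _) (by rw [abs_of_nonneg] <;> linarith)

/-- The component interpolates linearly between the signed fluxes through the two vertical edges,
both of which are close to the same constant `k`. -/
lemma errorEstimate_rectangle_zero : ∃ C, ErrorEstimate .rectangle 0 C := by
  obtain ⟨C, hC⟩ := exists_flux_estimate [(((1, 0), (1, 1)), 1), (((0, 1), (0, 0)), -1)]
    (by simpa using ⟨edgeAxis_rectangle_right, edgeAxis_rectangle_left⟩)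
  refine ⟨C, fun u c hu herr p hp => ?_⟩
  obtain ⟨k, hk, hc, hf⟩ := hC u c hu herr
  obtain ⟨f, g, h, m, h1, h2, h3, h4, hpc⟩ := interpolant_rectangle hp
  refine l2sq_sub_le_of_close (hu.meas 0) hk (hf (((0, 1), (0, 0)), -1) (by simp) _ h4)
    (hf (((1, 0), (1, 1)), 1) (by simp) _ h2) fun x hx => ?_
  rw [(hpc x).1, show -m * (1 - x.1) + g * x.1 - k = (-1 * m - k) * (1 - x.1) + (1 * g - k) * x.1 by ring]
  exact abs_affine_le (unit_of_mem hx).1.1 (unit_of_mem hx).1.2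

lemma errorEstimate_rectangle_one : ∃ C, ErrorEstimate .rectangle 1 C := by
  obtain ⟨C, hC⟩ := exists_flux_estimate [(((0, 0), (1, 0)), -1), (((1, 1), (0, 1)), 1)]
    (by simpa using ⟨edgeAxis_rectangle_bottom, edgeAxis_rectangle_top⟩)
  refine ⟨C, fun u c hu herr p hp => ?_⟩
  obtain ⟨k, hk, hc, hf⟩ := hC u c hu herr
  obtain ⟨f, g, h, m, h1, h2, h3, h4, hpc⟩ := interpolant_rectangle hp
  refine l2sq_sub_le_of_close (hu.meas 1) hk (hf (((0, 0), (1, 0)), -1) (by simp) _ h1)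
    (hf (((1, 1), (0, 1)), 1) (by simp) _ h3) fun x hx => ?_
  rw [(hpc x).2, show -f * (1 - x.2) + h * x.2 - k = (-1 * f - k) * (1 - x.2) + (1 * h - k) * x.2 by ring]
  exact abs_affine_le (unit_of_mem hx).2.1 (unit_of_mem hx).2.2

/-- The error estimate on the reference elements. -/
theorem l2sq_sub_interpolant_le : ∃ C : ℝ≥0, ∀ κ l u c, IsField κ u c →
    ∀ p, IsRTInterpolant κ 1 1 u (fun _ => c) p →
      l2sq (element κ 1 1) (fun x => u l x - p l x) ≤ C * errSq κ u l := by
  obtain ⟨A, hA⟩ := errorEstimate_triangle_zero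
  obtain ⟨B, hB⟩ := errorEstimate_triangle_one
  obtain ⟨D, hD⟩ := errorEstimate_rectangle_zero
  obtain ⟨E, hE⟩ := errorEstimate_rectangle_one
  set M : ℝ≥0 := max (max A B) (max D E) with hM
  have key : ∀ κ l, ErrorEstimate κ l M := by
    have mono : ∀ {κ l C}, C ≤ M → ErrorEstimate κ l C → ErrorEstimate κ l M := by
      intro κ l C h hC u c hu herr p hp
      refine (hC u c hu herr p hp).trans (mul_le_mul' (mul_le_mul' le_rfl ?_) le_rfl)
      exact_mod_cast h
    intro κ l
    cases κ <;> fin_cases l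
    · exact mono (by simp [hM]) hA
    · exact mono (by simp [hM]) hB
    · exact mono (by simp [hM]) hD
    · exact mono (by simp [hM]) hE
  -- The summand `1` makes the constant nonzero, so that the right-hand side is infinite whenever
  -- `errSq` is.
  refine ⟨10 * M + 1, fun κ l u c hu p hp => ?_⟩
  by_cases h : errSq κ u l = ⊤
  · rw [h, ENNReal.mul_top (by simp)]; exact le_top
  · refine (key κ l u c hu h p hp).trans (mul_le_mul' ?_ le_rfl)
    push_cast; exact le_self_add

/-! ### Independence of the representative -/

lemma hsSemiSq₁_congr {I : Set ℝ} {f g : ℝ → ℝ} (h : f =ᵐ[volume.restrict I] g) (s : ℝ) :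
    hsSemiSq₁ s I f = hsSemiSq₁ s I g :=
  lintegral_congr_ae (h.mono fun x hx => lintegral_congr_ae (h.mono fun y hy => by simp only [hx, hy]))

/-- Functions that agree almost everywhere in the plane agree almost everywhere on almost every
slice, by Fubini. -/
lemma ahSemiSq_congr {K : Set (ℝ × ℝ)} (hK : MeasurableSet K) {f g : ℝ × ℝ → ℝ}
    (h : f =ᵐ[volume.restrict K] g) (s : ℝ) (l : Fin 2) : ahSemiSq s K l f = ahSemiSq s K l g := by
  have h1 : ∀ᵐ x : ℝ × ℝ, x ∈ K → f x = g x := (ae_restrict_iff' hK).1 h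
  fin_cases l
  · have h2 : ∀ᵐ x : ℝ × ℝ, x.swap ∈ K → f x.swap = g x.swap :=
      measurePreserving_swap'.quasiMeasurePreserving.ae h1
    refine lintegral_congr_ae ((Measure.ae_ae_of_ae_prod h2).mono fun b hb => hsSemiSq₁_congr ?_ s)
    exact (ae_restrict_iff' (measurable_prodMk_right hK)).2 hb
  · refine lintegral_congr_ae ((Measure.ae_ae_of_ae_prod h1).mono fun b hb => hsSemiSq₁_congr ?_ s)
    exact (ae_restrict_iff' (measurable_prodMk_left hK)).2 hb

lemma gradPairing_congr {K : Set (ℝ × ℝ)} {u v : Fin 2 → ℝ × ℝ → ℝ}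
    (h : ∀ i, u i =ᵐ[volume.restrict K] v i) (ψ : ℝ × ℝ → ℝ) : gradPairing K u ψ = gradPairing K v ψ := by
  refine integral_congr_ae ?_
  filter_upwards [ae_all_iff.2 h] with x hx
  exact Finset.sum_congr rfl fun i _ => by rw [hx i]

lemma isRTInterpolant_congr {κ : Shape} {h₁ h₂ : ℝ} {u v : Fin 2 → ℝ × ℝ → ℝ} {d : ℝ × ℝ → ℝ}
    {p : Fin 2 → ℝ × ℝ → ℝ} (h : ∀ i, u i =ᵐ[volume.restrict (element κ h₁ h₂)] v i) :
    IsRTInterpolant κ h₁ h₂ u d p ↔ IsRTInterpolant κ h₁ h₂ v d p := by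
  simp only [IsRTInterpolant, HasNormalFlux, gradPairing_congr h]

/-- A field in `H^{1/2}` agrees with a measurable one vanishing outside the element. -/
lemma exists_isField {κ : Shape} {u : Fin 2 → ℝ × ℝ → ℝ} {c : ℝ} (hu : ∀ l, MemHs (1 / 2) (element κ 1 1) (u l))
    (hdiv : HasWeakDiv (element κ 1 1) u fun _ => c) :
    ∃ v, IsField κ v c ∧ ∀ i, u i =ᵐ[volume.restrict (element κ 1 1)] v i := by
  have hK := measurableSet_element κ
  set v : Fin 2 → ℝ × ℝ → ℝ := fun i => (element κ 1 1).indicator ((hu i).1.mk (u i)) with hv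
  have he : ∀ i, u i =ᵐ[volume.restrict (element κ 1 1)] v i := fun i =>
    (hu i).1.ae_eq_mk.trans (indicator_ae_eq_restrict hK).symm
  refine ⟨v, ⟨fun i => (hu i).1.stronglyMeasurable_mk.measurable.indicator hK,
    fun i x hx => Set.indicator_of_notMem hx _, fun i => ?_, fun φ hφ hc hs => ?_⟩, he⟩
  · rw [← hsNormSq_congr (he i)]; exact (hu i).2
  · rw [← gradPairing_congr he]; exact hdiv φ hφ hc hs

theorem reference_estimate : ∃ C : ℝ≥0, ∀ κ u c, (∀ l, MemHs (1 / 2) (element κ 1 1) (u l)) →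
    HasWeakDiv (element κ 1 1) u (fun _ => c) →
    (∃ p, IsRTInterpolant κ 1 1 u (fun _ => c) p) ∧ ∀ p, IsRTInterpolant κ 1 1 u (fun _ => c) p → ∀ l,
      l2sq (element κ 1 1) (fun x => u l x - p l x) ≤ C * errSq κ u l := by
  obtain ⟨C, hC⟩ := l2sq_sub_interpolant_le
  refine ⟨C, fun κ u c hu hdiv => ?_⟩
  obtain ⟨v, hv, he⟩ := exists_isField hu hdiv
  constructor
  · obtain ⟨p, hp⟩ := exists_isRTInterpolant hv
    exact ⟨p, (isRTInterpolant_congr he).2 hp⟩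
  · intro p hp l
    have h1 : l2sq (element κ 1 1) (fun x => u l x - p l x) = l2sq (element κ 1 1) fun x => v l x - p l x :=
      l2sq_congr ((he l).mono fun x hx => by simp only [hx])
    have h2 : errSq κ u l = errSq κ v l := by
      rw [errSq, errSq, hsSemiSq_congr (he l), ahSemiSq_congr (measurableSet_element κ) (he (l + 1))]
    rw [h1, h2]
    exact hC κ l v c hv p ((isRTInterpolant_congr he).1 hp)

/-! ### Scaling of the axes -/

/-- Scaling of the axes. -/
def dil (a b : ℝ) (x : ℝ × ℝ) : ℝ × ℝ := (a * x.1, b * x.2)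

/-- The Piola transform that belongs to a scaling of the axes, up to the determinant. -/
noncomputable def piola (a b : ℝ) (v : Fin 2 → ℝ × ℝ → ℝ) (i : Fin 2) (x : ℝ × ℝ) : ℝ :=
  (![a, b] : Fin 2 → ℝ) i * v i (dil a⁻¹ b⁻¹ x)

lemma l2sq_const_mul (K : Set (ℝ × ℝ)) (k : ℝ) (f : ℝ × ℝ → ℝ) :
    l2sq K (fun x => k * f x) = ‖k‖ₑ ^ 2 * l2sq K f := by
  simp_rw [l2sq, enorm_mul, mul_pow]
  exact lintegral_const_mul' _ _ (by simp)

lemma hsSemiSq_const_mul (s : ℝ) (K : Set (ℝ × ℝ)) (k : ℝ) (f : ℝ × ℝ → ℝ) :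
    hsSemiSq s K (fun x => k * f x) = ‖k‖ₑ ^ 2 * hsSemiSq s K f := by
  simp_rw [hsSemiSq, ← mul_sub, enorm_mul, mul_pow, mul_div_assoc]
  simp_rw [fun x => lintegral_const_mul' (μ := volume.restrict K) (‖k‖ₑ ^ 2)
    (fun y => ‖f x - f y‖ₑ ^ 2 / ENNReal.ofReal (eucl x y ^ (2 + 2 * s))) (by simp)]
  exact lintegral_const_mul' _ _ (by simp)

lemma hsNormSq_const_mul (s : ℝ) (K : Set (ℝ × ℝ)) (k : ℝ) (f : ℝ × ℝ → ℝ) :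
    hsNormSq s K (fun x => k * f x) = ‖k‖ₑ ^ 2 * hsNormSq s K f := by
  rw [hsNormSq, l2sq_const_mul, hsSemiSq_const_mul, ← mul_add]; rfl

section
variable {a b h₁ h₂ : ℝ} {κ : Shape}

lemma dil_dil_inv (ha : 0 < a) (hb : 0 < b) (x : ℝ × ℝ) : dil a b (dil a⁻¹ b⁻¹ x) = x := by
  ext <;> simp [dil, ha.ne', hb.ne']

lemma dil_inv_dil (ha : 0 < a) (hb : 0 < b) (x : ℝ × ℝ) : dil a⁻¹ b⁻¹ (dil a b x) = x := by
  ext <;> simp [dil, ha.ne', hb.ne']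

/-- Scaling of the axes as a homeomorphism. -/
noncomputable def dilHomeo (ha : 0 < a) (hb : 0 < b) : (ℝ × ℝ) ≃ₜ (ℝ × ℝ) where
  toFun := dil a b
  invFun := dil a⁻¹ b⁻¹
  left_inv := dil_inv_dil ha hb
  right_inv := dil_dil_inv ha hb
  continuous_toFun := by unfold dil; fun_prop
  continuous_invFun := by unfold dil; fun_prop

lemma measurableEmbedding_dil (ha : 0 < a) (hb : 0 < b) : MeasurableEmbedding (dil a b) :=
  (dilHomeo ha hb).measurableEmbedding

lemma contDiff_dil (a b : ℝ) : ContDiff ℝ ∞ (dil a b) := by unfold dil; fun_prop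

lemma mem_element_dil (ha : 0 < a) (hb : 0 < b) (x : ℝ × ℝ) :
    dil a b x ∈ element κ (a * h₁) (b * h₂) ↔ x ∈ element κ h₁ h₂ := by
  cases κ
  · have e : b * h₂ * (a * x.1) / (a * h₁) = b * (h₂ * x.1 / h₁) := by
      rw [show b * h₂ * (a * x.1) = a * (b * (h₂ * x.1)) by ring, mul_div_mul_left _ _ ha.ne', mul_div_assoc]
    simp only [element, dil, Set.mem_ofPred_eq, e, mul_pos_iff_of_pos_left ha, mul_pos_iff_of_pos_left hb,
      mul_lt_mul_iff_right₀ ha, mul_lt_mul_iff_right₀ hb]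
  · simp only [element, dil, Set.mem_ofPred_eq, mul_pos_iff_of_pos_left ha, mul_pos_iff_of_pos_left hb,
      mul_lt_mul_iff_right₀ ha, mul_lt_mul_iff_right₀ hb]

lemma preimage_element (ha : 0 < a) (hb : 0 < b) :
    dil a b ⁻¹' element κ (a * h₁) (b * h₂) = element κ h₁ h₂ := by
  ext x; exact mem_element_dil ha hb x

lemma map_dil (ha : 0 < a) (hb : 0 < b) :
    Measure.map (dil a b) volume = ENNReal.ofReal ((a * b)⁻¹) • (volume : Measure (ℝ × ℝ)) := by
  have e : dil a b = Prod.map (a * ·) (b * ·) := rfl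
  rw [e, volume_eq_prod', ← Measure.map_prod_map _ _ (by fun_prop) (by fun_prop), Real.map_volume_mul_left ha.ne',
    Real.map_volume_mul_left hb.ne', Measure.prod_smul_left, Measure.prod_smul_right, smul_smul,
    ← ENNReal.ofReal_mul (abs_nonneg _), ← abs_mul, ← mul_inv, abs_of_pos (by positivity)]

lemma map_restrict_dil (ha : 0 < a) (hb : 0 < b) :
    Measure.map (dil a b) (volume.restrict (element κ h₁ h₂)) =
      ENNReal.ofReal ((a * b)⁻¹) • volume.restrict (element κ (a * h₁) (b * h₂)) := by
  rw [← preimage_element ha hb, ← (measurableEmbedding_dil ha hb).restrict_map, map_dil ha hb, Measure.restrict_smul]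

lemma setLIntegral_dil (ha : 0 < a) (hb : 0 < b) (f : ℝ × ℝ → ℝ≥0∞) :
    ∫⁻ x in element κ h₁ h₂, f (dil a b x) =
      ENNReal.ofReal ((a * b)⁻¹) * ∫⁻ x in element κ (a * h₁) (b * h₂), f x := by
  rw [← (measurableEmbedding_dil ha hb).lintegral_map, map_restrict_dil ha hb, lintegral_smul_measure, smul_eq_mul]

lemma setIntegral_dil (ha : 0 < a) (hb : 0 < b) (f : ℝ × ℝ → ℝ) :
    ∫ x in element κ h₁ h₂, f (dil a b x) =
      (a * b)⁻¹ * ∫ x in element κ (a * h₁) (b * h₂), f x := by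
  rw [← (measurableEmbedding_dil ha hb).integral_map, map_restrict_dil ha hb, integral_smul_measure,
    ENNReal.toReal_ofReal (by positivity), smul_eq_mul]

lemma l2sq_dil (ha : 0 < a) (hb : 0 < b) (f : ℝ × ℝ → ℝ) :
    l2sq (element κ h₁ h₂) (fun x => f (dil a b x)) =
      ENNReal.ofReal ((a * b)⁻¹) * l2sq (element κ (a * h₁) (b * h₂)) f :=
  setLIntegral_dil ha hb fun x => ‖f x‖ₑ ^ 2

lemma eucl_dil_le (ha : 0 < a) (hb : 0 < b) (x y : ℝ × ℝ) : eucl (dil a b x) (dil a b y) ≤ max a b * eucl x y := by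
  have hm : 0 ≤ max a b := le_max_of_le_left ha.le
  have h1 : a ^ 2 ≤ max a b ^ 2 := pow_le_pow_left₀ ha.le (le_max_left _ _) 2
  have h2 : b ^ 2 ≤ max a b ^ 2 := pow_le_pow_left₀ hb.le (le_max_right _ _) 2
  rw [eucl, eucl, ← Real.sqrt_sq hm, ← Real.sqrt_mul (sq_nonneg _)]
  refine Real.sqrt_le_sqrt ?_
  simp only [dil]
  nlinarith [mul_le_mul_of_nonneg_right h1 (sq_nonneg (x.1 - y.1)),
    mul_le_mul_of_nonneg_right h2 (sq_nonneg (x.2 - y.2))]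

/-- Distances are stretched by at most `max a b`, and each of the two substitutions contributes the
Jacobian. For `s = 1/2` the kernel yields the cube of the larger scale, which is the source of
`h_max³`. -/
lemma hsSemiSq_dil_le (ha : 0 < a) (hb : 0 < b) {s : ℝ} (hs : 0 < s) (f : ℝ × ℝ → ℝ) :
    hsSemiSq s (element κ h₁ h₂) (fun x => f (dil a b x)) ≤
      ENNReal.ofReal (max a b ^ (2 + 2 * s) * ((a * b)⁻¹ * (a * b)⁻¹)) *
        hsSemiSq s (element κ (a * h₁) (b * h₂)) f := by
  set m := max a b with hm
  have hm0 : 0 < m := lt_max_of_lt_left ha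
  set k : ℝ × ℝ → ℝ × ℝ → ℝ≥0∞ := fun x y => ‖f x - f y‖ₑ ^ 2 / ENNReal.ofReal (eucl x y ^ (2 + 2 * s)) with hk
  have key : ∀ x y, ‖f (dil a b x) - f (dil a b y)‖ₑ ^ 2 / ENNReal.ofReal (eucl x y ^ (2 + 2 * s)) ≤
      ENNReal.ofReal (m ^ (2 + 2 * s)) * k (dil a b x) (dil a b y) := by
    intro x y
    rcases eq_or_ne x y with rfl | hxy
    · simp
    have h0 := eucl_pos hxy
    have h1 : dil a b x ≠ dil a b y := fun h => hxy ((measurableEmbedding_dil ha hb).injective h)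
    have h2 := eucl_pos h1
    have h3 : ENNReal.ofReal (m ^ (2 + 2 * s)) ≠ 0 := by simp; positivity
    simp only [hk]
    rw [div_eq_mul_inv, div_eq_mul_inv, mul_left_comm]
    refine mul_le_mul' le_rfl ?_
    rw [← ENNReal.ofReal_inv_of_pos (by positivity), ← ENNReal.ofReal_inv_of_pos (by positivity),
      ← ENNReal.ofReal_mul (by positivity)]
    refine ENNReal.ofReal_le_ofReal ?_
    rw [← div_eq_mul_inv, le_div_iff₀ (by positivity), inv_mul_le_iff₀ (by positivity), mul_comm (eucl x y ^ _),
      ← Real.mul_rpow hm0.le h0.le]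
    exact Real.rpow_le_rpow h2.le (eucl_dil_le ha hb x y) (by linarith)
  calc hsSemiSq s (element κ h₁ h₂) (fun x => f (dil a b x))
      ≤ ∫⁻ x in element κ h₁ h₂, ∫⁻ y in element κ h₁ h₂,
          ENNReal.ofReal (m ^ (2 + 2 * s)) * k (dil a b x) (dil a b y) :=
        lintegral_mono fun x => lintegral_mono fun y => key x y
    _ = ENNReal.ofReal (m ^ (2 + 2 * s)) * (ENNReal.ofReal ((a * b)⁻¹) * (ENNReal.ofReal ((a * b)⁻¹) *
          hsSemiSq s (element κ (a * h₁) (b * h₂)) f)) := by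
        simp_rw [fun x => lintegral_const_mul' (μ := volume.restrict (element κ h₁ h₂))
          (ENNReal.ofReal (m ^ (2 + 2 * s))) (fun y => k (dil a b x) (dil a b y)) ENNReal.ofReal_ne_top,
          fun x => setLIntegral_dil (κ := κ) (h₁ := h₁) (h₂ := h₂) ha hb (k (dil a b x))]
        rw [lintegral_const_mul' _ _ ENNReal.ofReal_ne_top, lintegral_const_mul' _ _ ENNReal.ofReal_ne_top,
          setLIntegral_dil ha hb fun x => ∫⁻ y in element κ (a * h₁) (b * h₂), k x y]
        rfl
    _ = _ := by
        rw [ENNReal.ofReal_mul (by positivity), ENNReal.ofReal_mul (by positivity)]; ring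

lemma exists_hsNormSq_dil_le (ha : 0 < a) (hb : 0 < b) {s : ℝ} (hs : 0 < s) :
    ∃ C : ℝ≥0, ∀ (κ : Shape) (h₁ h₂ : ℝ) (f : ℝ × ℝ → ℝ), hsNormSq s (element κ h₁ h₂) (fun x => f (dil a b x)) ≤
      C * hsNormSq s (element κ (a * h₁) (b * h₂)) f := by
  refine ⟨((a * b)⁻¹).toNNReal + (max a b ^ (2 + 2 * s) * ((a * b)⁻¹ * (a * b)⁻¹)).toNNReal,
    fun κ h₁ h₂ f => ?_⟩
  rw [hsNormSq, hsNormSq, l2sq_dil ha hb]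
  refine (add_le_add le_rfl (hsSemiSq_dil_le ha hb hs f)).trans ?_
  push_cast
  rw [add_mul, mul_add, mul_add]
  exact add_le_add le_self_add le_add_self

lemma memHs_dil (ha : 0 < a) (hb : 0 < b) {s : ℝ} (hs : 0 < s) {f : ℝ × ℝ → ℝ}
    (h : MemHs s (element κ (a * h₁) (b * h₂)) f) : MemHs s (element κ h₁ h₂) fun x => f (dil a b x) := by
  constructor
  · have h1 : AEStronglyMeasurable f (Measure.map (dil a b) (volume.restrict (element κ h₁ h₂))) := by
      rw [map_restrict_dil ha hb]
      exact h.1.mono_ac Measure.smul_absolutelyContinuous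
    exact h1.comp_measurable (measurableEmbedding_dil ha hb).measurable
  · obtain ⟨C, hC⟩ := exists_hsNormSq_dil_le ha hb hs
    exact (hC κ h₁ h₂ f).trans_lt (ENNReal.mul_lt_top ENNReal.coe_lt_top h.2)

lemma partialD_dil (a b : ℝ) {ψ : ℝ × ℝ → ℝ} (hψ : ContDiff ℝ ∞ ψ) (i : Fin 2) (x : ℝ × ℝ) :
    partialD i (fun x => ψ (dil a b x)) x = (![a, b] : Fin 2 → ℝ) i * partialD i ψ (dil a b x) := by
  have h1 : HasFDerivAt (dil a b)
      ((a • ContinuousLinearMap.fst ℝ ℝ ℝ).prod (b • ContinuousLinearMap.snd ℝ ℝ ℝ)) x :=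
    (hasFDerivAt_fst.const_mul a).prodMk (hasFDerivAt_snd.const_mul b)
  have h2 := ((hψ.differentiable (by simp) (dil a b x)).hasFDerivAt.comp x h1).fderiv
  change fderiv ℝ (ψ ∘ dil a b) x _ = _
  rw [h2, partialD]
  fin_cases i
  · have e : ((a, 0) : ℝ × ℝ) = a • (1, 0) := by simp
    simp only [ContinuousLinearMap.comp_apply, ContinuousLinearMap.prod_apply]
    simp
    rw [e, map_smul, smul_eq_mul]
  · have e : ((0, b) : ℝ × ℝ) = b • (0, 1) := by simp
    simp only [ContinuousLinearMap.comp_apply, ContinuousLinearMap.prod_apply]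
    simp
    rw [e, map_smul, smul_eq_mul]

/-- The factors that the chain rule produces in the gradient are absorbed into the field; this is
the reason for the Piola transform. The Jacobian remains. -/
lemma gradPairing_dil (ha : 0 < a) (hb : 0 < b) (u : Fin 2 → ℝ × ℝ → ℝ) {ψ : ℝ × ℝ → ℝ} (hψ : ContDiff ℝ ∞ ψ) :
    gradPairing (element κ h₁ h₂) u (fun x => ψ (dil a b x)) =
      (a * b)⁻¹ * gradPairing (element κ (a * h₁) (b * h₂)) (piola a b u) ψ := by
  rw [gradPairing, gradPairing, ← setIntegral_dil ha hb]
  refine integral_congr_ae (Eventually.of_forall fun x => ?_)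
  simp only [piola, partialD_dil a b hψ, dil_inv_dil ha hb]
  exact Finset.sum_congr rfl fun i _ => by ring

lemma hasWeakDiv_piola (ha : 0 < a) (hb : 0 < b) {u : Fin 2 → ℝ × ℝ → ℝ} {c : ℝ}
    (h : HasWeakDiv (element κ h₁ h₂) u fun _ => c) :
    HasWeakDiv (element κ (a * h₁) (b * h₂)) (piola a b u) fun _ => c := by
  intro φ hφ hc hs
  have h1 := h (fun x => φ (dil a b x)) (hφ.comp (contDiff_dil a b)) (hc.comp_homeomorph (dilHomeo ha hb)) ?_
  · rw [gradPairing_dil ha hb u hφ, setIntegral_dil ha hb fun x => c * φ x, ← mul_neg] at h1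
    exact mul_left_cancel₀ (by positivity) h1
  · have e := tsupport_comp_eq_preimage φ (dilHomeo ha hb)
    change tsupport (φ ∘ dil a b) = dil a b ⁻¹' tsupport φ at e
    change tsupport (φ ∘ dil a b) ⊆ _
    rw [e, ← preimage_element ha hb]
    exact Set.preimage_mono hs

/-- The image of an edge. -/
def Edge.dil (a b : ℝ) (e : Edge) : Edge := (RTAniso.dil a b e.1, RTAniso.dil a b e.2)

lemma edges_dil (κ : Shape) (a b h₁ h₂ : ℝ) : edges κ (a * h₁) (b * h₂) = (edges κ h₁ h₂).map (Edge.dil a b) := by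
  cases κ <;> simp [edges, Edge.dil, dil]

lemma Edge.dil_point (a b : ℝ) (e : Edge) (t : ℝ) : (e.dil a b).point t = RTAniso.dil a b (e.point t) := by
  ext <;> simp [Edge.point, Edge.dil, RTAniso.dil] <;> ring

lemma Edge.dil_injective (ha : 0 < a) (hb : 0 < b) : Function.Injective (Edge.dil a b) := by
  intro e e' h
  have h1 := congrArg Prod.fst h
  have h2 := congrArg Prod.snd h
  exact Prod.ext ((measurableEmbedding_dil ha hb).injective h1) ((measurableEmbedding_dil ha hb).injective h2)

lemma edge_length_pos (h₁_pos : 0 < h₁) (h₂_pos : 0 < h₂) {e : Edge} (he : e ∈ edges κ h₁ h₂) : 0 < e.length := by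
  refine eucl_pos ?_
  cases κ <;> simp only [edges, List.mem_cons, List.not_mem_nil, or_false] at he
  · rcases he with rfl | rfl | rfl <;> simp [h₁_pos.ne', h₂_pos.ne', h₁_pos.ne, h₂_pos.ne]
  · rcases he with rfl | rfl | rfl | rfl <;> simp [h₁_pos.ne', h₂_pos.ne', h₁_pos.ne, h₂_pos.ne]

lemma tendsto_l2sq_dil {e : Edge} (he : 0 < (e.dil a b).length) {f : ℕ → ℝ × ℝ → ℝ}
    (h : Tendsto (fun n => (e.dil a b).l2sq (f n)) atTop (𝓝 0)) :
    Tendsto (fun n => e.l2sq fun x => f n (dil a b x)) atTop (𝓝 0) := by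
  have e1 : ∀ n, e.l2sq (fun x => f n (dil a b x)) =
      ENNReal.ofReal (e.length / (e.dil a b).length) * (e.dil a b).l2sq (f n) := by
    intro n
    simp only [Edge.l2sq, Edge.dil_point]
    rw [← mul_assoc, ← ENNReal.ofReal_mul' he.le, div_mul_cancel₀ _ he.ne']
  simp_rw [e1]
  simpa using ENNReal.Tendsto.const_mul h (Or.inr (ENNReal.ofReal_ne_top (r := e.length / (e.dil a b).length)))

lemma tendsto_hsNormSq_dil (ha : 0 < a) (hb : 0 < b) {s : ℝ} (hs : 0 < s) {f : ℕ → ℝ × ℝ → ℝ}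
    (h : Tendsto (fun n => hsNormSq s (element κ (a * h₁) (b * h₂)) (f n)) atTop (𝓝 0)) :
    Tendsto (fun n => hsNormSq s (element κ h₁ h₂) fun x => f n (dil a b x)) atTop (𝓝 0) := by
  obtain ⟨C, hC⟩ := exists_hsNormSq_dil_le ha hb hs
  have := ENNReal.Tendsto.const_mul h (Or.inr (ENNReal.coe_ne_top (r := C)))
  rw [mul_zero] at this
  exact tendsto_of_tendsto_of_tendsto_of_le_of_le tendsto_const_nhds this (fun _ => zero_le)
    fun n => hC κ h₁ h₂ (f n)

lemma hasNormalFlux_piola (ha : 0 < a) (hb : 0 < b) (h₁_pos : 0 < h₁) (h₂_pos : 0 < h₂)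
    {u : Fin 2 → ℝ × ℝ → ℝ} {c : ℝ} {e : Edge} (he : e ∈ edges κ h₁ h₂) {f : ℝ}
    (h : HasNormalFlux κ h₁ h₂ u (fun _ => c) e f) :
    HasNormalFlux κ (a * h₁) (b * h₂) (piola a b u) (fun _ => c) (e.dil a b) (a * b * f) := by
  intro ε hε hε2 φ hφ ψ hψ ht htr hv
  have hmem : ∀ {e}, e ∈ edges κ h₁ h₂ → e.dil a b ∈ edges κ (a * h₁) (b * h₂) := fun {e} he => by
    rw [edges_dil]; exact List.mem_map_of_mem he
  have hlen : ∀ {e}, e ∈ edges κ h₁ h₂ → 0 < (e.dil a b).length := fun he =>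
    edge_length_pos (mul_pos ha h₁_pos) (mul_pos hb h₂_pos) (hmem he)
  have g1 := memHs_dil (κ := κ) (h₁ := h₁) (h₂ := h₂) ha hb (by linarith) hφ
  have g2 := tendsto_hsNormSq_dil (κ := κ) (h₁ := h₁) (h₂ := h₂) ha hb (by linarith)
    (f := fun n x => ψ n x - φ x) ht
  have g3 := tendsto_l2sq_dil (f := fun n x => ψ n x - 1) (hlen he) htr
  have g4 : ∀ e' ∈ edges κ h₁ h₂, e' ≠ e →
      Tendsto (fun n => e'.l2sq fun x => ψ n (dil a b x)) atTop (𝓝 0) := fun e' he' hne =>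
    tendsto_l2sq_dil (hlen he') (hv _ (hmem he') fun h => hne (Edge.dil_injective ha hb h))
  have h1 := h ε hε hε2 (fun x => φ (dil a b x)) g1 (fun n x => ψ n (dil a b x))
    (fun n => (hψ n).comp (contDiff_dil a b)) g2 g3 g4
  have h2 := h1.const_mul (a * b)
  refine h2.congr fun n => ?_
  rw [gradPairing_dil ha hb u (hψ n), setIntegral_dil ha hb fun x => c * ψ n x, ← mul_add, ← mul_assoc,
    mul_inv_cancel₀ (by positivity), one_mul]

/-- In the flux each component of the field meets the other component of the edge vector, so both
products acquire the same factor `a * b`. -/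
lemma Edge.integral_piola {e : Edge} (ha : 0 < a) (hb : 0 < b) (he : e.length ≠ 0) (he' : (e.dil a b).length ≠ 0)
    (p : Fin 2 → ℝ × ℝ → ℝ) :
    (e.dil a b).integral (fun x => ∑ i, piola a b p i x * (e.dil a b).normal i) =
      a * b * e.integral (fun x => ∑ i, p i x * e.normal i) := by
  rw [Edge.integral_normal he, Edge.integral_normal he', ← intervalIntegral.integral_const_mul]
  refine intervalIntegral.integral_congr fun t _ => ?_
  simp only [Edge.dil_point, piola, dil_inv_dil ha hb]
  simp only [Edge.dil, RTAniso.dil, Matrix.cons_val_zero, Matrix.cons_val_one]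
  ring

lemma memRT0_piola (ha : 0 < a) (hb : 0 < b) {p : Fin 2 → ℝ × ℝ → ℝ} (h : MemRT0 κ p) :
    MemRT0 κ (piola a b p) := by
  cases κ
  · obtain ⟨k, l, m, hp⟩ := h
    refine ⟨a * k, b * l, m, fun x => ?_⟩
    simp only [piola, Matrix.cons_val_zero, Matrix.cons_val_one, (hp _).1, (hp _).2, dil]
    constructor <;> field_simp
  · obtain ⟨k, l, m, n, hp⟩ := h
    refine ⟨a * k, b * l, m, n, fun x => ?_⟩
    simp only [piola, Matrix.cons_val_zero, Matrix.cons_val_one, (hp _).1, (hp _).2, dil]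
    constructor <;> field_simp

lemma isRTInterpolant_piola (ha : 0 < a) (hb : 0 < b) (h₁_pos : 0 < h₁) (h₂_pos : 0 < h₂)
    {u p : Fin 2 → ℝ × ℝ → ℝ} {c : ℝ} (h : IsRTInterpolant κ h₁ h₂ u (fun _ => c) p) :
    IsRTInterpolant κ (a * h₁) (b * h₂) (piola a b u) (fun _ => c) (piola a b p) := by
  refine ⟨memRT0_piola ha hb h.1, fun e' he' => ?_⟩
  have hpos := edge_length_pos (mul_pos ha h₁_pos) (mul_pos hb h₂_pos) he'
  rw [edges_dil] at he'
  obtain ⟨e, he, rfl⟩ := List.mem_map.1 he'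
  rw [Edge.integral_piola ha hb (edge_length_pos h₁_pos h₂_pos he).ne' hpos.ne']
  exact hasNormalFlux_piola ha hb h₁_pos h₂_pos he (h.2 e he)

lemma piola_piola_inv (ha : 0 < a) (hb : 0 < b) (u : Fin 2 → ℝ × ℝ → ℝ) :
    piola a b (piola a⁻¹ b⁻¹ u) = u := by
  funext i x
  have e := dil_dil_inv ha hb x
  fin_cases i <;> simp [piola, e, ha.ne', hb.ne']

lemma memHs_piola (ha : 0 < a) (hb : 0 < b) {s : ℝ} (hs : 0 < s) {u : Fin 2 → ℝ × ℝ → ℝ}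
    (h : ∀ l, MemHs s (element κ (a * h₁) (b * h₂)) (u l)) (l : Fin 2) :
    MemHs s (element κ h₁ h₂) (piola a⁻¹ b⁻¹ u l) := by
  have h1 := memHs_dil ha hb hs (h l)
  have e : piola a⁻¹ b⁻¹ u l = fun x => (![a⁻¹, b⁻¹] : Fin 2 → ℝ) l * u l (dil a b x) := by
    funext x; simp [piola]
  rw [e]
  exact ⟨h1.1.const_mul _, by
    rw [hsNormSq_const_mul]
    exact ENNReal.mul_lt_top (by simp) h1.2⟩

end

/-! ### Scaling of the anisotropic seminorms and the final estimate -/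

lemma setLIntegral_mul_left {r : ℝ} (hr : 0 < r) (I : Set ℝ) (f : ℝ → ℝ≥0∞) :
    ∫⁻ t in {t | r * t ∈ I}, f (r * t) = ENNReal.ofReal r⁻¹ * ∫⁻ t in I, f t := by
  have he : MeasurableEmbedding (r * ·) := (Homeomorph.mulLeft₀ r hr.ne').measurableEmbedding
  have e : {t | r * t ∈ I} = (r * ·) ⁻¹' I := rfl
  rw [e, ← he.lintegral_map, ← he.restrict_map, Real.map_volume_mul_left hr.ne', Measure.restrict_smul,
    lintegral_smul_measure, smul_eq_mul, abs_of_pos (by positivity)]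

/-- Scale invariance of the `H^{1/2}` seminorm on the line: the kernel contributes `r²` and each of
the two integrals `r⁻¹`. Hence the anisotropic seminorms only see the scaling of the transverse
variable. -/
lemma hsSemiSq₁_mul_left {r : ℝ} (hr : 0 < r) (I : Set ℝ) (g : ℝ → ℝ) :
    hsSemiSq₁ (1 / 2) {t | r * t ∈ I} (fun t => g (r * t)) = hsSemiSq₁ (1 / 2) I g := by
  set k : ℝ → ℝ → ℝ≥0∞ := fun x y => ‖g x - g y‖ₑ ^ 2 / ENNReal.ofReal (|x - y| ^ (1 + 2 * (1 / 2 : ℝ))) with hk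
  have key : ∀ x y, ‖g (r * x) - g (r * y)‖ₑ ^ 2 / ENNReal.ofReal (|x - y| ^ (1 + 2 * (1 / 2 : ℝ))) =
      ENNReal.ofReal (r ^ 2) * k (r * x) (r * y) := by
    intro x y
    have h2 : ∀ t : ℝ, t ^ (1 + 2 * (1 / 2 : ℝ)) = t ^ 2 := fun t => by
      rw [← Real.rpow_natCast]; norm_num
    have h3 : ENNReal.ofReal (r ^ 2) ≠ 0 := by simp; positivity
    simp only [hk, h2]
    rw [← mul_sub, abs_mul, mul_pow, abs_of_pos hr, ENNReal.ofReal_mul (by positivity), div_eq_mul_inv, div_eq_mul_inv,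
      ENNReal.mul_inv (Or.inl h3) (Or.inl ENNReal.ofReal_ne_top), mul_left_comm, ← mul_assoc (ENNReal.ofReal (r ^ 2)),
      ENNReal.mul_inv_cancel h3 ENNReal.ofReal_ne_top, one_mul]
  have e : hsSemiSq₁ (1 / 2) {t | r * t ∈ I} (fun t => g (r * t)) =
      ∫⁻ x in {t | r * t ∈ I}, ∫⁻ y in {t | r * t ∈ I}, ENNReal.ofReal (r ^ 2) * k (r * x) (r * y) :=
    lintegral_congr fun x => lintegral_congr fun y => key x y
  rw [e]
  simp_rw [fun x => lintegral_const_mul' (μ := volume.restrict {t | r * t ∈ I})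
    (ENNReal.ofReal (r ^ 2)) (fun y => k (r * x) (r * y)) ENNReal.ofReal_ne_top,
    fun x => setLIntegral_mul_left hr I (k (r * x))]
  rw [lintegral_const_mul' _ _ ENNReal.ofReal_ne_top, lintegral_const_mul' _ _ ENNReal.ofReal_ne_top,
    setLIntegral_mul_left hr I fun x => ∫⁻ y in I, k x y, ← mul_assoc, ← mul_assoc,
    ← ENNReal.ofReal_mul (by positivity), ← ENNReal.ofReal_mul (by positivity),
    show r ^ 2 * r⁻¹ * r⁻¹ = 1 by field_simp, ENNReal.ofReal_one, one_mul]
  rfl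

lemma ahSemiSq_dil {a b h₁ h₂ : ℝ} {κ : Shape} (ha : 0 < a) (hb : 0 < b) (l : Fin 2) (f : ℝ × ℝ → ℝ) :
    ahSemiSq (1 / 2) (element κ h₁ h₂) l (fun x => f (dil a b x)) =
      ENNReal.ofReal ((![a, b] : Fin 2 → ℝ) (l + 1))⁻¹ * ahSemiSq (1 / 2) (element κ (a * h₁) (b * h₂)) l f := by
  have hmem := fun x => mem_element_dil (κ := κ) (h₁ := h₁) (h₂ := h₂) ha hb x
  fin_cases l
  · have h1 := setLIntegral_mul_left hb Set.univ fun y =>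
      hsSemiSq₁ (1 / 2) {t | (t, y) ∈ element κ (a * h₁) (b * h₂)} fun t => f (t, y)
    simp only [Set.mem_univ, Set.ofPred_true, Measure.restrict_univ] at h1
    refine Eq.trans (lintegral_congr fun y => ?_) h1
    refine Eq.trans ?_ (hsSemiSq₁_mul_left ha {t | (t, b * y) ∈ element κ (a * h₁) (b * h₂)} fun t => f (t, b * y))
    have e : {t | (t, y) ∈ element κ h₁ h₂} =
        {t | a * t ∈ {t | (t, b * y) ∈ element κ (a * h₁) (b * h₂)}} := by
      ext t; exact (hmem (t, y)).symm
    rw [← e]; rfl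
  · have h1 := setLIntegral_mul_left ha Set.univ fun y =>
      hsSemiSq₁ (1 / 2) {t | (y, t) ∈ element κ (a * h₁) (b * h₂)} fun t => f (y, t)
    simp only [Set.mem_univ, Set.ofPred_true, Measure.restrict_univ] at h1
    refine Eq.trans (lintegral_congr fun y => ?_) h1
    refine Eq.trans ?_ (hsSemiSq₁_mul_left hb {t | (a * y, t) ∈ element κ (a * h₁) (b * h₂)} fun t => f (a * y, t))
    have e : {t | (y, t) ∈ element κ h₁ h₂} =
        {t | b * t ∈ {t | (a * y, t) ∈ element κ (a * h₁) (b * h₂)}} := by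
      ext t; exact (hmem (y, t)).symm
    rw [← e]; rfl

lemma hsSemiSq₁_const_mul (s : ℝ) (I : Set ℝ) (k : ℝ) (f : ℝ → ℝ) :
    hsSemiSq₁ s I (fun x => k * f x) = ‖k‖ₑ ^ 2 * hsSemiSq₁ s I f := by
  simp_rw [hsSemiSq₁, ← mul_sub, enorm_mul, mul_pow, mul_div_assoc]
  simp_rw [fun x => lintegral_const_mul' (μ := volume.restrict I) (‖k‖ₑ ^ 2)
    (fun y => ‖f x - f y‖ₑ ^ 2 / ENNReal.ofReal (|x - y| ^ (1 + 2 * s))) (by simp)]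
  exact lintegral_const_mul' _ _ (by simp)

lemma ahSemiSq_const_mul (s : ℝ) (K : Set (ℝ × ℝ)) (l : Fin 2) (k : ℝ) (f : ℝ × ℝ → ℝ) :
    ahSemiSq s K l (fun x => k * f x) = ‖k‖ₑ ^ 2 * ahSemiSq s K l f := by
  fin_cases l <;> simp only [ahSemiSq, hsSemiSq₁_const_mul] <;> exact lintegral_const_mul' _ _ (by simp)

/-- Here `x` and `y` stand for the sizes in the directions `l` and `l + 1`. After multiplication by
`x² (x y)` the planar seminorm carries exactly `m³ / (x y)`. The anisotropic one carries `x² / y =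
x³ / (x y)`, and `x ≤ m`. -/
lemma le_of_scaled {x y m : ℝ} (hx : 0 < x) (hy : 0 < y) (hm : x ≤ m) {D X Y C : ℝ≥0∞}
    (h : ENNReal.ofReal (x⁻¹ ^ 2 * (x * y)⁻¹) * D ≤
      C * (ENNReal.ofReal (x⁻¹ ^ 2 * (m ^ 3 * ((x * y)⁻¹ * (x * y)⁻¹))) * X + ENNReal.ofReal (y⁻¹ ^ 2 * x⁻¹) * Y)) :
    D ≤ C * (ENNReal.ofReal (m ^ 3 / (x * y)) * (X + Y)) := by
  have hm0 : 0 < m := hx.trans_le hm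
  have h1 := mul_le_mul' (le_refl (ENNReal.ofReal (x ^ 2 * (x * y)))) h
  rw [← mul_assoc, ← ENNReal.ofReal_mul (by positivity),
    show x ^ 2 * (x * y) * (x⁻¹ ^ 2 * (x * y)⁻¹) = 1 by field_simp, ENNReal.ofReal_one, one_mul,
    mul_left_comm, mul_add, ← mul_assoc (ENNReal.ofReal _) (ENNReal.ofReal _) X,
    ← mul_assoc (ENNReal.ofReal _) (ENNReal.ofReal _) Y, ← ENNReal.ofReal_mul (by positivity),
    ← ENNReal.ofReal_mul (by positivity)] at h1
  refine h1.trans (mul_le_mul' le_rfl ?_)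
  rw [mul_add]
  refine add_le_add (mul_le_mul' (ENNReal.ofReal_le_ofReal (le_of_eq ?_)) le_rfl)
    (mul_le_mul' (ENNReal.ofReal_le_ofReal ?_) le_rfl)
  · field_simp
  · rw [le_div_iff₀ (by positivity)]
    calc x ^ 2 * (x * y) * (y⁻¹ ^ 2 * x⁻¹) * (x * y) = x ^ 3 := by field_simp
      _ ≤ m ^ 3 := pow_le_pow_left₀ hx.le hm 3

/-- The error estimate on general elements. -/
theorem interpolation_estimate : ∃ C : ℝ≥0, ∀ (κ : Shape) (h₁ h₂ : ℝ), 0 < h₁ → 0 < h₂ →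
    ∀ (u : Fin 2 → ℝ × ℝ → ℝ) (c : ℝ), (∀ l, MemHs (1 / 2) (element κ h₁ h₂) (u l)) →
      HasWeakDiv (element κ h₁ h₂) u (fun _ => c) →
      (∃! p, IsRTInterpolant κ h₁ h₂ u (fun _ => c) p) ∧
      ∀ p, IsRTInterpolant κ h₁ h₂ u (fun _ => c) p → ∀ l : Fin 2,
        l2sq (element κ h₁ h₂) (fun x => u l x - p l x) ≤
          C * (ENNReal.ofReal (max h₁ h₂ ^ 3 / (h₁ * h₂)) *
            (hsSemiSq (1 / 2) (element κ h₁ h₂) (u l) +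
              ahSemiSq (1 / 2) (element κ h₁ h₂) (l + 1) (u (l + 1)))) := by
  obtain ⟨C, hC⟩ := reference_estimate
  refine ⟨C, fun κ h₁ h₂ p1 p2 u c hu hdiv => ?_⟩
  have i1 : 0 < h₁⁻¹ := inv_pos.2 p1
  have i2 : 0 < h₂⁻¹ := inv_pos.2 p2
  -- The transformed field lives on the reference element and has the same constant divergence `c`.
  set v := piola h₁⁻¹ h₂⁻¹ u with hv
  have hv_mem : ∀ l, MemHs (1 / 2) (element κ 1 1) (v l) := by
    refine memHs_piola p1 p2 (by norm_num) ?_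
    simpa only [mul_one] using hu
  have hv_div : HasWeakDiv (element κ 1 1) v fun _ => c := by
    have := hasWeakDiv_piola i1 i2 hdiv
    rwa [inv_mul_cancel₀ p1.ne', inv_mul_cancel₀ p2.ne'] at this
  obtain ⟨⟨q, hq⟩, hest⟩ := hC κ v c hv_mem hv_div
  have down : ∀ {p}, IsRTInterpolant κ h₁ h₂ u (fun _ => c) p →
      IsRTInterpolant κ 1 1 v (fun _ => c) (piola h₁⁻¹ h₂⁻¹ p) := fun {p} hp => by
    have := isRTInterpolant_piola i1 i2 p1 p2 hp
    rwa [inv_mul_cancel₀ p1.ne', inv_mul_cancel₀ p2.ne'] at this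
  refine ⟨⟨piola h₁ h₂ q, ?_, fun p hp => ?_⟩, fun p hp l => ?_⟩
  · have := isRTInterpolant_piola p1 p2 one_pos one_pos hq
    rwa [mul_one, mul_one, hv, piola_piola_inv p1 p2] at this
  · rw [← piola_piola_inv p1 p2 p, (down hp).unique_reference hq]
  · have h := hest _ (down hp) l
    set η : Fin 2 → ℝ := ![h₁⁻¹, h₂⁻¹] with hη
    set H : Fin 2 → ℝ := ![h₁, h₂] with hH
    have hηH : ∀ i, η i = (H i)⁻¹ := fun i => by fin_cases i <;> rfl
    have hHpos : ∀ i, 0 < H i := fun i => by fin_cases i; exacts [p1, p2]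
    have hHm : ∀ i, H i ≤ max h₁ h₂ := fun i => by fin_cases i; exacts [le_max_left _ _, le_max_right _ _]
    have hHH : h₁ * h₂ = H l * H (l + 1) := by
      fin_cases l
      · rfl
      · exact mul_comm _ _
    have hl2 : l + 1 + 1 = l := by fin_cases l <;> rfl
    have hen : ∀ i, ‖η i‖ₑ ^ 2 = ENNReal.ofReal ((H i)⁻¹ ^ 2) := fun i => by rw [enorm_sq_eq_ofReal, hηH]
    have ev : ∀ i, v i = fun x => η i * u i (dil h₁ h₂ x) := fun i => by
      funext x; simp [hv, piola, hη]
    have e1 : l2sq (element κ 1 1) (fun x => v l x - piola h₁⁻¹ h₂⁻¹ p l x) =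
        ENNReal.ofReal ((H l)⁻¹ ^ 2 * (H l * H (l + 1))⁻¹) * l2sq (element κ h₁ h₂) fun x => u l x - p l x := by
      have e2 : (fun x => v l x - piola h₁⁻¹ h₂⁻¹ p l x) =
          fun x => η l * (u l (dil h₁ h₂ x) - p l (dil h₁ h₂ x)) := by
        funext x; rw [ev, mul_sub]; simp [piola, hη]
      rw [e2, l2sq_const_mul, l2sq_dil p1 p2 fun x => u l x - p l x, mul_one, mul_one, hen, ← mul_assoc,
        ← ENNReal.ofReal_mul (by positivity), hHH]
    have e3 : errSq κ v l ≤ ENNReal.ofReal ((H l)⁻¹ ^ 2 * (max h₁ h₂ ^ 3 *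
          ((H l * H (l + 1))⁻¹ * (H l * H (l + 1))⁻¹))) * hsSemiSq (1 / 2) (element κ h₁ h₂) (u l) +
        ENNReal.ofReal ((H (l + 1))⁻¹ ^ 2 * (H l)⁻¹) * ahSemiSq (1 / 2) (element κ h₁ h₂) (l + 1) (u (l + 1)) := by
      rw [errSq, ev l, ev (l + 1), hsSemiSq_const_mul, ahSemiSq_const_mul, ahSemiSq_dil p1 p2, hl2, hen, hen,
        mul_one, mul_one, ← mul_assoc, ← ENNReal.ofReal_mul (by positivity)]
      refine add_le_add ?_ le_rfl
      rw [ENNReal.ofReal_mul (by positivity), mul_assoc]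
      refine mul_le_mul' le_rfl ((hsSemiSq_dil_le p1 p2 (by norm_num) (u l)).trans (le_of_eq ?_))
      have e4 : max h₁ h₂ ^ (2 + 2 * (1 / 2 : ℝ)) = max h₁ h₂ ^ 3 := by
        rw [← Real.rpow_natCast]; norm_num
      rw [e4, mul_one, mul_one, hHH]
    rw [e1] at h
    rw [hHH]
    exact le_of_scaled (hHpos l) (hHpos (l + 1)) (hHm l) (h.trans (mul_le_mul' le_rfl e3))

lemma l2sq_le_add_sub {K : Set (ℝ × ℝ)} {u p : ℝ × ℝ → ℝ} (hu : AEStronglyMeasurable u (volume.restrict K)) :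
    l2sq K p ≤ 2 * (l2sq K u + l2sq K fun x => u x - p x) := by
  rw [l2sq, l2sq, l2sq, ← lintegral_add_left' (hu.enorm.pow_const 2), ← lintegral_const_mul' _ _ (by simp)]
  refine lintegral_mono fun x => ?_
  have := enorm_sub_sq_le (u x) (u x - p x)
  rwa [sub_sub_cancel] at this

end RTAniso

theorem theorem5p3 :
    ∃ C : ℝ≥0, ∀ (κ : RTAniso.Shape) (h₁ h₂ : ℝ), 0 < h₁ → 0 < h₂ →
      ∀ (u : Fin 2 → ℝ × ℝ → ℝ) (c : ℝ),
        (∀ l, RTAniso.MemHs (1 / 2) (RTAniso.element κ h₁ h₂) (u l)) →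
        RTAniso.HasWeakDiv (RTAniso.element κ h₁ h₂) u (fun _ => c) →
        (∃! p, RTAniso.IsRTInterpolant κ h₁ h₂ u (fun _ => c) p) ∧
        ∀ p, RTAniso.IsRTInterpolant κ h₁ h₂ u (fun _ => c) p → ∀ l : Fin 2,
          RTAniso.l2sq (RTAniso.element κ h₁ h₂) (p l) ≤
            C * (RTAniso.l2sq (RTAniso.element κ h₁ h₂) (u l) +
              ENNReal.ofReal (max h₁ h₂ ^ 3 / (h₁ * h₂)) *
                (RTAniso.hsSemiSq (1 / 2) (RTAniso.element κ h₁ h₂) (u l) +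
                  RTAniso.ahSemiSq (1 / 2) (RTAniso.element κ h₁ h₂) (l + 1) (u (l + 1)) +
                  RTAniso.hMinusHalfNorm (RTAniso.element κ h₁ h₂) (fun _ => c) ^ 2)) ∧
          RTAniso.l2sq (RTAniso.element κ h₁ h₂) (fun x => u l x - p l x) ≤
            C * (ENNReal.ofReal (max h₁ h₂ ^ 3 / (h₁ * h₂)) *
                (RTAniso.hsSemiSq (1 / 2) (RTAniso.element κ h₁ h₂) (u l) +
                  RTAniso.ahSemiSq (1 / 2) (RTAniso.element κ h₁ h₂) (l + 1) (u (l + 1)) +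
                  RTAniso.hMinusHalfNorm (RTAniso.element κ h₁ h₂) (fun _ => c) ^ 2)) := by
  obtain ⟨C, hC⟩ := RTAniso.interpolation_estimate
  -- The stability bound comes from the error bound by the triangle inequality, whose squared form
  -- costs the factor `2`. The constant is chosen to serve both estimates.
  refine ⟨2 + 2 * C, fun κ h₁ h₂ p1 p2 u c hu hdiv => ?_⟩
  obtain ⟨hex, hest⟩ := hC κ h₁ h₂ p1 p2 u c hu hdiv
  refine ⟨hex, fun p hp l => ?_⟩
  have h := hest p hp l
  set W := ENNReal.ofReal (max h₁ h₂ ^ 3 / (h₁ * h₂))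
  set X := RTAniso.hsSemiSq (1 / 2) (RTAniso.element κ h₁ h₂) (u l) +
    RTAniso.ahSemiSq (1 / 2) (RTAniso.element κ h₁ h₂) (l + 1) (u (l + 1))
  set Z := RTAniso.hMinusHalfNorm (RTAniso.element κ h₁ h₂) (fun _ => c) ^ 2
  -- The bound already holds without the norm of the divergence; the term `Z` is added because it is
  -- nonnegative.
  have h1 : RTAniso.l2sq (RTAniso.element κ h₁ h₂) (fun x => u l x - p l x) ≤ C * (W * (X + Z)) :=
    h.trans (mul_le_mul' le_rfl (mul_le_mul' le_rfl le_self_add))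
  push_cast
  constructor
  · calc RTAniso.l2sq (RTAniso.element κ h₁ h₂) (p l)
        ≤ 2 * (RTAniso.l2sq (RTAniso.element κ h₁ h₂) (u l) + C * (W * (X + Z))) :=
          (RTAniso.l2sq_le_add_sub (hu l).1).trans (mul_le_mul' le_rfl (add_le_add le_rfl h1))
      _ ≤ 2 * (RTAniso.l2sq (RTAniso.element κ h₁ h₂) (u l) + C * (W * (X + Z))) +
          (2 * C * RTAniso.l2sq (RTAniso.element κ h₁ h₂) (u l) + 2 * (W * (X + Z))) := le_self_add
      _ = _ := by ring
  · refine h1.trans (mul_le_mul' ?_ le_rfl)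
    calc (C : ℝ≥0∞) ≤ C + (2 + C) := le_self_add
      _ = _ := by ring
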